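/- All graphs are finite and simple. For a graph $G$ and $A\subseteq V(G)$, let $\delta A$ be the set of edges with exactly one end in $A$ (an edge-cut if $\emptyset\ne A\ne V(G)$), let $G|A$ be the subgraph induced on $A$, and $G\backslash A$ the subgraph induced on $V(G)-A$. A quadrangle is a circuit of length four. A cubic graph $G$ is cyclically $k$-connected ($k\ge4$) if it is $3$-connected, has at least $2k$ vertices, and for every edge-cut $\delta A$ with $|\delta A|<k$ one of $G|A$, $G\backslash A$ has no circuit. A cubic graph $G$ is quad-connected if it is cyclically $4$-connected, has at least $10$ vertices, has at least $12$ vertices if it has more than one quadrangle, and for every edge-cut $\delta A$ with $|\delta A|\le 4$ one of $G|A$, $G\backslash A$ is a forest or a quadrangle. A homeomorphic embedding of $G$ into $H$ (written $G\hookrightarrow H$ when one exists) maps the vertices of $G$ injectively to vertices of $H$, and every edge $uv$ of $G$ to a path of $H$ between the images of $u$ and $v$ that contains no other image of a vertex of $G$, such that the paths of distinct edges are edge-disjoint and every vertex common to two of them is an end of both. For distinct edges $uv$, $xy$ of $G$, let $G+(u,v,x,y)$ be obtained by subdividing $uv$ by a new vertex $k$ and $xy$ by a new vertex $l$ and adding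 the edge $kl$; $k,l$ (in this order) are its new vertices. It is a $1$-extension of $G$ if $u,v,x,y$ are pairwise distinct; the $1$-extension is long if moreover neither $u$ nor $v$ is adjacent in $G$ to $x$ or $y$, and short otherwise. Let $G$ be a quad-connected cubic graph and $C$ a quadrangle in $G$. In what follows $u_1,u_2,u_3,u_4$ are the vertices of $C$ in (any) cyclic order, $v_i$ is the neighbor of $u_i$ not on $C$, $v_i'\ne u_i$ is a neighbor of $v_i$, and $G_1=G+(u_1,u_2,v_1,v_1')$ with new vertices $k,l$; so $\{u_1,k,l,v_1\}$ is the vertex-set of a quadrangle $C_1$ of $G_1$, the new quadrangle. The expansions of $G$ based at $C$ are, up to isomorphism, the following graphs. * Type A: a long $1$-extension $G+(u_1,u_2,x,y)$ with $x,y\notin V(C)$. * Type B: a long $1$-extension $G_1+(v_1,l,a,b)$ of $G_1$. * Type C: $G_1+(k,l,v_2,v_2')$ or $G_1+(u_1,v_1,v_4,v_4')$, if it is a long $1$-extension of $G_1$. * Type D: $G_1+(u_1,k,u_3,v_3)$. * Type E: $G_5'+(b,u_4,v_3,v_3')$, where $G_5'=G_1+(u_1,k,u_3,u_4)$ has new vertices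 $a,b$. * Type F, based on $(u_1,u_2)$: if $v_1'=v_2'$, the graph $G_6''+(k,l,k_2,l_2)$, where $G_6'=G_1+(u_2,k,v_2,v_2')$ has new vertices $k_2,l_2$ and $G_6''=G_6'+(k_2,k,u_3,u_4)$. * Type G: a type F expansion of $G_1$ based on $(u_1,k)$ (with respect to the quadrangle $C_1$ of $G_1$). * Type H: if $G$ has a quadrangle with vertices $x_1,x_2,x_3,x_4\notin V(C)$ in order such that $x_1$ is adjacent to $u_1$, $u_2$ and $x_2$ have a common neighbor, and $u_4$ and $x_4$ have a common neighbor, a type F expansion based on $(x_1,l)$ of the graph $G_1=G+(u_1,u_2,x_1,x_2)$ with new vertices $k,l$ (with respect to the new quadrangle of $G_1$, with vertices $x_1,l,k,u_1$). Theorem. Let $G,H$ be cubic graphs with $G\hookrightarrow H$, let $G$ be quad-connected, let $C$ be a quadrangle in $G$, and let $H$ be cyclically $5$-connected. Then there exists an expansion $G'$ of $G$ based at $C$ of type A, B, C, D, E, F, G or H such that $G'\hookrightarrow H$. -/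

import Mathlib

universe u v w

namespace SimpleGraph

/-! ### Connectivity of cubic graphs -/

section Connectivity

variable {V : Type u} (G : SimpleGraph V)

/-- Every vertex has degree three. -/
def IsCubic : Prop := ∀ x : V, (G.neighborSet x).encard = 3

/-- At least four vertices, and deleting at most two vertices leaves a connected graph. -/
def IsThreeConnected : Prop :=
  4 ≤ Nat.card V ∧ ∀ X : Set V, X.encard < 3 → (G.induce Xᶜ).Connected

/-- `δ A`: the edges with one end in `A` and the other end outside `A`. -/
def edgeCut (A : Set V) : Set (Sym2 V) :=
  {e | ∃ a ∈ A, ∃ b ∉ A, G.Adj a b ∧ e = s(a, b)}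

/-- Cyclic `k`-connectivity (used for cubic graphs and `k ≥ 4`). -/
def IsCyclicallyConnected (k : ℕ) : Prop :=
  G.IsThreeConnected ∧ 2 * k ≤ Nat.card V ∧
    ∀ A : Set V, A.Nonempty → A ≠ Set.univ → (G.edgeCut A).encard < k →
      (G.induce A).IsAcyclic ∨ (G.induce Aᶜ).IsAcyclic

variable {G}

/-- The subgraph `C` is the circuit of length four with vertices `a, b, c, d`, in this order. -/
structure Subgraph.IsQuadrangleWith (C : G.Subgraph) (a b c d : V) : Prop where
  nodup : [a, b, c, d].Nodup
  verts_eq : C.verts = {a, b, c, d}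
  edgeSet_eq : C.edgeSet = {s(a, b), s(b, c), s(c, d), s(d, a)}

/-- `C` is a quadrangle, that is, a circuit of length four. -/
def Subgraph.IsQuadrangle (C : G.Subgraph) : Prop :=
  ∃ a b c d : V, C.IsQuadrangleWith a b c d

variable (G)

/-- Quad-connectivity (used for cubic graphs). -/
def IsQuadConnected : Prop :=
  G.IsCyclicallyConnected 4 ∧
  10 ≤ Nat.card V ∧
  ((∃ C D : G.Subgraph, C.IsQuadrangle ∧ D.IsQuadrangle ∧ C ≠ D) → 12 ≤ Nat.card V) ∧
  ∀ A : Set V, A.Nonempty → A ≠ Set.univ → (G.edgeCut A).encard ≤ 4 →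
    ((G.induce A).IsAcyclic ∨ Nonempty (G.induce A ≃g cycleGraph 4)) ∨
    ((G.induce Aᶜ).IsAcyclic ∨ Nonempty (G.induce Aᶜ ≃g cycleGraph 4))

end Connectivity

/-! ### Homeomorphic embeddings -/

/-- A homeomorphic embedding of `G` into `H`. The image of an edge `xy` is a path of `H`,
recorded as a walk from the image of `x` to the image of `y`; by `path_symm` the
walk recorded for `yx` is the same path, read backwards. -/
structure HomeoEmbedding {V : Type u} {W : Type v} (G : SimpleGraph V) (H : SimpleGraph W) where
  toFun : V → W
  injective : Function.Injective toFun
  path : ∀ {x y : V}, G.Adj x y → H.Walk (toFun x) (toFun y)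
  path_symm : ∀ {x y : V} (h : G.Adj x y), path h.symm = (path h).reverse
  isPath : ∀ {x y : V} (h : G.Adj x y), (path h).IsPath
  vertex_disjoint : ∀ {x y : V} (h : G.Adj x y) (z : V),
    toFun z ∈ (path h).support → z = x ∨ z = y
  edge_disjoint : ∀ {x y x' y' : V} (h : G.Adj x y) (h' : G.Adj x' y'), s(x, y) ≠ s(x', y') →
    ∀ e ∈ (path h).edges, e ∉ (path h').edges
  inner_disjoint : ∀ {x y x' y' : V} (h : G.Adj x y) (h' : G.Adj x' y'), s(x, y) ≠ s(x', y') →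
    ∀ t : W, t ∈ (path h).support → t ∈ (path h').support →
      (t = toFun x ∨ t = toFun y) ∧ (t = toFun x' ∨ t = toFun y')

/-! ### The graphs `G + (u, v, x, y)` -/

section Plus

variable {V : Type u}

/-- The vertex of `G + (u, v, x, y)` that comes from the vertex `a` of `G`. -/
abbrev old (a : V) : V ⊕ Fin 2 := Sum.inl a

/-- The first new vertex of `G + (u, v, x, y)`: it subdivides `uv`. -/
abbrev newK : V ⊕ Fin 2 := Sum.inr 0

/-- The second new vertex of `G + (u, v, x, y)`: it subdivides `xy`. -/
abbrev newL : V ⊕ Fin 2 := Sum.inr 1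

variable (G : SimpleGraph V)

/-- `G + (u, v, x, y)`: subdivide the edges `uv` and `xy` and join the two new
vertices by an edge. (Meaningful if `uv` and `xy` are distinct edges.) -/
def plus (u v x y : V) : SimpleGraph (V ⊕ Fin 2) where
  Adj p q := match p, q with
    | .inl a, .inl b => G.Adj a b ∧ s(a, b) ≠ s(u, v) ∧ s(a, b) ≠ s(x, y)
    | .inl a, .inr i => if i = 0 then a = u ∨ a = v else a = x ∨ a = y
    | .inr i, .inl a => if i = 0 then a = u ∨ a = v else a = x ∨ a = y
    | .inr i, .inr j => i ≠ j
  symm := ⟨by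
    rintro (a | i) (b | j) h
    · exact ⟨h.1.symm, by rw [Sym2.eq_swap]; exact h.2.1, by rw [Sym2.eq_swap]; exact h.2.2⟩
    · exact h
    · exact h
    · exact Ne.symm h⟩
  loopless := ⟨by
    rintro (a | i) h
    · exact G.loopless.irrefl a h.1
    · exact h rfl⟩

/-- `G + (u, v, x, y)` is a `1`-extension of `G`. -/
structure IsOneExtension (u v x y : V) : Prop where
  adj_left : G.Adj u v
  adj_right : G.Adj x y
  nodup : [u, v, x, y].Nodup

/-- `G + (u, v, x, y)` is a long `1`-extension of `G`. -/
structure IsLongOneExtension (u v x y : V) : Prop extends G.IsOneExtension u v x y where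
  not_adj_ux : ¬ G.Adj u x
  not_adj_uy : ¬ G.Adj u y
  not_adj_vx : ¬ G.Adj v x
  not_adj_vy : ¬ G.Adj v y

end Plus

/-! ### Expansions based at a quadrangle

Everything is up to isomorphism of the expansion. Throughout, `u₁, u₂, u₃, u₄` are the vertices of
the quadrangle `C` in order, `vᵢ` is the neighbor of `uᵢ` not on `C`, and `vᵢ' ≠ uᵢ` is a neighbor
of `vᵢ`. The labelling is existentially quantified, so all rotations and reflections are covered. -/

namespace Subgraph

variable {V : Type u} {G : SimpleGraph V} (C : G.Subgraph) {V' : Type w} (G' : SimpleGraph V')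

/-- `v` is a neighbor of `u` not on `C`. -/
def IsOuterNeighbor (u v : V) : Prop := G.Adj u v ∧ v ∉ C.verts

/-- The data for a short `1`-extension `G₁ = G + (u₁, u₂, v₁, v₁')` based at `C`. Its new quadrangle
has vertices `u₁, k, l, v₁`, in this order. -/
structure IsShortData (u₁ u₂ u₃ u₄ v₁ v₁' : V) : Prop where
  quad : C.IsQuadrangleWith u₁ u₂ u₃ u₄
  outer : C.IsOuterNeighbor u₁ v₁
  outer' : C.IsOuterNeighbor v₁ v₁'
  ext : G.IsOneExtension u₁ u₂ v₁ v₁'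

/-- Type A: a long `1`-extension based at `C`. -/
def IsTypeA : Prop :=
  ∃ u₁ u₂ x y : V, C.Adj u₁ u₂ ∧ x ∉ C.verts ∧ y ∉ C.verts ∧
    G.IsLongOneExtension u₁ u₂ x y ∧ Nonempty (G' ≃g G.plus u₁ u₂ x y)

/-- Type B: `G₁ + (v₁, l, a, b)`, provided that this is long. (Then `a` and `b`
are not on the new quadrangle of `G₁`, since each of its vertices is one of `v₁, l` or adjacent
to one of them.) -/
def IsTypeB : Prop :=
  ∃ (u₁ u₂ u₃ u₄ v₁ v₁' : V) (a b : V ⊕ Fin 2), C.IsShortData u₁ u₂ u₃ u₄ v₁ v₁' ∧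
    (G.plus u₁ u₂ v₁ v₁').IsLongOneExtension (old v₁) newL a b ∧
    Nonempty (G' ≃g (G.plus u₁ u₂ v₁ v₁').plus (old v₁) newL a b)

/-- Type C: `G₁ + (k, l, v₂, v₂')` or `G₁ + (u₁, v₁, v₄, v₄')`, provided that this is long. -/
def IsTypeC : Prop :=
  ∃ u₁ u₂ u₃ u₄ v₁ v₁' : V, C.IsShortData u₁ u₂ u₃ u₄ v₁ v₁' ∧
    ((∃ v₂ v₂' : V, C.IsOuterNeighbor u₂ v₂ ∧ G.Adj v₂ v₂' ∧ v₂' ≠ u₂ ∧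
        (G.plus u₁ u₂ v₁ v₁').IsLongOneExtension newK newL (old v₂) (old v₂') ∧
        Nonempty (G' ≃g (G.plus u₁ u₂ v₁ v₁').plus newK newL (old v₂) (old v₂'))) ∨
      ∃ v₄ v₄' : V, C.IsOuterNeighbor u₄ v₄ ∧ G.Adj v₄ v₄' ∧ v₄' ≠ u₄ ∧
        (G.plus u₁ u₂ v₁ v₁').IsLongOneExtension (old u₁) (old v₁) (old v₄) (old v₄') ∧
        Nonempty (G' ≃g (G.plus u₁ u₂ v₁ v₁').plus (old u₁) (old v₁) (old v₄) (old v₄')))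

/-- Type D: `G₁ + (u₁, k, u₃, v₃)`. -/
def IsTypeD : Prop :=
  ∃ u₁ u₂ u₃ u₄ v₁ v₁' v₃ : V, C.IsShortData u₁ u₂ u₃ u₄ v₁ v₁' ∧ C.IsOuterNeighbor u₃ v₃ ∧
    (G.plus u₁ u₂ v₁ v₁').IsOneExtension (old u₁) newK (old u₃) (old v₃) ∧
    Nonempty (G' ≃g (G.plus u₁ u₂ v₁ v₁').plus (old u₁) newK (old u₃) (old v₃))

/-- Type E: `G₅' + (b, u₄, v₃, v₃')`, where `G₅' = G₁ + (u₁, k, u₃, u₄)` has new vertices `a, b`. -/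
def IsTypeE : Prop :=
  ∃ u₁ u₂ u₃ u₄ v₁ v₁' v₃ v₃' : V, C.IsShortData u₁ u₂ u₃ u₄ v₁ v₁' ∧
    C.IsOuterNeighbor u₃ v₃ ∧ G.Adj v₃ v₃' ∧ v₃' ≠ u₃ ∧
    (G.plus u₁ u₂ v₁ v₁').IsOneExtension (old u₁) newK (old u₃) (old u₄) ∧
    ((G.plus u₁ u₂ v₁ v₁').plus (old u₁) newK (old u₃) (old u₄)).IsOneExtension
      newL (old (old u₄)) (old (old v₃)) (old (old v₃')) ∧
    Nonempty (G' ≃g ((G.plus u₁ u₂ v₁ v₁').plus (old u₁) newK (old u₃) (old u₄)).plus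
      newL (old (old u₄)) (old (old v₃)) (old (old v₃')))

/-- Type F based on `(u₁, u₂)`: here `v₁' = v₂'` is a common neighbor `z` of `v₁` and `v₂`, and with
`G₁ = G + (u₁, u₂, v₁, z)` and its new vertices `k, l`,
`G₂ = G₁ + (u₂, k, v₂, z)` and its new vertices `k₂, l₂`, and
`G₃ = G₂ + (k₂, k, u₃, u₄)`, the expansion is `G₃ + (k, l, k₂, l₂)`. -/
def IsTypeFOn (u₁ u₂ : V) : Prop :=
  ∃ u₃ u₄ v₁ v₂ z : V, C.IsShortData u₁ u₂ u₃ u₄ v₁ z ∧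
    C.IsOuterNeighbor u₂ v₂ ∧ G.Adj v₂ z ∧
    let G₁ : SimpleGraph (V ⊕ Fin 2) := G.plus u₁ u₂ v₁ z
    let k : V ⊕ Fin 2 := newK
    let l : V ⊕ Fin 2 := newL
    let G₂ : SimpleGraph ((V ⊕ Fin 2) ⊕ Fin 2) := G₁.plus (old u₂) k (old v₂) (old z)
    let k₂ : (V ⊕ Fin 2) ⊕ Fin 2 := newK
    let l₂ : (V ⊕ Fin 2) ⊕ Fin 2 := newL
    let G₃ : SimpleGraph (((V ⊕ Fin 2) ⊕ Fin 2) ⊕ Fin 2) :=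
      G₂.plus k₂ (old k) (old (old u₃)) (old (old u₄))
    G₁.IsOneExtension (old u₂) k (old v₂) (old z) ∧
    G₂.IsOneExtension k₂ (old k) (old (old u₃)) (old (old u₄)) ∧
    G₃.IsOneExtension (old (old k)) (old (old l)) (old k₂) (old l₂) ∧
    Nonempty (G' ≃g G₃.plus (old (old k)) (old (old l)) (old k₂) (old l₂))

/-- Type F: based on some pair of consecutive vertices of `C`. -/
def IsTypeF : Prop := ∃ u₁ u₂ : V, C.IsTypeFOn G' u₁ u₂

/-- Type G: a type F expansion of `G₁` based on `(u₁, k)`, for the new quadrangle of `G₁`. -/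
def IsTypeG : Prop :=
  ∃ u₁ u₂ u₃ u₄ v₁ v₁' : V, C.IsShortData u₁ u₂ u₃ u₄ v₁ v₁' ∧
    ∃ C₁ : (G.plus u₁ u₂ v₁ v₁').Subgraph,
      C₁.IsQuadrangleWith (old u₁) newK newL (old v₁) ∧ C₁.IsTypeFOn G' (old u₁) newK

/-- Type H: `x₁, x₂, x₃, x₄` are, in order, the vertices of a quadrangle `D` disjoint from `C`, `x₁` is
adjacent to `u₁`, the vertices `u₂, x₂` have a common neighbor, and so do `u₄, x₄`. The
expansion is a type F expansion of `G₁ = G + (u₁, u₂, x₁, x₂)` based on `(x₁, l)`, for the new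
quadrangle of `G₁`. -/
def IsTypeH : Prop :=
  ∃ u₁ u₂ u₃ u₄ x₁ x₂ x₃ x₄ : V, C.IsShortData u₁ u₂ u₃ u₄ x₁ x₂ ∧
    (∃ D : G.Subgraph, D.IsQuadrangleWith x₁ x₂ x₃ x₄ ∧ Disjoint D.verts C.verts) ∧
    (∃ p : V, G.Adj u₂ p ∧ G.Adj x₂ p) ∧ (∃ q : V, G.Adj u₄ q ∧ G.Adj x₄ q) ∧
    ∃ C₁ : (G.plus u₁ u₂ x₁ x₂).Subgraph,
      C₁.IsQuadrangleWith (old x₁) newL newK (old u₁) ∧ C₁.IsTypeFOn G' (old x₁) newL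

/-- `G'` is an expansion of `G` based at `C` of type A, B, C, D, E, F, G or H. -/
def IsExpansion : Prop :=
  C.IsTypeA G' ∨ C.IsTypeB G' ∨ C.IsTypeC G' ∨ C.IsTypeD G' ∨
    C.IsTypeE G' ∨ C.IsTypeF G' ∨ C.IsTypeG G' ∨ C.IsTypeH G'

end Subgraph

end SimpleGraph

namespace QuadExp

open SimpleGraph

section Emb

variable {X : Type*} {Y : Type*} {W : Type*}

/-- `a` and `b` are joined in `H` by a walk whose inner vertices lie in `S`. -/
def Join (H : SimpleGraph W) (a b : W) (S : Set W) : Prop :=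
  ∃ l : List W, (a :: (l ++ [b])).IsChain H.Adj ∧ ∀ z ∈ l, z ∈ S

lemma Join.mono {H : SimpleGraph W} {a b : W} {S T : Set W} (h : Join H a b S) (hST : S ⊆ T) :
    Join H a b T := by
  obtain ⟨l, hl, hS⟩ := h
  exact ⟨l, hl, fun z hz => hST (hS z hz)⟩

lemma Join.of_adj {H : SimpleGraph W} {a b : W} (h : H.Adj a b) (S : Set W) : Join H a b S :=
  ⟨[], by simpa using h, by simp⟩

lemma Join.symm {H : SimpleGraph W} {a b : W} {S : Set W} (h : Join H a b S) : Join H b a S := by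
  obtain ⟨l, hl, hS⟩ := h
  refine ⟨l.reverse, ?_, by simpa using hS⟩
  have : b :: (l.reverse ++ [a]) = (a :: (l ++ [b])).reverse := by simp
  rw [this, List.isChain_reverse]
  exact hl.imp fun _ _ h => h.symm

lemma Join.trans {H : SimpleGraph W} {a b c : W} {S T : Set W} (h : Join H a b S)
    (h' : Join H b c T) : Join H a c (insert b (S ∪ T)) := by
  obtain ⟨l, hl, hS⟩ := h
  obtain ⟨l', hl', hT⟩ := h'
  refine ⟨l ++ b :: l', ?_, ?_⟩
  · have : a :: (l ++ b :: l' ++ [c]) = (a :: l) ++ b :: (l' ++ [c]) := by simp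
    rw [this, List.isChain_split]
    exact ⟨by simpa using hl, hl'⟩
  · intro z hz
    rcases List.mem_append.1 hz with h | h
    · exact Or.inr (Or.inl (hS z h))
    · rcases List.mem_cons.1 h with rfl | h
      · exact Or.inl rfl
      · exact Or.inr (Or.inr (hT z h))

lemma exists_walk_of_chain {H : SimpleGraph W} {b : W} : ∀ (l : List W) (a : W),
    (a :: (l ++ [b])).IsChain H.Adj → ∃ p : H.Walk a b, p.support = a :: (l ++ [b]) := by
  intro l
  induction l with
  | nil =>
    intro a h
    have h : H.Adj a b := by simpa using h
    exact ⟨Walk.cons h Walk.nil, by simp⟩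
  | cons c l ih =>
    intro a h
    simp only [List.cons_append, List.isChain_cons_cons] at h
    obtain ⟨p, hp⟩ := ih c h.2
    exact ⟨Walk.cons h.1 p, by simp [hp]⟩

lemma Join.exists_path {H : SimpleGraph W} {a b : W} {S : Set W} (h : Join H a b S) :
    ∃ p : H.Walk a b, p.IsPath ∧ ∀ z ∈ p.support, z = a ∨ z = b ∨ z ∈ S := by
  classical
  obtain ⟨l, hl, hS⟩ := h
  obtain ⟨p, hp⟩ := exists_walk_of_chain l a hl
  refine ⟨p.bypass, p.bypass_isPath, fun z hz => ?_⟩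
  have := p.support_bypass_subset_support hz
  rw [hp] at this
  simp only [List.mem_cons, List.mem_append, List.not_mem_nil, or_false] at this
  rcases this with h | h | h
  · exact Or.inl h
  · exact Or.inr (Or.inr (hS z h))
  · exact Or.inr (Or.inl h)

lemma exists_support_eq {H : SimpleGraph W} {a b : W} (p : H.Walk a b) (hab : a ≠ b) :
    ∃ l : List W, p.support = a :: (l ++ [b]) := by
  cases p with
  | nil => exact absurd rfl hab
  | cons hadj q =>
    refine ⟨q.support.dropLast, ?_⟩
    rw [Walk.support_cons]
    conv_lhs => rw [← List.dropLast_append_getLast q.support_ne_nil]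
    simp

lemma nodup_path_list {a b : W} {l : List W} (h : (a :: (l ++ [b])).Nodup) :
    ∀ z ∈ l, z ≠ a ∧ z ≠ b := by
  intro z hz
  simp only [List.nodup_cons, List.mem_append, List.nodup_append] at h
  refine ⟨?_, ?_⟩
  · rintro rfl
    exact h.1 (Or.inl hz)
  · rintro rfl
    exact h.2.2.2 z hz z (by simp) rfl

lemma Join.exists_nodup {H : SimpleGraph W} {a b : W} {S : Set W} (h : Join H a b S)
    (hab : a ≠ b) : ∃ l : List W, (a :: (l ++ [b])).IsChain H.Adj ∧ (a :: (l ++ [b])).Nodup ∧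
      ∀ z ∈ l, z ∈ S := by
  obtain ⟨p, hp, hS⟩ := h.exists_path
  obtain ⟨l, hl⟩ := exists_support_eq p hab
  have hn := hp.support_nodup
  rw [hl] at hn
  refine ⟨l, hl ▸ p.isChain_adj_support, hn, fun z hz => ?_⟩
  have h1 := nodup_path_list hn z hz
  have h2 := hS z (by rw [hl]; simp [hz])
  tauto

/-- The existence of a homeomorphic embedding, described through the vertex map and the sets of
inner vertices of the paths; isolated vertices of `G` are ignored. -/
def Emb (G : SimpleGraph X) (H : SimpleGraph W) : Prop :=
  ∃ (f : X → W) (I : Sym2 X → Set W), Set.InjOn f G.support ∧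
    (∀ x y, G.Adj x y → Join H (f x) (f y) (I s(x, y))) ∧
    (∀ e ∈ G.edgeSet, ∀ e' ∈ G.edgeSet, e ≠ e' → Disjoint (I e) (I e')) ∧
    ∀ e ∈ G.edgeSet, ∀ x ∈ G.support, f x ∉ I e

lemma Emb.of_index {G : SimpleGraph X} {H : SimpleGraph W} {ι : Type*} (ends : ι → X × X)
    (hG : ∀ x y, G.Adj x y → ∃ i, s((ends i).1, (ends i).2) = s(x, y))
    (f : X → W) (J : ι → Set W) (hinj : Set.InjOn f G.support)
    (hJ : ∀ i, Join H (f (ends i).1) (f (ends i).2) (J i))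
    (hdisj : ∀ i j, i ≠ j → Disjoint (J i) (J j))
    (hf : ∀ i, ∀ x ∈ G.support, f x ∉ J i) : Emb G H := by
  classical
  have hG' : ∀ e : G.edgeSet, ∃ i, s((ends i).1, (ends i).2) = e.1 := by
    rintro ⟨e, he⟩
    induction e with
    | h x y => exact hG x y he
  choose c hc using hG'
  refine ⟨f, fun e => if h : e ∈ G.edgeSet then J (c ⟨e, h⟩) else ∅, hinj, ?_, ?_, ?_⟩
  · intro x y h
    have h' : s(x, y) ∈ G.edgeSet := h
    simp only [h', dif_pos]
    have h1 := hc ⟨s(x, y), h'⟩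
    have h2 := hJ (c ⟨s(x, y), h'⟩)
    rcases Sym2.eq_iff.1 h1 with ⟨ha, hb⟩ | ⟨ha, hb⟩
    · rw [ha, hb] at h2; exact h2
    · rw [ha, hb] at h2; exact h2.symm
  · intro e he e' he' hne
    simp only [he, he', dif_pos]
    apply hdisj
    intro h
    apply hne
    have h1 := hc ⟨e, he⟩
    have h2 := hc ⟨e', he'⟩
    rw [h] at h1
    exact h1.symm.trans h2
  · intro e he x hx
    simp only [he, dif_pos]
    exact hf _ x hx

lemma Emb.of_hom {G : SimpleGraph X} {H : SimpleGraph Y} (f : X → Y)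
    (hinj : Set.InjOn f G.support) (hf : ∀ x y, G.Adj x y → H.Adj (f x) (f y)) : Emb G H :=
  ⟨f, fun _ => ∅, hinj, fun x y h => Join.of_adj (hf x y h) _, by simp, by simp⟩

lemma Join.left_mem_support {H : SimpleGraph W} {a b : W} {S : Set W} (h : Join H a b S) :
    a ∈ H.support := by
  obtain ⟨l, hl, -⟩ := h
  cases l with
  | nil => exact ⟨b, by simpa using hl⟩
  | cons c l => exact ⟨c, by simp at hl; exact hl.1⟩

lemma join_of_chain {H : SimpleGraph Y} {L : SimpleGraph W} {f : Y → W} {I : Sym2 Y → Set W}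
    (hI : ∀ x y, H.Adj x y → Join L (f x) (f y) (I s(x, y))) {T : Set W} {C : Set Y} {b : Y}
    (hT : ∀ x y, H.Adj x y → x ∈ C → y ∈ C → I s(x, y) ⊆ T) (hb : b ∈ C) :
    ∀ (l : List Y) (a : Y), a ∈ C → (∀ z ∈ l, z ∈ C) → (∀ z ∈ l, z ∈ H.support → f z ∈ T) →
      (a :: (l ++ [b])).IsChain H.Adj → Join L (f a) (f b) T := by
  intro l
  induction l with
  | nil =>
    intro a ha _ _ hc
    have hc : H.Adj a b := by simpa using hc
    exact (hI a b hc).mono (hT a b hc ha hb)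
  | cons c l ih =>
    intro a ha hl hlT hc
    simp only [List.cons_append, List.isChain_cons_cons] at hc
    have hcC := hl c (by simp)
    have h1 := ih c hcC (fun z hz => hl z (by simp [hz])) (fun z hz => hlT z (by simp [hz])) hc.2
    refine ((hI a c hc.1).trans h1).mono ?_
    refine Set.insert_subset (hlT c (by simp) ⟨a, hc.1.symm⟩) (Set.union_subset ?_ subset_rfl)
    exact hT a c hc.1 ha hcC

lemma Emb.trans {G : SimpleGraph X} {H : SimpleGraph Y} {L : SimpleGraph W}
    (h₁ : Emb G H) (h₂ : Emb H L) : Emb G L := by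
  obtain ⟨f, I, hinj, hJ, hd, hf⟩ := h₁
  obtain ⟨f', I', hinj', hJ', hd', hf'⟩ := h₂
  let C : Sym2 X → Set Y := fun e => I e ∪ f '' {x | x ∈ e}
  have hsup : ∀ x ∈ G.support, f x ∈ H.support := by
    rintro x ⟨y, hxy⟩
    exact (hJ x y hxy).left_mem_support
  have hmem : ∀ e ∈ G.edgeSet, ∀ x ∈ e, x ∈ G.support := by
    intro e he x hx
    obtain ⟨y, rfl⟩ := hx
    exact ⟨y, he⟩
  have hCC : ∀ e ∈ G.edgeSet, ∀ e' ∈ G.edgeSet, e ≠ e' → ∀ t, t ∈ C e → t ∈ C e' →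
      ∃ x, x ∈ e ∧ x ∈ e' ∧ f x = t := by
    rintro e he e' he' hne t (h | ⟨x, hx, rfl⟩) (h' | ⟨x', hx', h'⟩)
    · exact absurd h' (Set.disjoint_left.1 (hd e he e' he' hne) h)
    · exact absurd (h' ▸ h) (hf e he x' (hmem e' he' x' hx'))
    · exact absurd h' (hf e' he' x (hmem e he x hx))
    · have := hinj (hmem e' he' x' hx') (hmem e he x hx) h'
      subst this
      exact ⟨x', hx, hx', rfl⟩
  refine ⟨f' ∘ f, fun e => {z | (∃ e' ∈ H.edgeSet, (∀ t ∈ e', t ∈ C e) ∧ z ∈ I' e') ∨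
    ∃ t ∈ I e, t ∈ H.support ∧ f' t = z}, ?_, ?_, ?_, ?_⟩
  · intro x hx y hy h
    exact hinj hx hy (hinj' (hsup x hx) (hsup y hy) h)
  · intro x y hxy
    obtain ⟨l, hl, hlI⟩ := hJ x y hxy
    refine join_of_chain hJ' (C := C s(x, y)) ?_ (Or.inr ⟨y, by simp, rfl⟩) l (f x)
      (Or.inr ⟨x, by simp, rfl⟩) (fun z hz => Or.inl (hlI z hz))
      (fun z hz hz' => Or.inr ⟨z, hlI z hz, hz', rfl⟩) hl
    intro a b hab ha hb z hz
    refine Or.inl ⟨s(a, b), hab, ?_, hz⟩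
    intro t ht
    rcases Sym2.mem_iff.1 ht with rfl | rfl <;> assumption
  · intro e he e' he' hne
    rw [Set.disjoint_left]
    rintro z (⟨d, hdm, hdC, hz⟩ | ⟨t, ht, hts, rfl⟩) (⟨d', hdm', hdC', hz'⟩ | ⟨t', ht', hts', h⟩)
    · by_cases hdd : d = d'
      · subst hdd
        induction d with
        | h a b =>
          obtain ⟨x, hx, hx', hxa⟩ := hCC e he e' he' hne a (hdC a (by simp)) (hdC' a (by simp))
          obtain ⟨y, hy, hy', hyb⟩ := hCC e he e' he' hne b (hdC b (by simp)) (hdC' b (by simp))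
          have hab : a ≠ b := H.ne_of_adj hdm
          have hxy : x ≠ y := by rintro rfl; exact hab (hxa.symm.trans hyb)
          exact hne (((Sym2.mem_and_mem_iff hxy).1 ⟨hx, hy⟩).trans
            ((Sym2.mem_and_mem_iff hxy).1 ⟨hx', hy'⟩).symm)
      · exact Set.disjoint_left.1 (hd' d hdm d' hdm' hdd) hz hz'
    · exact hf' d hdm t' hts' (h ▸ hz)
    · exact hf' d' hdm' t hts hz'
    · have := hinj' hts' hts h
      subst this
      exact Set.disjoint_left.1 (hd e he e' he' hne) ht ht'
  · rintro e he x hx (⟨d, hdm, -, hz⟩ | ⟨t, ht, hts, h⟩)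
    · exact hf' d hdm _ (hsup x hx) hz
    · have := hinj' hts (hsup x hx) h
      subst this
      exact hf e he x hx ht

lemma Emb.of_homeoEmbedding {G : SimpleGraph X} {H : SimpleGraph W} (η : G.HomeoEmbedding H) :
    Emb G H := by
  refine ⟨η.toFun, fun e => {t | ∃ (x y : X) (h : G.Adj x y), e = s(x, y) ∧
    t ∈ (η.path h).support ∧ t ≠ η.toFun x ∧ t ≠ η.toFun y}, η.injective.injOn, ?_, ?_, ?_⟩
  · intro x y h
    have hne : η.toFun x ≠ η.toFun y := fun h' => G.ne_of_adj h (η.injective h')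
    obtain ⟨l, hl⟩ := exists_support_eq (η.path h) hne
    have hn := (η.isPath h).support_nodup
    rw [hl] at hn
    exact ⟨l, hl ▸ (η.path h).isChain_adj_support, fun z hz =>
      ⟨x, y, h, rfl, by rw [hl]; simp [hz], nodup_path_list hn z hz⟩⟩
  · intro e _ e' _ hne
    rw [Set.disjoint_left]
    rintro t ⟨x, y, h, rfl, ht, hx, hy⟩ ⟨x', y', h', rfl, ht', -, -⟩
    rcases (η.inner_disjoint h h' hne t ht ht').1 with h | h
    · exact hx h
    · exact hy h
  · rintro e he z hz ⟨x, y, h, rfl, ht, hx, hy⟩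
    rcases η.vertex_disjoint h z ht with rfl | rfl
    · exact hx rfl
    · exact hy rfl

lemma Emb.homeoEmbedding {G : SimpleGraph X} {H : SimpleGraph W} (h : Emb G H)
    (hs : ∀ x, x ∈ G.support) : Nonempty (G.HomeoEmbedding H) := by
  classical
  obtain ⟨f, I, hinj, hJ, hd, hf⟩ := h
  have hinj : Function.Injective f := fun x y h => hinj (hs x) (hs y) h
  choose Q hQ hQs using fun (x y : X) (h : G.Adj x y) => (hJ x y h).exists_path
  let P : ∀ (x y : X), G.Adj x y → H.Walk (f x) (f y) := fun x y h =>
    if x = (Quot.out s(x, y)).1 then Q x y h else (Q y x h.symm).reverse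
  have hPp : ∀ x y h, (P x y h).IsPath := by
    intro x y h
    simp only [P]
    split_ifs
    · exact hQ x y h
    · exact (hQ y x h.symm).reverse
  have hPs : ∀ x y h, ∀ z ∈ (P x y h).support, z = f x ∨ z = f y ∨ z ∈ I s(x, y) := by
    intro x y h z hz
    simp only [P] at hz
    split_ifs at hz
    · exact hQs x y h z hz
    · rw [Walk.support_reverse, List.mem_reverse] at hz
      have := hQs y x h.symm z hz
      rw [Sym2.eq_swap] at this
      tauto
  have hin : ∀ {x y x' y' : X} (h : G.Adj x y) (h' : G.Adj x' y'), s(x, y) ≠ s(x', y') →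
    ∀ t : W, t ∈ (P x y h).support → t ∈ (P x' y' h').support →
      (t = f x ∨ t = f y) ∧ (t = f x' ∨ t = f y') := by
    intro x y x' y' h h' hne t ht ht'
    have h1 := hPs _ _ h t ht
    have h2 := hPs _ _ h' t ht'
    have h3 := hf s(x, y) h
    have h4 := hf s(x', y') h'
    have h5 : t ∈ I s(x, y) → t ∉ I s(x', y') := fun h1 =>
      Set.disjoint_left.1 (hd s(x, y) h s(x', y') h' hne) h1
    rcases h1 with rfl | rfl | h1
    · exact ⟨Or.inl rfl, by have := h4 x (hs x); tauto⟩
    · exact ⟨Or.inr rfl, by have := h4 y (hs y); tauto⟩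
    · rcases h2 with rfl | rfl | h2
      · exact absurd h1 (h3 _ (hs _))
      · exact absurd h1 (h3 _ (hs _))
      · exact absurd h2 (h5 h1)
  refine ⟨⟨f, hinj, fun {x y} h => P x y h, ?_, fun h => hPp _ _ h, ?_, ?_, hin⟩⟩
  · intro x y h
    have hxy := G.ne_of_adj h
    have hout : (Quot.out s(x, y)).1 = x ∨ (Quot.out s(x, y)).1 = y := by
      have : s((Quot.out s(x, y)).1, (Quot.out s(x, y)).2) = s(x, y) := Quot.out_eq s(x, y)
      rcases Sym2.eq_iff.1 this with ⟨h, -⟩ | ⟨h, -⟩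
      · exact Or.inl h
      · exact Or.inr h
    have hsw : s(y, x) = s(x, y) := Sym2.eq_swap
    simp only [P, hsw]
    rcases hout with h1 | h1
    · rw [h1, if_neg hxy.symm, if_pos rfl]
    · rw [h1, if_pos rfl, if_neg hxy, Walk.reverse_reverse]
  · intro x y h z hz
    rcases hPs x y h _ hz with h1 | h1 | h1
    · exact Or.inl (hinj h1)
    · exact Or.inr (hinj h1)
    · exact absurd h1 (hf s(x, y) h z (hs z))
  · intro x y x' y' h h' hne e he he'
    induction e with
    | h a b =>
      have hab : a ≠ b := H.ne_of_adj (Walk.adj_of_mem_edges _ he)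
      have h1 := hin h h' hne a (Walk.fst_mem_support_of_mem_edges _ he)
        (Walk.fst_mem_support_of_mem_edges _ he')
      have h2 := hin h h' hne b (Walk.snd_mem_support_of_mem_edges _ he)
        (Walk.snd_mem_support_of_mem_edges _ he')
      apply hne
      have hfe : ∀ {s t : X}, f s = f t ↔ s = t := hinj.eq_iff
      rcases h1 with ⟨rfl | rfl, h3⟩ <;> rcases h2 with ⟨rfl | rfl, h4⟩ <;>
        simp only [hfe, Sym2.eq_iff, ne_eq] at * <;> grind

/-- The graph `K + (u, v, x, y)` built inside the vertex type of `K`, with `p`, `q` as its new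
vertices. -/
def ins (K : SimpleGraph X) (u v x y p q : X) : SimpleGraph X :=
  K.deleteEdges {s(u, v), s(x, y)} ⊔
    fromEdgeSet {s(u, p), s(p, v), s(x, q), s(q, y), s(p, q)}

lemma ins_adj {K : SimpleGraph X} {u v x y p q a b : X} :
    (ins K u v x y p q).Adj a b ↔ (K.Adj a b ∧ s(a, b) ≠ s(u, v) ∧ s(a, b) ≠ s(x, y)) ∨
      (a ≠ b ∧ (s(a, b) = s(u, p) ∨ s(a, b) = s(p, v) ∨ s(a, b) = s(x, q) ∨ s(a, b) = s(q, y) ∨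
        s(a, b) = s(p, q))) := by
  simp only [ins, sup_adj, deleteEdges_adj, fromEdgeSet_adj, Set.mem_insert_iff,
    Set.mem_singleton_iff, not_or, ne_eq]
  tauto

lemma ins_swap_right (K : SimpleGraph X) (u v x y p q : X) :
    ins K u v x y p q = ins K u v y x p q := by
  ext a b
  rw [ins_adj, ins_adj, Sym2.eq_swap (a := x) (b := y), Sym2.eq_swap (a := x) (b := q),
    Sym2.eq_swap (a := q) (b := y)]
  tauto

lemma ins_swap_left (K : SimpleGraph X) (u v x y p q : X) :
    ins K u v x y p q = ins K v u x y p q := by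
  ext a b
  rw [ins_adj, ins_adj, Sym2.eq_swap (a := u) (b := v), Sym2.eq_swap (a := u) (b := p),
    Sym2.eq_swap (a := p) (b := v)]
  tauto

lemma ins_support {K : SimpleGraph X} {u v x y p q : X} (huv : K.Adj u v) (hxy : K.Adj x y)
    (hp : p ∉ K.support) (hq : q ∉ K.support) (hpq : p ≠ q) :
    (ins K u v x y p q).support = insert p (insert q K.support) := by
  have hu : u ∈ K.support := ⟨v, huv⟩
  have hv : v ∈ K.support := ⟨u, huv.symm⟩
  have hx : x ∈ K.support := ⟨y, hxy⟩
  have hy : y ∈ K.support := ⟨x, hxy.symm⟩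
  have hne : ∀ z ∈ K.support, z ≠ p ∧ z ≠ q := fun z hz =>
    ⟨fun h => hp (h ▸ hz), fun h => hq (h ▸ hz)⟩
  ext z
  simp only [Set.mem_insert_iff]
  constructor
  · rintro ⟨t, ht⟩
    replace ht := ins_adj.1 ht
    rcases ht with ⟨h, -, -⟩ | ⟨-, h⟩
    · exact Or.inr (Or.inr ⟨t, h⟩)
    · simp only [Sym2.eq_iff] at h
      rcases h with (⟨rfl, -⟩ | ⟨rfl, -⟩) | (⟨rfl, -⟩ | ⟨rfl, -⟩) | (⟨rfl, -⟩ | ⟨rfl, -⟩) |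
        (⟨rfl, -⟩ | ⟨rfl, -⟩) | (⟨rfl, -⟩ | ⟨rfl, -⟩) <;> simp [*]
  · rintro (rfl | rfl | hz)
    · exact ⟨q, ins_adj.2 (Or.inr ⟨hpq, by simp⟩)⟩
    · exact ⟨p, ins_adj.2 (Or.inr ⟨hpq.symm, by simp⟩)⟩
    · by_cases h1 : z = u ∨ z = v
      · exact ⟨p, ins_adj.2 (Or.inr ⟨(hne z hz).1, by rcases h1 with rfl | rfl <;> simp⟩)⟩
      by_cases h2 : z = x ∨ z = y
      · exact ⟨q, ins_adj.2 (Or.inr ⟨(hne z hz).2, by rcases h2 with rfl | rfl <;> simp⟩)⟩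
      obtain ⟨t, ht⟩ := hz
      refine ⟨t, ins_adj.2 (Or.inl ⟨ht, ?_, ?_⟩)⟩ <;> rw [Ne, Sym2.eq_iff] <;> tauto

lemma emb_ins {K : SimpleGraph X} {u v x y p q : X} (huv : K.Adj u v) (hxy : K.Adj x y)
    (hne : s(u, v) ≠ s(x, y)) (hp : p ∉ K.support) (hq : q ∉ K.support) (hpq : p ≠ q) :
    Emb K (ins K u v x y p q) := by
  have hn : ∀ z ∈ K.support, z ≠ p ∧ z ≠ q := fun z hz =>
    ⟨fun h => hp (h ▸ hz), fun h => hq (h ▸ hz)⟩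
  refine ⟨id, fun e => {z | (e = s(u, v) ∧ z = p) ∨ (e = s(x, y) ∧ z = q)}, Set.injOn_id _,
    ?_, ?_, ?_⟩
  · intro a b hab
    have ha := hn a ⟨b, hab⟩
    have hb := hn b ⟨a, hab.symm⟩
    by_cases h1 : s(a, b) = s(u, v)
    · refine ⟨[p], ?_, by simp [h1]⟩
      simp only [id_eq, List.cons_append, List.nil_append, List.isChain_cons_cons,
        List.isChain_singleton, and_true, ins_adj]
      rcases Sym2.eq_iff.1 h1 with ⟨rfl, rfl⟩ | ⟨rfl, rfl⟩ <;> simp [ha.1, hb.1.symm]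
    by_cases h2 : s(a, b) = s(x, y)
    · refine ⟨[q], ?_, by simp [h2]⟩
      simp only [id_eq, List.cons_append, List.nil_append, List.isChain_cons_cons,
        List.isChain_singleton, and_true, ins_adj]
      rcases Sym2.eq_iff.1 h2 with ⟨rfl, rfl⟩ | ⟨rfl, rfl⟩ <;> simp [ha.2, hb.2.symm]
    · exact Join.of_adj (ins_adj.2 (Or.inl ⟨hab, h1, h2⟩)) _
  · intro e _ e' _ h
    rw [Set.disjoint_left]
    rintro z (⟨rfl, rfl⟩ | ⟨rfl, rfl⟩) (⟨rfl, h'⟩ | ⟨rfl, h'⟩)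
    · exact h rfl
    · exact hpq h'
    · exact hpq h'.symm
    · exact h rfl
  · rintro e _ z hz (⟨-, rfl⟩ | ⟨-, rfl⟩)
    · exact hp hz
    · exact hq hz

lemma emb_ins_of_jump {K : SimpleGraph X} {H : SimpleGraph W} {f : X → W} {I : Sym2 X → Set W}
    (hinj : Set.InjOn f K.support)
    (hJ : ∀ x y, K.Adj x y → Join H (f x) (f y) (I s(x, y)))
    (hd : ∀ e ∈ K.edgeSet, ∀ e' ∈ K.edgeSet, e ≠ e' → Disjoint (I e) (I e'))
    (hf : ∀ e ∈ K.edgeSet, ∀ x ∈ K.support, f x ∉ I e)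
    {u v x y p q : X} (huv : K.Adj u v) (hxy : K.Adj x y)
    (hne : s(u, v) ≠ s(x, y)) (hp : p ∉ K.support) (hq : q ∉ K.support) (hpq : p ≠ q)
    {a o : W} {A₁ A₂ B₁ B₂ S : Set W} (hA₁ : Join H (f u) a A₁) (hA₂ : Join H a (f v) A₂)
    (hB₁ : Join H (f x) o B₁) (hB₂ : Join H o (f y) B₂) (hS : Join H a o S)
    (hA : insert a (A₁ ∪ A₂) ⊆ I s(u, v)) (hB : insert o (B₁ ∪ B₂) ⊆ I s(x, y))
    (hA' : Disjoint A₁ A₂) (hB' : Disjoint B₁ B₂) (ha : a ∉ A₁ ∪ A₂) (ho : o ∉ B₁ ∪ B₂)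
    (hSf : ∀ x ∈ K.support, f x ∉ S) (hSI : ∀ e ∈ K.edgeSet, Disjoint (I e) S) :
    Emb (ins K u v x y p q) H := by
  classical
  have hn : ∀ z ∈ K.support, z ≠ p ∧ z ≠ q := fun z hz =>
    ⟨fun h => hp (h ▸ hz), fun h => hq (h ▸ hz)⟩
  have hus := hn u ⟨v, huv⟩
  have hvs := hn v ⟨u, huv.symm⟩
  have hxs := hn x ⟨y, hxy⟩
  have hys := hn y ⟨x, hxy.symm⟩
  obtain ⟨f', hf'⟩ : ∃ f' : X → W, f' = fun z => if z = p then a else if z = q then o else f z :=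
    ⟨_, rfl⟩
  have hfp : f' p = a := by simp [hf']
  have hfq : f' q = o := by simp [hf', hpq.symm]
  have hff : ∀ z ∈ K.support, f' z = f z := fun z hz => by simp [hf', (hn z hz).1, (hn z hz).2]
  have hA1 : A₁ ⊆ I s(u, v) := fun z hz => hA (Or.inr (Or.inl hz))
  have hA2 : A₂ ⊆ I s(u, v) := fun z hz => hA (Or.inr (Or.inr hz))
  have hB1 : B₁ ⊆ I s(x, y) := fun z hz => hB (Or.inr (Or.inl hz))
  have hB2 : B₂ ⊆ I s(x, y) := fun z hz => hB (Or.inr (Or.inr hz))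
  have haI : a ∈ I s(u, v) := hA (Or.inl rfl)
  have hoI : o ∈ I s(x, y) := hB (Or.inl rfl)
  have hAB := hd _ huv _ hxy hne
  let ι := {e : Sym2 X // e ∈ K.edgeSet ∧ e ≠ s(u, v) ∧ e ≠ s(x, y)}
  let J : ι ⊕ Fin 5 → Set W := Sum.elim (fun e => I e.1) ![A₁, A₂, B₁, B₂, S]
  have hJd : ∀ (e : ι), Disjoint (I e.1) (I s(u, v)) ∧ Disjoint (I e.1) (I s(x, y)) ∧
      Disjoint (I e.1) S :=
    fun e => ⟨hd _ e.2.1 _ huv e.2.2.1, hd _ e.2.1 _ hxy e.2.2.2, hSI _ e.2.1⟩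
  have hSuv := hSI s(u, v) huv
  have hSxy := hSI s(x, y) hxy
  have hmix : ∀ (e : ι) (j : Fin 5), Disjoint (I e.1) (![A₁, A₂, B₁, B₂, S] j) := by
    intro e j
    obtain ⟨h1, h2, h3⟩ := hJd e
    fin_cases j
    · exact h1.mono_right hA1
    · exact h1.mono_right hA2
    · exact h2.mono_right hB1
    · exact h2.mono_right hB2
    · exact h3
  have hfin : ∀ i j : Fin 5, i < j →
      Disjoint (![A₁, A₂, B₁, B₂, S] i) (![A₁, A₂, B₁, B₂, S] j) := by
    intro i j hij
    fin_cases i <;> fin_cases j <;> first | exact absurd hij (by decide) | skip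
    · exact hA'
    · exact hAB.mono hA1 hB1
    · exact hAB.mono hA1 hB2
    · exact hSuv.mono_left hA1
    · exact hAB.mono hA2 hB1
    · exact hAB.mono hA2 hB2
    · exact hSuv.mono_left hA2
    · exact hB'
    · exact hSxy.mono_left hB1
    · exact hSxy.mono_left hB2
  refine Emb.of_index (ι := ι ⊕ Fin 5)
    (Sum.elim (fun e => Quot.out e.1) ![(u, p), (p, v), (x, q), (q, y), (p, q)]) ?_ f' J
    ?_ ?_ ?_ ?_
  · intro s t hst
    rw [ins_adj] at hst
    rcases hst with h | ⟨-, h | h | h | h | h⟩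
    · exact ⟨Sum.inl ⟨s(s, t), h⟩, Quot.out_eq s(s, t)⟩
    · exact ⟨Sum.inr 0, h.symm⟩
    · exact ⟨Sum.inr 1, h.symm⟩
    · exact ⟨Sum.inr 2, h.symm⟩
    · exact ⟨Sum.inr 3, h.symm⟩
    · exact ⟨Sum.inr 4, h.symm⟩
  · rw [ins_support huv hxy hp hq hpq]
    have hap : ∀ z ∈ K.support, f z ≠ a := fun z hz h => hf _ huv z hz (h ▸ haI)
    have hoq : ∀ z ∈ K.support, f z ≠ o := fun z hz h => hf _ hxy z hz (h ▸ hoI)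
    have hao : a ≠ o := by
      rintro rfl
      exact Set.disjoint_left.1 hAB haI hoI
    rintro z (rfl | rfl | hz) t (rfl | rfl | ht) h
    · rfl
    · rw [hfp, hfq] at h; exact absurd h hao
    · rw [hfp, hff _ ht] at h; exact absurd h.symm (hap t ht)
    · rw [hfp, hfq] at h; exact absurd h.symm hao
    · rfl
    · rw [hfq, hff _ ht] at h; exact absurd h.symm (hoq t ht)
    · rw [hfp, hff _ hz] at h; exact absurd h (hap z hz)
    · rw [hfq, hff _ hz] at h; exact absurd h (hoq z hz)
    · rw [hff _ hz, hff _ ht] at h; exact hinj hz ht h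
  · rintro (⟨e, he, h1, h2⟩ | i)
    · have h3 : s((Quot.out e).1, (Quot.out e).2) = e := Quot.out_eq e
      have h4 : K.Adj (Quot.out e).1 (Quot.out e).2 := by rw [← h3] at he; exact he
      have h5 := hJ _ _ h4
      rw [h3] at h5
      simp only [Sum.elim_inl, J]
      rw [hff _ ⟨_, h4⟩, hff _ ⟨_, h4.symm⟩]
      exact h5
    · have hu' := hff u ⟨v, huv⟩
      have hv' := hff v ⟨u, huv.symm⟩
      have hx' := hff x ⟨y, hxy⟩
      have hy' := hff y ⟨x, hxy.symm⟩
      fin_cases i <;> simp [J, hfp, hfq, hu', hv', hx', hy'] <;> assumption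
  · rintro (e | i) (e' | j) hij
    · exact hd _ e.2.1 _ e'.2.1 fun h => hij (congrArg Sum.inl (Subtype.ext h))
    · exact hmix e j
    · exact (hmix e' i).symm
    · rcases lt_trichotomy i j with h | h | h
      · exact hfin i j h
      · exact absurd (congrArg Sum.inr h) hij
      · exact (hfin j i h).symm
  · rw [ins_support huv hxy hp hq hpq]
    have haS : a ∉ S := Set.disjoint_left.1 hSuv haI
    have hoS : o ∉ S := Set.disjoint_left.1 hSxy hoI
    have haxy : a ∉ I s(x, y) := Set.disjoint_left.1 hAB haI
    have houv : o ∉ I s(u, v) := Set.disjoint_right.1 hAB hoI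
    rintro (e | i) z hz
    · obtain ⟨h1, h2, h3⟩ := hJd e
      rcases hz with rfl | rfl | hz
      · rw [hfp]; exact Set.disjoint_right.1 h1 haI
      · rw [hfq]; exact Set.disjoint_right.1 h2 hoI
      · rw [hff z hz]; exact hf _ e.2.1 z hz
    · have hzuv := fun hz => hf s(u, v) huv z hz
      have hzxy := fun hz => hf s(x, y) hxy z hz
      rcases hz with rfl | rfl | hz
      · rw [hfp]
        fin_cases i
        · exact fun h => ha (Or.inl h)
        · exact fun h => ha (Or.inr h)
        · exact fun h => haxy (hB1 h)
        · exact fun h => haxy (hB2 h)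
        · exact haS
      · rw [hfq]
        fin_cases i
        · exact fun h => houv (hA1 h)
        · exact fun h => houv (hA2 h)
        · exact fun h => ho (Or.inl h)
        · exact fun h => ho (Or.inr h)
        · exact hoS
      · rw [hff z hz]
        fin_cases i
        · exact fun h => hzuv hz (hA1 h)
        · exact fun h => hzuv hz (hA2 h)
        · exact fun h => hzxy hz (hB1 h)
        · exact fun h => hzxy hz (hB2 h)
        · exact hSf z hz

end Emb

end QuadExp

namespace QuadExp

open SimpleGraph

section Cubic

variable {W : Type*}

lemma eq_of_encard_eq_three {s : Set W} (hs : s.encard = 3) {x y z : W} (hx : x ∈ s) (hy : y ∈ s)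
    (hz : z ∈ s) (hxy : x ≠ y) (hxz : x ≠ z) (hyz : y ≠ z) : ∀ t ∈ s, t = x ∨ t = y ∨ t = z := by
  have h3 : ({x, y, z} : Set W).encard = 3 := Set.encard_eq_three.2 ⟨x, y, z, hxy, hxz, hyz, rfl⟩
  have hfin : s.Finite := Set.finite_of_encard_eq_coe (k := 3) hs
  have hsub : ({x, y, z} : Set W) ⊆ s := by
    rintro t (rfl | rfl | rfl) <;> assumption
  have hle : s.encard ≤ ({x, y, z} : Set W).encard := by rw [hs, h3]
  have := hfin.eq_of_subset_of_encard_le' hsub hle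
  intro t ht
  rw [← this] at ht
  simpa using ht

lemma card_add_two_le_edgeCut [Finite W] {H : SimpleGraph W} (hH : H.IsCubic) {B : Set W}
    (hB : B.Nonempty) (hac : (H.induce B).IsAcyclic) : B.ncard + 2 ≤ (H.edgeCut B).ncard := by
  classical
  have := Fintype.ofFinite W
  have : Nonempty B := hB.to_subtype
  obtain ⟨T, hFT, hT⟩ := Finite.exists_le_maximal (p := IsAcyclic) hac
  have hTree : T.IsTree := isTree_iff_maximal_isAcyclic.2 ⟨inferInstance, hT⟩
  have h1 := hTree.card_edgeFinset
  have h2 : (H.induce B).edgeFinset.card ≤ T.edgeFinset.card :=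
    Finset.card_le_card (edgeFinset_mono hFT)
  have h3 := (H.induce B).sum_degrees_eq_twice_card_edges
  have hcard : Fintype.card B = B.ncard := by
    rw [← Nat.card_eq_fintype_card, Nat.card_coe_set_eq]
  let out : B → Finset W := fun x => Finset.univ.filter fun y => H.Adj x y ∧ y ∉ B
  have hdeg : ∀ x : B, (H.induce B).degree x + (out x).card = 3 := by
    intro x
    have ha : (H.induce B).degree x =
        (Finset.univ.filter fun y => H.Adj x y ∧ y ∈ B).card := by
      rw [← card_neighborFinset_eq_degree,
        ← Finset.card_map (Function.Embedding.subtype (· ∈ B))]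
      congr 1
      ext y
      simp [and_comm]
    have hb : (Finset.univ.filter fun y => H.Adj x y).card = 3 := by
      have := hH x
      rw [Set.encard_eq_coe_toFinset_card] at this
      have h : (H.neighborSet x).toFinset = Finset.univ.filter fun y => H.Adj x y := by
        ext y; simp
      rw [h] at this
      exact_mod_cast this
    rw [ha, ← hb, ← Finset.card_filter_add_card_filter_not (s := Finset.univ.filter
      fun y => H.Adj x y) (fun y => y ∈ B), Finset.filter_filter, Finset.filter_filter]
  have hsum : ∑ x : B, (H.induce B).degree x + ∑ x : B, (out x).card = 3 * Fintype.card B := by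
    rw [← Finset.sum_add_distrib, Finset.sum_congr rfl fun x _ => hdeg x]
    simp [mul_comm]
  have hcut : ∑ x : B, (out x).card ≤ (H.edgeCut B).ncard := by
    rw [← Finset.card_sigma, Set.ncard_eq_toFinset_card']
    refine Finset.card_le_card_of_injOn (fun z => s((z.1 : W), z.2)) ?_ ?_
    · rintro ⟨x, y⟩ hz
      simp only [Finset.coe_sigma, Set.mem_sigma_iff, out] at hz
      have hz := (Finset.mem_filter.1 hz.2).2
      simp only [Set.coe_toFinset]
      exact ⟨x, x.2, y, hz.2, hz.1, rfl⟩
    · rintro ⟨x, y⟩ hz ⟨x', y'⟩ hz' h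
      simp only [Finset.coe_sigma, Set.mem_sigma_iff, out] at hz hz'
      have hz := (Finset.mem_filter.1 hz.2).2
      have hz' := (Finset.mem_filter.1 hz'.2).2
      simp only [Sym2.eq_iff] at h
      rcases h with ⟨h1, rfl⟩ | ⟨h1, h2⟩
      · obtain rfl := Subtype.ext h1
        rfl
      · exact absurd (h1 ▸ x.2) hz'.2
  omega

lemma not_isAcyclic_of_edgeCut_le [Finite W] {H : SimpleGraph W} (hH : H.IsCubic) {B : Set W}
    (hB : 3 ≤ B.ncard) (hcut : (H.edgeCut B).encard ≤ 4) : ¬ (H.induce B).IsAcyclic := by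
  intro hac
  have hne : B.Nonempty := by
    rw [← Set.ncard_pos]; omega
  have h := card_add_two_le_edgeCut hH hne hac
  have : (H.edgeCut B).ncard ≤ 4 := by
    rw [← Set.Finite.cast_ncard_eq (Set.toFinite _)] at hcut
    exact_mod_cast hcut
  omega

lemma edgeCut_compl (H : SimpleGraph W) (B : Set W) : H.edgeCut Bᶜ = H.edgeCut B := by
  ext e
  constructor
  · rintro ⟨a, ha, b, hb, hab, rfl⟩
    exact ⟨b, not_not.1 hb, a, ha, hab.symm, Sym2.eq_swap⟩
  · rintro ⟨a, ha, b, hb, hab, rfl⟩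
    exact ⟨b, hb, a, not_not.2 ha, hab.symm, Sym2.eq_swap⟩

lemma five_le_edgeCut [Finite W] {H : SimpleGraph W} (hH : H.IsCubic)
    (hH5 : H.IsCyclicallyConnected 5) {B : Set W} (hB : 3 ≤ B.ncard) (hB' : 3 ≤ Bᶜ.ncard) :
    ¬ (H.edgeCut B).encard ≤ 4 := by
  intro h
  have hne : B.Nonempty := by rw [← Set.ncard_pos]; omega
  have hne' : Bᶜ.Nonempty := by rw [← Set.ncard_pos]; omega
  rcases hH5.2.2 B hne (Set.nonempty_compl.1 hne') (lt_of_le_of_lt h (by norm_num)) with h1 | h1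
  · exact not_isAcyclic_of_edgeCut_le hH hB h h1
  · exact not_isAcyclic_of_edgeCut_le hH hB' (by rwa [edgeCut_compl]) h1

end Cubic

section Frame

variable {W : Type*}

lemma pair_infix_append {x y : W} {l₁ l₂ : List W} (h : [x, y] <:+: l₁ ++ l₂) (hx : x ∉ l₁) :
    [x, y] <:+: l₂ := by
  induction l₁ with
  | nil => simpa using h
  | cons c l ih =>
    rw [List.cons_append, List.infix_cons_iff] at h
    rcases h with h | h
    · rw [List.cons_prefix_cons] at h
      exact absurd (by simp [h.1]) hx
    · exact ih h (fun hx' => hx (by simp [hx']))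

lemma not_mem_of_head_not_mem {S : Set W} : ∀ {l : List W},
    (∀ x y, [x, y] <:+: l → y ∈ S → x ∈ S) → (∀ z, l.head? = some z → z ∉ S) → ∀ z ∈ l, z ∉ S
  | [], _, _ => by simp
  | [c], _, h => by simpa using h
  | c :: d :: l, hcl, h => by
    have hc : c ∉ S := h c rfl
    have hd : d ∉ S := fun hd => hc (hcl c d ⟨[], l, rfl⟩ hd)
    intro z hz
    rcases List.mem_cons.1 hz with rfl | hz
    · exact hc
    · exact not_mem_of_head_not_mem (l := d :: l)
        (fun x y hxy => hcl x y (hxy.trans (List.infix_cons (List.infix_refl _))))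
        (fun z hz => by simp at hz; exact hz ▸ hd) z hz

lemma exit_unique {S : Set W} {l : List W} (hcl : ∀ x y, [x, y] <:+: l → y ∈ S → x ∈ S)
    {x y x' y' : W} (h : [x, y] <:+: l) (h' : [x', y'] <:+: l) (hx : x ∈ S) (hy : y ∉ S)
    (hx' : x' ∈ S) (hy' : y' ∉ S) : x = x' ∧ y = y' := by
  induction l with
  | nil => simp at h
  | cons c l ih =>
    have hcl' : ∀ x y, [x, y] <:+: l → y ∈ S → x ∈ S := fun x y hxy =>
      hcl x y (hxy.trans (List.infix_cons (List.infix_refl _)))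
    have key : ∀ {x y x' y' : W}, [x, y] <+: c :: l → [x', y'] <:+: l → y ∉ S → x' ∈ S → False := by
      intro x y x' y' h h' hy hx'
      rw [List.cons_prefix_cons] at h
      obtain ⟨t, ht⟩ := h.2
      refine not_mem_of_head_not_mem hcl' (fun z hz => ?_) x' (h'.subset (by simp)) hx'
      rw [← ht] at hz
      simp at hz
      exact hz ▸ hy
    rw [List.infix_cons_iff] at h h'
    rcases h with h | h <;> rcases h' with h' | h'
    · obtain ⟨t, ht⟩ := h
      obtain ⟨t', ht'⟩ := h'
      rw [← ht'] at ht
      simp at ht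
      exact ⟨ht.1, ht.2.1⟩
    · exact (key h h' hy hx').elim
    · exact (key h' h hy' hx).elim
    · exact ih hcl' h h'

/-- A circuit through `a₁, a₂, a₃, a₄` (with the inner vertices `cᵢ` between them) and four paths
from `aᵢ` to `pᵢ` (with inner vertices `rᵢ`). -/
structure Frame (W : Type*) where
  (a₁ a₂ a₃ a₄ p₁ p₂ p₃ p₄ : W)
  (c₁ c₂ c₃ c₄ r₁ r₂ r₃ r₄ : List W)

namespace Frame

variable (F : Frame W) (H : SimpleGraph W) (O : Set W)

/-- The vertices of the circuit. -/
def circ : List W := F.a₁ :: F.c₁ ++ F.a₂ :: F.c₂ ++ F.a₃ :: F.c₃ ++ F.a₄ :: F.c₄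

/-- The vertices of the circuit and the inner vertices of the paths. -/
def total : List W := F.circ ++ F.r₁ ++ F.r₂ ++ F.r₃ ++ F.r₄

/-- The frame rotated by one step. -/
def rot : Frame W :=
  ⟨F.a₂, F.a₃, F.a₄, F.a₁, F.p₂, F.p₃, F.p₄, F.p₁, F.c₂, F.c₃, F.c₄, F.c₁, F.r₂, F.r₃, F.r₄, F.r₁⟩

/-- The frame reflected so that `a₁` and `a₂` are exchanged. -/
def refl : Frame W :=
  ⟨F.a₂, F.a₁, F.a₄, F.a₃, F.p₂, F.p₁, F.p₄, F.p₃, F.c₁.reverse, F.c₄.reverse, F.c₃.reverse,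
    F.c₂.reverse, F.r₂, F.r₁, F.r₄, F.r₃⟩

/-- The frame lies in `H`, is disjoint from `O`, and its paths end in `O`. -/
structure Valid : Prop where
  hc₁ : (F.a₁ :: (F.c₁ ++ [F.a₂])).IsChain H.Adj
  hc₂ : (F.a₂ :: (F.c₂ ++ [F.a₃])).IsChain H.Adj
  hc₃ : (F.a₃ :: (F.c₃ ++ [F.a₄])).IsChain H.Adj
  hc₄ : (F.a₄ :: (F.c₄ ++ [F.a₁])).IsChain H.Adj
  hr₁ : (F.a₁ :: (F.r₁ ++ [F.p₁])).IsChain H.Adj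
  hr₂ : (F.a₂ :: (F.r₂ ++ [F.p₂])).IsChain H.Adj
  hr₃ : (F.a₃ :: (F.r₃ ++ [F.p₃])).IsChain H.Adj
  hr₄ : (F.a₄ :: (F.r₄ ++ [F.p₄])).IsChain H.Adj
  nodup : F.total.Nodup
  out : ∀ z ∈ F.total, z ∉ O
  hp₁ : F.p₁ ∈ O
  hp₂ : F.p₂ ∈ O
  hp₃ : F.p₃ ∈ O
  hp₄ : F.p₄ ∈ O

/-- A step of a walk of `H` that does not follow one of the four paths in forward direction. -/
def Res (x y : W) : Prop :=
  H.Adj x y ∧ ¬ [x, y] <:+: F.a₁ :: (F.r₁ ++ [F.p₁]) ∧ ¬ [x, y] <:+: F.a₂ :: (F.r₂ ++ [F.p₂]) ∧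
    ¬ [x, y] <:+: F.a₃ :: (F.r₃ ++ [F.p₃]) ∧ ¬ [x, y] <:+: F.a₄ :: (F.r₄ ++ [F.p₄])

variable {F H O}

lemma chain_reverse {a b : W} {l : List W} (h : (a :: (l ++ [b])).IsChain H.Adj) :
    (b :: (l.reverse ++ [a])).IsChain H.Adj := by
  have : b :: (l.reverse ++ [a]) = (a :: (l ++ [b])).reverse := by simp
  rw [this, List.isChain_reverse]
  exact h.imp fun _ _ h => h.symm

lemma mem_circ_rot {z : W} : z ∈ F.rot.circ ↔ z ∈ F.circ := by
  simp only [circ, rot, List.mem_append, List.mem_cons]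
  tauto

lemma mem_circ_refl {z : W} : z ∈ F.refl.circ ↔ z ∈ F.circ := by
  simp only [circ, refl, List.mem_append, List.mem_cons, List.mem_reverse]
  tauto

lemma mem_total_rot {z : W} : z ∈ F.rot.total ↔ z ∈ F.total := by
  simp only [total, List.mem_append, mem_circ_rot]
  simp only [rot]
  tauto

lemma mem_total_refl {z : W} : z ∈ F.refl.total ↔ z ∈ F.total := by
  simp only [total, List.mem_append, mem_circ_refl]
  simp only [refl]
  tauto

/-- The number of occurrences of `x` in `[a]`. -/
def hit [DecidableEq W] (x a : W) : ℕ := [a].count x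

lemma count_cons_eq [DecidableEq W] (x a : W) (l : List W) :
    (a :: l).count x = hit x a + l.count x := by
  unfold hit
  rw [← List.singleton_append, List.count_append]

lemma nodup_total_rot (h : F.total.Nodup) : F.rot.total.Nodup := by
  classical
  rw [List.nodup_iff_count_le_one] at h ⊢
  intro x
  have := h x
  simp only [total, circ, rot, List.count_append, count_cons_eq] at this ⊢
  omega

lemma nodup_total_refl (h : F.total.Nodup) : F.refl.total.Nodup := by
  classical
  rw [List.nodup_iff_count_le_one] at h ⊢
  intro x
  have := h x
  simp only [total, circ, refl, List.count_append, count_cons_eq, List.count_reverse] at this ⊢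
  omega

lemma Valid.rot (h : F.Valid H O) : F.rot.Valid H O :=
  ⟨h.hc₂, h.hc₃, h.hc₄, h.hc₁, h.hr₂, h.hr₃, h.hr₄, h.hr₁, nodup_total_rot h.nodup,
    fun z hz => h.out z (mem_total_rot.1 hz), h.hp₂, h.hp₃, h.hp₄, h.hp₁⟩

lemma Valid.refl (h : F.Valid H O) : F.refl.Valid H O :=
  ⟨chain_reverse h.hc₁, chain_reverse h.hc₄, chain_reverse h.hc₃, chain_reverse h.hc₂,
    h.hr₂, h.hr₁, h.hr₄, h.hr₃, nodup_total_refl h.nodup,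
    fun z hz => h.out z (mem_total_refl.1 hz), h.hp₂, h.hp₁, h.hp₄, h.hp₃⟩

lemma Res.rot {x y : W} (h : F.Res H x y) : F.rot.Res H x y :=
  ⟨h.1, h.2.2.1, h.2.2.2.1, h.2.2.2.2, h.2.1⟩

lemma Res.refl {x y : W} (h : F.Res H x y) : F.refl.Res H x y :=
  ⟨h.1, h.2.2.1, h.2.1, h.2.2.2.2, h.2.2.2.1⟩

end Frame

end Frame

end QuadExp

namespace QuadExp

open SimpleGraph

namespace Frame

variable {W : Type*} {F : Frame W} {H : SimpleGraph W} {O : Set W}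

lemma exists_cons_eq_append_singleton (l : List W) (b : W) : ∃ h t, l ++ [b] = h :: t := by
  cases l with
  | nil => exact ⟨b, [], rfl⟩
  | cons c l => exact ⟨c, l ++ [b], rfl⟩

lemma exists_append_singleton_eq_cons (l : List W) (b : W) : ∃ t h, b :: l = t ++ [h] := by
  refine ⟨(b :: l).dropLast, (b :: l).getLast (by simp), ?_⟩
  rw [List.dropLast_append_getLast]

lemma ne_of_nodup [DecidableEq W] {L l₁ l₂ : List W} (hL : L.Nodup)
    (h : ∀ x, l₁.count x + l₂.count x ≤ L.count x) {x y : W} (hx : x ∈ l₁) (hy : y ∈ l₂) :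
    x ≠ y := by
  rintro rfl
  have h1 := List.nodup_iff_count_le_one.1 hL x
  have h2 := List.count_pos_iff.2 hx
  have h3 := List.count_pos_iff.2 hy
  have := h x
  omega

/-- The step of a walk after it has met an inner vertex `b` of a path leads back along this path, or
it repeats the preceding step. -/
lemma back_step (hH : H.IsCubic) {a p b z o : W} {e e' s t : List W}
    (hr : (a :: (e ++ b :: e' ++ [p])).IsChain H.Adj)
    (hw : (z :: (s ++ b :: t ++ [o])).IsChain H.Adj)
    (hfw : ∀ y t', t ++ [o] = y :: t' → ¬ [b, y] <:+: a :: (e ++ b :: e' ++ [p]))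
    (h₁ : ∀ x ∈ a :: e, ∀ y ∈ e' ++ [p], x ≠ y) (h₂ : ∀ x ∈ z :: s, x ∉ a :: e)
    (h₃ : ∀ x ∈ z :: s, x ∉ e' ++ [p]) (h₄ : o ∉ a :: e) (h₅ : o ∉ z :: s) :
    (∃ y t', t = y :: t' ∧ y ∈ a :: e) ∨ ∃ s' l t', t = l :: t' ∧ z :: s = s' ++ [l] := by
  obtain ⟨e₀, x₁, hx₁⟩ := exists_append_singleton_eq_cons e a
  obtain ⟨x₂, e₂, hx₂⟩ := exists_cons_eq_append_singleton e' p
  obtain ⟨s₀, x₃, hx₃⟩ := exists_append_singleton_eq_cons s z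
  obtain ⟨y, t', hy⟩ := exists_cons_eq_append_singleton t o
  have hr' : a :: (e ++ b :: e' ++ [p]) = e₀ ++ x₁ :: b :: x₂ :: e₂ := by
    have : a :: (e ++ b :: e' ++ [p]) = (a :: e) ++ b :: (e' ++ [p]) := by simp
    rw [this, hx₁, hx₂]; simp
  have hw' : z :: (s ++ b :: t ++ [o]) = s₀ ++ x₃ :: b :: y :: t' := by
    have : z :: (s ++ b :: t ++ [o]) = (z :: s) ++ b :: (t ++ [o]) := by simp
    rw [this, hx₃, hy]; simp
  rw [hr'] at hr
  rw [hw'] at hw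
  have hr2 := (List.isChain_append.1 hr).2.1
  have hw2 := (List.isChain_append.1 hw).2.1
  simp only [List.isChain_cons_cons] at hr2 hw2
  have m₁ : x₁ ∈ a :: e := by rw [hx₁]; simp
  have m₂ : x₂ ∈ e' ++ [p] := by rw [hx₂]; simp
  have m₃ : x₃ ∈ z :: s := by rw [hx₃]; simp
  have n₁ : x₁ ≠ x₂ := h₁ _ m₁ _ m₂
  have n₂ : x₁ ≠ x₃ := fun h => h₂ _ m₃ (h ▸ m₁)
  have n₃ : x₂ ≠ x₃ := fun h => h₃ _ m₃ (h ▸ m₂)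
  rcases eq_of_encard_eq_three (hH b) (x := x₁) (y := x₂) (z := x₃) hr2.1.symm hr2.2.1 hw2.1.symm
    n₁ n₂ n₃ y hw2.2.1 with h | h | h
  · left
    cases t with
    | nil =>
      simp only [List.nil_append, List.cons.injEq] at hy
      exact absurd (hy.1.trans h ▸ m₁) h₄
    | cons c t =>
      simp only [List.cons_append, List.cons.injEq] at hy
      exact ⟨c, t, rfl, by rw [hy.1, h]; exact m₁⟩
  · refine absurd ?_ (hfw y t' hy)
    rw [hr', h]
    exact ⟨e₀ ++ [x₁], e₂, by simp⟩
  · right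
    cases t with
    | nil =>
      simp only [List.nil_append, List.cons.injEq] at hy
      exact absurd (hy.1.trans h ▸ m₃) h₅
    | cons c t =>
      simp only [List.cons_append, List.cons.injEq] at hy
      exact ⟨s₀, c, t, rfl, by rw [hy.1, h]; exact hx₃⟩

lemma chain_skip {R : W → W → Prop} {z o b l : W} {s t s' : List W}
    (hw : (z :: (s ++ b :: l :: t ++ [o])).IsChain R) (hl : z :: s = s' ++ [l]) :
    (z :: (s ++ t ++ [o])).IsChain R := by
  have h1 : z :: (s ++ b :: l :: t ++ [o]) = s' ++ l :: (b :: l :: (t ++ [o])) := by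
    have : z :: (s ++ b :: l :: t ++ [o]) = (z :: s) ++ b :: l :: (t ++ [o]) := by simp
    rw [this, hl]; simp
  have h2 : z :: (s ++ t ++ [o]) = s' ++ l :: (t ++ [o]) := by
    have : z :: (s ++ t ++ [o]) = (z :: s) ++ (t ++ [o]) := by simp
    rw [this, hl]; simp
  rw [h1, List.isChain_split] at hw
  rw [h2, List.isChain_split]
  refine ⟨hw.1, ?_⟩
  have := hw.2
  simp only [List.isChain_cons_cons] at this
  exact this.2.2

lemma chain_drop {R : W → W → Prop} {z : W} {s t : List W} (h : (z :: (s ++ t)).IsChain R) :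
    t.IsChain R :=
  (List.isChain_append (l₁ := z :: s)).1 (by simpa using h) |>.2.1

lemma chain_take {R : W → W → Prop} {z b : W} {s t : List W}
    (h : (z :: (s ++ b :: t)).IsChain R) : (z :: (s ++ [b])).IsChain R := by
  have := ((List.isChain_split (l₁ := z :: s)).1 (by simpa using h)).1
  simpa using this

lemma chain_glue {R : W → W → Prop} {z b : W} {s t : List W} (h : (z :: (s ++ [b])).IsChain R)
    (h' : (b :: t).IsChain R) : (z :: (s ++ b :: t)).IsChain R := by
  have := (List.isChain_split (l₁ := z :: s)).2 ⟨by simpa using h, h'⟩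
  simpa using this

/-- The frame obtained by moving `a₁` along its path to `b`. -/
def shift (F : Frame W) (z b : W) (d' s e e' : List W) : Frame W :=
  { F with a₁ := b, c₁ := s.reverse ++ z :: d', c₄ := F.c₄ ++ F.a₁ :: e, r₁ := e' }

/-- The frame obtained by leading the circuit from `z` between `a₁` and `a₂` to the vertex `b` of the
path that starts at `a₃`. -/
def turn (F : Frame W) (z b : W) (d d' s e e' : List W) : Frame W :=
  { F with a₂ := z, a₃ := b, c₁ := d, c₂ := s, c₃ := e.reverse ++ F.a₃ :: F.c₃,
           r₂ := d' ++ F.a₂ :: F.r₂, r₃ := e' }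

lemma Valid.shift (hF : F.Valid H O) {z b : W} {d d' s e e' : List W} (hc : F.c₁ = d ++ z :: d')
    (hr : F.r₁ = e ++ b :: e') (hs : (z :: (s ++ [b])).IsChain H.Adj) (hn : s.Nodup)
    (hst : ∀ x ∈ s, x ∉ F.total) (hsO : ∀ x ∈ s, x ∉ O) :
    (F.shift z b d' s e e').Valid H O := by
  classical
  have h1 := hF.hc₁
  have h2 := hF.hr₁
  rw [hc] at h1
  rw [hr] at h2
  simp only [List.append_assoc, List.cons_append] at h1 h2
  refine ⟨?_, hF.hc₂, hF.hc₃, ?_, ?_, hF.hr₂, hF.hr₃, hF.hr₄, ?_, ?_, hF.hp₁, hF.hp₂, hF.hp₃,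
    hF.hp₄⟩
  · have := chain_glue (chain_reverse hs) (chain_drop h1)
    simpa [Frame.shift] using this
  · have := chain_glue hF.hc₄ (chain_take h2)
    simpa [Frame.shift] using this
  · have := chain_drop h2
    simpa [Frame.shift] using this
  · have hN := hF.nodup
    rw [List.nodup_iff_count_le_one] at hN hn ⊢
    intro x
    have h3 := hN x
    have h4 := hn x
    have h5 : s.count x = 0 ∨ F.total.count x = 0 := by
      by_cases hx : x ∈ s
      · exact Or.inr (List.count_eq_zero.2 (hst x hx))
      · exact Or.inl (List.count_eq_zero.2 hx)
    simp only [total, circ, Frame.shift, hc, hr, List.count_append, List.count_reverse,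
      count_cons_eq] at h3 h5 ⊢
    omega
  · intro x hx
    have : x ∈ F.total ∨ x ∈ s := by
      simp only [total, circ, Frame.shift, hc, hr, List.mem_append, List.mem_cons,
        List.mem_reverse] at hx ⊢
      tauto
    exact this.elim (hF.out x) (hsO x)

lemma Valid.turn (hF : F.Valid H O) {z b : W} {d d' s e e' : List W} (hc : F.c₁ = d ++ z :: d')
    (hr : F.r₃ = e ++ b :: e') (hs : (z :: (s ++ [b])).IsChain H.Adj) (hn : s.Nodup)
    (hst : ∀ x ∈ s, x ∉ F.total) (hsO : ∀ x ∈ s, x ∉ O) :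
    (F.turn z b d d' s e e').Valid H O := by
  classical
  have h1 := hF.hc₁
  have h2 := hF.hr₃
  rw [hc] at h1
  rw [hr] at h2
  simp only [List.append_assoc, List.cons_append] at h1 h2
  refine ⟨chain_take h1, hs, ?_, hF.hc₄, hF.hr₁, ?_, ?_, hF.hr₄, ?_, ?_, hF.hp₁, hF.hp₂, hF.hp₃,
    hF.hp₄⟩
  · have := chain_glue (chain_reverse (chain_take h2)) hF.hc₃
    simpa [Frame.turn] using this
  · have := chain_glue (chain_drop h1) hF.hr₂
    simpa [Frame.turn] using this
  · have := chain_drop h2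
    simpa [Frame.turn] using this
  · have hN := hF.nodup
    rw [List.nodup_iff_count_le_one] at hN hn ⊢
    intro x
    have h3 := hN x
    have h4 := hn x
    have h5 : s.count x = 0 ∨ F.total.count x = 0 := by
      by_cases hx : x ∈ s
      · exact Or.inr (List.count_eq_zero.2 (hst x hx))
      · exact Or.inl (List.count_eq_zero.2 hx)
    simp only [total, circ, Frame.turn, hc, hr, List.count_append, List.count_reverse,
      count_cons_eq] at h3 h5 ⊢
    omega
  · intro x hx
    have : x ∈ F.total ∨ x ∈ s := by
      simp only [total, circ, Frame.turn, hc, hr, List.mem_append, List.mem_cons,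
        List.mem_reverse] at hx ⊢
      tauto
    exact this.elim (hF.out x) (hsO x)

end Frame

end QuadExp

namespace QuadExp

open SimpleGraph

namespace Frame

variable {W : Type*} {F : Frame W} {H : SimpleGraph W} {O : Set W}

/-- Every walk with fewer than `n` inner vertices from the circuit of an admissible frame to `O`
yields `R`. -/
def Reach (H : SimpleGraph W) (O : Set W) (Ok : W → W → W → W → Prop) (R : Prop) (n : ℕ) : Prop :=
  ∀ F : Frame W, F.Valid H O → Ok F.p₁ F.p₂ F.p₃ F.p₄ → ∀ (z : W) (t : List W) (o : W),
    z ∈ F.circ → o ∈ O → t.length < n → (z :: (t ++ [o])).IsChain (F.Res H) → R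

lemma Valid.back_step (hF : F.Valid H O) (hH : H.IsCubic) {a p b z o : W} {r e e' s t : List W}
    (hr : (a :: (r ++ [p])).IsChain H.Adj) (hre : r = e ++ b :: e') (hp : p ∈ O) (ho : o ∈ O)
    (hsub : ∀ [DecidableEq W], ∀ x, (a :: r).count x + F.c₁.count x ≤ F.total.count x)
    (hfw : ∀ x y, F.Res H x y → ¬ [x, y] <:+: a :: (r ++ [p])) (hz : z ∈ F.c₁)
    (hw : (z :: (s ++ b :: t ++ [o])).IsChain (F.Res H))
    (hst : ∀ x ∈ s, x ∉ F.total) (hsO : ∀ x ∈ s, x ∉ O) :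
    (∃ y t', t = y :: t' ∧ y ∈ a :: e) ∨ ∃ s' l t', t = l :: t' ∧ z :: s = s' ++ [l] := by
  classical
  have hmem : ∀ x, x ∈ a :: r ∨ x ∈ F.c₁ → x ∈ F.total := by
    intro x hx
    have h1 := hsub x
    rw [← List.count_pos_iff]
    rcases hx with h | h <;> have := List.count_pos_iff.2 h <;> omega
  have hzO : z ∉ O := hF.out z (hmem z (Or.inr hz))
  subst hre
  refine Frame.back_step hH hr (hw.imp fun _ _ h => h.1) ?_ ?_ ?_ ?_ ?_ ?_
  · intro y t' hy
    apply hfw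
    have h1 : z :: (s ++ b :: t ++ [o]) = z :: (s ++ b :: y :: t') := by
      rw [← hy]; simp
    rw [h1] at hw
    have := chain_drop hw
    simp only [List.isChain_cons_cons] at this
    exact this.1
  · intro x hx y hy
    rcases List.mem_append.1 hy with h | h
    · refine ne_of_nodup hF.nodup (fun w => ?_) hx h
      have := hsub w
      simp only [List.count_append, count_cons_eq] at this ⊢
      omega
    · rw [List.mem_singleton] at h
      rintro rfl
      refine hF.out x (hmem x (Or.inl ?_)) (h ▸ hp)
      simp only [List.mem_cons, List.mem_append] at hx ⊢
      tauto
  · intro x hx hx'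
    have hx' : x ∈ a :: (e ++ b :: e') := by
      simp only [List.mem_cons, List.mem_append] at hx' ⊢
      tauto
    rcases List.mem_cons.1 hx with rfl | h
    · exact ne_of_nodup hF.nodup hsub hx' hz rfl
    · exact hst x h (hmem x (Or.inl hx'))
  · intro x hx hx'
    rcases List.mem_append.1 hx' with h' | h'
    · have hx' : x ∈ a :: (e ++ b :: e') := by
        simp only [List.mem_cons, List.mem_append]
        tauto
      rcases List.mem_cons.1 hx with rfl | h
      · exact ne_of_nodup hF.nodup hsub hx' hz rfl
      · exact hst x h (hmem x (Or.inl hx'))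
    · rw [List.mem_singleton] at h'
      subst h'
      rcases List.mem_cons.1 hx with rfl | h
      · exact hzO hp
      · exact hsO x h hp
  · intro h
    refine hF.out o (hmem o (Or.inl ?_)) ho
    simp only [List.mem_cons, List.mem_append] at h ⊢
    tauto
  · intro h
    rcases List.mem_cons.1 h with rfl | h
    · exact hzO ho
    · exact hsO o h ho

variable {Ok : W → W → W → W → Prop} {R : Prop} {n : ℕ}

lemma Reach.step (IH : Reach H O Ok R n) (hH : H.IsCubic) (hF : F.Valid H O)
    (hok : Ok F.p₁ F.p₂ F.p₃ F.p₄) {z b o : W} {s t : List W} (hz : z ∈ F.c₁)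
    (hb : b ∈ F.r₁ ∨ b ∈ F.r₃) (ho : o ∈ O) (hn : (s ++ b :: t).length ≤ n)
    (hst : ∀ x ∈ s, x ∉ F.total) (hO : ∀ x ∈ s ++ b :: t, x ∉ O)
    (hC : ∀ x ∈ s ++ b :: t, x ∉ F.circ) (hw : (z :: (s ++ b :: t ++ [o])).IsChain (F.Res H)) :
    R := by
  classical
  have hsO : ∀ x ∈ s, x ∉ O := fun x hx => hO x (by simp [hx])
  have hzC : z ∈ F.circ := by
    simp only [circ, List.mem_append, List.mem_cons]; tauto
  have hoC : o ∉ F.circ := fun h => hF.out o (by simp only [total, List.mem_append]; tauto) ho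
  have skip : (∃ s' l t', t = l :: t' ∧ z :: s = s' ++ [l]) → R := by
    rintro ⟨s', l, t', rfl, hl⟩
    refine IH F hF hok z (s ++ t') o hzC ho ?_ (by simpa using chain_skip hw hl)
    simp at hn ⊢
    omega
  obtain ⟨d, d', hd⟩ := List.append_of_mem hz
  have hseg : (z :: (s ++ [b])).IsChain H.Adj := by
    have : (z :: (s ++ b :: (t ++ [o]))).IsChain (F.Res H) := by simpa using hw
    exact (chain_take this).imp fun _ _ h => h.1
  have hbz : z ≠ b := by
    rintro rfl
    exact hC z (by simp) hzC
  obtain ⟨s', hs', hsn, hss⟩ := Join.exists_nodup (S := {x | x ∈ s}) ⟨s, hseg, fun _ h => h⟩ hbz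
  have hsn' : s'.Nodup := by
    simp only [List.nodup_cons, List.nodup_append] at hsn
    exact hsn.2.1
  rcases hb with hb | hb
  · obtain ⟨e, e', he⟩ := List.append_of_mem hb
    rcases hF.back_step hH hF.hr₁ he hF.hp₁ ho (fun x => by
      simp only [total, circ, List.count_append, count_cons_eq]; omega)
      (fun x y h => h.2.1) hz hw hst hsO with ⟨y, t', rfl, hy⟩ | h
    · have hV := hF.shift hd he hs' hsn' (fun x hx => hst x (hss x hx)) fun x hx => hsO x (hss x hx)
      refine IH _ hV hok y t' o ?_ ho (by simp at hn; omega) ?_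
      · simp only [circ, Frame.shift, List.mem_append, List.mem_cons] at hy ⊢
        tauto
      · have h1 : (z :: ((s ++ [b]) ++ (y :: (t' ++ [o])))).IsChain (F.Res H) := by simpa using hw
        refine (chain_drop h1).imp fun x x' h => ⟨h.1, fun h' => h.2.1 ?_, h.2.2⟩
        refine h'.trans ⟨F.a₁ :: e, [], ?_⟩
        simp [he, Frame.shift]
    · exact skip h
  · obtain ⟨e, e', he⟩ := List.append_of_mem hb
    rcases hF.back_step hH hF.hr₃ he hF.hp₃ ho (fun x => by
      simp only [total, circ, List.count_append, count_cons_eq]; omega)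
      (fun x y h => h.2.2.2.1) hz hw hst hsO with ⟨y, t', rfl, hy⟩ | h
    · have hV := hF.turn hd he hs' hsn' (fun x hx => hst x (hss x hx)) fun x hx => hsO x (hss x hx)
      refine IH _ hV hok y t' o ?_ ho (by simp at hn; omega) ?_
      · simp only [circ, Frame.turn, List.mem_append, List.mem_cons, List.mem_reverse] at hy ⊢
        tauto
      · have h1 : (z :: ((s ++ [b]) ++ (y :: (t' ++ [o])))).IsChain (F.Res H) := by simpa using hw
        refine (chain_drop h1).imp_of_mem_imp fun x x' hx _ h =>
          ⟨h.1, h.2.1, fun h' => h.2.2.1 ?_, fun h' => h.2.2.2.1 ?_, h.2.2.2.2⟩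
        · have hxC : x ∉ F.circ := by
            have : x ∈ (s ++ b :: y :: t') ∨ x = o := by
              simp only [List.mem_cons, List.mem_append, List.not_mem_nil, or_false] at hx ⊢
              tauto
            rcases this with h | rfl
            · exact hC x h
            · exact hoC
          have h2 : [x, x'] <:+: (z :: d') ++ (F.a₂ :: (F.r₂ ++ [F.p₂])) := by
            simpa [Frame.turn] using h'
          refine pair_infix_append h2 fun hx' => hxC ?_
          simp only [circ, hd, List.mem_append, List.mem_cons] at hx' ⊢
          tauto
        · refine h'.trans ⟨F.a₃ :: e, [], ?_⟩
          simp [he, Frame.turn]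
    · exact skip h

lemma exists_first {P : W → Prop} {t : List W} (h : ∃ x ∈ t, P x) :
    ∃ s b t', t = s ++ b :: t' ∧ P b ∧ ∀ x ∈ s, ¬ P x := by
  induction t with
  | nil => simp at h
  | cons c t ih =>
    by_cases hc : P c
    · exact ⟨[], c, t, rfl, hc, by simp⟩
    · obtain ⟨x, hx, hP⟩ := h
      rcases List.mem_cons.1 hx with rfl | hx
      · exact absurd hP hc
      · obtain ⟨s, b, t', rfl, hb, hs⟩ := ih ⟨x, hx, hP⟩
        refine ⟨c :: s, b, t', rfl, hb, ?_⟩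
        intro y hy
        rcases List.mem_cons.1 hy with rfl | hy
        · exact hc
        · exact hs y hy

/-- A direct connection from an inner vertex of the first side of an admissible frame to `O`
yields `R`. -/
def Jump (H : SimpleGraph W) (O : Set W) (Ok : W → W → W → W → Prop) (R : Prop) : Prop :=
  ∀ F : Frame W, F.Valid H O → Ok F.p₁ F.p₂ F.p₃ F.p₄ → ∀ (z o : W) (s : List W), z ∈ F.c₁ → o ∈ O →
    (z :: (s ++ [o])).IsChain H.Adj → (∀ x ∈ s, x ∉ F.total ∧ x ∉ O) → R

lemma Reach.side (IH : Reach H O Ok R n) (hH : H.IsCubic) (hJ : Jump H O Ok R)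
    (hrefl : ∀ a b c d, Ok a b c d → Ok b a d c) (hF : F.Valid H O)
    (hok : Ok F.p₁ F.p₂ F.p₃ F.p₄) {z o : W} {t : List W} (hz : z ∈ F.c₁)
    (ho : o ∈ O) (hn : t.length ≤ n) (hO : ∀ x ∈ t, x ∉ O)
    (hC : ∀ x ∈ t, x ∉ F.circ) (hw : (z :: (t ++ [o])).IsChain (F.Res H)) : R := by
  by_cases h : ∃ x ∈ t, x ∈ F.total
  · obtain ⟨s, b, t', rfl, hb, hs⟩ := exists_first h
    have hb' : (b ∈ F.r₁ ∨ b ∈ F.r₃) ∨ (b ∈ F.r₂ ∨ b ∈ F.r₄) := by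
      have := hC b (by simp)
      simp only [total, List.mem_append] at hb
      tauto
    rcases hb' with hb' | hb'
    · exact IH.step hH hF hok hz hb' ho hn hs hO hC hw
    · refine IH.step hH hF.refl (hrefl _ _ _ _ hok) (z := z) (b := b) (s := s) (t := t') ?_ hb' ho
        hn (fun x hx hx' => hs x hx (mem_total_refl.1 hx')) hO
        (fun x hx hx' => hC x hx (mem_circ_refl.1 hx')) (hw.imp fun _ _ h => h.refl)
      simpa [Frame.refl] using hz
  · push Not at h
    exact hJ F hF hok z o t hz ho (hw.imp fun _ _ h => h.1) fun x hx => ⟨h x hx, hO x hx⟩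

lemma Valid.corner (hF : F.Valid H O) (hH : H.IsCubic) {o : W} {t : List W} (ho : o ∈ O)
    (hC : ∀ x ∈ t, x ∉ F.circ) (hw : (F.a₁ :: (t ++ [o])).IsChain (F.Res H)) : False := by
  classical
  obtain ⟨x₁, l₁, h₁⟩ := exists_cons_eq_append_singleton F.c₁ F.a₂
  obtain ⟨x₂, l₂, h₂⟩ := exists_cons_eq_append_singleton F.c₄.reverse F.a₄
  obtain ⟨x₃, l₃, h₃⟩ := exists_cons_eq_append_singleton F.r₁ F.p₁
  obtain ⟨y, l₄, h₄⟩ := exists_cons_eq_append_singleton t o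
  have c₁ := hF.hc₁
  have c₂ := chain_reverse hF.hc₄
  have c₃ := hF.hr₁
  rw [h₁, List.isChain_cons_cons] at c₁
  rw [h₂, List.isChain_cons_cons] at c₂
  rw [h₃, List.isChain_cons_cons] at c₃
  rw [h₄, List.isChain_cons_cons] at hw
  have m₁ : x₁ ∈ F.c₁ ++ [F.a₂] := by rw [h₁]; simp
  have m₂ : x₂ ∈ F.c₄.reverse ++ [F.a₄] := by rw [h₂]; simp
  have m₃ : x₃ ∈ F.r₁ ++ [F.p₁] := by rw [h₃]; simp
  have m₄ : y ∈ t ++ [o] := by rw [h₄]; simp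
  have hyC : y ∉ F.circ := by
    rcases List.mem_append.1 m₄ with h | h
    · exact hC y h
    · rw [List.mem_singleton] at h
      subst h
      exact fun h => hF.out y (by simp only [total, List.mem_append]; tauto) ho
  have hx₁ : x₁ ∈ F.circ := by
    simp only [circ, List.mem_append, List.mem_cons, List.not_mem_nil, or_false] at m₁ ⊢
    tauto
  have hx₂ : x₂ ∈ F.circ := by
    simp only [circ, List.mem_append, List.mem_cons, List.mem_reverse, List.not_mem_nil,
      or_false] at m₂ ⊢
    tauto
  have hx₃ : x₃ ∉ F.circ := by
    intro h
    rcases List.mem_append.1 m₃ with h' | h'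
    · refine ne_of_nodup hF.nodup (fun x => ?_) h h' rfl
      simp only [total, List.count_append]
      omega
    · rw [List.mem_singleton] at h'
      exact hF.out x₃ (by simp only [total, List.mem_append]; tauto) (h' ▸ hF.hp₁)
  have hne : x₁ ≠ x₂ := by
    refine ne_of_nodup hF.nodup (fun x => ?_) m₁ m₂
    simp only [total, circ, List.count_append, count_cons_eq, List.count_reverse, List.count_nil]
    omega
  rcases eq_of_encard_eq_three (hH F.a₁) (x := x₁) (y := x₂) (z := x₃) c₁.1 c₂.1 c₃.1 hne
    (fun h => hx₃ (h ▸ hx₁)) (fun h => hx₃ (h ▸ hx₂)) y hw.1.1 with h | h | h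
  · exact hyC (h ▸ hx₁)
  · exact hyC (h ▸ hx₂)
  · refine hw.1.2.1 ?_
    rw [h₃, h]
    exact ⟨[], l₃, rfl⟩

lemma reach (hH : H.IsCubic) (hJ : Jump H O Ok R) (hrot : ∀ a b c d, Ok a b c d → Ok b c d a)
    (hrefl : ∀ a b c d, Ok a b c d → Ok b a d c) : ∀ n, Reach H O Ok R n := by
  intro n
  induction n with
  | zero => intro _ _ _ _ _ _ _ _ h; exact absurd h (by simp)
  | succ n IH =>
    intro F hF hok z t o hz ho hn hw
    by_cases h : ∃ x ∈ t, x ∈ F.circ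
    · obtain ⟨x, hx, hxC⟩ := h
      obtain ⟨s, t', rfl⟩ := List.append_of_mem hx
      refine IH F hF hok x t' o hxC ho (by simp at hn; omega) ?_
      have : (z :: (s ++ (x :: (t' ++ [o])))).IsChain (F.Res H) := by simpa using hw
      exact chain_drop this
    by_cases h' : ∃ x ∈ t, x ∈ O
    · obtain ⟨x, hx, hxO⟩ := h'
      obtain ⟨s, t', rfl⟩ := List.append_of_mem hx
      refine IH F hF hok z s x hz hxO (by simp at hn; omega) ?_
      have : (z :: (s ++ (x :: (t' ++ [o])))).IsChain (F.Res H) := by simpa using hw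
      exact chain_take this
    push Not at h h'
    have main : ∀ F : Frame W, F.Valid H O → Ok F.p₁ F.p₂ F.p₃ F.p₄ → (z = F.a₁ ∨ z ∈ F.c₁) →
        (∀ x ∈ t, x ∉ F.circ) → (z :: (t ++ [o])).IsChain (F.Res H) → R := by
      rintro F hF hok (rfl | hz) hC hw
      · exact (hF.corner hH ho hC hw).elim
      · exact IH.side hH hJ hrefl hF hok hz ho (by omega) h' hC hw
    have hz' : (z = F.a₁ ∨ z ∈ F.c₁) ∨ (z = F.a₂ ∨ z ∈ F.c₂) ∨ (z = F.a₃ ∨ z ∈ F.c₃) ∨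
        (z = F.a₄ ∨ z ∈ F.c₄) := by
      simp only [circ, List.mem_append, List.mem_cons] at hz
      tauto
    have h2 := hrot _ _ _ _ hok
    have h3 := hrot _ _ _ _ h2
    have h4 := hrot _ _ _ _ h3
    rcases hz' with hz | hz | hz | hz
    · exact main F hF hok hz h hw
    · exact main F.rot hF.rot h2 hz (fun x hx hx' => h x hx (mem_circ_rot.1 hx'))
        (hw.imp fun _ _ h => h.rot)
    · exact main F.rot.rot hF.rot.rot h3 hz
        (fun x hx hx' => h x hx (mem_circ_rot.1 (mem_circ_rot.1 hx')))
        (hw.imp fun _ _ h => h.rot.rot)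
    · exact main F.rot.rot.rot hF.rot.rot.rot h4 hz
        (fun x hx hx' => h x hx (mem_circ_rot.1 (mem_circ_rot.1 (mem_circ_rot.1 hx'))))
        (hw.imp fun _ _ h => h.rot.rot.rot)

lemma not_reverse_infix {l : List W} (hl : l.Nodup) {x y : W} (h : [x, y] <:+: l) :
    ¬ [y, x] <:+: l := by
  intro h'
  induction l with
  | nil => simp at h
  | cons c l ih =>
    rw [List.nodup_cons] at hl
    rw [List.infix_cons_iff] at h h'
    rcases h with h | h <;> rcases h' with h' | h'
    · rw [List.cons_prefix_cons] at h h'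
      exact hl.1 (h'.1 ▸ h.2.subset (by simp))
    · rw [List.cons_prefix_cons] at h
      exact hl.1 (h.1 ▸ h'.subset (by simp))
    · rw [List.cons_prefix_cons] at h'
      exact hl.1 (h'.1 ▸ h.subset (by simp))
    · exact ih hl.2 h h'

/-- In a cubic cyclically `5`-connected graph there is a walk from the circuit of a frame to `O` that
does not follow the paths of the frame in forward direction. -/
lemma Valid.exists_chain [Finite W] (hF : F.Valid H O) (hH : H.IsCubic)
    (hH5 : H.IsCyclicallyConnected 5) (hp : [F.p₁, F.p₂, F.p₃, F.p₄].Nodup) :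
    ∃ (z : W) (t : List W) (o : W), z ∈ F.circ ∧ o ∈ O ∧ (z :: (t ++ [o])).IsChain (F.Res H) := by
  classical
  by_contra hno
  push Not at hno
  let S : Set W := {x | ∃ z ∈ F.circ, Relation.ReflTransGen (F.Res H) z x}
  have hSO : ∀ x ∈ S, x ∉ O := by
    rintro x ⟨z, hz, hzx⟩ hx
    obtain ⟨l, hl, hlast⟩ := List.exists_isChain_cons_of_relationReflTransGen hzx
    rcases List.eq_nil_or_concat l with rfl | ⟨t, o, rfl⟩
    · simp at hlast
      subst hlast
      exact hF.out z (by simp only [total, List.mem_append]; tauto) hx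
    · have : o = x := by simpa using hlast
      subst this
      exact hno z t o hz hx (by simpa using hl)
  have hSC : ∀ x ∈ F.circ, x ∈ S := fun x hx => ⟨x, hx, Relation.ReflTransGen.refl⟩
  have hSR : ∀ x y, x ∈ S → F.Res H x y → y ∈ S := by
    rintro x y ⟨z, hz, hzx⟩ h
    exact ⟨z, hz, hzx.tail h⟩
  let L₁ := F.a₁ :: (F.r₁ ++ [F.p₁])
  let L₂ := F.a₂ :: (F.r₂ ++ [F.p₂])
  let L₃ := F.a₃ :: (F.r₃ ++ [F.p₃])
  let L₄ := F.a₄ :: (F.r₄ ++ [F.p₄])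
  have hnd : (L₁ ++ L₂ ++ L₃ ++ L₄).Nodup := by
    have hN := hF.nodup
    rw [List.nodup_iff_count_le_one] at hN hp ⊢
    intro x
    have h3 := hN x
    have h4 := hp x
    have h5 : [F.p₁, F.p₂, F.p₃, F.p₄].count x = 0 ∨ F.total.count x = 0 := by
      by_cases hx : x ∈ O
      · exact Or.inr (List.count_eq_zero.2 fun h => hF.out x h hx)
      · refine Or.inl (List.count_eq_zero.2 fun h => hx ?_)
        simp only [List.mem_cons, List.not_mem_nil, or_false] at h
        rcases h with rfl | rfl | rfl | rfl
        exacts [hF.hp₁, hF.hp₂, hF.hp₃, hF.hp₄]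
    simp only [L₁, L₂, L₃, L₄, total, circ, List.count_append, count_cons_eq, List.count_nil]
      at h3 h4 h5 ⊢
    omega
  have hback : ∀ x y, ([x, y] <:+: L₁ ∨ [x, y] <:+: L₂ ∨ [x, y] <:+: L₃ ∨ [x, y] <:+: L₄) →
      y ∈ S → x ∈ S := by
    intro x y h hy
    simp only [List.nodup_append] at hnd
    obtain ⟨⟨⟨n1, n2, n12⟩, n3, n123⟩, n4, n1234⟩ := hnd
    simp only [List.mem_append] at n123 n1234
    have hx : ∀ {L : List W}, [x, y] <:+: L → x ∈ L := fun h => h.subset (by simp)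
    have hx' : ∀ {L : List W}, [y, x] <:+: L → x ∈ L := fun h => h.subset (by simp)
    refine hSR y x hy ?_
    have hadj : ∀ {L : List W}, L.IsChain H.Adj → [x, y] <:+: L → H.Adj y x := by
      rintro L hL ⟨A, B, rfl⟩
      have := (List.isChain_append.1 (List.isChain_append.1 hL).1).2.1
      simp at this
      exact this.symm
    rcases h with h | h | h | h
    · exact ⟨hadj hF.hr₁ h, not_reverse_infix n1 h, fun h' => n12 x (hx h) x (hx' h') rfl,
        fun h' => n123 x (Or.inl (hx h)) x (hx' h') rfl,
        fun h' => n1234 x (Or.inl (Or.inl (hx h))) x (hx' h') rfl⟩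
    · exact ⟨hadj hF.hr₂ h, fun h' => n12 x (hx' h') x (hx h) rfl, not_reverse_infix n2 h,
        fun h' => n123 x (Or.inr (hx h)) x (hx' h') rfl,
        fun h' => n1234 x (Or.inl (Or.inr (hx h))) x (hx' h') rfl⟩
    · exact ⟨hadj hF.hr₃ h, fun h' => n123 x (Or.inl (hx' h')) x (hx h) rfl,
        fun h' => n123 x (Or.inr (hx' h')) x (hx h) rfl, not_reverse_infix n3 h,
        fun h' => n1234 x (Or.inr (hx h)) x (hx' h') rfl⟩
    · exact ⟨hadj hF.hr₄ h, fun h' => n1234 x (Or.inl (Or.inl (hx' h'))) x (hx h) rfl,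
        fun h' => n1234 x (Or.inl (Or.inr (hx' h'))) x (hx h) rfl,
        fun h' => n1234 x (Or.inr (hx' h')) x (hx h) rfl, not_reverse_infix n4 h⟩
  let E : List W → Set (Sym2 W) := fun L => {e | ∃ x ∈ S, ∃ y ∉ S, [x, y] <:+: L ∧ e = s(x, y)}
  have hE : ∀ L, (∀ x y, [x, y] <:+: L → y ∈ S → x ∈ S) → (E L).encard ≤ 1 := by
    intro L hL
    rw [Set.encard_le_one_iff]
    rintro e e' ⟨x, hx, y, hy, h, rfl⟩ ⟨x', hx', y', hy', h', rfl⟩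
    obtain ⟨rfl, rfl⟩ := exit_unique hL h h' hx hy hx' hy'
    rfl
  have hsub : H.edgeCut S ⊆ E L₁ ∪ E L₂ ∪ E L₃ ∪ E L₄ := by
    rintro e ⟨x, hx, y, hy, hxy, rfl⟩
    have hnot : ¬ F.Res H x y := fun h => hy (hSR x y hx h)
    by_cases h1 : [x, y] <:+: L₁
    · exact Or.inl (Or.inl (Or.inl ⟨x, hx, y, hy, h1, rfl⟩))
    by_cases h2 : [x, y] <:+: L₂
    · exact Or.inl (Or.inl (Or.inr ⟨x, hx, y, hy, h2, rfl⟩))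
    by_cases h3 : [x, y] <:+: L₃
    · exact Or.inl (Or.inr ⟨x, hx, y, hy, h3, rfl⟩)
    by_cases h4 : [x, y] <:+: L₄
    · exact Or.inr ⟨x, hx, y, hy, h4, rfl⟩
    exact absurd ⟨hxy, h1, h2, h3, h4⟩ hnot
  have hcut : (H.edgeCut S).encard ≤ 4 := by
    refine (Set.encard_le_encard hsub).trans ?_
    refine (Set.encard_union_le _ _).trans ?_
    refine (add_le_add ((Set.encard_union_le _ _).trans (add_le_add (Set.encard_union_le _ _)
      le_rfl)) le_rfl).trans ?_
    refine (add_le_add (add_le_add (add_le_add (hE _ fun x y h => hback x y (Or.inl h))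
      (hE _ fun x y h => hback x y (Or.inr (Or.inl h))))
      (hE _ fun x y h => hback x y (Or.inr (Or.inr (Or.inl h)))))
      (hE _ fun x y h => hback x y (Or.inr (Or.inr (Or.inr h))))).trans ?_
    norm_num
  have three : ∀ {x y z : W} {B : Set W}, x ≠ y → x ≠ z → y ≠ z → x ∈ B → y ∈ B → z ∈ B →
      3 ≤ B.ncard := by
    intro x y z B hxy hxz hyz hx hy hz
    have h3 : ({x, y, z} : Set W).ncard = 3 := Set.ncard_eq_three.2 ⟨x, y, z, hxy, hxz, hyz, rfl⟩
    rw [← h3]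
    refine Set.ncard_le_ncard ?_ (Set.toFinite _)
    rintro t (rfl | rfl | rfl) <;> assumption
  have ha : ∀ z, z = F.a₁ ∨ z = F.a₂ ∨ z = F.a₃ → z ∈ S := by
    intro z hz
    apply hSC
    simp only [circ, List.mem_append, List.mem_cons]
    tauto
  have hane : ∀ {l₁ l₂ : List W}, (∀ x, l₁.count x + l₂.count x ≤ F.total.count x) →
    ∀ {x y : W}, x ∈ l₁ → y ∈ l₂ → x ≠ y := fun h _ _ hx hy => ne_of_nodup hF.nodup h hx hy
  simp only [List.nodup_cons, List.mem_cons, List.not_mem_nil, or_false, not_or] at hp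
  refine five_le_edgeCut hH hH5 (B := S) ?_ ?_ hcut
  · refine three (x := F.a₁) (y := F.a₂) (z := F.a₃) ?_ ?_ ?_ (ha _ (by simp)) (ha _ (by simp))
      (ha _ (by simp))
    · refine hane (l₁ := [F.a₁]) (l₂ := [F.a₂]) (fun x => ?_) (by simp) (by simp)
      simp only [total, circ, List.count_append, count_cons_eq, List.count_nil]; omega
    · refine hane (l₁ := [F.a₁]) (l₂ := [F.a₃]) (fun x => ?_) (by simp) (by simp)
      simp only [total, circ, List.count_append, count_cons_eq, List.count_nil]; omega
    · refine hane (l₁ := [F.a₂]) (l₂ := [F.a₃]) (fun x => ?_) (by simp) (by simp)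
      simp only [total, circ, List.count_append, count_cons_eq, List.count_nil]; omega
  · exact three (x := F.p₁) (y := F.p₂) (z := F.p₃) hp.1.1 hp.1.2.1 hp.2.1.1
      (fun h => hSO _ h hF.hp₁) (fun h => hSO _ h hF.hp₂) (fun h => hSO _ h hF.hp₃)

/-- Starting from an admissible frame in a cubic cyclically `5`-connected graph, one finds an
admissible frame with a direct connection from its circuit to `O`. -/
theorem Valid.exists_jump [Finite W] (hF : F.Valid H O) (hH : H.IsCubic)
    (hH5 : H.IsCyclicallyConnected 5) (hp : [F.p₁, F.p₂, F.p₃, F.p₄].Nodup)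
    (hrot : ∀ a b c d, Ok a b c d → Ok b c d a) (hrefl : ∀ a b c d, Ok a b c d → Ok b a d c)
    (hok : Ok F.p₁ F.p₂ F.p₃ F.p₄) (hJ : Jump H O Ok R) : R := by
  obtain ⟨z, t, o, hz, ho, hw⟩ := hF.exists_chain hH hH5 hp
  exact reach hH hJ hrot hrefl (t.length + 1) F hF hok z t o hz ho (by simp) hw

end Frame

end QuadExp

namespace QuadExp

open SimpleGraph

variable {X : Type*} {W : Type*}

/-- `K` is a triangle-free cubic graph (with isolated vertices, which are ignored), `u₁, u₂, u₃, u₄`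
are the vertices of a quadrangle of `K` in order, and the neighbor `vᵢ` of `uᵢ` off the
quadrangle are distinct, pairwise nonadjacent, and satisfy two further sparsity conditions. -/
structure QS (K : SimpleGraph X) (u₁ u₂ u₃ u₄ v₁ v₂ v₃ v₄ : X) : Prop where
  fin : K.support.Finite
  cubic : ∀ x ∈ K.support, (K.neighborSet x).encard = 3
  tri : ∀ a b c, K.Adj a b → K.Adj b c → ¬ K.Adj a c
  k23 : ∀ a b x y z, a ≠ b → x ≠ y → x ≠ z → y ≠ z → K.Adj a x → K.Adj a y → K.Adj a z →
    K.Adj b x → K.Adj b y → ¬ K.Adj b z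
  n₁ : ∀ y, K.Adj u₁ y ↔ y = u₂ ∨ y = u₄ ∨ y = v₁
  n₂ : ∀ y, K.Adj u₂ y ↔ y = u₃ ∨ y = u₁ ∨ y = v₂
  n₃ : ∀ y, K.Adj u₃ y ↔ y = u₄ ∨ y = u₂ ∨ y = v₃
  n₄ : ∀ y, K.Adj u₄ y ↔ y = u₁ ∨ y = u₃ ∨ y = v₄
  nodup : [u₁, u₂, u₃, u₄, v₁, v₂, v₃, v₄].Nodup
  nonadj : ¬ K.Adj v₁ v₂ ∧ ¬ K.Adj v₁ v₃ ∧ ¬ K.Adj v₁ v₄ ∧ ¬ K.Adj v₂ v₃ ∧ ¬ K.Adj v₂ v₄ ∧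
    ¬ K.Adj v₃ v₄
  m₁₂ : ∀ w x, w ≠ x → K.Adj v₁ w → K.Adj v₁ x → K.Adj v₂ w → ¬ K.Adj v₂ x
  m₂₃ : ∀ w x, w ≠ x → K.Adj v₂ w → K.Adj v₂ x → K.Adj v₃ w → ¬ K.Adj v₃ x
  m₃₄ : ∀ w x, w ≠ x → K.Adj v₃ w → K.Adj v₃ x → K.Adj v₄ w → ¬ K.Adj v₄ x
  m₄₁ : ∀ w x, w ≠ x → K.Adj v₄ w → K.Adj v₄ x → K.Adj v₁ w → ¬ K.Adj v₁ x

namespace QS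

variable {K : SimpleGraph X} {u₁ u₂ u₃ u₄ v₁ v₂ v₃ v₄ : X}

lemma rot (h : QS K u₁ u₂ u₃ u₄ v₁ v₂ v₃ v₄) : QS K u₂ u₃ u₄ u₁ v₂ v₃ v₄ v₁ where
  fin := h.fin
  cubic := h.cubic
  tri := h.tri
  k23 := h.k23
  n₁ := h.n₂
  n₂ := h.n₃
  n₃ := h.n₄
  n₄ := h.n₁
  nodup := by
    have := h.nodup
    simp only [List.nodup_cons, List.mem_cons, List.not_mem_nil, or_false, not_or, not_false_eq_true,
      List.nodup_nil, and_true] at this ⊢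
    simp only [eq_comm] at *
    tauto
  nonadj := by
    have := h.nonadj
    simp only [K.adj_comm v₂ v₁, K.adj_comm v₃ v₁, K.adj_comm v₄ v₁]
    tauto
  m₁₂ := h.m₂₃
  m₂₃ := h.m₃₄
  m₃₄ := h.m₄₁
  m₄₁ := h.m₁₂

lemma refl (h : QS K u₁ u₂ u₃ u₄ v₁ v₂ v₃ v₄) : QS K u₂ u₁ u₄ u₃ v₂ v₁ v₄ v₃ where
  fin := h.fin
  cubic := h.cubic
  tri := h.tri
  k23 := h.k23
  n₁ := fun y => by rw [h.n₂]; tauto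
  n₂ := fun y => by rw [h.n₁]; tauto
  n₃ := fun y => by rw [h.n₄]; tauto
  n₄ := fun y => by rw [h.n₃]; tauto
  nodup := by
    have := h.nodup
    simp only [List.nodup_cons, List.mem_cons, List.not_mem_nil, or_false, not_or, not_false_eq_true,
      List.nodup_nil, and_true] at this ⊢
    simp only [eq_comm] at *
    tauto
  nonadj := by
    have := h.nonadj
    simp only [K.adj_comm v₂ v₁, K.adj_comm v₄ v₃]
    tauto
  m₁₂ := fun w x hwx h1 h2 h3 h4 => h.m₁₂ w x hwx h3 h4 h1 h2
  m₂₃ := fun w x hwx h1 h2 h3 h4 => h.m₄₁ w x hwx h3 h4 h1 h2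
  m₃₄ := fun w x hwx h1 h2 h3 h4 => h.m₃₄ w x hwx h3 h4 h1 h2
  m₄₁ := fun w x hwx h1 h2 h3 h4 => h.m₂₃ w x hwx h3 h4 h1 h2

end QS

end QuadExp

namespace QuadExp

open SimpleGraph

variable {X : Type*} {W : Type*} {K : SimpleGraph X} {H : SimpleGraph W}

/-- The data of an embedding of `K` in `H`. -/
structure EmbData (K : SimpleGraph X) (H : SimpleGraph W) (f : X → W) (I : Sym2 X → Set W) :
    Prop where
  inj : Set.InjOn f K.support
  join : ∀ x y, K.Adj x y → Join H (f x) (f y) (I s(x, y))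
  disj : ∀ e ∈ K.edgeSet, ∀ e' ∈ K.edgeSet, e ≠ e' → Disjoint (I e) (I e')
  notMem : ∀ e ∈ K.edgeSet, ∀ x ∈ K.support, f x ∉ I e

/-- The inner vertices of the paths can be listed in order. -/
lemma EmbData.exists_lists {f : X → W} {I : Sym2 X → Set W} (h : EmbData K H f I) :
    ∃ l : X → X → List W, ∀ x y, K.Adj x y → (f x :: (l x y ++ [f y])).IsChain H.Adj ∧
      (f x :: (l x y ++ [f y])).Nodup ∧ ∀ z ∈ l x y, z ∈ I s(x, y) := by
  classical
  have : ∀ x y, ∃ l : List W, K.Adj x y → (f x :: (l ++ [f y])).IsChain H.Adj ∧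
      (f x :: (l ++ [f y])).Nodup ∧ ∀ z ∈ l, z ∈ I s(x, y) := by
    intro x y
    by_cases hxy : K.Adj x y
    · obtain ⟨l, hl⟩ := (h.join x y hxy).exists_nodup fun h' =>
        K.ne_of_adj hxy (h.inj ⟨y, hxy⟩ ⟨x, hxy.symm⟩ h')
      exact ⟨l, fun _ => hl⟩
    · exact ⟨[], fun h => absurd h hxy⟩
  choose l hl using this
  exact ⟨l, hl⟩

/-- All edges at the image of a vertex are used by the embedding. -/
lemma EmbData.nbr {f : X → W} {I : Sym2 X → Set W} (h : EmbData K H f I) (hH : H.IsCubic) {x : X}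
    (hx : (K.neighborSet x).encard = 3) {t : W} (ht : H.Adj (f x) t) :
    ∃ y, K.Adj x y ∧ (t ∈ I s(x, y) ∨ t = f y) := by
  have hfirst : ∀ y, K.Adj x y → ∃ t, H.Adj (f x) t ∧ (t ∈ I s(x, y) ∨ t = f y) := by
    intro y hy
    obtain ⟨l, hl, hI⟩ := h.join x y hy
    cases l with
    | nil => exact ⟨f y, by simpa using hl, Or.inr rfl⟩
    | cons c l =>
      simp only [List.cons_append, List.isChain_cons_cons] at hl
      exact ⟨c, hl.1, Or.inl (hI c (by simp))⟩
  have hne : ∀ {y y' t t'}, K.Adj x y → K.Adj x y' → y ≠ y' → (t ∈ I s(x, y) ∨ t = f y) →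
      (t' ∈ I s(x, y') ∨ t' = f y') → t ≠ t' := by
    rintro y y' t t' hy hy' hyy ht ht' rfl
    have hee : s(x, y) ≠ s(x, y') := by
      rw [Ne, Sym2.eq_iff]
      rintro (⟨-, h⟩ | ⟨h, h'⟩)
      · exact hyy h
      · exact hyy (h'.trans h)
    rcases ht with ht | ht <;> rcases ht' with ht' | ht'
    · exact Set.disjoint_left.1 (h.disj _ hy _ hy' hee) ht ht'
    · exact h.notMem s(x, y) hy y' ⟨x, hy'.symm⟩ (ht' ▸ ht)
    · exact h.notMem s(x, y') hy' y ⟨x, hy.symm⟩ (ht ▸ ht')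
    · exact hyy (h.inj ⟨x, hy.symm⟩ ⟨x, hy'.symm⟩ (ht.symm.trans ht'))
  obtain ⟨y₁, y₂, y₃, h12, h13, h23, hset⟩ := Set.encard_eq_three.1 hx
  have a₁ : K.Adj x y₁ := by
    have : y₁ ∈ K.neighborSet x := by rw [hset]; simp
    exact this
  have a₂ : K.Adj x y₂ := by
    have : y₂ ∈ K.neighborSet x := by rw [hset]; simp
    exact this
  have a₃ : K.Adj x y₃ := by
    have : y₃ ∈ K.neighborSet x := by rw [hset]; simp
    exact this
  obtain ⟨t₁, b₁, c₁⟩ := hfirst y₁ a₁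
  obtain ⟨t₂, b₂, c₂⟩ := hfirst y₂ a₂
  obtain ⟨t₃, b₃, c₃⟩ := hfirst y₃ a₃
  rcases eq_of_encard_eq_three (hH (f x)) b₁ b₂ b₃ (hne a₁ a₂ h12 c₁ c₂) (hne a₁ a₃ h13 c₁ c₃)
    (hne a₂ a₃ h23 c₂ c₃) t ht with rfl | rfl | rfl
  · exact ⟨y₁, a₁, c₁⟩
  · exact ⟨y₂, a₂, c₂⟩
  · exact ⟨y₃, a₃, c₃⟩

/-- The part of `H` occupied by the vertices and edges of `K` off the set `U`. -/
def offPart (K : SimpleGraph X) (U : Set X) (f : X → W) (l : X → X → List W) : Set W :=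
  {z | (∃ x ∈ K.support, x ∉ U ∧ f x = z) ∨ ∃ x y, K.Adj x y ∧ x ∉ U ∧ y ∉ U ∧ z ∈ l x y}

section Assemble

open Classical in
/-- The vertex map of the embedding given by a frame. -/
noncomputable def frameMap (u₁ u₂ u₃ u₄ : X) (F : Frame W) (f : X → W) : X → W := fun x =>
  if x = u₁ then F.a₁ else if x = u₂ then F.a₂ else if x = u₃ then F.a₃ else
    if x = u₄ then F.a₄ else f x

/-- The vertex `z` is an inner vertex of the path of the edge `e`, in the embedding given by a
frame. -/
def frameOwn (K : SimpleGraph X) (u₁ u₂ u₃ u₄ v₁ v₂ v₃ v₄ : X) (F : Frame W)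
    (l : X → X → List W) (e : Sym2 X) : Set W := {z |
  (e = s(u₁, u₂) ∧ z ∈ F.c₁) ∨ (e = s(u₂, u₃) ∧ z ∈ F.c₂) ∨ (e = s(u₃, u₄) ∧ z ∈ F.c₃) ∨
  (e = s(u₄, u₁) ∧ z ∈ F.c₄) ∨ (e = s(u₁, v₁) ∧ z ∈ F.r₁) ∨ (e = s(u₂, v₂) ∧ z ∈ F.r₂) ∨
  (e = s(u₃, v₃) ∧ z ∈ F.r₃) ∨ (e = s(u₄, v₄) ∧ z ∈ F.r₄) ∨
  ∃ x y, K.Adj x y ∧ x ∉ ({u₁, u₂, u₃, u₄} : Set X) ∧ y ∉ ({u₁, u₂, u₃, u₄} : Set X) ∧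
    e = s(x, y) ∧ z ∈ l x y}

variable {u₁ u₂ u₃ u₄ v₁ v₂ v₃ v₄ : X}

lemma embData_frame (hK : QS K u₁ u₂ u₃ u₄ v₁ v₂ v₃ v₄) {f : X → W} {I : Sym2 X → Set W}
    (h : EmbData K H f I) {l : X → X → List W}
    (hl : ∀ x y, K.Adj x y → (f x :: (l x y ++ [f y])).IsChain H.Adj ∧
      (f x :: (l x y ++ [f y])).Nodup ∧ ∀ z ∈ l x y, z ∈ I s(x, y))
    {F : Frame W} (hF : F.Valid H (offPart K {u₁, u₂, u₃, u₄} f l)) (hp₁ : F.p₁ = f v₁)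
    (hp₂ : F.p₂ = f v₂) (hp₃ : F.p₃ = f v₃) (hp₄ : F.p₄ = f v₄) :
    EmbData K H (frameMap u₁ u₂ u₃ u₄ F f) (frameOwn K u₁ u₂ u₃ u₄ v₁ v₂ v₃ v₄ F l) := by
  classical
  have hnd := hK.nodup
  simp only [List.nodup_cons, List.mem_cons, List.not_mem_nil, or_false, not_or, not_false_eq_true,
      List.nodup_nil, and_true] at hnd
  obtain ⟨⟨h12, h13, h14, -, h1v2, h1v3, h1v4⟩, ⟨h23, h24, h2v1, -, h2v3, h2v4⟩,
    ⟨h34, h3v1, h3v2, -, h3v4⟩, ⟨h4v1, h4v2, h4v3, -⟩, -⟩ := hnd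
  have g1 : frameMap u₁ u₂ u₃ u₄ F f u₁ = F.a₁ := by simp [frameMap]
  have g2 : frameMap u₁ u₂ u₃ u₄ F f u₂ = F.a₂ := by simp [frameMap, Ne.symm h12]
  have g3 : frameMap u₁ u₂ u₃ u₄ F f u₃ = F.a₃ := by
    simp [frameMap, Ne.symm h13, Ne.symm h23]
  have g4 : frameMap u₁ u₂ u₃ u₄ F f u₄ = F.a₄ := by
    simp [frameMap, Ne.symm h14, Ne.symm h24, Ne.symm h34]
  have gf : ∀ x, x ∉ ({u₁, u₂, u₃, u₄} : Set X) → frameMap u₁ u₂ u₃ u₄ F f x = f x := by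
    intro x hx
    simp only [Set.mem_insert_iff, Set.mem_singleton_iff, not_or] at hx
    simp [frameMap, hx]
  have hv : ∀ {i : X}, (i = v₁ ∨ i = v₂ ∨ i = v₃ ∨ i = v₄) → i ∉ ({u₁, u₂, u₃, u₄} : Set X) := by
    have := hK.nodup
    simp only [List.nodup_cons, List.mem_cons, List.not_mem_nil, or_false, not_or,
      not_false_eq_true, List.nodup_nil, and_true] at this
    rintro i (rfl | rfl | rfl | rfl) <;>
      simp only [Set.mem_insert_iff, Set.mem_singleton_iff, not_or] <;>
      refine ⟨?_, ?_, ?_, ?_⟩ <;> rintro rfl <;> simp at this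
  have gv1 : frameMap u₁ u₂ u₃ u₄ F f v₁ = F.p₁ := by rw [gf _ (hv (by simp)), hp₁]
  have gv2 : frameMap u₁ u₂ u₃ u₄ F f v₂ = F.p₂ := by rw [gf _ (hv (by simp)), hp₂]
  have gv3 : frameMap u₁ u₂ u₃ u₄ F f v₃ = F.p₃ := by rw [gf _ (hv (by simp)), hp₃]
  have gv4 : frameMap u₁ u₂ u₃ u₄ F f v₄ = F.p₄ := by rw [gf _ (hv (by simp)), hp₄]
  have hcount : ∀ z, F.total.count z ≤ 1 := List.nodup_iff_count_le_one.1 hF.nodup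
  have hUc : ∀ x, x ∈ ({u₁, u₂, u₃, u₄} : Set X) → frameMap u₁ u₂ u₃ u₄ F f x ∈ F.total := by
    rintro x (rfl | rfl | rfl | rfl) <;>
      simp [g1, g2, g3, g4, Frame.total, Frame.circ]
  have hoff : ∀ x ∈ K.support, x ∉ ({u₁, u₂, u₃, u₄} : Set X) →
      frameMap u₁ u₂ u₃ u₄ F f x ∈ offPart K {u₁, u₂, u₃, u₄} f l := by
    intro x hx hxU
    rw [gf x hxU]
    exact Or.inl ⟨x, hx, hxU, rfl⟩
  have hjoin : ∀ x y, K.Adj x y → x ∈ ({u₁, u₂, u₃, u₄} : Set X) →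
      Join H (frameMap u₁ u₂ u₃ u₄ F f x) (frameMap u₁ u₂ u₃ u₄ F f y)
        (frameOwn K u₁ u₂ u₃ u₄ v₁ v₂ v₃ v₄ F l s(x, y)) := by
    rintro x y hxy (rfl | rfl | rfl | rfl)
    · rcases (hK.n₁ y).1 hxy with rfl | rfl | rfl
      · rw [g1, g2]; exact ⟨_, hF.hc₁, fun z hz => Or.inl ⟨rfl, hz⟩⟩
      · rw [g1, g4]
        exact Join.symm ⟨_, hF.hc₄, fun z hz => by simp [frameOwn, Sym2.eq_swap, hz]⟩
      · rw [g1, gv1]; exact ⟨_, hF.hr₁, fun z hz => by simp [frameOwn, hz]⟩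
    · rcases (hK.n₂ y).1 hxy with rfl | rfl | rfl
      · rw [g2, g3]; exact ⟨_, hF.hc₂, fun z hz => by simp [frameOwn, hz]⟩
      · rw [g2, g1]
        exact Join.symm ⟨_, hF.hc₁, fun z hz => by simp [frameOwn, Sym2.eq_swap, hz]⟩
      · rw [g2, gv2]; exact ⟨_, hF.hr₂, fun z hz => by simp [frameOwn, hz]⟩
    · rcases (hK.n₃ y).1 hxy with rfl | rfl | rfl
      · rw [g3, g4]; exact ⟨_, hF.hc₃, fun z hz => by simp [frameOwn, hz]⟩
      · rw [g3, g2]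
        exact Join.symm ⟨_, hF.hc₂, fun z hz => by simp [frameOwn, Sym2.eq_swap, hz]⟩
      · rw [g3, gv3]; exact ⟨_, hF.hr₃, fun z hz => by simp [frameOwn, hz]⟩
    · rcases (hK.n₄ y).1 hxy with rfl | rfl | rfl
      · rw [g4, g1]; exact ⟨_, hF.hc₄, fun z hz => by simp [frameOwn, hz]⟩
      · rw [g4, g3]
        exact Join.symm ⟨_, hF.hc₃, fun z hz => by simp [frameOwn, Sym2.eq_swap, hz]⟩
      · rw [g4, gv4]; exact ⟨_, hF.hr₄, fun z hz => by simp [frameOwn, hz]⟩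
  have hmem : ∀ e z, z ∈ frameOwn K u₁ u₂ u₃ u₄ v₁ v₂ v₃ v₄ F l e →
      (z ∈ F.total) ∨ ∃ x y, K.Adj x y ∧ x ∉ ({u₁, u₂, u₃, u₄} : Set X) ∧
        y ∉ ({u₁, u₂, u₃, u₄} : Set X) ∧ e = s(x, y) ∧ z ∈ l x y := by
    rintro e z (h | h | h | h | h | h | h | h | h)
    on_goal 9 => exact Or.inr h
    all_goals
      left
      simp only [Frame.total, Frame.circ, List.mem_append, List.mem_cons]
      tauto
  have hown : ∀ z e e', z ∈ frameOwn K u₁ u₂ u₃ u₄ v₁ v₂ v₃ v₄ F l e →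
      z ∈ frameOwn K u₁ u₂ u₃ u₄ v₁ v₂ v₃ v₄ F l e' → e = e' := by
    intro z e e' hz hz'
    have hc := hcount z
    simp only [Frame.total, Frame.circ, List.count_append, Frame.count_cons_eq] at hc
    by_cases hzt : z ∈ F.total
    · have hno : ∀ e, ¬ ∃ x y, K.Adj x y ∧ x ∉ ({u₁, u₂, u₃, u₄} : Set X) ∧
          y ∉ ({u₁, u₂, u₃, u₄} : Set X) ∧ e = s(x, y) ∧ z ∈ l x y := by
        rintro e ⟨x, y, hxy, hx, hy, -, hz⟩
        exact hF.out z hzt (Or.inr ⟨x, y, hxy, hx, hy, hz⟩)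
      simp only [frameOwn, Set.mem_ofPred_eq, hno, or_false] at hz hz'
      simp only [← List.count_pos_iff] at hz hz'
      rcases hz with ⟨rfl, h⟩ | ⟨rfl, h⟩ | ⟨rfl, h⟩ | ⟨rfl, h⟩ | ⟨rfl, h⟩ | ⟨rfl, h⟩ | ⟨rfl, h⟩ |
        ⟨rfl, h⟩ <;>
      rcases hz' with ⟨rfl, h'⟩ | ⟨rfl, h'⟩ | ⟨rfl, h'⟩ | ⟨rfl, h'⟩ | ⟨rfl, h'⟩ | ⟨rfl, h'⟩ |
        ⟨rfl, h'⟩ | ⟨rfl, h'⟩ <;> first | rfl | (exfalso; omega)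
    · rcases hmem e z hz with h1 | ⟨x, y, hxy, -, -, rfl, h1⟩
      · exact absurd h1 hzt
      rcases hmem e' z hz' with h2 | ⟨x', y', hxy', -, -, rfl, h2⟩
      · exact absurd h2 hzt
      by_contra hne
      exact Set.disjoint_left.1 (h.disj _ hxy _ hxy' hne) ((hl x y hxy).2.2 z h1)
        ((hl x' y' hxy').2.2 z h2)
  refine ⟨?_, ?_, ?_, ?_⟩
  · intro x hx y hy hxy
    by_cases hxU : x ∈ ({u₁, u₂, u₃, u₄} : Set X) <;> by_cases hyU : y ∈ ({u₁, u₂, u₃, u₄} : Set X)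
    · have hc := hcount (frameMap u₁ u₂ u₃ u₄ F f x)
      simp only [Frame.total, Frame.circ, List.count_append, Frame.count_cons_eq] at hc
      have hit : ∀ z : W, Frame.hit z z = 1 := fun z => by simp [Frame.hit]
      rcases hxU with rfl | rfl | rfl | rfl <;> rcases hyU with rfl | rfl | rfl | rfl <;>
        first
        | rfl
        | (exfalso
           simp only [g1, g2, g3, g4] at hxy hc
           have e1 := hit F.a₁
           have e2 := hit F.a₂
           have e3 := hit F.a₃
           have e4 := hit F.a₄
           rw [hxy] at hc
           omega)
    · exact absurd (hoff y hy hyU) (hxy ▸ hF.out _ (hUc x hxU))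
    · exact absurd (hoff x hx hxU) (hxy ▸ hF.out _ (hUc y hyU))
    · rw [gf x hxU, gf y hyU] at hxy
      exact h.inj hx hy hxy
  · intro x y hxy
    by_cases hxU : x ∈ ({u₁, u₂, u₃, u₄} : Set X)
    · exact hjoin x y hxy hxU
    by_cases hyU : y ∈ ({u₁, u₂, u₃, u₄} : Set X)
    · have := (hjoin y x hxy.symm hyU).symm
      rwa [Sym2.eq_swap] at this
    · rw [gf x hxU, gf y hyU]
      refine ⟨l x y, (hl x y hxy).1, fun z hz => ?_⟩
      simp only [frameOwn, Set.mem_ofPred_eq]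
      iterate 8 right
      exact ⟨x, y, hxy, hxU, hyU, rfl, hz⟩
  · intro e _ e' _ hne
    rw [Set.disjoint_left]
    exact fun z hz hz' => hne (hown z e e' hz hz')
  · intro e he x hx hz
    by_cases hxU : x ∈ ({u₁, u₂, u₃, u₄} : Set X)
    · have hxt := hUc x hxU
      have hno : ∀ e, ¬ ∃ x' y, K.Adj x' y ∧ x' ∉ ({u₁, u₂, u₃, u₄} : Set X) ∧
          y ∉ ({u₁, u₂, u₃, u₄} : Set X) ∧ e = s(x', y) ∧ frameMap u₁ u₂ u₃ u₄ F f x ∈ l x' y := by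
        rintro e ⟨x', y, hxy, hx, hy, -, hz⟩
        exact hF.out _ hxt (Or.inr ⟨x', y, hxy, hx, hy, hz⟩)
      simp only [frameOwn, Set.mem_ofPred_eq, hno, or_false] at hz
      have hc := hcount (frameMap u₁ u₂ u₃ u₄ F f x)
      simp only [Frame.total, Frame.circ, List.count_append, Frame.count_cons_eq] at hc
      have hit : ∀ z : W, Frame.hit z z = 1 := fun z => by simp [Frame.hit]
      simp only [← List.count_pos_iff] at hz
      have e1 := hit F.a₁
      have e2 := hit F.a₂
      have e3 := hit F.a₃
      have e4 := hit F.a₄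
      rcases hxU with rfl | rfl | rfl | rfl <;> simp only [g1, g2, g3, g4] at hc hz <;>
        rcases hz with ⟨-, h⟩ | ⟨-, h⟩ | ⟨-, h⟩ | ⟨-, h⟩ | ⟨-, h⟩ | ⟨-, h⟩ | ⟨-, h⟩ | ⟨-, h⟩ <;>
        omega
    · rcases hmem e _ hz with h1 | ⟨x', y, hxy, -, -, rfl, h1⟩
      · exact hF.out _ h1 (hoff x hx hxU)
      · rw [gf x hxU] at h1
        exact h.notMem _ hxy x hx ((hl x' y hxy).2.2 _ h1)

end Assemble

end QuadExp

namespace QuadExp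

open SimpleGraph

variable {X : Type*} {W : Type*} {K : SimpleGraph X} {H : SimpleGraph W}
  {u₁ u₂ u₃ u₄ v₁ v₂ v₃ v₄ : X}

lemma exists_frame (hK : QS K u₁ u₂ u₃ u₄ v₁ v₂ v₃ v₄) {f : X → W} {I : Sym2 X → Set W}
    (h : EmbData K H f I) {l : X → X → List W}
    (hl : ∀ x y, K.Adj x y → (f x :: (l x y ++ [f y])).IsChain H.Adj ∧
      (f x :: (l x y ++ [f y])).Nodup ∧ ∀ z ∈ l x y, z ∈ I s(x, y)) :
    ∃ F : Frame W, F.Valid H (offPart K {u₁, u₂, u₃, u₄} f l) ∧ F.p₁ = f v₁ ∧ F.p₂ = f v₂ ∧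
      F.p₃ = f v₃ ∧ F.p₄ = f v₄ := by
  have hnd := hK.nodup
  simp only [List.nodup_cons, List.mem_cons, List.not_mem_nil, or_false, not_or, not_false_eq_true,
      List.nodup_nil, and_true] at hnd
  have c12 : K.Adj u₁ u₂ := (hK.n₁ _).2 (by simp)
  have c23 : K.Adj u₂ u₃ := (hK.n₂ _).2 (by simp)
  have c34 : K.Adj u₃ u₄ := (hK.n₃ _).2 (by simp)
  have c41 : K.Adj u₄ u₁ := (hK.n₄ _).2 (by simp)
  have d1 : K.Adj u₁ v₁ := (hK.n₁ _).2 (by simp)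
  have d2 : K.Adj u₂ v₂ := (hK.n₂ _).2 (by simp)
  have d3 : K.Adj u₃ v₃ := (hK.n₃ _).2 (by simp)
  have d4 : K.Adj u₄ v₄ := (hK.n₄ _).2 (by simp)
  have hnodup : ∀ x y, K.Adj x y → (l x y).Nodup := by
    intro x y hxy
    have := (hl x y hxy).2.1
    simp only [List.nodup_cons, List.nodup_append] at this
    exact this.2.1
  have hdisj : ∀ {x y x' y'}, K.Adj x y → K.Adj x' y' → s(x, y) ≠ s(x', y') →
      (l x y).Disjoint (l x' y') := by
    intro x y x' y' hxy hxy' hne z hz hz'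
    exact Set.disjoint_left.1 (h.disj _ hxy _ hxy' hne) ((hl x y hxy).2.2 z hz)
      ((hl x' y' hxy').2.2 z hz')
  have hf : ∀ {x y z}, K.Adj x y → z ∈ K.support → f z ∉ l x y := by
    intro x y z hxy hz hz'
    exact h.notMem s(x, y) hxy z hz ((hl x y hxy).2.2 _ hz')
  have hff : ∀ {x y}, x ∈ K.support → y ∈ K.support → x ≠ y → f x ≠ f y := by
    intro x y hx hy hxy h'
    exact hxy (h.inj hx hy h')
  have s1 : u₁ ∈ K.support := ⟨_, c12⟩
  have s2 : u₂ ∈ K.support := ⟨_, c23⟩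
  have s3 : u₃ ∈ K.support := ⟨_, c34⟩
  have s4 : u₄ ∈ K.support := ⟨_, c41⟩
  have hoff : ∀ z ∈ offPart K {u₁, u₂, u₃, u₄} f l, ∀ u ∈ ({u₁, u₂, u₃, u₄} : Set X), ∀ y,
      K.Adj u y → z ≠ f u ∧ z ∉ l u y := by
    rintro z hz u hu y huy
    rcases hz with ⟨x, hx, hxU, rfl⟩ | ⟨x, x', hxx, hxU, hxU', hz⟩
    · refine ⟨hff hx ⟨_, huy⟩ fun h => hxU (h ▸ hu), hf huy hx⟩
    · refine ⟨?_, fun hz' => hdisj hxx huy ?_ hz hz'⟩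
      · rintro rfl
        exact hf hxx ⟨_, huy⟩ hz
      · rw [Ne, Sym2.eq_iff]
        rintro (⟨rfl, -⟩ | ⟨-, rfl⟩)
        · exact hxU hu
        · exact hxU' hu
  have hp : ∀ {u v}, K.Adj u v → v ∉ ({u₁, u₂, u₃, u₄} : Set X) →
      f v ∈ offPart K {u₁, u₂, u₃, u₄} f l := fun h h' => Or.inl ⟨_, ⟨_, h.symm⟩, h', rfl⟩
  refine ⟨⟨f u₁, f u₂, f u₃, f u₄, f v₁, f v₂, f v₃, f v₄, l u₁ u₂, l u₂ u₃, l u₃ u₄, l u₄ u₁,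
    l u₁ v₁, l u₂ v₂, l u₃ v₃, l u₄ v₄⟩, ⟨(hl _ _ c12).1, (hl _ _ c23).1, (hl _ _ c34).1,
    (hl _ _ c41).1, (hl _ _ d1).1, (hl _ _ d2).1, (hl _ _ d3).1, (hl _ _ d4).1, ?_, ?_, hp d1 ?_,
    hp d2 ?_, hp d3 ?_, hp d4 ?_⟩, rfl, rfl, rfl, rfl⟩
  · classical
    suffices hN : (List.flatten [[f u₁], [f u₂], [f u₃], [f u₄], l u₁ u₂, l u₂ u₃, l u₃ u₄,
        l u₄ u₁, l u₁ v₁, l u₂ v₂, l u₃ v₃, l u₄ v₄]).Nodup by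
      rw [List.nodup_iff_count_le_one] at hN ⊢
      intro x
      have := hN x
      simp only [Frame.total, Frame.circ, List.flatten_cons, List.flatten_nil, List.count_append,
        Frame.count_cons_eq, List.count_nil] at this ⊢
      omega
    rw [List.nodup_flatten]
    refine ⟨?_, ?_⟩
    · simp only [List.mem_cons, List.not_mem_nil, or_false, forall_eq_or_imp, forall_eq,
        List.nodup_singleton, true_and, hnodup _ _ c12, hnodup _ _ c23, hnodup _ _ c34,
        hnodup _ _ c41, hnodup _ _ d1, hnodup _ _ d2, hnodup _ _ d3, hnodup _ _ d4]
    · simp only [List.pairwise_cons, List.mem_cons, List.not_mem_nil, or_false, forall_eq_or_imp,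
        forall_eq, List.Pairwise.nil, and_true, IsEmpty.forall_iff, implies_true]
      simp only [List.singleton_disjoint, List.mem_singleton, hf c12 s1, hf c12 s2, hf c12 s3,
        hf c12 s4, hf c23 s1, hf c23 s2, hf c23 s3, hf c23 s4, hf c34 s1, hf c34 s2, hf c34 s3,
        hf c34 s4, hf c41 s1, hf c41 s2, hf c41 s3, hf c41 s4, hf d1 s1, hf d1 s2, hf d1 s3,
        hf d1 s4, hf d2 s1, hf d2 s2, hf d2 s3, hf d2 s4, hf d3 s1, hf d3 s2, hf d3 s3, hf d3 s4,
        hf d4 s1, hf d4 s2, hf d4 s3, hf d4 s4, not_false_eq_true, and_true, true_and]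
      refine ⟨⟨hff s1 s2 (by tauto), hff s1 s3 (by tauto), hff s1 s4 (by tauto)⟩,
        ⟨hff s2 s3 (by tauto), hff s2 s4 (by tauto)⟩, hff s3 s4 (by tauto), ?_⟩
      and_intros <;> apply hdisj <;> first | assumption | (rw [Ne, Sym2.eq_iff]; grind)
  · intro z hz hzO
    have h1 := hoff z hzO
    simp only [Frame.total, Frame.circ, List.mem_append, List.mem_cons] at hz
    have e1 := h1 u₁ (by simp) u₂ c12
    have e2 := h1 u₂ (by simp) u₃ c23
    have e3 := h1 u₃ (by simp) u₄ c34
    have e4 := h1 u₄ (by simp) u₁ c41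
    have g1 := h1 u₁ (by simp) v₁ d1
    have g2 := h1 u₂ (by simp) v₂ d2
    have g3 := h1 u₃ (by simp) v₃ d3
    have g4 := h1 u₄ (by simp) v₄ d4
    tauto
  all_goals
    simp only [Set.mem_insert_iff, Set.mem_singleton_iff]
    grind

/-- One finds a `1`-extension of `K` in `H` that joins an edge of the quadrangle to an edge
off the quadrangle. -/
theorem exists_extension [Finite W] (hK : QS K u₁ u₂ u₃ u₄ v₁ v₂ v₃ v₄) (hH : H.IsCubic)
    (hH5 : H.IsCyclicallyConnected 5) (hKH : Emb K H) (P : X → X → X → X → Prop)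
    (hrot : ∀ a b c d, P a b c d → P b c d a) (hrefl : ∀ a b c d, P a b c d → P b a d c)
    (hP : P u₁ u₂ u₃ u₄) :
    ∃ a₁ a₂ a₃ a₄ b₁ b₂ b₃ b₄ x y, QS K a₁ a₂ a₃ a₄ b₁ b₂ b₃ b₄ ∧ P a₁ a₂ a₃ a₄ ∧ K.Adj x y ∧
      x ∉ ({a₁, a₂, a₃, a₄} : Set X) ∧ y ∉ ({a₁, a₂, a₃, a₄} : Set X) ∧
      ∀ p q, p ∉ K.support → q ∉ K.support → p ≠ q → Emb (ins K a₁ a₂ x y p q) H := by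
  obtain ⟨f, I, hE1, hE2, hE3, hE4⟩ := hKH
  have h : EmbData K H f I := ⟨hE1, hE2, hE3, hE4⟩
  obtain ⟨l, hl⟩ := h.exists_lists
  obtain ⟨F, hF, hp₁, hp₂, hp₃, hp₄⟩ := exists_frame hK h hl
  have hnd := hK.nodup
  have d1 : K.Adj u₁ v₁ := (hK.n₁ _).2 (by simp)
  have d2 : K.Adj u₂ v₂ := (hK.n₂ _).2 (by simp)
  have d3 : K.Adj u₃ v₃ := (hK.n₃ _).2 (by simp)
  have d4 : K.Adj u₄ v₄ := (hK.n₄ _).2 (by simp)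
  have hpn : [F.p₁, F.p₂, F.p₃, F.p₄].Nodup := by
    rw [hp₁, hp₂, hp₃, hp₄]
    have : [v₁, v₂, v₃, v₄].Nodup :=
      hnd.sublist (List.drop_sublist 4 [u₁, u₂, u₃, u₄, v₁, v₂, v₃, v₄])
    refine this.map_on (f := f) ?_
    intro x hx y hy hxy
    refine h.inj ?_ ?_ hxy
    · simp only [List.mem_cons, List.not_mem_nil, or_false] at hx
      rcases hx with rfl | rfl | rfl | rfl
      exacts [⟨_, d1.symm⟩, ⟨_, d2.symm⟩, ⟨_, d3.symm⟩, ⟨_, d4.symm⟩]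
    · simp only [List.mem_cons, List.not_mem_nil, or_false] at hy
      rcases hy with rfl | rfl | rfl | rfl
      exacts [⟨_, d1.symm⟩, ⟨_, d2.symm⟩, ⟨_, d3.symm⟩, ⟨_, d4.symm⟩]
  refine hF.exists_jump hH hH5 hpn (Ok := fun p₁ p₂ p₃ p₄ => ∃ a₁ a₂ a₃ a₄ b₁ b₂ b₃ b₄,
    QS K a₁ a₂ a₃ a₄ b₁ b₂ b₃ b₄ ∧ P a₁ a₂ a₃ a₄ ∧
    ({a₁, a₂, a₃, a₄} : Set X) = {u₁, u₂, u₃, u₄} ∧ p₁ = f b₁ ∧ p₂ = f b₂ ∧ p₃ = f b₃ ∧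
    p₄ = f b₄) ?_ ?_ ⟨_, _, _, _, _, _, _, _, hK, hP, rfl, hp₁, hp₂, hp₃, hp₄⟩ ?_
  · rintro _ _ _ _ ⟨a₁, a₂, a₃, a₄, b₁, b₂, b₃, b₄, hQ, hP, hU, rfl, rfl, rfl, rfl⟩
    refine ⟨_, _, _, _, _, _, _, _, hQ.rot, hrot _ _ _ _ hP, ?_, rfl, rfl, rfl, rfl⟩
    rw [← hU]
    ext z
    simp only [Set.mem_insert_iff, Set.mem_singleton_iff]
    tauto
  · rintro _ _ _ _ ⟨a₁, a₂, a₃, a₄, b₁, b₂, b₃, b₄, hQ, hP, hU, rfl, rfl, rfl, rfl⟩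
    refine ⟨_, _, _, _, _, _, _, _, hQ.refl, hrefl _ _ _ _ hP, ?_, rfl, rfl, rfl, rfl⟩
    rw [← hU]
    ext z
    simp only [Set.mem_insert_iff, Set.mem_singleton_iff]
    tauto
  · rintro F hF ⟨a₁, a₂, a₃, a₄, b₁, b₂, b₃, b₄, hQ, hP, hU, hp₁, hp₂, hp₃, hp₄⟩ z o s hz ho hs hsO
    rw [← hU] at hF ho hsO
    have hD := embData_frame hQ h hl hF hp₁ hp₂ hp₃ hp₄
    have c12 : K.Adj a₁ a₂ := (hQ.n₁ _).2 (by simp)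
    have hzI : z ∈ frameOwn K a₁ a₂ a₃ a₄ b₁ b₂ b₃ b₄ F l s(a₁, a₂) := Or.inl ⟨rfl, hz⟩
    have hownT : ∀ e t, t ∈ frameOwn K a₁ a₂ a₃ a₄ b₁ b₂ b₃ b₄ F l e →
        t ∈ F.total ∨ t ∈ offPart K {a₁, a₂, a₃, a₄} f l := by
      rintro e t (h | h | h | h | h | h | h | h | ⟨x, y, hxy, hx, hy, -, h⟩)
      on_goal 9 => exact Or.inr (Or.inr ⟨x, y, hxy, hx, hy, h⟩)
      all_goals
        left
        simp only [Frame.total, Frame.circ, List.mem_append, List.mem_cons]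
        tauto
    have hmapT : ∀ x ∈ K.support, frameMap a₁ a₂ a₃ a₄ F f x ∈ F.total ∨
        frameMap a₁ a₂ a₃ a₄ F f x ∈ offPart K {a₁, a₂, a₃, a₄} f l := by
      intro x hx
      simp only [frameMap]
      split_ifs with h1 h2 h3 h4
      iterate 4 left; simp [Frame.total, Frame.circ]
      exact Or.inr (Or.inl ⟨x, hx, by simp [h1, h2, h3, h4], rfl⟩)
    rcases ho with ⟨x, hx, hxU, rfl⟩ | ⟨x, y, hxy, hx, hy, ho⟩
    · exfalso
      obtain ⟨s₀, t, ht⟩ := Frame.exists_append_singleton_eq_cons s z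
      have hgx : frameMap a₁ a₂ a₃ a₄ F f x = f x := by
        simp only [Set.mem_insert_iff, Set.mem_singleton_iff, not_or] at hxU
        simp [frameMap, hxU]
      have hadj : H.Adj (frameMap a₁ a₂ a₃ a₄ F f x) t := by
        rw [hgx]
        have : z :: (s ++ [f x]) = s₀ ++ [t, f x] := by
          rw [← List.cons_append, ht]; simp
        rw [this] at hs
        have := (List.isChain_append.1 hs).2.1
        simp at this
        exact this.symm
      obtain ⟨y, hxy, hty⟩ := hD.nbr hH (hK.cubic x hx) hadj
      have htm : t ∈ z :: s := by rw [ht]; simp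
      rcases List.mem_cons.1 htm with rfl | hts
      · rcases hty with hty | hty
        · refine Set.disjoint_left.1 (hD.disj s(x, y) hxy s(a₁, a₂) c12 ?_) hty hzI
          rw [Ne, Sym2.eq_iff]
          rintro (⟨rfl, -⟩ | ⟨rfl, -⟩) <;> exact hxU (by simp)
        · exact hD.notMem s(a₁, a₂) c12 y ⟨x, hxy.symm⟩ (hty ▸ hzI)
      · have := hsO t hts
        rcases hty with hty | hty
        · have := hownT _ _ hty
          tauto
        · have := hmapT y ⟨x, hxy.symm⟩
          rw [← hty] at this
          tauto
    · refine ⟨a₁, a₂, a₃, a₄, b₁, b₂, b₃, b₄, x, y, hQ, hP, hxy, hx, hy, ?_⟩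
      intro p q hp hq hpq
      obtain ⟨d, d', hd⟩ := List.append_of_mem hz
      obtain ⟨e, e', he⟩ := List.append_of_mem ho
      have hnd := hQ.nodup
      have g1 : frameMap a₁ a₂ a₃ a₄ F f a₁ = F.a₁ := by simp [frameMap]
      have g2 : frameMap a₁ a₂ a₃ a₄ F f a₂ = F.a₂ := by
        have : a₂ ≠ a₁ := (K.ne_of_adj c12).symm
        simp [frameMap, this]
      have gx : ∀ x, x ∉ ({a₁, a₂, a₃, a₄} : Set X) → frameMap a₁ a₂ a₃ a₄ F f x = f x := by
        intro x hxU
        simp only [Set.mem_insert_iff, Set.mem_singleton_iff, not_or] at hxU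
        simp [frameMap, hxU]
      have hc := hF.hc₁
      rw [hd, List.append_assoc, List.cons_append] at hc
      have hlx := hl x y hxy
      rw [he, List.append_assoc, List.cons_append] at hlx
      have hcn : (d ++ z :: d').Nodup := by
        rw [← hd]
        refine hF.nodup.sublist ?_
        simp only [Frame.total, Frame.circ, List.append_assoc, List.cons_append]
        exact ((List.sublist_append_left _ _).cons _)
      have hln : (e ++ o :: e').Nodup := by
        have := hlx.2.1
        have h1 : f x :: (e ++ o :: (e' ++ [f y])) = [f x] ++ (e ++ o :: e') ++ [f y] := by simp
        rw [h1] at this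
        exact (List.nodup_append.1 (List.nodup_append.1 this).1).2.1
      simp only [List.nodup_append, List.nodup_cons] at hcn hln
      refine emb_ins_of_jump hD.inj hD.join hD.disj hD.notMem c12 hxy ?_ hp hq hpq (a := z) (o := o)
        (A₁ := {t | t ∈ d}) (A₂ := {t | t ∈ d'}) (B₁ := {t | t ∈ e}) (B₂ := {t | t ∈ e'})
        (S := {t | t ∈ s}) ?_ ?_ ?_ ?_ ⟨s, hs, fun _ h => h⟩ ?_ ?_ ?_ ?_ ?_ ?_ ?_ ?_
      · rw [Ne, Sym2.eq_iff]
        rintro (⟨rfl, -⟩ | ⟨rfl, -⟩)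
        · exact hx (by simp)
        · exact hy (by simp)
      · rw [g1]; exact ⟨d, Frame.chain_take hc, fun _ h => h⟩
      · rw [g2]; exact ⟨d', Frame.chain_drop hc, fun _ h => h⟩
      · rw [gx x hx]; exact ⟨e, Frame.chain_take hlx.1, fun _ h => h⟩
      · rw [gx y hy]; exact ⟨e', Frame.chain_drop hlx.1, fun _ h => h⟩
      · rintro t (rfl | h | h)
        · exact hzI
        · exact Or.inl ⟨rfl, by rw [hd]; exact List.mem_append_left _ h⟩
        · exact Or.inl ⟨rfl, by rw [hd]; exact List.mem_append_right _ (List.mem_cons_of_mem _ h)⟩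
      · intro t ht
        have : t ∈ l x y := by
          rw [he]
          rcases ht with rfl | h | h
          · simp
          · exact List.mem_append_left _ h
          · exact List.mem_append_right _ (List.mem_cons_of_mem _ h)
        simp only [frameOwn, Set.mem_ofPred_eq]
        iterate 8 right
        exact ⟨x, y, hxy, hx, hy, rfl, this⟩
      · rw [Set.disjoint_left]
        exact fun t h h' => hcn.2.2 t h t (List.mem_cons_of_mem _ h') rfl
      · rw [Set.disjoint_left]
        exact fun t h h' => hln.2.2 t h t (List.mem_cons_of_mem _ h') rfl
      · rintro (h | h)
        · exact hcn.2.2 z h z (by simp) rfl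
        · exact hcn.2.1.1 h
      · rintro (h | h)
        · exact hln.2.2 o h o (by simp) rfl
        · exact hln.2.1.1 h
      · intro t ht hts
        have h1 := hsO _ hts
        have h2 := hmapT t ht
        tauto
      · intro e he
        rw [Set.disjoint_left]
        intro t ht hts
        have h1 := hsO t hts
        have h2 := hownT e t ht
        tauto

end QuadExp

namespace QuadExp

open SimpleGraph

/-! ### Skeletons

A skeleton is a list of pairs of labels, the edges. The labels less than `20` are the leaves. -/

namespace Skel

/-- The pairs `(a, b)` and `(c, d)` are equal up to order. -/
def same (a b c d : ℕ) : Bool := (Nat.beq a c && Nat.beq b d) || (Nat.beq a d && Nat.beq b c)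

/-- The edge `ab` is present. -/
def has (E : List (ℕ × ℕ)) (a b : ℕ) : Bool := E.any fun e => same e.1 e.2 a b

/-- Remove the edge `ab`. -/
def rem (E : List (ℕ × ℕ)) (a b : ℕ) : List (ℕ × ℕ) := E.filter fun e => !same e.1 e.2 a b

/-- Subdivide `ij` by `m` and `kl` by `m + 1` and join the two new labels. -/
def splus (m : ℕ) (E : List (ℕ × ℕ)) (i j k l : ℕ) : List (ℕ × ℕ) :=
  (i, m) :: (m, j) :: (k, m + 1) :: (m + 1, l) :: (m, m + 1) :: rem (rem E i j) k l

/-- The neighbors of `i`. -/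
def nb (E : List (ℕ × ℕ)) (i : ℕ) : List ℕ :=
  E.filterMap fun e => if Nat.beq e.1 i then some e.2 else if Nat.beq e.2 i then some e.1 else none

/-- Perform a list of extensions, checking that they are possible. -/
def srun (σ : ℕ → ℕ) : List (ℕ × ℕ × ℕ × ℕ) → ℕ → List (ℕ × ℕ) → Option (List (ℕ × ℕ))
  | [], _, E => some E
  | (a, b, c, d) :: r, m, E =>
    if has E (σ a) (σ b) && has E (σ c) (σ d) && !same (σ a) (σ b) (σ c) (σ d) then
      srun σ r (m + 2) (splus m E (σ a) (σ b) (σ c) (σ d)) else none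

/-- A step in the choice of the labels of an expansion: a neighbor of an earlier vertex, a
copy of an earlier vertex, or the two ends of an edge; the list names earlier vertices that have
to be avoided. -/
inductive Step
  | child (p : ℕ) (avoid : List ℕ)
  | copy (p : ℕ)
  | free (avoid : List ℕ)

/-- A type of expansions: the labels `0, 1, 2, 3` are the vertices of the quadrangle, the steps
determine the labels from `4` on, and the `t`-th operation creates the labels `20 + 2 * t` and
`21 + 2 * t`. -/
structure Spec where
  steps : List Step
  eqs : List (ℕ × ℕ)
  ops : List (ℕ × ℕ × ℕ × ℕ)

def specA : Spec := ⟨[.child 0 [1, 3], .child 1 [0, 2], .free [0, 1, 2, 3, 4, 5]], [],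
  [(0, 1, 6, 7)]⟩
def specB : Spec := ⟨[.child 0 [1, 3], .child 4 [0], .child 4 [0, 5], .free [0, 4, 5, 6]], [],
  [(0, 1, 4, 5), (4, 21, 7, 8)]⟩
def specC : Spec := ⟨[.child 0 [1, 3], .child 4 [0], .child 1 [0, 2], .copy 6, .child 7 [1, 5]], [],
  [(0, 1, 4, 5), (20, 21, 7, 8)]⟩
def specD : Spec := ⟨[.child 0 [1, 3], .child 4 [0], .child 2 [1, 3]], [],
  [(0, 1, 4, 5), (0, 20, 2, 6)]⟩
def specE : Spec := ⟨[.child 0 [1, 3], .child 4 [0], .child 2 [1, 3], .copy 6, .child 7 [2]], [],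
  [(0, 1, 4, 5), (0, 20, 2, 3), (23, 3, 7, 8)]⟩
def specF : Spec := ⟨[.child 0 [1, 3], .child 4 [0], .child 1 [0, 2], .copy 6, .child 7 [1]],
  [(5, 8)], [(0, 1, 4, 5), (1, 20, 7, 8), (22, 20, 2, 3), (20, 21, 22, 23)]⟩
def specG : Spec := ⟨[.child 0 [1, 3], .child 4 [0]], [],
  [(0, 1, 4, 5), (0, 20, 3, 2), (20, 22, 1, 2), (24, 22, 21, 4), (22, 23, 24, 25)]⟩

def specs : List Spec := [specA, specB, specC, specD, specE, specF, specG]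

/-- The eight cyclic orderings of a quadrangle. -/
def rots {α : Type*} (a b c d : α) : List (List α) :=
  [[a, b, c, d], [b, c, d, a], [c, d, a, b], [d, a, b, c],
   [b, a, d, c], [c, b, a, d], [d, c, b, a], [a, d, c, b]]

/-- The label of the expansion label `t`, if `s` lists the labels of `0, 1, 2, …` and the new labels
start at `m`. -/
def sg (s : List ℕ) (m t : ℕ) : ℕ := if Nat.blt t 20 then s.getD t (s.getD 0 0) else m + (t - 20)

/-- All choices of labels allowed by a list of steps; the free edges are taken from `fr`. A choice ends
early if a neighbor of a leaf has to be chosen. -/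
def enum (E fr : List (ℕ × ℕ)) : List Step → List ℕ → List (List ℕ)
  | [], s => [s]
  | .child p av :: r, s =>
    if Nat.ble 20 (s.getD p 0) then
      (nb E (s.getD p 0)).flatMap fun n =>
        if av.all fun x => !Nat.beq n (s.getD x 0) then enum E fr r (s ++ [n]) else []
    else [s]
  | .copy p :: r, s => enum E fr r (s ++ [s.getD p 0])
  | .free av :: r, s =>
    fr.flatMap fun e =>
      if av.all fun x => !Nat.beq e.1 (s.getD x 0) && !Nat.beq e.2 (s.getD x 0) then
        enum E fr r (s ++ [e.1, e.2]) ++ enum E fr r (s ++ [e.2, e.1]) else []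

/-- The pairs of labels required to be distinct. -/
def nes : List Step → ℕ → List (ℕ × ℕ)
  | [], _ => []
  | .child _ av :: r, n => av.map (fun x => (n, x)) ++ nes r (n + 1)
  | .copy _ :: r, n => nes r (n + 1)
  | .free av :: r, n => av.map (fun x => (n, x)) ++ av.map (fun x => (n + 1, x)) ++ nes r (n + 2)

/-- The pairs of labels required to be equal by copying. -/
def copies : List Step → ℕ → List (ℕ × ℕ)
  | [], _ => []
  | .child _ _ :: r, n => copies r (n + 1)
  | .copy p :: r, n => (n, p) :: copies r (n + 1)
  | .free _ :: r, n => copies r (n + 2)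

/-- The pairs of labels required to be adjacent. -/
def adjs : List Step → ℕ → List (ℕ × ℕ)
  | [], _ => []
  | .child p _ :: r, n => (p, n) :: adjs r (n + 1)
  | .copy _ :: r, n => adjs r (n + 1)
  | .free _ :: r, n => (n, n + 1) :: adjs r (n + 2)

/-- The number of labels less than `20`. -/
def len : List Step → ℕ → ℕ
  | [], n => n
  | .child _ _ :: r, n => len r (n + 1)
  | .copy _ :: r, n => len r (n + 1)
  | .free _ :: r, n => len r (n + 2)

/-- Apply the label map to a pair. -/
def pr (s : List ℕ) (e : ℕ × ℕ) : ℕ × ℕ := (s.getD e.1 0, s.getD e.2 0)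

def bothLeaf (e : ℕ × ℕ) : Bool := Nat.blt e.1 20 && Nat.blt e.2 20

/-- A certificate for the containment of an expansion: its type, its labels, the edges to be deleted,
and the images of its inner labels. -/
structure Cert where
  k : ℕ
  s : List ℕ
  del : List (ℕ × ℕ)
  phi : List ℕ

def phiF (phi : List ℕ) (n : ℕ) : ℕ := if Nat.blt n 20 then n else phi.getD (n - 20) 0

/-- Follow the vertices of degree two up to `t`. -/
def follow (E : List (ℕ × ℕ)) (phi : List ℕ) (t : ℕ) : ℕ → ℕ → ℕ → Option (List ℕ)
  | 0, _, _ => none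
  | f + 1, p, c =>
    if Nat.beq c t then some []
    else if Nat.blt c 20 || phi.any (Nat.beq c) then none
    else match (nb E c).filter fun n => !Nat.beq n p with
      | [] => none
      | n :: _ => (follow E phi t f c n).map (c :: ·)

/-- The inner labels of the path from `s` to `t`. -/
def findPath (E : List (ℕ × ℕ)) (phi : List ℕ) (s t : ℕ) : List ℕ :=
  if has E s t then [] else ((nb E s).findSome? fun n => follow E phi t 30 s n).getD []

def chainB (E : List (ℕ × ℕ)) (t : ℕ) : ℕ → List ℕ → Bool
  | s, [] => has E s t
  | s, c :: r => has E s c && chainB E t c r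

def nodupB : List ℕ → Bool
  | [] => true
  | a :: r => !r.any (Nat.beq a) && nodupB r

/-- The skeleton `S` contains a subdivision of the skeleton `T` with `phi` as vertex map and the
given inner labels of the paths. -/
def pathsOK (S T : List (ℕ × ℕ)) (phi : List ℕ) (P : List (List ℕ)) : Bool :=
  Nat.beq T.length P.length &&
  (T.zip P).all (fun z => chainB S (phiF phi z.1.2) (phiF phi z.1.1) z.2) &&
  nodupB (phi ++ P.flatten) && (phi ++ P.flatten).all (Nat.ble 20)

/-- The containment part of the check of a certificate. -/
def certOK (m : ℕ) (E S : List (ℕ × ℕ)) (c : Cert) : Bool :=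
  match specs[c.k]? with
  | none => false
  | some sp =>
    (rots 20 21 22 23).any (fun q => List.beq q (c.s.take 4)) &&
    Nat.beq c.s.length (len sp.steps 4) &&
    (adjs sp.steps 4).all (fun e => has E (pr c.s e).1 (pr c.s e).2) &&
    (nes sp.steps 4).all (fun e => !Nat.beq (pr c.s e).1 (pr c.s e).2) &&
    (sp.eqs ++ copies sp.steps 4).all (fun e => Nat.beq (pr c.s e).1 (pr c.s e).2 ||
      bothLeaf (pr c.s e)) &&
    match srun (sg c.s m) sp.ops m E with
    | none => false
    | some T =>
      let S' := c.del.foldl (fun S e => rem S e.1 e.2) S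
      Nat.beq (m + 2 * sp.ops.length) (20 + c.phi.length) &&
      pathsOK S T c.phi (T.map fun e => findPath S' c.phi (phiF c.phi e.1) (phiF c.phi e.2))

/-- The conditions on the leaves under which a certificate applies. -/
def lits (c : Cert) : List (Bool × ℕ × ℕ) :=
  match specs[c.k]? with
  | none => []
  | some sp =>
    (((nes sp.steps 4).map (pr c.s)).filter bothLeaf).map (fun e => (false, e)) ++
    ((((sp.eqs ++ copies sp.steps 4).map (pr c.s)).filter fun e => !Nat.beq e.1 e.2)).map
      (fun e => (true, e))

/-- The equations `ts` and inequations `fs` are contradictory, given that the leaves `7` and `8` are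
adjacent and the pairs in `na` are not. -/
def contra (na ts fs : List (ℕ × ℕ)) : Bool :=
  ts.any fun e => has fs e.1 e.2 || (ts.any fun d =>
    (Nat.beq e.1 d.1 && has fs e.2 d.2) || (Nat.beq e.1 d.2 && has fs e.2 d.1) ||
    (Nat.beq e.2 d.1 && has fs e.1 d.2) || (Nat.beq e.2 d.2 && has fs e.1 d.1)) ||
    na.any fun d => (has ts 7 d.1 && has ts 8 d.2) || (has ts 7 d.2 && has ts 8 d.1)

def sat (ts fs : List (ℕ × ℕ)) (l : Bool × ℕ × ℕ) : Bool :=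
  if l.1 then has ts l.2.1 l.2.2 else has fs l.2.1 l.2.2

def undecided (ts fs : List (ℕ × ℕ)) (l : Bool × ℕ × ℕ) : Bool :=
  !has ts l.2.1 l.2.2 && !has fs l.2.1 l.2.2

/-- In each case one of the conjunctions of literals in `cs` is satisfied. -/
def cover (na : List (ℕ × ℕ)) (cs : List (List (Bool × ℕ × ℕ))) :
    ℕ → List (ℕ × ℕ) → List (ℕ × ℕ) → Bool
  | 0, _, _ => false
  | f + 1, ts, fs =>
    contra na ts fs || cs.any (fun c => c.all (sat ts fs)) ||
    match cs.findSome? fun c => c.find? (undecided ts fs) with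
    | none => false
    | some l => cover na cs f (l.2 :: ts) fs && cover na cs f ts (l.2 :: fs)

/-- A skeleton with a short extension and the facts known about its leaves. The short extension has
the labels `20, 21, 24, w`. In an expansion of type B of the short extension with `0` labelled `q`
and `4` labelled `r`, for `(q, r, y)` in `avoid`, the free edge does not contain `y`; if `only` is
not empty, just the expansions of type B are considered that violate this for an element of `only`. -/
structure Base where
  m : ℕ
  E : List (ℕ × ℕ)
  w : ℕ
  known : List (ℕ × ℕ)
  nonadj : List (ℕ × ℕ)
  carved : Bool
  avoid : List (ℕ × ℕ × ℕ)
  only : List (ℕ × ℕ × ℕ)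

namespace Base

def S (B : Base) : List (ℕ × ℕ) := splus B.m B.E 20 21 24 B.w

def fr (B : Base) : List (ℕ × ℕ) := if B.carved then [(7, 8)] else B.S

/-- The certificates apply to the expansion of the short extension given by `ops` and `s`. -/
def checkHyp (B : Base) (ops : List (ℕ × ℕ × ℕ × ℕ)) (s : List ℕ) (ts fs : List (ℕ × ℕ))
    (cs : List Cert) : Bool :=
  match srun (sg s (B.m + 2)) ops (B.m + 2) B.S with
  | none => false
  | some S => cs.all (certOK B.m B.E S) && cover B.nonadj (cs.map lits) 12 ts (fs ++ B.known)

def avoids (B : Base) (k : ℕ) (s : List ℕ) : List (ℕ × ℕ) :=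
  if Nat.beq k 1 then B.avoid.flatMap fun a =>
    if Nat.beq a.1 (s.getD 0 0) && Nat.beq a.2.1 (s.getD 4 0) then
      [(s.getD 7 0, a.2.2), (s.getD 8 0, a.2.2)] else [] else []

def hypTs (sp : Spec) (s : List ℕ) : List (ℕ × ℕ) :=
  (sp.eqs.map (pr s)).filter fun e => !Nat.beq e.1 e.2

def hypFs (B : Base) (k : ℕ) (sp : Spec) (s : List ℕ) : List (ℕ × ℕ) :=
  ((nes sp.steps 4).map (pr s)).filter bothLeaf ++ B.avoids k s

/-- The expansion of type `k` with labels `s` need not be checked. -/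
def drop (B : Base) (pre : List (List ℕ)) (k : ℕ) (sp : Spec) (s : List ℕ) : Bool :=
  (Nat.blt 0 k && pre.any (List.beq (s.take 6))) ||
  (Nat.beq s.length (len sp.steps 4) && !(hypTs sp s).all bothLeaf) ||
  (!B.only.isEmpty && (!Nat.beq k 1 ||
    (Nat.ble 5 s.length && !B.only.any fun a => Nat.beq a.1 (s.getD 0 0) &&
      Nat.beq a.2.1 (s.getD 4 0) && (!Nat.beq s.length 9 ||
      (Nat.beq a.2.2 (s.getD 7 0) || Nat.beq a.2.2 (s.getD 8 0))))))

/-- The expansions of the short extension of type `k` that have to be checked. -/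
def hyps (B : Base) (pre : List (List ℕ)) (k : ℕ) (sp : Spec) : List (List ℕ) :=
  ((rots 20 B.m (B.m + 1) 24).flatMap fun q => enum B.S B.fr sp.steps q).filter fun s =>
    !B.drop pre k sp s

/-- Check the members of a list with the corresponding certificates. -/
def zipAll {α β : Type} (f : α → β → Bool) : List α → List β → Bool
  | [], _ => true
  | _ :: _, [] => false
  | a :: as, b :: bs => f a b && zipAll f as bs

/-- Check the expansions of type `k`; the certificates are given by their positions in `pool`. -/
def checkType (B : Base) (pre : List (List ℕ)) (pool : List Cert) (k : ℕ) (sp : Spec)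
    (idx : List (List ℕ)) : Bool :=
  zipAll (fun s is => Nat.beq s.length (len sp.steps 4) &&
    B.checkHyp sp.ops s (hypTs sp s) (B.hypFs k sp s) (is.map fun i => pool.getD i ⟨7, [], [], []⟩))
    (B.hyps pre k sp) idx

/-- Check a list of first extensions. -/
def checkPre (B : Base) (pool : List Cert) (pre : List (List ℕ)) (idx : List (List ℕ)) : Bool :=
  zipAll (fun s is => Nat.beq s.length 6 &&
    B.checkHyp [(0, 1, 4, 5)] s [] [] (is.map fun i => pool.getD i ⟨7, [], [], []⟩)) pre idx

end Base

end Skel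

end QuadExp

namespace QuadExp

open SimpleGraph

namespace Skel

variable {X : Type*} {W : Type*} {R : SimpleGraph X} {H : SimpleGraph W} {lab : ℕ → X}

lemma same_iff {a b c d : ℕ} : same a b c d = true ↔ s(a, b) = s(c, d) := by
  simp [same]

lemma has_iff {E : List (ℕ × ℕ)} {a b : ℕ} :
    has E a b = true ↔ ∃ e ∈ E, s(e.1, e.2) = s(a, b) := by
  simp only [has, List.any_eq_true, same_iff]

lemma mem_rem {E : List (ℕ × ℕ)} {a b : ℕ} {e : ℕ × ℕ} :
    e ∈ rem E a b ↔ e ∈ E ∧ s(e.1, e.2) ≠ s(a, b) := by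
  simp only [rem, List.mem_filter, Bool.not_eq_true', ← Bool.not_eq_true, same_iff, ne_eq]

lemma mem_nb {E : List (ℕ × ℕ)} {i j : ℕ} (h : has E i j = true) : j ∈ nb E i := by
  obtain ⟨⟨a, b⟩, he, h⟩ := has_iff.1 h
  rw [nb, List.mem_filterMap]
  refine ⟨(a, b), he, ?_⟩
  rcases Sym2.eq_iff.1 h with ⟨rfl, rfl⟩ | ⟨rfl, rfl⟩
  · simp
  · by_cases hab : a = b <;> simp [hab]

/-- The pair of vertices named by a pair of labels. -/
def pair (lab : ℕ → X) (e : ℕ × ℕ) : Sym2 X := s(lab e.1, lab e.2)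

lemma pair_eq_of_eq {e d : ℕ × ℕ} (h : s(e.1, e.2) = s(d.1, d.2)) : pair lab e = pair lab d := by
  rcases Sym2.eq_iff.1 h with ⟨h1, h2⟩ | ⟨h1, h2⟩ <;> simp [pair, h1, h2, Sym2.eq_swap]

/-- The graph `R` together with the edges of a skeleton. -/
def glue (R : SimpleGraph X) (lab : ℕ → X) (E : List (ℕ × ℕ)) : SimpleGraph X :=
  R ⊔ fromEdgeSet {e | ∃ d ∈ E, pair lab d = e}

lemma glue_adj {E : List (ℕ × ℕ)} {a b : X} : (glue R lab E).Adj a b ↔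
    R.Adj a b ∨ (∃ d ∈ E, pair lab d = s(a, b)) ∧ a ≠ b := by
  simp [glue]

/-- The inner labels name distinct isolated vertices of `R`, distinct from those named by leaves. -/
structure Good (R : SimpleGraph X) (lab : ℕ → X) : Prop where
  inj : ∀ n k, 20 ≤ n → lab n = lab k → n = k
  iso : ∀ n y, 20 ≤ n → ¬ R.Adj (lab n) y

/-- The edges of the skeleton `E` name distinct pairs of distinct vertices, not adjacent in `R`. -/
structure WF (R : SimpleGraph X) (lab : ℕ → X) (m : ℕ) (E : List (ℕ × ℕ)) : Prop where
  le : 20 ≤ m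
  lt : ∀ e ∈ E, e.1 < m ∧ e.2 < m
  ne : ∀ e ∈ E, lab e.1 ≠ lab e.2
  inj : ∀ e ∈ E, ∀ d ∈ E, pair lab e = pair lab d → s(e.1, e.2) = s(d.1, d.2)
  not_adj : ∀ e ∈ E, ¬ R.Adj (lab e.1) (lab e.2)

lemma Good.ne_of_lt (h : Good R lab) {m k : ℕ} (hm : 20 ≤ m) (hk : k < m) : lab k ≠ lab m :=
  fun e => (h.inj m k hm e.symm ▸ hk).false

lemma WF.adj {m : ℕ} {E : List (ℕ × ℕ)} (hE : WF R lab m E) {i j : ℕ} (h : has E i j = true) :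
    (glue R lab E).Adj (lab i) (lab j) := by
  obtain ⟨e, he, h⟩ := has_iff.1 h
  refine glue_adj.2 (Or.inr ⟨⟨e, he, pair_eq_of_eq (d := (i, j)) h⟩, ?_⟩)
  have h1 := hE.ne e he
  rcases Sym2.eq_iff.1 h with ⟨h2, h3⟩ | ⟨h2, h3⟩
  · rwa [← h2, ← h3]
  · rw [← h2, ← h3]; exact h1.symm

lemma WF.not_mem_support (hg : Good R lab) {m : ℕ} {E : List (ℕ × ℕ)} (hE : WF R lab m E) {n : ℕ}
    (hn : m ≤ n) : lab n ∉ (glue R lab E).support := by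
  rintro ⟨y, hy⟩
  rcases glue_adj.1 hy with h | ⟨⟨d, hd, h⟩, -⟩
  · exact hg.iso n y (hE.le.trans hn) h
  · have h1 := hE.lt d hd
    have h2 := hE.le
    rcases Sym2.eq_iff.1 h with ⟨h3, -⟩ | ⟨-, h3⟩
    · exact hg.ne_of_lt (by omega) (by omega) h3
    · exact hg.ne_of_lt (by omega) (by omega) h3

section Plus

variable {m : ℕ} {E : List (ℕ × ℕ)} {i j k l : ℕ}

lemma WF.splus (hg : Good R lab) (hE : WF R lab m E) (hij : has E i j = true)
    (hkl : has E k l = true) :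
    WF R lab (m + 2) (splus m E i j k l) := by
  have hlt : ∀ a b, has E a b = true → (a < m ∧ b < m) ∧ lab a ≠ lab b := by
    intro a b h
    obtain ⟨e, he, h⟩ := has_iff.1 h
    have h1 := hE.lt e he
    have h2 := hE.ne e he
    rcases Sym2.eq_iff.1 h with ⟨rfl, rfl⟩ | ⟨rfl, rfl⟩
    · exact ⟨h1, h2⟩
    · exact ⟨h1.symm, h2.symm⟩
  obtain ⟨⟨hi, hj⟩, hij'⟩ := hlt i j hij
  obtain ⟨⟨hk, hl⟩, hkl'⟩ := hlt k l hkl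
  have hm := hE.le
  have n1 : ∀ x < m, lab x ≠ lab m ∧ lab x ≠ lab (m + 1) := fun x hx =>
    ⟨hg.ne_of_lt hm hx, hg.ne_of_lt (by omega) (by omega)⟩
  have n2 : lab m ≠ lab (m + 1) := hg.ne_of_lt (by omega) (by omega)
  have iso1 : ∀ y, ¬ R.Adj (lab m) y := fun y => hg.iso m y hm
  have iso2 : ∀ y, ¬ R.Adj (lab (m + 1)) y := fun y => hg.iso _ y (by omega)
  have iso1' : ∀ y, ¬ R.Adj y (lab m) := fun y h => iso1 y h.symm
  have iso2' : ∀ y, ¬ R.Adj y (lab (m + 1)) := fun y h => iso2 y h.symm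
  have hr : ∀ e ∈ rem (rem E i j) k l, e ∈ E ∧ e.1 < m ∧ e.2 < m := fun e he => by
    have := (mem_rem.1 (mem_rem.1 he).1).1
    exact ⟨this, hE.lt e this⟩
  have hi' := n1 i hi
  have hj' := n1 j hj
  have hk' := n1 k hk
  have hl' := n1 l hl
  refine ⟨by omega, ?_, ?_, ?_, ?_⟩
  · intro e he
    simp only [Skel.splus, List.mem_cons] at he
    rcases he with rfl | rfl | rfl | rfl | rfl | he
    iterate 5 constructor <;> simp only <;> omega
    have := hr e he
    omega
  · intro e he
    simp only [Skel.splus, List.mem_cons] at he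
    rcases he with rfl | rfl | rfl | rfl | rfl | he
    · exact hi'.1
    · exact hj'.1.symm
    · exact hk'.2
    · exact hl'.2.symm
    · exact n2
    · exact hE.ne e (hr e he).1
  · intro e he d hd h
    simp only [Skel.splus, List.mem_cons] at he hd
    have hold : ∀ e ∈ rem (rem E i j) k l, lab m ∉ pair lab e ∧ lab (m + 1) ∉ pair lab e := by
      intro e he
      obtain ⟨-, h1, h2⟩ := hr e he
      have h1 := n1 _ h1
      have h2 := n1 _ h2
      simp only [pair, Sym2.mem_iff, not_or]
      exact ⟨⟨h1.1.symm, h2.1.symm⟩, h1.2.symm, h2.2.symm⟩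
    have hnew : ∀ e, e = (i, m) ∨ e = (m, j) ∨ e = (k, m + 1) ∨ e = (m + 1, l) ∨ e = (m, m + 1) →
        lab m ∈ pair lab e ∨ lab (m + 1) ∈ pair lab e := by
      rintro e (rfl | rfl | rfl | rfl | rfl) <;> simp [pair]
    have hs : ∀ e, (e = (i, m) ∨ e = (m, j) ∨ e = (k, m + 1) ∨ e = (m + 1, l) ∨ e = (m, m + 1) ∨
        e ∈ rem (rem E i j) k l) → e ∉ rem (rem E i j) k l →
        e = (i, m) ∨ e = (m, j) ∨ e = (k, m + 1) ∨ e = (m + 1, l) ∨ e = (m, m + 1) := by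
      rintro e (h | h | h | h | h | h) h'
      exacts [.inl h, .inr (.inl h), .inr (.inr (.inl h)), .inr (.inr (.inr (.inl h))),
        .inr (.inr (.inr (.inr h))), absurd h h']
    by_cases he' : e ∈ rem (rem E i j) k l
    · by_cases hd' : d ∈ rem (rem E i j) k l
      · exact hE.inj e (hr e he').1 d (hr d hd').1 h
      · have h0 := hold e he'
        have h1 := hnew d (hs d hd hd')
        rw [← h] at h1
        exact absurd h1 (not_or.2 h0)
    · by_cases hd' : d ∈ rem (rem E i j) k l
      · have h0 := hold d hd'
        have h1 := hnew e (hs e he he')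
        rw [h] at h1
        exact absurd h1 (not_or.2 h0)
      · have he := hs e he he'
        have hd := hs d hd hd'
        clear hnew hold hs hr he' hd' iso1 iso1' iso2 iso2' n1 hlt hE hg hij hkl
        rcases he with rfl | rfl | rfl | rfl | rfl <;> rcases hd with rfl | rfl | rfl | rfl | rfl <;>
          simp only [pair, Sym2.eq_iff] at h <;> first | rfl | (exfalso; grind)
  · intro e he
    simp only [Skel.splus, List.mem_cons] at he
    rcases he with rfl | rfl | rfl | rfl | rfl | he
    · exact iso1' _
    · exact iso1 _
    · exact iso2' _
    · exact iso2 _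
    · exact iso1 _
    · exact hE.not_adj e (hr e he).1

lemma glue_splus (hE : WF R lab m E) (hij : has E i j = true)
    (hkl : has E k l = true) :
    glue R lab (Skel.splus m E i j k l) =
      ins (glue R lab E) (lab i) (lab j) (lab k) (lab l) (lab m) (lab (m + 1)) := by
  have hadj : ∀ a b, has E a b = true → ∃ e ∈ E, pair lab e = s(lab a, lab b) ∧
      s(e.1, e.2) = s(a, b) := by
    intro a b h
    obtain ⟨e, he, h⟩ := has_iff.1 h
    exact ⟨e, he, pair_eq_of_eq (d := (a, b)) h, h⟩
  obtain ⟨e₁, he₁, hp₁, hl₁⟩ := hadj i j hij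
  obtain ⟨e₂, he₂, hp₂, hl₂⟩ := hadj k l hkl
  have hR : ∀ e ∈ E, ∀ a b, R.Adj a b → s(a, b) ≠ pair lab e := by
    intro e he a b hab h
    have := hE.not_adj e he
    rcases Sym2.eq_iff.1 h with ⟨rfl, rfl⟩ | ⟨rfl, rfl⟩
    · exact this hab
    · exact this hab.symm
  ext a b
  rw [ins_adj, glue_adj, glue_adj]
  constructor
  · rintro (h | ⟨⟨d, hd, h⟩, hab⟩)
    · exact Or.inl ⟨Or.inl h, hp₁ ▸ hR _ he₁ a b h, hp₂ ▸ hR _ he₂ a b h⟩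
    · simp only [Skel.splus, List.mem_cons] at hd
      rcases hd with rfl | rfl | rfl | rfl | rfl | hd
      iterate 5 exact Or.inr ⟨hab, by simp [← h, pair]⟩
      obtain ⟨hd, h2⟩ := mem_rem.1 hd
      obtain ⟨hd, h1⟩ := mem_rem.1 hd
      refine Or.inl ⟨Or.inr ⟨⟨d, hd, h⟩, hab⟩, ?_, ?_⟩
      · rw [← h, ← hp₁]
        exact fun h' => h1 ((hE.inj d hd e₁ he₁ h').trans hl₁)
      · rw [← h, ← hp₂]
        exact fun h' => h2 ((hE.inj d hd e₂ he₂ h').trans hl₂)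
  · rintro (⟨h | ⟨⟨d, hd, h⟩, hab⟩, h1, h2⟩ | ⟨hab, h⟩)
    · exact Or.inl h
    · refine Or.inr ⟨⟨d, ?_, h⟩, hab⟩
      simp only [Skel.splus, List.mem_cons, mem_rem]
      refine Or.inr (Or.inr (Or.inr (Or.inr (Or.inr ⟨⟨hd, fun h' => h1 ?_⟩, fun h' => h2 ?_⟩))))
      · rw [← h]; exact pair_eq_of_eq (d := (i, j)) h'
      · rw [← h]; exact pair_eq_of_eq (d := (k, l)) h'
    · refine Or.inr ⟨?_, hab⟩
      rcases h with h | h | h | h | h <;> rw [h] <;> simp [Skel.splus, pair]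

lemma WF.pair_ne (hE : WF R lab m E) (hij : has E i j = true)
    (hkl : has E k l = true) (hne : same i j k l = false) : s(lab i, lab j) ≠ s(lab k, lab l) := by
  obtain ⟨e₁, he₁, h₁⟩ := has_iff.1 hij
  obtain ⟨e₂, he₂, h₂⟩ := has_iff.1 hkl
  intro h
  rw [← Bool.not_eq_true, same_iff] at hne
  apply hne
  rw [← h₁, ← h₂]
  apply hE.inj _ he₁ _ he₂
  rw [pair_eq_of_eq (lab := lab) (d := (i, j)) h₁, pair_eq_of_eq (lab := lab) (d := (k, l)) h₂]
  exact h

end Plus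

/-- Perform a list of extensions; the new vertices are `g t, g (t + 1), …`. -/
def insL (g : ℕ → X) : List (ℕ × ℕ × ℕ × ℕ) → ℕ → SimpleGraph X → SimpleGraph X
  | [], _, K => K
  | (a, b, c, d) :: r, t, K => insL g r (t + 2) (ins K (g a) (g b) (g c) (g d) (g t) (g (t + 1)))

lemma srun_sound (hg : Good R lab) {g : ℕ → X} {σ : ℕ → ℕ} (hσ : ∀ t, g t = lab (σ t)) :
    ∀ (ops : List (ℕ × ℕ × ℕ × ℕ)) (t m : ℕ) (E T : List (ℕ × ℕ)), WF R lab m E →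
    σ t = m → (∀ n, σ (t + n) = m + n) → srun σ ops m E = some T →
    WF R lab (m + 2 * ops.length) T ∧ insL g ops t (glue R lab E) = glue R lab T ∧
      Emb (glue R lab E) (glue R lab T) ∧
      Emb (insL g (ops.take 1) t (glue R lab E)) (insL g ops t (glue R lab E)) := by
  intro ops
  induction ops with
  | nil =>
    intro t m E T hE _ _ h
    simp only [srun, Option.some.injEq] at h
    subst h
    have : Emb (glue R lab E) (glue R lab E) := Emb.of_hom id (Set.injOn_id _) fun _ _ h => h
    exact ⟨hE, rfl, this, this⟩
  | cons o r ih =>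
    obtain ⟨a, b, c, d⟩ := o
    intro t m E T hE ht hn h
    simp only [srun] at h
    split at h
    swap
    · simp at h
    rename_i hc
    simp only [Bool.and_eq_true, Bool.not_eq_true'] at hc
    obtain ⟨⟨h1, h2⟩, h3⟩ := hc
    have hE' := hE.splus hg h1 h2
    have hglue := glue_splus hE h1 h2
    have hg1 : lab m = g t := by rw [hσ, ht]
    have hg2 : lab (m + 1) = g (t + 1) := by rw [hσ, hn 1]
    rw [← hσ, ← hσ, ← hσ, ← hσ, hg1, hg2] at hglue
    obtain ⟨i1, i2, i3, i4⟩ := ih (t + 2) (m + 2) _ T hE' (hn 2)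
      (fun n => by rw [add_assoc, hn, add_assoc]) h
    have hstep : Emb (glue R lab E) (glue R lab (splus m E (σ a) (σ b) (σ c) (σ d))) := by
      have hp := hE.pair_ne h1 h2 h3
      have a1 := hE.adj h1
      have a2 := hE.adj h2
      rw [hglue]
      rw [← hσ, ← hσ] at a1 a2
      rw [← hσ, ← hσ, ← hσ, ← hσ] at hp
      refine emb_ins a1 a2 hp ?_ ?_ ?_
      · rw [← hg1]; exact hE.not_mem_support hg le_rfl
      · rw [← hg2]; exact hE.not_mem_support hg (by omega)
      · rw [← hg1, ← hg2]; exact hg.ne_of_lt (hE.le.trans (by omega)) (by omega)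
    rw [hglue] at i2 i3 i4
    refine ⟨by rw [List.length_cons]; convert i1 using 1; ring, i2, ?_, ?_⟩
    · exact (hglue ▸ hstep).trans i3
    · simp only [List.take_succ_cons, List.take_zero, insL]
      rw [i2]
      exact i3

end Skel

end QuadExp

namespace QuadExp

open SimpleGraph

namespace Skel

variable {X : Type*} {W : Type*} {R : SimpleGraph X} {H : SimpleGraph W} {lab : ℕ → X}

lemma nodupB_iff {l : List ℕ} (h : nodupB l = true) : l.Nodup := by
  induction l with
  | nil => simp
  | cons a l ih =>
    simp only [nodupB, Bool.and_eq_true, Bool.not_eq_true', List.any_eq_false] at h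
    exact List.nodup_cons.2 ⟨fun ha => h.1 a ha (by simp), ih h.2⟩

lemma chainB_sound {m : ℕ} {S : List (ℕ × ℕ)} (hS : WF R lab m S) {t : ℕ} : ∀ (l : List ℕ) (s : ℕ),
    chainB S t s l = true → Join (glue R lab S) (lab s) (lab t) {x | ∃ n ∈ l, lab n = x} := by
  suffices h : ∀ (l : List ℕ) (s : ℕ), chainB S t s l = true →
      (lab s :: (l.map lab ++ [lab t])).IsChain (glue R lab S).Adj from
    fun l s hl => ⟨l.map lab, h l s hl, by simp⟩
  intro l
  induction l with
  | nil =>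
    intro s h
    simpa using hS.adj h
  | cons c l ih =>
    intro s h
    simp only [chainB, Bool.and_eq_true] at h
    simp only [List.map_cons, List.cons_append, List.isChain_cons_cons]
    exact ⟨hS.adj h.1, ih c h.2⟩

lemma pathsOK_sound (hg : Good R lab) {mS mT : ℕ} {S T : List (ℕ × ℕ)} (hS : WF R lab mS S)
    (hT : WF R lab mT T) {phi : List ℕ} {P : List (List ℕ)} (hphi : mT = 20 + phi.length)
    (h : pathsOK S T phi P = true) : Emb (glue R lab T) (glue R lab S) := by
  classical
  simp only [pathsOK, Bool.and_eq_true, Nat.beq_eq] at h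
  obtain ⟨⟨⟨hlen, hch⟩, hnd⟩, hge⟩ := h
  have hnd := nodupB_iff hnd
  simp only [List.all_eq_true, Nat.ble_eq] at hch hge
  obtain ⟨hn1, hn2, hn3⟩ := List.nodup_append.1 hnd
  have hn4 := (List.nodup_flatten.1 hn2).2
  have hPge : ∀ l ∈ P, ∀ n ∈ l, 20 ≤ n := fun l hl n hn =>
    hge n (List.mem_append_right _ (List.mem_flatten.2 ⟨l, hl, hn⟩))
  have hpg : ∀ n, 20 ≤ n → n < mT → phiF phi n ∈ phi := by
    intro n h1 h2
    rw [phiF, if_neg (by simpa using h1), List.getD_eq_getElem _ _ (by omega)]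
    exact List.getElem_mem _
  have hpi : ∀ n k, 20 ≤ n → n < mT → 20 ≤ k → k < mT → phiF phi n = phiF phi k → n = k := by
    intro n k h1 h2 h3 h4 h
    rw [phiF, phiF, if_neg (by simpa using h1), if_neg (by simpa using h3),
      List.getD_eq_getElem _ _ (by omega), List.getD_eq_getElem _ _ (by omega)] at h
    have := (List.Nodup.getElem_inj_iff hn1).1 h
    omega
  let f : X → X := fun z => if h : ∃ n, 20 ≤ n ∧ n < mT ∧ lab n = z then lab (phiF phi h.choose) else z
  have f1 : ∀ n, n < mT → f (lab n) = lab (phiF phi n) := by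
    intro n h2
    by_cases h1 : 20 ≤ n
    · have h : ∃ n', 20 ≤ n' ∧ n' < mT ∧ lab n' = lab n := ⟨n, h1, h2, rfl⟩
      simp only [f, dif_pos h]
      rw [hg.inj _ _ h.choose_spec.1 h.choose_spec.2.2]
    · have h : ¬ ∃ n', 20 ≤ n' ∧ n' < mT ∧ lab n' = lab n := by
        rintro ⟨n', h3, -, h4⟩
        exact h1 (hg.inj _ _ h3 h4 ▸ h3)
      simp only [f, dif_neg h]
      rw [phiF, if_pos (by simpa using h1)]
  have f2 : ∀ z, (∀ n, 20 ≤ n → lab n ≠ z) → f z = z := by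
    intro z h
    simp only [f]
    rw [dif_neg]
    rintro ⟨n, h1, -, h2⟩
    exact h n h1 h2
  have hsupp : ∀ z ∈ (glue R lab T).support, (∃ n, 20 ≤ n ∧ n < mT ∧ lab n = z) ∨
      ∀ n, 20 ≤ n → lab n ≠ z := by
    intro z hz
    by_contra! hcon
    obtain ⟨n, h1, rfl⟩ := hcon.2
    refine hT.not_mem_support hg (n := n) ?_ hz
    by_contra! h2
    exact hcon.1 n h1 h2 rfl
  refine Emb.of_index (ι := R.edgeSet ⊕ Fin T.length)
    (Sum.elim (fun e => Quot.out e.1) fun i => (lab T[i].1, lab T[i].2)) ?_ f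
    (Sum.elim (fun _ => ∅) fun i => {x | ∃ n ∈ P[i]'(hlen ▸ i.2), lab n = x}) ?_ ?_ ?_ ?_
  · intro x y hxy
    rcases glue_adj.1 hxy with h | ⟨⟨d, hd, h⟩, -⟩
    · exact ⟨Sum.inl ⟨s(x, y), h⟩, Quot.out_eq s(x, y)⟩
    · obtain ⟨i, hi, rfl⟩ := List.getElem_of_mem hd
      exact ⟨Sum.inr ⟨i, hi⟩, h⟩
  · intro z hz t ht h
    rcases hsupp z hz with ⟨n, h1, h2, rfl⟩ | hz <;> rcases hsupp t ht with ⟨k, h3, h4, rfl⟩ | ht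
    · rw [f1 _ h2, f1 _ h4] at h
      rw [hpi n k h1 h2 h3 h4 (hg.inj _ _ (hge _ (List.mem_append_left _ (hpg n h1 h2))) h)]
    · rw [f1 _ h2, f2 _ ht] at h
      exact absurd h (ht _ (hge _ (List.mem_append_left _ (hpg n h1 h2))))
    · rw [f1 _ h4, f2 _ hz] at h
      exact absurd h.symm (hz _ (hge _ (List.mem_append_left _ (hpg k h3 h4))))
    · rwa [f2 _ hz, f2 _ ht] at h
  · rintro (⟨e, he⟩ | i)
    · have h3 : s((Quot.out e).1, (Quot.out e).2) = e := Quot.out_eq e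
      have h4 : R.Adj (Quot.out e).1 (Quot.out e).2 := by rw [← h3] at he; exact he
      simp only [Sum.elim_inl]
      rw [f2 _ fun n hn h => hg.iso n _ hn (h ▸ h4), f2 _ fun n hn h => hg.iso n _ hn (h ▸ h4.symm)]
      exact Join.of_adj (glue_adj.2 (Or.inl h4)) _
    · have hlt := hT.lt T[i] (List.getElem_mem _)
      simp only [Sum.elim_inr]
      rw [f1 _ hlt.1, f1 _ hlt.2]
      have hi : (i : ℕ) < P.length := hlen ▸ i.2
      refine chainB_sound hS (P[i]'hi) _ (hch (T[i], P[i]'hi) ?_)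
      have := List.getElem_zip (l := T) (l' := P) (i := i) (h := by simp [hi])
      exact this ▸ List.getElem_mem _
  · rintro (e | i) (e' | j) hij
    · simp
    · simp
    · simp
    · have hi : (i : ℕ) < P.length := hlen ▸ i.2
      have hj : (j : ℕ) < P.length := hlen ▸ j.2
      have hij' : (i : ℕ) ≠ j := fun h => hij (congrArg Sum.inr (Fin.ext h))
      have hd : (P[i]'hi).Disjoint (P[j]'hj) := by
        rcases lt_or_gt_of_ne hij' with h | h
        · exact List.pairwise_iff_getElem.1 hn4 _ _ hi hj h
        · exact (List.pairwise_iff_getElem.1 hn4 _ _ hj hi h).symm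
      simp only [Sum.elim_inr]
      rw [Set.disjoint_left]
      rintro x ⟨n, hn, rfl⟩ ⟨k, hk, h⟩
      have := hg.inj _ _ (hPge _ (List.getElem_mem _) k hk) h
      subst this
      exact hd hn hk
  · rintro (e | i) z hz
    · simp
    · have hi : (i : ℕ) < P.length := hlen ▸ i.2
      simp only [Sum.elim_inr]
      rintro ⟨k, hk, h⟩
      have hk20 := hPge _ (List.getElem_mem hi) k hk
      rcases hsupp z hz with ⟨n, h1, h2, rfl⟩ | hz
      · rw [f1 _ h2] at h
        have := hg.inj _ _ hk20 h
        exact hn3 _ (hpg n h1 h2) k (List.mem_flatten.2 ⟨_, List.getElem_mem hi, hk⟩) this.symm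
      · rw [f2 _ hz] at h
        exact hz k hk20 h

/-- A literal holds. -/
def Holds (lab : ℕ → X) (l : Bool × ℕ × ℕ) : Prop := l.1 = true ↔ lab l.2.1 = lab l.2.2

lemma eq_of_has {E : List (ℕ × ℕ)} (hE : ∀ e ∈ E, lab e.1 = lab e.2) {a b : ℕ}
    (h : has E a b = true) : lab a = lab b := by
  obtain ⟨e, he, h⟩ := has_iff.1 h
  rcases Sym2.eq_iff.1 h with ⟨rfl, rfl⟩ | ⟨rfl, rfl⟩
  · exact hE e he
  · exact (hE e he).symm

lemma ne_of_has {E : List (ℕ × ℕ)} (hE : ∀ e ∈ E, lab e.1 ≠ lab e.2) {a b : ℕ}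
    (h : has E a b = true) : lab a ≠ lab b := by
  obtain ⟨e, he, h⟩ := has_iff.1 h
  rcases Sym2.eq_iff.1 h with ⟨rfl, rfl⟩ | ⟨rfl, rfl⟩
  · exact hE e he
  · exact (hE e he).symm

variable {K : SimpleGraph X}

lemma contra_sound {na ts fs : List (ℕ × ℕ)}
    (hna : ∀ d ∈ na, K.Adj (lab 7) (lab 8) ∧ ¬ K.Adj (lab d.1) (lab d.2))
    (ht : ∀ e ∈ ts, lab e.1 = lab e.2) (hf : ∀ e ∈ fs, lab e.1 ≠ lab e.2) :
    contra na ts fs = false := by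
  rw [Bool.eq_false_iff]
  intro h
  simp only [contra, List.any_eq_true, Bool.or_eq_true, Bool.and_eq_true, Nat.beq_eq] at h
  obtain ⟨e, he, (h | ⟨d, hd, h⟩) | ⟨d, hd, h⟩⟩ := h
  · exact ne_of_has hf h (ht e he)
  · have h1 := ht e he
    have h2 := ht d hd
    rcases h with ((⟨h, h'⟩ | ⟨h, h'⟩) | ⟨h, h'⟩) | ⟨h, h'⟩
    · exact ne_of_has hf h' (by rw [← h1, h, h2])
    · exact ne_of_has hf h' (by rw [← h1, h, h2])
    · exact ne_of_has hf h' (by rw [h1, h, h2])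
    · exact ne_of_has hf h' (by rw [h1, h, h2])
  · obtain ⟨h1, h2⟩ := hna d hd
    rcases h with ⟨h, h'⟩ | ⟨h, h'⟩
    · rw [eq_of_has ht h, eq_of_has ht h'] at h1
      exact h2 h1
    · rw [eq_of_has ht h, eq_of_has ht h'] at h1
      exact h2 h1.symm

lemma cover_sound {na : List (ℕ × ℕ)} {cs : List (List (Bool × ℕ × ℕ))}
    (hna : ∀ d ∈ na, K.Adj (lab 7) (lab 8) ∧ ¬ K.Adj (lab d.1) (lab d.2)) :
    ∀ (f : ℕ) (ts fs : List (ℕ × ℕ)), cover na cs f ts fs = true →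
    (∀ e ∈ ts, lab e.1 = lab e.2) → (∀ e ∈ fs, lab e.1 ≠ lab e.2) →
    ∃ c ∈ cs, ∀ l ∈ c, Holds lab l := by
  intro f
  induction f with
  | zero => intro ts fs h; simp [cover] at h
  | succ f ih =>
    intro ts fs h ht hf
    simp only [cover, contra_sound hna ht hf, Bool.false_or, Bool.or_eq_true] at h
    rcases h with h | h
    · simp only [List.any_eq_true, List.all_eq_true] at h
      obtain ⟨c, hc, h⟩ := h
      refine ⟨c, hc, fun l hl => ?_⟩
      have := h l hl
      rw [sat] at this
      rw [Holds]
      split at this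
      · simp [*, eq_of_has ht this]
      · simp [*, ne_of_has hf this]
    · split at h
      · simp at h
      · rename_i l _
        simp only [Bool.and_eq_true] at h
        by_cases hl : lab l.2.1 = lab l.2.2
        · exact ih _ _ h.1 (by simpa [hl] using ht) hf
        · exact ih _ _ h.2 ht (by simpa [hl] using hf)

end Skel

end QuadExp

namespace QuadExp

open SimpleGraph

namespace Skel

variable {X : Type*} {W : Type*} {R : SimpleGraph X} {H : SimpleGraph W} {lab : ℕ → X}

/-- The pairs of labels of the free edges. -/
def frees : List Step → ℕ → List (ℕ × ℕ)
  | [], _ => []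
  | .child _ _ :: r, n => frees r (n + 1)
  | .copy _ :: r, n => frees r (n + 1)
  | .free _ :: r, n => (n, n + 1) :: frees r (n + 2)

/-- Each step refers to earlier labels only. -/
def okSteps : List Step → ℕ → Bool
  | [], _ => true
  | .child p av :: r, n => Nat.blt p n && av.all (Nat.blt · n) && okSteps r (n + 1)
  | .copy p :: r, n => Nat.blt p n && okSteps r (n + 1)
  | .free av :: r, n => av.all (Nat.blt · n) && okSteps r (n + 2)

/-- The labels used in a specification are in range. -/
def okSpec (sp : Spec) : Bool :=
  okSteps sp.steps 4 && Nat.ble 4 (len sp.steps 4) && Nat.ble (len sp.steps 4) 20 &&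
  (adjs sp.steps 4 ++ (nes sp.steps 4 ++ (sp.eqs ++ copies sp.steps 4))).all fun e =>
    Nat.blt e.1 (len sp.steps 4) && Nat.blt e.2 (len sp.steps 4)

lemma okSpec_of_mem : ∀ sp ∈ specs, okSpec sp = true := by
  simp only [specs, List.forall_mem_cons]
  decide

/-- The vertices `g 0, g 1, …` satisfy the conditions for an expansion of `K` of type `sp` at the
quadrangle `u₁, u₂, u₃, u₄`. -/
structure IsExp (K : SimpleGraph X) (u₁ u₂ u₃ u₄ : X) (sp : Spec) (g : ℕ → X) : Prop where
  rot : [g 0, g 1, g 2, g 3] ∈ rots u₁ u₂ u₃ u₄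
  adj : ∀ e ∈ adjs sp.steps 4, K.Adj (g e.1) (g e.2)
  ne : ∀ e ∈ nes sp.steps 4, g e.1 ≠ g e.2
  eq : ∀ e ∈ sp.eqs ++ copies sp.steps 4, g e.1 = g e.2
  pad : ∀ t, len sp.steps 4 ≤ t → t < 20 → g t = g 0
  inj : ∀ i j, g (20 + i) = g (20 + j) → i = j
  fresh : ∀ i, g (20 + i) ∉ K.support

/-- `H` contains an expansion of `K` at the quadrangle `u₁, u₂, u₃, u₄`. -/
def Exp (K : SimpleGraph X) (H : SimpleGraph W) (u₁ u₂ u₃ u₄ : X) : Prop :=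
  ∃ sp ∈ specs, ∃ g : ℕ → X, IsExp K u₁ u₂ u₃ u₄ sp g ∧ Emb (insL g sp.ops 20 K) H ∧
    Emb (insL g (sp.ops.take 1) 20 K) H

lemma rots_map {α β : Type*} (f : α → β) (a b c d : α) :
    rots (f a) (f b) (f c) (f d) = (rots a b c d).map (List.map f) := by
  simp [rots]

lemma sg_of_lt {s : List ℕ} {m t : ℕ} (h : t < s.length) (h' : t < 20) :
    sg s m t = s.getD t 0 := by
  simp [sg, h', h]

lemma sg_add (s : List ℕ) (m t : ℕ) : sg s m (20 + t) = m + t := by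
  simp [sg]

lemma beq_eq {a b : List ℕ} (h : List.beq a b = true) : a = b :=
  eq_of_beq (α := List ℕ) h

lemma certOK_sound (hg : Good R lab) {m mS : ℕ} {E S : List (ℕ × ℕ)} (hE : WF R lab m E)
    (hS : WF R lab mS S) {c : Cert} (hc : certOK m E S c = true) (hl : ∀ l ∈ lits c, Holds lab l)
    (hH : Emb (glue R lab S) H) : Exp (glue R lab E) H (lab 20) (lab 21) (lab 22) (lab 23) := by
  rw [certOK] at hc
  rw [lits] at hl
  split at hc
  · simp at hc
  rename_i sp hsp
  simp only [hsp] at hl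
  have hmem : sp ∈ specs := List.mem_of_getElem? hsp
  have hok := okSpec_of_mem sp hmem
  simp only [okSpec, Bool.and_eq_true, Nat.ble_eq, List.all_eq_true, Nat.blt_eq] at hok
  obtain ⟨⟨⟨-, h4⟩, h20⟩, hidx⟩ := hok
  simp only [Bool.and_eq_true, Nat.beq_eq, List.any_eq_true, List.all_eq_true] at hc
  obtain ⟨⟨⟨⟨⟨⟨q, hq, hq'⟩, hlen⟩, hadj⟩, hne⟩, heq⟩, hrun⟩ := hc
  have hq' := beq_eq hq'
  have hpr : ∀ e ∈ adjs sp.steps 4 ++ (nes sp.steps 4 ++ (sp.eqs ++ copies sp.steps 4)),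
      (pr c.s e).1 = sg c.s m e.1 ∧ (pr c.s e).2 = sg c.s m e.2 := by
    intro e he
    have := hidx e he
    rw [sg_of_lt (by omega) (by omega), sg_of_lt (by omega) (by omega)]
    exact ⟨rfl, rfl⟩
  split at hrun
  · simp at hrun
  rename_i T hT
  simp only [Bool.and_eq_true, Nat.beq_eq] at hrun
  obtain ⟨hm, hpath⟩ := hrun
  have hσ : ∀ n, sg c.s m (20 + n) = m + n := sg_add c.s m
  obtain ⟨hT1, hT2, hT3, hT4⟩ := srun_sound hg (g := fun t => lab (sg c.s m t)) (fun _ => rfl)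
    sp.ops 20 m E T hE (hσ 0) hσ hT
  have hTH : Emb (glue R lab T) H := (pathsOK_sound hg hS hT1 hm hpath).trans hH
  refine ⟨sp, hmem, fun t => lab (sg c.s m t), ⟨?_, ?_, ?_, ?_, ?_, ?_, ?_⟩, hT2 ▸ hTH,
    hT4.trans (hT2 ▸ hTH)⟩
  · rw [rots_map, List.mem_map]
    refine ⟨q, hq, ?_⟩
    rw [hq']
    rw [sg_of_lt (by omega) (by omega), sg_of_lt (by omega) (by omega),
      sg_of_lt (by omega) (by omega), sg_of_lt (by omega) (by omega)]
    match h : c.s, hlen with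
    | a :: b :: c' :: d :: r, _ => simp
    | [], h' => simp at h'; omega
    | [_], h' => simp at h'; omega
    | [_, _], h' => simp at h'; omega
    | [_, _, _], h' => simp at h'; omega
  · intro e he
    have h1 := hadj e he
    rw [(hpr e (by simp [he])).1, (hpr e (by simp [he])).2] at h1
    exact hE.adj h1
  · intro e he
    have h1 := hne e he
    have h3 := hpr e (by simp [he])
    simp only [Bool.not_eq_true', ← Bool.not_eq_true, Nat.beq_eq] at h1
    simp only [← h3.1, ← h3.2]
    by_cases hb : bothLeaf (pr c.s e) = true
    · have := hl (false, pr c.s e) (by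
        simp only [List.mem_append, List.mem_map, List.mem_filter]
        exact Or.inl ⟨pr c.s e, ⟨⟨e, he, rfl⟩, hb⟩, rfl⟩)
      simpa [Holds] using this
    · intro h
      simp only [bothLeaf, Bool.and_eq_true, Nat.blt_eq, not_and_or, not_lt] at hb
      rcases hb with hb | hb
      · exact h1 (hg.inj _ _ hb h)
      · exact h1 (hg.inj _ _ hb h.symm).symm
  · intro e he
    have h1 := heq e he
    have h3 := hpr e (by simp only [List.mem_append] at he ⊢; tauto)
    simp only [← h3.1, ← h3.2]
    by_cases hb : (pr c.s e).1 = (pr c.s e).2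
    · rw [hb]
    · have := hl (true, pr c.s e) (by
        simp only [List.mem_append (s := List.map _ _), List.mem_map, List.mem_filter]
        refine Or.inr ⟨pr c.s e, ⟨⟨e, he, rfl⟩, ?_⟩, rfl⟩
        simpa only [Bool.not_eq_true', ← Bool.not_eq_true, Nat.beq_eq] using hb)
      simpa [Holds] using this
  · intro t h1 h2
    have : c.s.length ≤ t := hlen ▸ h1
    have h0 : 0 < c.s.length := by omega
    simp [sg, h2, this, h0]
  · intro i j h
    simp only [hσ] at h
    have := hg.inj _ _ (by have := hE.le; omega) h
    omega
  · intro i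
    simp only [hσ]
    exact hE.not_mem_support hg (by omega)

lemma getD_append_lt {s r : List ℕ} {t : ℕ} (h : t < s.length) :
    (s ++ r).getD t 0 = s.getD t 0 := by
  rw [List.getD_append _ _ _ _ h]

lemma enum_sound (hg : Good R lab) {E fr : List (ℕ × ℕ)} {g : ℕ → X} :
    ∀ (steps : List Step) (s : List ℕ), okSteps steps s.length = true →
    (∀ t < s.length, g t = lab (s.getD t 0)) →
    (∀ e ∈ adjs steps s.length, (glue R lab E).Adj (g e.1) (g e.2)) →
    (∀ e ∈ nes steps s.length, g e.1 ≠ g e.2) → (∀ e ∈ copies steps s.length, g e.1 = g e.2) →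
    (∀ e ∈ frees steps s.length, ∃ d ∈ fr, pair lab d = s(g e.1, g e.2)) →
    ∃ s' ∈ enum E fr steps s, ∀ t < s'.length, g t = lab (s'.getD t 0) := by
  intro steps
  induction steps with
  | nil =>
    intro s _ hs _ _ _ _
    exact ⟨s, by simp [enum], hs⟩
  | cons st r ih =>
    intro s hok hs hadj hne hcp hfr
    have hext : ∀ n, g s.length = lab n → ∀ t < (s ++ [n]).length,
        g t = lab ((s ++ [n]).getD t 0) := by
      intro n hn t ht
      rw [List.length_append, List.length_singleton] at ht
      rcases Nat.lt_succ_iff_lt_or_eq.1 ht with h | rfl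
      · rw [getD_append_lt h, hs t h]
      · simpa using hn
    have hext2 : ∀ n k, g s.length = lab n → g (s.length + 1) = lab k →
        ∀ t < (s ++ [n, k]).length, g t = lab ((s ++ [n, k]).getD t 0) := by
      intro n k hn hk t ht
      have ht : t < s.length + 2 := by simpa using ht
      rcases (by omega : t < s.length ∨ t = s.length ∨ t = s.length + 1) with h | rfl | rfl
      · rw [getD_append_lt h, hs t h]
      · simpa using hn
      · rw [hk]; simp
    cases st with
    | child p av =>
      simp only [okSteps, Bool.and_eq_true, Nat.blt_eq, List.all_eq_true] at hok
      simp only [adjs, nes, copies, frees, List.mem_cons, List.mem_append, List.mem_map] at hadj hne hcp hfr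
      obtain ⟨⟨hp, hav⟩, hok⟩ := hok
      rw [enum]
      split
      swap
      · exact ⟨s, by simp, hs⟩
      rename_i h20
      rw [Nat.ble_eq] at h20
      have h1 := hadj _ (Or.inl rfl)
      rw [hs p hp] at h1
      simp only at h1
      obtain ⟨n, hn, hn'⟩ : ∃ n, has E (s.getD p 0) n = true ∧ g s.length = lab n := by
        rcases glue_adj.1 h1 with h | ⟨⟨d, hd, h⟩, -⟩
        · exact absurd h (hg.iso _ _ h20)
        · rcases Sym2.eq_iff.1 h with ⟨h2, h3⟩ | ⟨h2, h3⟩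
          · have := hg.inj _ _ h20 h2.symm
            exact ⟨d.2, has_iff.2 ⟨d, hd, by rw [this]⟩, h3.symm⟩
          · have := hg.inj _ _ h20 h3.symm
            exact ⟨d.1, has_iff.2 ⟨d, hd, by rw [this, Sym2.eq_swap]⟩, h2.symm⟩
      obtain ⟨s', hs', h'⟩ := ih (s ++ [n]) (by simpa using hok) (hext n hn')
        (by simpa using fun a b h => hadj (a, b) (Or.inr h))
        (by simpa using fun a b h => hne (a, b) (Or.inr h))
        (by simpa using fun a b h => hcp (a, b) h)
        (by simpa using fun a b h => hfr (a, b) h)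
      refine ⟨s', List.mem_flatMap.2 ⟨n, mem_nb hn, ?_⟩, h'⟩
      rw [if_pos]
      · exact hs'
      · simp only [List.all_eq_true, Bool.not_eq_true', ← Bool.not_eq_true, Nat.beq_eq]
        intro x hx h
        refine hne (s.length, x) (Or.inl ⟨x, hx, rfl⟩) ?_
        simp only
        rw [hn', hs x (hav x hx), h]
    | copy p =>
      simp only [okSteps, Bool.and_eq_true, Nat.blt_eq] at hok
      simp only [adjs, nes, copies, frees, List.mem_cons] at hadj hne hcp hfr
      obtain ⟨hp, hok⟩ := hok
      rw [enum]
      have h1 := hcp _ (Or.inl rfl)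
      rw [hs p hp] at h1
      exact ih (s ++ [s.getD p 0]) (by simpa using hok) (hext _ h1)
        (by simpa using fun a b h => hadj (a, b) h)
        (by simpa using fun a b h => hne (a, b) h)
        (by simpa using fun a b h => hcp (a, b) (Or.inr h))
        (by simpa using fun a b h => hfr (a, b) h)
    | free av =>
      simp only [okSteps, Bool.and_eq_true, Nat.blt_eq, List.all_eq_true] at hok
      simp only [adjs, nes, copies, frees, List.mem_cons, List.mem_append, List.mem_map] at hadj hne hcp hfr
      obtain ⟨hav, hok⟩ := hok
      obtain ⟨d, hd, h⟩ := hfr _ (Or.inl rfl)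
      simp only at h
      have key : ∀ n k, g s.length = lab n → g (s.length + 1) = lab k →
          ∃ s' ∈ enum E fr r (s ++ [n, k]), ∀ t < s'.length, g t = lab (s'.getD t 0) :=
        fun n k h1 h2 => ih (s ++ [n, k]) (by simpa using hok) (hext2 n k h1 h2)
          (by simpa using fun a b h => hadj (a, b) (Or.inr h))
          (by simpa using fun a b h => hne (a, b) (Or.inr h))
          (by simpa using fun a b h => hcp (a, b) h)
          (by simpa using fun a b h => hfr (a, b) (Or.inr h))
      have hav' : ∀ x ∈ av, lab d.1 ≠ lab (s.getD x 0) ∧ lab d.2 ≠ lab (s.getD x 0) := by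
        intro x hx
        have h1 := hne (s.length, x) (Or.inl (Or.inl ⟨x, hx, rfl⟩))
        have h2 := hne (s.length + 1, x) (Or.inl (Or.inr ⟨x, hx, rfl⟩))
        simp only [hs x (hav x hx)] at h1 h2
        rcases Sym2.eq_iff.1 h with ⟨h3, h4⟩ | ⟨h3, h4⟩ <;> rw [h3, h4]
        · exact ⟨h1, h2⟩
        · exact ⟨h2, h1⟩
      have hcond : (av.all fun x => !Nat.beq d.1 (s.getD x 0) && !Nat.beq d.2 (s.getD x 0)) = true := by
        simp only [List.all_eq_true, Bool.and_eq_true, Bool.not_eq_true', ← Bool.not_eq_true,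
          Nat.beq_eq]
        exact fun x hx => ⟨fun h => (hav' x hx).1 (by rw [h]), fun h => (hav' x hx).2 (by rw [h])⟩
      rw [enum]
      simp only [List.mem_flatMap]
      rcases Sym2.eq_iff.1 h with ⟨h3, h4⟩ | ⟨h3, h4⟩
      · obtain ⟨s', hs', h'⟩ := key d.1 d.2 h3.symm h4.symm
        exact ⟨s', ⟨d, hd, by rw [if_pos hcond]; exact List.mem_append_left _ hs'⟩, h'⟩
      · obtain ⟨s', hs', h'⟩ := key d.2 d.1 h4.symm h3.symm
        exact ⟨s', ⟨d, hd, by rw [if_pos hcond]; exact List.mem_append_right _ hs'⟩, h'⟩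

end Skel

end QuadExp

namespace QuadExp

open SimpleGraph

namespace Skel

variable {X : Type*} {W : Type*} {R : SimpleGraph X} {H : SimpleGraph W} {lab : ℕ → X}

namespace Base

variable {B : Base}

/-- The short extension is possible, and the labels in `only` are inner labels. -/
def ok (B : Base) : Bool := has B.E 20 21 && has B.E 24 B.w && (B.only.all fun a =>
  Nat.ble 20 a.1 && Nat.ble 20 a.2.1 && Nat.ble 20 a.2.2)

/-- The labels `lab` realize the skeleton `B` on top of the graph `R`. -/
structure Model (B : Base) (R : SimpleGraph X) (lab : ℕ → X) : Prop where
  good : Good R lab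
  wf : WF R lab B.m B.E
  known : ∀ e ∈ B.known, lab e.1 ≠ lab e.2
  nonadj : ∀ d ∈ B.nonadj, (glue R lab B.E).Adj (lab 7) (lab 8) ∧
    ¬ (glue R lab B.E).Adj (lab d.1) (lab d.2)

lemma checkHyp_sound (hB : B.Model R lab) (hok : B.ok = true) {ops : List (ℕ × ℕ × ℕ × ℕ)}
    {s : List ℕ} {ts fs : List (ℕ × ℕ)} {cs : List Cert} (h : B.checkHyp ops s ts fs cs = true)
    (ht : ∀ e ∈ ts, lab e.1 = lab e.2) (hf : ∀ e ∈ fs, lab e.1 ≠ lab e.2)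
    (hH : Emb (insL (fun t => lab (sg s (B.m + 2) t)) ops 20 (glue R lab B.S)) H) :
    Exp (glue R lab B.E) H (lab 20) (lab 21) (lab 22) (lab 23) := by
  simp only [ok, Bool.and_eq_true] at hok
  have hS : WF R lab (B.m + 2) B.S := hB.wf.splus hB.good hok.1.1 hok.1.2
  rw [checkHyp] at h
  split at h
  · simp at h
  rename_i S hrun
  simp only [Bool.and_eq_true, List.all_eq_true] at h
  obtain ⟨h1, h2, -⟩ := srun_sound hB.good (g := fun t => lab (sg s (B.m + 2) t)) (fun _ => rfl)
    ops 20 _ _ S hS (sg_add s _ 0) (sg_add s _) hrun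
  obtain ⟨c, hc, hl⟩ := cover_sound hB.nonadj _ _ _ h.2 ht (by
    intro e he
    rcases List.mem_append.1 he with he | he
    · exact hf e he
    · exact hB.known e he)
  obtain ⟨c, hc', rfl⟩ := List.mem_map.1 hc
  exact certOK_sound hB.good hB.wf h1 (h.1 c hc') hl (h2 ▸ hH)

lemma zipAll_sound {α β : Type} {f : α → β → Bool} : ∀ {l : List α} {l' : List β},
    zipAll f l l' = true → ∀ a ∈ l, ∃ b, f a b = true := by
  intro l
  induction l with
  | nil => simp
  | cons x l ih =>
    intro l' h a ha
    cases l' with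
    | nil => simp [zipAll] at h
    | cons b l' =>
      simp only [zipAll, Bool.and_eq_true] at h
      rcases List.mem_cons.1 ha with rfl | ha
      · exact ⟨b, h.1⟩
      · exact ih h.2 a ha

lemma take_ops : ∀ k sp, specs[k]? = some sp → 0 < k → sp.ops.take 1 = [(0, 1, 4, 5)] := by
  intro k sp h hk
  match k with
  | 1 | 2 | 3 | 4 | 5 | 6 =>
    simp only [specs, List.getElem?_cons_succ, List.getElem?_cons_zero, Option.some.injEq] at h
    rw [← h]
    rfl
  | n + 7 => simp [specs] at h

/-- If all checks succeed for a type of expansions, then such an expansion of the short extension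
leads to an expansion of the original graph. -/
theorem sound (hB : B.Model R lab) (hok : B.ok = true) {pool : List Cert} {pre : List (List ℕ)}
    {pidx idx : List (List ℕ)} (hpre : B.checkPre pool pre pidx = true) {k : ℕ} {sp : Spec}
    (hk : specs[k]? = some sp) (hty : B.checkType pre pool k sp idx = true) {g : ℕ → X}
    (hg : IsExp (glue R lab B.S) (lab 20) (lab B.m) (lab (B.m + 1)) (lab 24) sp g)
    (hnew : ∀ j, g (20 + j) = lab (B.m + 2 + j))
    (hfree : ∀ e ∈ frees sp.steps 4, ∃ d ∈ B.fr, pair lab d = s(g e.1, g e.2))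
    (havoid : k = 1 → ∀ a ∈ B.avoid, g 0 = lab a.1 → g 4 = lab a.2.1 →
      g 7 ≠ lab a.2.2 ∧ g 8 ≠ lab a.2.2)
    (honly : B.only = [] ∨ k = 1 ∧ ∃ a ∈ B.only, g 0 = lab a.1 ∧ g 4 = lab a.2.1 ∧
      (g 7 = lab a.2.2 ∨ g 8 = lab a.2.2))
    (hH : Emb (insL g sp.ops 20 (glue R lab B.S)) H)
    (hH₁ : Emb (insL g (sp.ops.take 1) 20 (glue R lab B.S)) H) :
    Exp (glue R lab B.E) H (lab 20) (lab 21) (lab 22) (lab 23) := by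
  have hmem : sp ∈ specs := List.mem_of_getElem? hk
  have hsp := okSpec_of_mem sp hmem
  simp only [okSpec, Bool.and_eq_true, Nat.ble_eq, List.all_eq_true, Nat.blt_eq] at hsp
  obtain ⟨⟨⟨hsteps, h4⟩, h20⟩, hidx⟩ := hsp
  have hrot := hg.rot
  rw [rots_map, List.mem_map] at hrot
  obtain ⟨q, hq, hq'⟩ := hrot
  obtain ⟨q₀, q₁, q₂, q₃, rfl⟩ : ∃ a b c d, q = [a, b, c, d] := by
    simp only [rots, List.mem_cons, List.not_mem_nil, or_false] at hq
    rcases hq with rfl | rfl | rfl | rfl | rfl | rfl | rfl | rfl <;> exact ⟨_, _, _, _, rfl⟩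
  simp only [List.map_cons, List.map_nil, List.cons.injEq, and_true] at hq'
  obtain ⟨hq0, hq1, hq2, hq3⟩ := hq'
  have hs0 : ∀ t < [q₀, q₁, q₂, q₃].length, g t = lab ([q₀, q₁, q₂, q₃].getD t 0) := by
    intro t ht
    match t with
    | 0 => exact hq0.symm
    | 1 => exact hq1.symm
    | 2 => exact hq2.symm
    | 3 => exact hq3.symm
    | n + 4 => simp at ht
  obtain ⟨s, hs, hst⟩ := enum_sound hB.good (E := B.S) (fr := B.fr) (g := g) sp.steps
    [q₀, q₁, q₂, q₃] hsteps hs0 hg.adj hg.ne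
    (fun e he => hg.eq e (List.mem_append_right _ he)) hfree
  have hpr : ∀ e ∈ adjs sp.steps 4 ++ (nes sp.steps 4 ++ (sp.eqs ++ copies sp.steps 4)),
      s.length = len sp.steps 4 → lab (pr s e).1 = g e.1 ∧ lab (pr s e).2 = g e.2 := by
    intro e he h
    have := hidx e he
    exact ⟨(hst e.1 (by omega)).symm, (hst e.2 (by omega)).symm⟩
  have hTs : s.length = len sp.steps 4 → ∀ e ∈ hypTs sp s, lab e.1 = lab e.2 := by
    intro h e he
    simp only [hypTs, List.mem_filter, List.mem_map] at he
    obtain ⟨⟨d, hd, rfl⟩, -⟩ := he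
    have h1 := hpr d (by simp [hd]) h
    rw [h1.1, h1.2]
    exact hg.eq d (List.mem_append_left _ hd)
  by_cases hdrop : B.drop pre k sp s = true
  · simp only [drop, Bool.or_eq_true, Bool.and_eq_true, Nat.blt_eq, List.any_eq_true] at hdrop
    rcases hdrop with (⟨hk0, p, hp, hp'⟩ | ⟨hl, hb⟩) | ⟨ho, h⟩
    · have hp' := beq_eq hp'
      obtain ⟨is, his⟩ := zipAll_sound hpre p hp
      simp only [Bool.and_eq_true, Nat.beq_eq] at his
      have hlen6 : 6 ≤ s.length := by
        have h1 := his.1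
        rw [← hp', List.length_take] at h1
        omega
      have hsg : ∀ t < 6, lab (sg p (B.m + 2) t) = g t := by
        intro t ht
        rw [sg_of_lt (by omega) (by omega), hst t (by omega), ← hp']
        simp [List.getD_eq_getElem?_getD, ht]
      refine checkHyp_sound hB hok his.2 (by simp) (by simp) ?_
      rw [take_ops k sp hk hk0] at hH₁
      simp only [insL] at hH₁ ⊢
      rw [hsg 0 (by omega), hsg 1 (by omega), hsg 4 (by omega), hsg 5 (by omega)]
      have e0 := hnew 0
      have e1 := hnew 1
      have f0 := sg_add p (B.m + 2) 0
      have f1 := sg_add p (B.m + 2) 1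
      norm_num at e0 e1 f0 f1 hH₁ ⊢
      rw [f0, f1, ← e0, ← e1]
      exact hH₁
    · exfalso
      rw [Nat.beq_eq] at hl
      simp only [Bool.not_eq_true', ← Bool.not_eq_true, List.all_eq_true, not_forall] at hb
      obtain ⟨e, he, hb⟩ := hb
      have h1 := hTs hl e he
      simp only [hypTs, List.mem_filter, Bool.not_eq_true', ← Bool.not_eq_true, Nat.beq_eq] at he
      simp only [bothLeaf, Bool.and_eq_true, Nat.blt_eq, not_and_or, not_lt] at hb
      rcases hb with hb | hb
      · exact he.2 (hB.good.inj _ _ hb h1)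
      · exact he.2 (hB.good.inj _ _ hb h1.symm).symm
    · exfalso
      rcases honly with honly | ⟨rfl, a, ha, h0, h4', h78⟩
      · simp [honly] at ho
      simp only [Bool.not_eq_true', ← Bool.not_eq_true, Nat.beq_eq, not_true_eq_false, false_or,
        Nat.ble_eq, List.any_eq_true, not_exists, not_and, Bool.or_eq_true, Bool.and_eq_true,
        not_or] at h
      obtain ⟨h5, h⟩ := h
      simp only [ok, Bool.and_eq_true, List.all_eq_true, Nat.ble_eq] at hok
      obtain ⟨⟨o1, o2⟩, o3⟩ := hok.2 a ha
      have a0 : a.1 = s.getD 0 0 := hB.good.inj _ _ o1 (by rw [← h0, hst 0 (by omega)])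
      have a4 : a.2.1 = s.getD 4 0 := hB.good.inj _ _ o2 (by rw [← h4', hst 4 (by omega)])
      obtain ⟨h9, h7, h8⟩ := h a ha ⟨a0, a4⟩
      rw [not_not] at h9
      rcases h78 with h78 | h78
      · exact h7 (hB.good.inj _ _ o3 (by rw [← h78, hst 7 (by omega)]))
      · exact h8 (hB.good.inj _ _ o3 (by rw [← h78, hst 8 (by omega)]))
  · have hs' : s ∈ B.hyps pre k sp := by
      rw [hyps, List.mem_filter, List.mem_flatMap]
      exact ⟨⟨_, hq, hs⟩, by simpa using hdrop⟩
    obtain ⟨is, his⟩ := zipAll_sound hty s hs'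
    simp only [Bool.and_eq_true, Nat.beq_eq] at his
    obtain ⟨hlen, his⟩ := his
    have hgs : (fun t => lab (sg s (B.m + 2) t)) = g := by
      funext t
      by_cases ht : t < 20
      · by_cases ht' : t < s.length
        · rw [sg_of_lt ht' ht, hst t ht']
        · rw [hg.pad t (by omega) ht, hst 0 (by omega)]
          have : s.length ≤ t := not_lt.1 ht'
          have h0 : 0 < s.length := by omega
          simp [sg, ht, this, h0]
      · obtain ⟨j, rfl⟩ := Nat.exists_eq_add_of_le (not_lt.1 ht)
        rw [sg_add, hnew]
    refine checkHyp_sound hB hok his (hTs hlen) ?_ (by rw [hgs]; exact hH)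
    intro e he
    rcases List.mem_append.1 he with he | he'
    · simp only [List.mem_filter, List.mem_map] at he
      obtain ⟨⟨d, hd, rfl⟩, -⟩ := he
      have h1 := hpr d (by simp [hd]) hlen
      rw [h1.1, h1.2]
      exact hg.ne d hd
    · rw [avoids] at he'
      split at he'
      swap
      · simp at he'
      rename_i hk1
      rw [Nat.beq_eq] at hk1
      subst hk1
      obtain ⟨a, ha, he⟩ := List.mem_flatMap.1 he'
      split at he
      swap
      · simp at he
      rename_i h0
      simp only [Bool.and_eq_true, Nat.beq_eq] at h0
      have hl9 : s.length = 9 := by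
        rw [hlen]
        simp only [specs, List.getElem?_cons_succ, List.getElem?_cons_zero, Option.some.injEq] at hk
        rw [← hk]
        rfl
      have h78 := havoid rfl a ha (by rw [h0.1, hst 0 (by omega)]) (by rw [h0.2, hst 4 (by omega)])
      simp only [List.mem_cons, List.not_mem_nil, or_false] at he
      rcases he with rfl | rfl
      · simp only [← hst 7 (by omega)]; exact h78.1
      · simp only [← hst 8 (by omega)]; exact h78.2

end Base

end Skel

end QuadExp

namespace QuadExp

open SimpleGraph

namespace Skel

variable {X : Type*} {W : Type*} {K : SimpleGraph X} {H : SimpleGraph W} {lab : ℕ → X}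

lemma has_of_mem_nb {E : List (ℕ × ℕ)} {i j : ℕ} (h : j ∈ nb E i) : has E i j = true := by
  obtain ⟨⟨a, b⟩, he, h⟩ := List.mem_filterMap.1 h
  rw [has_iff]
  refine ⟨(a, b), he, ?_⟩
  simp only [Nat.beq_eq] at h
  split at h
  · simp_all
  · split at h
    · simp_all
    · simp at h

namespace Base

variable {B : Base}

/-- The labels are known to name distinct vertices. -/
def dist (B : Base) (a b : ℕ) : Bool :=
  !Nat.beq a b && (Nat.ble 20 a || Nat.ble 20 b || has B.known a b)

/-- The edges are known to name distinct pairs of vertices, and all of them, except for the carved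
edge, have an inner end. -/
def shape (B : Base) : Bool :=
  B.ok && Nat.ble 20 B.m && (B.E.all fun e => Nat.blt e.1 B.m && Nat.blt e.2 B.m &&
    (Nat.ble 20 e.1 || Nat.ble 20 e.2 || (B.carved && same 7 8 e.1 e.2))) &&
  B.E.all fun e => B.E.all fun d => same e.1 e.2 d.1 d.2 ||
    ((B.dist e.1 d.1 || B.dist e.2 d.2) && (B.dist e.1 d.2 || B.dist e.2 d.1))

/-- All checks succeed for `B`. -/
structure Checked (B : Base) : Prop where
  shape : B.shape = true
  check : ∃ pool pre, (∃ idx, B.checkPre pool pre idx = true) ∧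
    ∀ k sp, specs[k]? = some sp → (B.carved = true → k < 2) →
      ∃ idx, B.checkType pre pool k sp idx = true

/-- The labels `lab` realize the skeleton `B` in the graph `K`. -/
structure Fit (B : Base) (K : SimpleGraph X) (lab : ℕ → X) : Prop where
  inj : ∀ n k, 20 ≤ n → lab n = lab k → n = k
  fresh : ∀ n, B.m ≤ n → lab n ∉ K.support
  nb : ∀ n, 20 ≤ n → n < B.m → ∀ y, K.Adj (lab n) y ↔ ∃ a ∈ nb B.E n, y = lab a
  known : ∀ e ∈ B.known, lab e.1 ≠ lab e.2
  nonadj : ∀ d ∈ B.nonadj, K.Adj (lab 7) (lab 8) ∧ ¬ K.Adj (lab d.1) (lab d.2)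
  carved : B.carved = true → K.Adj (lab 7) (lab 8)

/-- The edges not described by the skeleton. -/
def rest (B : Base) (K : SimpleGraph X) (lab : ℕ → X) : SimpleGraph X :=
  K.deleteEdges {e | ∃ d ∈ B.E, pair lab d = e}

lemma Fit.adj_of_mem (h : B.Fit K lab) (hs : B.shape = true) {e : ℕ × ℕ} (he : e ∈ B.E) :
    K.Adj (lab e.1) (lab e.2) := by
  simp only [Base.shape, Bool.and_eq_true, List.all_eq_true, Bool.or_eq_true, Nat.ble_eq,
    Nat.blt_eq] at hs
  obtain ⟨⟨h1, h2⟩, (h3 | h3) | h3⟩ := hs.1.2 e he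
  · exact (h.nb _ h3 h1 _).2 ⟨_, mem_nb (has_iff.2 ⟨e, he, rfl⟩), rfl⟩
  · exact ((h.nb _ h3 h2 _).2 ⟨_, mem_nb (has_iff.2 ⟨e, he, Sym2.eq_swap⟩), rfl⟩).symm
  · have := h.carved h3.1
    rcases Sym2.eq_iff.1 (same_iff.1 h3.2) with ⟨h1, h2⟩ | ⟨h1, h2⟩
    · rwa [← h1, ← h2]
    · rw [← h1, ← h2]; exact this.symm

lemma Fit.glue_rest (h : B.Fit K lab) (hs : B.shape = true) :
    glue (B.rest K lab) lab B.E = K := by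
  ext a b
  rw [glue_adj, rest, deleteEdges_adj]
  constructor
  · rintro (h' | ⟨⟨d, hd, h'⟩, -⟩)
    · exact h'.1
    · have := h.adj_of_mem hs hd
      rcases Sym2.eq_iff.1 h' with ⟨h1, h2⟩ | ⟨h1, h2⟩
      · rwa [h1, h2] at this
      · rw [h1, h2] at this; exact this.symm
  · intro hab
    by_cases hE : ∃ d ∈ B.E, pair lab d = s(a, b)
    · exact Or.inr ⟨hE, hab.ne⟩
    · exact Or.inl ⟨hab, hE⟩

lemma Fit.model (h : B.Fit K lab) (hs : B.shape = true) : B.Model (B.rest K lab) lab := by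
  have hs' := hs
  simp only [Base.shape, Bool.and_eq_true, List.all_eq_true, Bool.or_eq_true, Nat.ble_eq,
    Nat.blt_eq] at hs'
  have hdist : ∀ a b, B.dist a b = true → lab a ≠ lab b := by
    intro a b hab
    simp only [dist, Bool.and_eq_true, Bool.or_eq_true, Nat.ble_eq, Bool.not_eq_true',
      ← Bool.not_eq_true, Nat.beq_eq] at hab
    rcases hab with ⟨hab, (h1 | h1) | h1⟩
    · exact fun h' => hab (h.inj _ _ h1 h')
    · exact fun h' => hab (h.inj _ _ h1 h'.symm).symm
    · exact ne_of_has h.known h1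
  refine ⟨⟨h.inj, ?_⟩, ⟨hs'.1.1.2, ?_, ?_, ?_, ?_⟩, h.known, ?_⟩
  · intro n y hn hy
    rw [rest, deleteEdges_adj] at hy
    have hlt : n < B.m := by
      by_contra! h'
      exact h.fresh n h' ⟨y, hy.1⟩
    obtain ⟨a, ha, rfl⟩ := (h.nb n hn hlt y).1 hy.1
    obtain ⟨e, he, h'⟩ := has_iff.1 (has_of_mem_nb ha)
    exact hy.2 ⟨e, he, pair_eq_of_eq (d := (n, a)) h'⟩
  · exact fun e he => (hs'.1.2 e he).1
  · exact fun e he => (h.adj_of_mem hs he).ne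
  · intro e he d hd hp
    rcases hs'.2 e he d hd with h1 | ⟨h1, h2⟩
    · exact same_iff.1 h1
    · exfalso
      rcases Sym2.eq_iff.1 hp with ⟨h3, h4⟩ | ⟨h3, h4⟩
      · rcases h1 with h1 | h1
        · exact hdist _ _ h1 h3
        · exact hdist _ _ h1 h4
      · rcases h2 with h2 | h2
        · exact hdist _ _ h2 h3
        · exact hdist _ _ h2 h4
  · intro e he h'
    rw [rest, deleteEdges_adj] at h'
    exact h'.2 ⟨e, he, rfl⟩
  · rw [h.glue_rest hs]
    exact h.nonadj

lemma Fit.glue_S (h : B.Fit K lab) (hs : B.shape = true) : glue (B.rest K lab) lab B.S =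
    ins K (lab 20) (lab 21) (lab 24) (lab B.w) (lab B.m) (lab (B.m + 1)) := by
  have hm := h.model hs
  have h' := hs
  simp only [Base.shape, ok, Bool.and_eq_true] at h'
  rw [Base.S, glue_splus hm.wf h'.1.1.1.1.1 h'.1.1.1.1.2, h.glue_rest hs]

theorem Checked.exp (hB : B.Checked) (h : B.Fit K lab) {k : ℕ} {sp : Spec}
    (hk : specs[k]? = some sp) (hkc : B.carved = true → k < 2) {g : ℕ → X}
    (hg : IsExp (ins K (lab 20) (lab 21) (lab 24) (lab B.w) (lab B.m) (lab (B.m + 1)))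
      (lab 20) (lab B.m) (lab (B.m + 1)) (lab 24) sp g)
    (hnew : ∀ j, g (20 + j) = lab (B.m + 2 + j))
    (hfree : ∀ e ∈ frees sp.steps 4, ∃ d ∈ B.fr, pair lab d = s(g e.1, g e.2))
    (havoid : k = 1 → ∀ a ∈ B.avoid, g 0 = lab a.1 → g 4 = lab a.2.1 →
      g 7 ≠ lab a.2.2 ∧ g 8 ≠ lab a.2.2)
    (honly : B.only = [] ∨ k = 1 ∧ ∃ a ∈ B.only, g 0 = lab a.1 ∧ g 4 = lab a.2.1 ∧
      (g 7 = lab a.2.2 ∨ g 8 = lab a.2.2))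
    (hH : Emb (insL g sp.ops 20
      (ins K (lab 20) (lab 21) (lab 24) (lab B.w) (lab B.m) (lab (B.m + 1)))) H)
    (hH₁ : Emb (insL g (sp.ops.take 1) 20
      (ins K (lab 20) (lab 21) (lab 24) (lab B.w) (lab B.m) (lab (B.m + 1)))) H) :
    Exp K H (lab 20) (lab 21) (lab 22) (lab 23) := by
  obtain ⟨pool, pre, ⟨pidx, hpre⟩, hty⟩ := hB.check
  obtain ⟨idx, hty⟩ := hty k sp hk hkc
  rw [← h.glue_S hB.shape] at hg hH hH₁
  have hok : B.ok = true := by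
    have := hB.shape
    simp only [Base.shape, Bool.and_eq_true] at this
    exact this.1.1.1
  have := sound (h.model hB.shape) hok hpre hk hty hg hnew hfree havoid honly hH hH₁
  rwa [h.glue_rest hB.shape] at this

/-- The base obtained by adding an edge between two new leaves `7` and `8` to the skeleton. -/
def carve (B : Base) (na : List (ℕ × ℕ)) : Base where
  m := B.m
  E := (7, 8) :: B.E
  w := B.w
  known := (7, 8) :: B.known
  nonadj := na
  carved := true
  avoid := B.avoid
  only := B.only

/-- The leaves `7` and `8` are not in use. -/
def spare (B : Base) (na : List (ℕ × ℕ)) : Bool :=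
  !B.carved && B.only.isEmpty && Nat.ble 20 B.w && Nat.blt B.w B.m &&
  (B.E ++ (B.known ++ na)).all fun e =>
    !Nat.beq e.1 7 && !Nat.beq e.1 8 && !Nat.beq e.2 7 && !Nat.beq e.2 8

lemma frees_of_mem : ∀ k sp, specs[k]? = some sp → frees sp.steps 4 = [] ∨
    k < 2 ∧ ∃ e ∈ adjs sp.steps 4, frees sp.steps 4 = [e] := by
  intro k sp h
  match k with
  | 0 | 1 | 2 | 3 | 4 | 5 | 6 =>
    simp only [specs, List.getElem?_cons_succ, List.getElem?_cons_zero, Option.some.injEq] at h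
    rw [← h]
    decide
  | n + 7 => simp [specs] at h

theorem Checked.exp_of_carve {na : List (ℕ × ℕ)} (hB : B.Checked) (hC : (B.carve na).Checked)
    (hsp : B.spare na = true) (h : B.Fit K lab) (hna : ∀ d ∈ na, ¬ K.Adj (lab d.1) (lab d.2))
    (hav : ∀ a ∈ B.avoid, a.1 ≠ 7 ∧ a.1 ≠ 8 ∧ a.2.1 ≠ 7 ∧ a.2.1 ≠ 8 ∧ a.2.2 ≠ 7 ∧ a.2.2 ≠ 8)
    {k : ℕ} {sp : Spec} (hk : specs[k]? = some sp) {g : ℕ → X}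
    (hg : IsExp (ins K (lab 20) (lab 21) (lab 24) (lab B.w) (lab B.m) (lab (B.m + 1)))
      (lab 20) (lab B.m) (lab (B.m + 1)) (lab 24) sp g)
    (hnew : ∀ j, g (20 + j) = lab (B.m + 2 + j))
    (havoid : k = 1 → ∀ a ∈ B.avoid, g 0 = lab a.1 → g 4 = lab a.2.1 →
      g 7 ≠ lab a.2.2 ∧ g 8 ≠ lab a.2.2)
    (hH : Emb (insL g sp.ops 20
      (ins K (lab 20) (lab 21) (lab 24) (lab B.w) (lab B.m) (lab (B.m + 1)))) H)
    (hH₁ : Emb (insL g (sp.ops.take 1) 20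
      (ins K (lab 20) (lab 21) (lab 24) (lab B.w) (lab B.m) (lab (B.m + 1)))) H) :
    Exp K H (lab 20) (lab 21) (lab 22) (lab 23) := by
  simp only [spare, Bool.and_eq_true, Bool.not_eq_true', List.isEmpty_iff, Nat.ble_eq, Nat.blt_eq,
    List.all_eq_true, ← Bool.not_eq_true, Nat.beq_eq, List.mem_append] at hsp
  obtain ⟨⟨⟨⟨hcarved, honly⟩, hw⟩, hwm⟩, hsp⟩ := hsp
  have hm : 20 ≤ B.m := by omega
  have hfr : B.fr = B.S := by simp [fr, hcarved]
  by_cases hfree : ∀ e ∈ frees sp.steps 4, ∃ d ∈ B.fr, pair lab d = s(g e.1, g e.2)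
  · exact hB.exp h hk (fun h => absurd h hcarved) hg hnew hfree havoid (Or.inl honly) hH hH₁
  rcases frees_of_mem k sp hk with hnil | ⟨hk2, e, he, hfe⟩
  · simp [hnil] at hfree
  rw [hfe, hfr] at hfree
  simp only [List.mem_singleton, forall_eq] at hfree
  have hadj := hg.adj e he
  rw [← h.glue_S hB.shape, glue_adj] at hadj
  replace hadj : (B.rest K lab).Adj (g e.1) (g e.2) := by
    rcases hadj with h | h
    · exact h
    · exact absurd h.1 hfree
  have hmodel := h.model hB.shape
  have hKadj : K.Adj (g e.1) (g e.2) := by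
    rw [rest, deleteEdges_adj] at hadj
    exact hadj.1
  obtain ⟨lab', hlab'⟩ : ∃ lab' : ℕ → X, lab' = fun n => if n = 7 then g e.1 else
    if n = 8 then g e.2 else lab n := ⟨_, rfl⟩
  have h7 : lab' 7 = g e.1 := by simp [hlab']
  have h8 : lab' 8 = g e.2 := by simp [hlab']
  have hl : ∀ n, n ≠ 7 → n ≠ 8 → lab' n = lab n := fun n h1 h2 => by simp [hlab', h1, h2]
  have hl20 : ∀ n, 20 ≤ n → lab' n = lab n := fun n hn => hl n (by omega) (by omega)
  have hfit : (B.carve na).Fit K lab' := by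
    refine ⟨?_, ?_, ?_, ?_, ?_, ?_⟩
    · intro n k hn hnk
      rw [hl20 n hn] at hnk
      by_cases hk7 : k = 7
      · subst hk7
        rw [h7] at hnk
        exact absurd (hnk ▸ hadj) (hmodel.good.iso n _ hn)
      by_cases hk8 : k = 8
      · subst hk8
        rw [h8] at hnk
        exact absurd (hnk ▸ hadj.symm) (hmodel.good.iso n _ hn)
      rw [hl k hk7 hk8] at hnk
      exact h.inj n k hn hnk
    · intro n hn
      rw [hl20 n (hm.trans hn)]
      exact h.fresh n hn
    · intro n hn hnm y
      have hnb : Skel.nb ((7, 8) :: B.E) n = Skel.nb B.E n := by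
        have h1 : 7 ≠ n := by omega
        have h2 : 8 ≠ n := by omega
        simp [Skel.nb, h1, h2]
      have hmem : ∀ a ∈ Skel.nb B.E n, lab' a = lab a := by
        intro a ha
        obtain ⟨d, hd, h'⟩ := has_iff.1 (has_of_mem_nb ha)
        obtain ⟨⟨⟨d1, d2⟩, d3⟩, d4⟩ := hsp d (Or.inl hd)
        rcases Sym2.eq_iff.1 h' with ⟨-, rfl⟩ | ⟨rfl, -⟩
        · exact hl _ d3 d4
        · exact hl _ d1 d2
      rw [hl20 n hn, h.nb n hn hnm]
      simp only [carve, hnb]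
      constructor
      · rintro ⟨a, ha, rfl⟩
        exact ⟨a, ha, (hmem a ha).symm⟩
      · rintro ⟨a, ha, rfl⟩
        exact ⟨a, ha, hmem a ha⟩
    · intro d hd
      rcases List.mem_cons.1 hd with rfl | hd
      · simp only [h7, h8]
        exact hKadj.ne
      · obtain ⟨⟨⟨d1, d2⟩, d3⟩, d4⟩ := hsp d (Or.inr (Or.inl hd))
        rw [hl _ d1 d2, hl _ d3 d4]
        exact h.known d hd
    · intro d hd
      obtain ⟨⟨⟨d1, d2⟩, d3⟩, d4⟩ := hsp d (Or.inr (Or.inr hd))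
      rw [h7, h8, hl _ d1 d2, hl _ d3 d4]
      exact ⟨hKadj, hna d hd⟩
    · intro _
      rw [h7, h8]
      exact hKadj
  have := hC.exp hfit hk (fun _ => hk2) (g := g)
    (by
      simp only [carve]
      rwa [hl20 20 (by omega), hl20 21 (by omega), hl20 24 (by omega), hl20 _ hw, hl20 _ hm,
        hl20 _ (by omega)])
    (fun j => by rw [hl20 _ (by simp only [carve]; omega), hnew]; rfl)
    (by
      rw [hfe]
      simp only [List.mem_singleton, forall_eq]
      exact ⟨(7, 8), by simp [fr, carve], by simp only [pair, h7, h8]⟩)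
    (by
      intro hk1 a ha
      obtain ⟨a1, a2, a3, a4, a5, a6⟩ := hav a ha
      rw [hl _ a1 a2, hl _ a3 a4, hl _ a5 a6]
      exact havoid hk1 a ha)
    (Or.inl honly)
    (by
      simp only [carve]
      rwa [hl20 20 (by omega), hl20 21 (by omega), hl20 24 (by omega), hl20 _ hw, hl20 _ hm,
        hl20 _ (by omega)])
    (by
      simp only [carve]
      rwa [hl20 20 (by omega), hl20 21 (by omega), hl20 24 (by omega), hl20 _ hw, hl20 _ hm,
        hl20 _ (by omega)])
  rwa [hl20 20 (by omega), hl20 21 (by omega), hl20 22 (by omega), hl20 23 (by omega)] at this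

end Base

end Skel

end QuadExp

namespace QuadExp

open SimpleGraph

namespace Skel

lemma forall_specs {P : ℕ → Spec → Prop} (hA : P 0 specA) (hB : P 1 specB) (hC : P 2 specC)
    (hD : P 3 specD) (hE : P 4 specE) (hF : P 5 specF) (hG : P 6 specG) :
    ∀ k sp, specs[k]? = some sp → P k sp := by
  intro k sp h
  match k with
  | 0 | 1 | 2 | 3 | 4 | 5 | 6 =>
    simp only [specs, List.getElem?_cons_succ, List.getElem?_cons_zero, Option.some.injEq] at h
    rw [← h]
    assumption
  | n + 7 => simp [specs] at h

def base₀₀ : Base where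
  m := 27
  E := [
    (20, 21), (21, 22), (22, 23), (23, 20), (20, 24), (24, 25), (24, 26), (22, 1), (25, 4),
    (26, 6), (21, 0), (25, 3), (23, 2), (26, 5)]
  w := 25
  known := [(0, 1), (0, 2), (1, 2), (3, 4), (5, 6), (0, 3), (0, 4), (2, 5), (2, 6)]
  nonadj := []
  carved := false
  avoid := []
  only := []

namespace base₀₀

def pool : List Cert := [
  ⟨0, [22, 23, 20, 21, 1, 2, 24, 26], [(20, 29)], [27, 21, 22, 30, 28, 25, 26, 23, 24]⟩,
  ⟨0, [21, 22, 23, 20, 0, 1, 24, 25], [(27, 29)], [20, 21, 22, 23, 24, 25, 26, 30, 28]⟩,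
  ⟨0, [20, 21, 22, 23, 24, 0, 25, 3], [(28, 29)], [20, 21, 22, 23, 24, 30, 26, 27, 25]⟩,
  ⟨0, [20, 21, 22, 23, 24, 0, 25, 4], [(28, 29)], [20, 21, 22, 23, 24, 30, 26, 27, 25]⟩,
  ⟨0, [23, 20, 21, 22, 2, 24, 26, 6], [(24, 29)], [27, 21, 22, 23, 28, 25, 26, 20, 30]⟩,
  ⟨0, [23, 20, 21, 22, 2, 24, 26, 5], [(24, 29)], [27, 21, 22, 23, 28, 25, 26, 20, 30]⟩,
  ⟨0, [21, 22, 23, 20, 0, 1, 24, 25], [(27, 29)], [20, 30, 22, 23, 24, 25, 26, 21, 28]⟩,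
  ⟨0, [20, 21, 22, 23, 24, 0, 25, 4], [(28, 29)], [20, 21, 22, 23, 24, 25, 26, 27, 30]⟩,
  ⟨0, [20, 21, 22, 23, 24, 0, 25, 3], [(28, 29)], [20, 21, 22, 23, 24, 25, 26, 27, 30]⟩,
  ⟨0, [23, 20, 21, 22, 2, 24, 26, 5], [(24, 29)], [27, 21, 22, 23, 28, 25, 30, 20, 26]⟩,
  ⟨0, [23, 20, 21, 22, 2, 24, 26, 6], [(24, 29)], [27, 21, 22, 23, 28, 25, 30, 20, 26]⟩,
  ⟨0, [22, 23, 20, 21, 1, 2, 24, 26], [(20, 29)], [27, 21, 22, 23, 28, 25, 26, 30, 24]⟩,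
  ⟨3, [20, 21, 22, 23, 24, 25, 1], [], [20, 21, 22, 23, 24, 25, 26, 27, 28, 29, 30]⟩,
  ⟨0, [20, 21, 22, 23, 24, 0, 25, 4], [(27, 28)], [20, 21, 22, 23, 24, 25, 26, 29, 30]⟩,
  ⟨0, [23, 20, 21, 22, 2, 24, 26, 6], [(20, 24)], [27, 21, 22, 23, 28, 25, 26, 29, 30]⟩,
  ⟨0, [20, 21, 22, 23, 24, 0, 25, 3], [(27, 28)], [20, 21, 22, 23, 24, 25, 26, 29, 30]⟩,
  ⟨0, [23, 20, 21, 22, 2, 24, 26, 5], [(20, 24)], [27, 21, 22, 23, 28, 25, 26, 29, 30]⟩,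
  ⟨0, [22, 23, 20, 21, 1, 2, 24, 25], [(27, 29)], [20, 21, 22, 23, 24, 25, 26, 30, 28]⟩,
  ⟨0, [21, 22, 23, 20, 0, 1, 24, 25], [(21, 22)], [20, 27, 30, 23, 24, 25, 26, 29, 28]⟩,
  ⟨0, [23, 20, 21, 22, 2, 24, 26, 5], [(24, 28)], [27, 21, 22, 23, 29, 25, 30, 20, 26]⟩,
  ⟨0, [22, 23, 20, 21, 1, 2, 24, 26], [(20, 27)], [29, 21, 22, 30, 28, 25, 26, 23, 24]⟩,
  ⟨0, [23, 20, 21, 22, 2, 24, 26, 6], [(24, 28)], [27, 21, 22, 23, 29, 25, 30, 20, 26]⟩,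
  ⟨1, [20, 21, 22, 23, 24, 25, 26, 21, 22], [], [20, 21, 22, 23, 24, 25, 26, 27, 28, 29, 30]⟩,
  ⟨1, [20, 21, 22, 23, 24, 25, 26, 22, 23], [], [20, 21, 22, 23, 24, 25, 26, 27, 28, 29, 30]⟩,
  ⟨1, [20, 21, 22, 23, 24, 25, 26, 22, 1], [], [20, 21, 22, 23, 24, 25, 26, 27, 28, 29, 30]⟩,
  ⟨1, [20, 21, 22, 23, 24, 25, 26, 21, 0], [], [20, 21, 22, 23, 24, 25, 26, 27, 28, 29, 30]⟩,
  ⟨1, [20, 21, 22, 23, 24, 25, 26, 23, 2], [], [20, 21, 22, 23, 24, 25, 26, 27, 28, 29, 30]⟩,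
  ⟨0, [21, 22, 23, 20, 0, 1, 24, 26], [(29, 20)], [27, 21, 22, 23, 28, 25, 26, 30, 24]⟩,
  ⟨0, [22, 23, 20, 21, 1, 2, 24, 26], [(22, 23)], [27, 21, 30, 20, 28, 25, 26, 29, 24]⟩,
  ⟨0, [20, 21, 22, 23, 24, 0, 25, 3], [(24, 28)], [20, 21, 22, 23, 29, 30, 26, 27, 25]⟩,
  ⟨0, [21, 22, 23, 20, 0, 1, 24, 25], [(20, 27)], [29, 30, 22, 23, 24, 25, 26, 21, 28]⟩,
  ⟨0, [20, 21, 22, 23, 24, 0, 25, 4], [(24, 28)], [20, 21, 22, 23, 29, 30, 26, 27, 25]⟩,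
  ⟨3, [20, 21, 22, 23, 24, 25, 1], [(21, 22)], [20, 32, 31, 23, 24, 25, 26, 27, 28, 29, 30]⟩,
  ⟨1, [20, 21, 22, 23, 24, 25, 26, 22, 23], [(29, 30)], [20, 21, 22, 23, 24, 25, 26, 27, 28, 32, 31]⟩,
  ⟨0, [22, 23, 20, 21, 1, 2, 24, 25], [(23, 31), (20, 24)], [27, 21, 22, 29, 28, 25, 26, 30, 32]⟩,
  ⟨0, [22, 23, 20, 21, 1, 2, 24, 26], [(31, 30), (29, 27)], [32, 21, 22, 23, 28, 25, 26, 20, 24]⟩,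
  ⟨0, [22, 23, 20, 21, 1, 2, 24, 26], [(23, 31), (20, 24)], [27, 21, 22, 29, 28, 25, 26, 30, 32]⟩,
  ⟨4, [20, 21, 22, 23, 24, 25, 1, 4, 25], [], [20, 21, 22, 23, 24, 25, 26, 27, 28, 29, 30, 31, 32]⟩,
  ⟨0, [22, 23, 20, 21, 1, 2, 25, 4], [(23, 31), (20, 24)], [27, 21, 22, 29, 28, 25, 26, 30, 32]⟩,
  ⟨0, [22, 23, 20, 21, 1, 2, 26, 6], [(23, 31), (20, 24)], [27, 21, 22, 29, 28, 25, 26, 30, 32]⟩,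
  ⟨4, [20, 21, 22, 23, 24, 25, 1, 6, 26], [], [20, 21, 22, 23, 24, 25, 26, 27, 28, 29, 30, 31, 32]⟩,
  ⟨4, [20, 21, 22, 23, 24, 25, 1, 3, 25], [], [20, 21, 22, 23, 24, 25, 26, 27, 28, 29, 30, 31, 32]⟩,
  ⟨0, [22, 23, 20, 21, 1, 2, 25, 3], [(23, 31), (20, 24)], [27, 21, 22, 29, 28, 25, 26, 30, 32]⟩,
  ⟨0, [22, 23, 20, 21, 1, 2, 26, 5], [(23, 31), (20, 24)], [27, 21, 22, 29, 28, 25, 26, 30, 32]⟩,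
  ⟨4, [20, 21, 22, 23, 24, 25, 1, 5, 26], [], [20, 21, 22, 23, 24, 25, 26, 27, 28, 29, 30, 31, 32]⟩,
  ⟨1, [20, 21, 22, 23, 24, 25, 26, 21, 0], [(29, 30)], [20, 21, 22, 23, 24, 25, 26, 27, 28, 32, 31]⟩,
  ⟨0, [21, 22, 23, 20, 0, 1, 24, 25], [(31, 30), (29, 28)], [20, 27, 22, 23, 24, 25, 26, 21, 32]⟩,
  ⟨3, [20, 21, 22, 23, 24, 25, 1], [(22, 23)], [20, 30, 31, 32, 24, 25, 26, 29, 28, 27, 21]⟩,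
  ⟨0, [21, 22, 23, 20, 0, 1, 24, 25], [(21, 31), (20, 27)], [32, 30, 22, 23, 24, 25, 26, 29, 28]⟩,
  ⟨0, [21, 22, 23, 20, 0, 1, 24, 26], [(31, 30), (29, 28)], [20, 27, 22, 23, 24, 25, 26, 21, 32]⟩,
  ⟨0, [21, 22, 23, 20, 0, 1, 25, 4], [(31, 30), (29, 28)], [20, 27, 22, 23, 24, 25, 26, 21, 32]⟩,
  ⟨4, [20, 23, 22, 21, 24, 26, 1, 4, 25], [], [29, 30, 22, 23, 28, 25, 26, 20, 24, 27, 21, 31, 32]⟩,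
  ⟨4, [20, 23, 22, 21, 24, 26, 1, 6, 26], [], [29, 30, 22, 23, 28, 25, 26, 20, 24, 27, 21, 31, 32]⟩,
  ⟨0, [21, 22, 23, 20, 0, 1, 26, 6], [(31, 30), (29, 28)], [20, 27, 22, 23, 24, 25, 26, 21, 32]⟩,
  ⟨0, [21, 22, 23, 20, 0, 1, 25, 3], [(31, 30), (29, 28)], [20, 27, 22, 23, 24, 25, 26, 21, 32]⟩,
  ⟨4, [20, 23, 22, 21, 24, 26, 1, 3, 25], [], [29, 30, 22, 23, 28, 25, 26, 20, 24, 27, 21, 31, 32]⟩,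
  ⟨4, [20, 23, 22, 21, 24, 26, 1, 5, 26], [], [29, 30, 22, 23, 28, 25, 26, 20, 24, 27, 21, 31, 32]⟩,
  ⟨0, [21, 22, 23, 20, 0, 1, 26, 5], [(31, 30), (29, 28)], [20, 27, 22, 23, 24, 25, 26, 21, 32]⟩,
  ⟨1, [20, 21, 22, 23, 24, 25, 26, 21, 22], [(29, 30)], [20, 21, 22, 23, 24, 25, 26, 27, 28, 32, 31]⟩,
  ⟨0, [21, 22, 23, 20, 0, 1, 24, 25], [(21, 31), (27, 28)], [20, 29, 22, 23, 24, 25, 26, 30, 32]⟩,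
  ⟨3, [20, 21, 22, 23, 24, 25, 1], [(22, 23)], [20, 21, 31, 32, 24, 25, 26, 27, 28, 29, 30]⟩,
  ⟨0, [21, 22, 23, 20, 0, 1, 24, 25], [(31, 30), (29, 20)], [32, 21, 22, 23, 24, 25, 26, 27, 28]⟩,
  ⟨0, [21, 22, 23, 20, 0, 1, 24, 26], [(21, 31), (27, 28)], [20, 29, 22, 23, 24, 25, 26, 30, 32]⟩,
  ⟨0, [21, 22, 23, 20, 0, 1, 25, 4], [(21, 31), (27, 28)], [20, 29, 22, 23, 24, 25, 26, 30, 32]⟩,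
  ⟨4, [20, 23, 22, 21, 24, 26, 1, 4, 25], [], [27, 21, 22, 23, 28, 25, 26, 20, 24, 29, 30, 31, 32]⟩,
  ⟨4, [20, 23, 22, 21, 24, 26, 1, 6, 26], [], [27, 21, 22, 23, 28, 25, 26, 20, 24, 29, 30, 31, 32]⟩,
  ⟨0, [21, 22, 23, 20, 0, 1, 26, 6], [(21, 31), (27, 28)], [20, 29, 22, 23, 24, 25, 26, 30, 32]⟩,
  ⟨0, [21, 22, 23, 20, 0, 1, 25, 3], [(21, 31), (27, 28)], [20, 29, 22, 23, 24, 25, 26, 30, 32]⟩,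
  ⟨4, [20, 23, 22, 21, 24, 26, 1, 3, 25], [], [27, 21, 22, 23, 28, 25, 26, 20, 24, 29, 30, 31, 32]⟩,
  ⟨4, [20, 23, 22, 21, 24, 26, 1, 5, 26], [], [27, 21, 22, 23, 28, 25, 26, 20, 24, 29, 30, 31, 32]⟩,
  ⟨0, [21, 22, 23, 20, 0, 1, 26, 5], [(21, 31), (27, 28)], [20, 29, 22, 23, 24, 25, 26, 30, 32]⟩,
  ⟨3, [20, 21, 22, 23, 24, 25, 1], [(21, 22)], [29, 32, 31, 30, 24, 25, 26, 27, 28, 20, 23]⟩,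
  ⟨1, [20, 21, 22, 23, 24, 25, 26, 23, 2], [(29, 30)], [20, 21, 22, 23, 24, 25, 26, 27, 28, 32, 31]⟩,
  ⟨0, [22, 23, 20, 21, 1, 2, 24, 25], [(31, 30), (29, 24)], [27, 21, 22, 20, 28, 25, 26, 23, 32]⟩,
  ⟨0, [22, 23, 20, 21, 1, 2, 24, 26], [(23, 31), (20, 27)], [32, 21, 22, 30, 28, 25, 26, 29, 24]⟩,
  ⟨0, [22, 23, 20, 21, 1, 2, 24, 26], [(31, 30), (29, 24)], [27, 21, 22, 20, 28, 25, 26, 23, 32]⟩,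
  ⟨4, [20, 21, 22, 23, 24, 25, 1, 4, 25], [], [29, 21, 22, 30, 24, 25, 26, 27, 28, 20, 23, 31, 32]⟩,
  ⟨0, [22, 23, 20, 21, 1, 2, 25, 4], [(31, 30), (29, 24)], [27, 21, 22, 20, 28, 25, 26, 23, 32]⟩,
  ⟨0, [22, 23, 20, 21, 1, 2, 26, 6], [(31, 30), (29, 24)], [27, 21, 22, 20, 28, 25, 26, 23, 32]⟩,
  ⟨4, [20, 21, 22, 23, 24, 25, 1, 6, 26], [], [29, 21, 22, 30, 24, 25, 26, 27, 28, 20, 23, 31, 32]⟩,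
  ⟨4, [20, 21, 22, 23, 24, 25, 1, 3, 25], [], [29, 21, 22, 30, 24, 25, 26, 27, 28, 20, 23, 31, 32]⟩,
  ⟨0, [22, 23, 20, 21, 1, 2, 25, 3], [(31, 30), (29, 24)], [27, 21, 22, 20, 28, 25, 26, 23, 32]⟩,
  ⟨0, [22, 23, 20, 21, 1, 2, 26, 5], [(31, 30), (29, 24)], [27, 21, 22, 20, 28, 25, 26, 23, 32]⟩,
  ⟨4, [20, 21, 22, 23, 24, 25, 1, 5, 26], [], [29, 21, 22, 30, 24, 25, 26, 27, 28, 20, 23, 31, 32]⟩,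
  ⟨0, [21, 22, 23, 20, 0, 1, 24, 25], [(31, 30), (21, 32)], [20, 29, 22, 23, 24, 25, 26, 27, 28]⟩,
  ⟨0, [20, 21, 22, 23, 24, 0, 25, 4], [(31, 30), (25, 32)], [20, 21, 22, 23, 24, 28, 26, 27, 29]⟩,
  ⟨0, [20, 21, 22, 23, 24, 0, 25, 3], [(31, 30), (25, 32)], [20, 21, 22, 23, 24, 28, 26, 27, 29]⟩,
  ⟨0, [22, 23, 20, 21, 1, 2, 24, 26], [(31, 30), (23, 32)], [27, 21, 22, 29, 28, 25, 26, 20, 24]⟩,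
  ⟨0, [23, 20, 21, 22, 2, 24, 26, 6], [(31, 30), (26, 32)], [27, 21, 22, 23, 28, 25, 24, 20, 29]⟩,
  ⟨0, [23, 20, 21, 22, 2, 24, 26, 5], [(31, 30), (26, 32)], [27, 21, 22, 23, 28, 25, 24, 20, 29]⟩,
  ⟨1, [20, 21, 22, 23, 24, 26, 25, 23, 2], [(28, 32)], [29, 21, 22, 30, 31, 25, 26, 27, 24, 20, 23]⟩,
  ⟨1, [20, 21, 22, 23, 24, 26, 25, 21, 0], [(24, 32)], [20, 21, 22, 23, 28, 25, 26, 27, 31, 29, 30]⟩,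
  ⟨1, [20, 21, 22, 23, 24, 26, 25, 21, 0], [(24, 32)], [20, 30, 22, 23, 28, 25, 26, 29, 31, 27, 21]⟩,
  ⟨1, [20, 21, 22, 23, 24, 26, 25, 23, 2], [(28, 32)], [20, 21, 22, 23, 31, 25, 26, 27, 24, 29, 30]⟩,
  ⟨0, [20, 21, 22, 23, 24, 0, 25, 3], [(32, 33), (31, 29), (21, 22)], [20, 27, 30, 23, 24, 34, 26, 28, 25]⟩,
  ⟨0, [20, 21, 22, 23, 24, 0, 25, 4], [(32, 33), (31, 29), (21, 22)], [20, 27, 30, 23, 24, 34, 26, 28, 25]⟩,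
  ⟨0, [23, 20, 21, 22, 2, 24, 26, 6], [(32, 33), (29, 28), (27, 21)], [31, 30, 22, 23, 24, 25, 26, 20, 34]⟩,
  ⟨0, [23, 20, 21, 22, 2, 24, 26, 5], [(32, 33), (29, 28), (27, 21)], [31, 30, 22, 23, 24, 25, 26, 20, 34]⟩,
  ⟨0, [23, 20, 21, 22, 2, 24, 26, 5], [(32, 33), (31, 29), (22, 23)], [27, 21, 30, 20, 28, 25, 34, 24, 26]⟩,
  ⟨0, [23, 20, 21, 22, 2, 24, 26, 6], [(32, 33), (31, 29), (22, 23)], [27, 21, 30, 20, 28, 25, 34, 24, 26]⟩,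
  ⟨0, [20, 21, 22, 23, 24, 0, 25, 4], [(32, 33), (29, 24), (23, 20)], [31, 21, 22, 30, 28, 25, 26, 27, 34]⟩,
  ⟨0, [20, 21, 22, 23, 24, 0, 25, 3], [(32, 33), (29, 24), (23, 20)], [31, 21, 22, 30, 28, 25, 26, 27, 34]⟩,
  ⟨6, [20, 21, 22, 23, 24, 25], [], [20, 21, 22, 23, 24, 25, 26, 27, 28, 29, 30, 31, 32, 33, 34, 35, 36]⟩,
  ⟨0, [20, 21, 22, 23, 24, 0, 25, 4], [(29, 35), (24, 34), (20, 27), (22, 23)], [31, 30, 21, 33, 28, 25, 26, 36, 32]⟩,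
  ⟨0, [20, 21, 22, 23, 24, 0, 25, 3], [(29, 35), (24, 34), (20, 27), (22, 23)], [31, 30, 21, 33, 28, 25, 26, 36, 32]⟩,
  ⟨6, [20, 21, 22, 23, 24, 25], [], [20, 21, 22, 23, 24, 25, 26, 27, 28, 31, 32, 29, 30, 33, 34, 36, 35]⟩,
  ⟨0, [23, 20, 21, 22, 2, 24, 26, 6], [(29, 35), (28, 34), (20, 27), (21, 22)], [31, 33, 23, 30, 24, 25, 26, 36, 32]⟩,
  ⟨0, [23, 20, 21, 22, 2, 24, 26, 5], [(29, 35), (28, 34), (20, 27), (21, 22)], [31, 33, 23, 30, 24, 25, 26, 36, 32]⟩,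
  ⟨6, [20, 21, 22, 23, 24, 25], [(21, 22)], [20, 27, 30, 23, 24, 25, 26, 34, 28, 31, 36, 38, 29, 37, 32, 35, 33]⟩,
  ⟨6, [20, 21, 22, 23, 24, 25], [(22, 23)], [32, 30, 21, 20, 24, 25, 26, 29, 28, 37, 27, 33, 36, 38, 34, 31, 35]⟩,
  ⟨6, [20, 21, 22, 23, 24, 25], [(22, 23)], [34, 21, 30, 20, 24, 25, 26, 27, 28, 38, 29, 31, 36, 37, 32, 33, 35]⟩,
  ⟨6, [20, 21, 22, 23, 24, 25], [(21, 22)], [29, 27, 23, 30, 24, 25, 26, 32, 28, 33, 36, 37, 20, 38, 34, 35, 31]⟩]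

def pre : List (List ℕ) := [
  [20, 27, 28, 24, 23, 2], [27, 28, 24, 20, 21, 22], [28, 24, 20, 27, 25, 4],
  [28, 24, 20, 27, 25, 3], [24, 20, 27, 28, 26, 6], [24, 20, 27, 28, 26, 5],
  [27, 20, 24, 28, 21, 0], [28, 27, 20, 24, 25, 4], [28, 27, 20, 24, 25, 3],
  [24, 28, 27, 20, 26, 6], [24, 28, 27, 20, 26, 5], [20, 24, 28, 27, 23, 22]]

theorem check_pre : base₀₀.checkPre pool pre
  [[0], [1], [2], [3], [4], [5], [6], [7], [8], [9], [10], [11]] = true := by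
  decide +kernel

theorem check_specA : base₀₀.checkType pre pool 0 specA
  [[12], [12], [13], [13], [14], [14], [15], [15], [16], [16], [17], [17], [18], [18], [19], [19],
  [20], [20], [21], [21], [22], [22], [23], [23], [24], [24], [25], [25], [26], [26], [27], [27],
  [28], [28], [29], [29], [30], [30], [31], [31], [12], [12], [13], [13], [14], [14], [15], [15],
  [16], [16], [17], [17], [18], [18], [19], [19], [20], [20], [21], [21], [22], [22], [23], [23],
  [24], [24], [25], [25], [26], [26], [27], [27], [28], [28], [29], [29], [30], [30], [31], [31]] = true := by
  decide +kernel

theorem check_specB : base₀₀.checkType pre pool 1 specB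
  [[32], [32], [33], [33], [34], [34], [35], [35], [36], [36], [37, 38], [37, 38], [39, 40],
  [39, 40], [32], [32], [41, 42], [41, 42], [43, 44], [43, 44], [45], [45], [46], [46], [47], [47],
  [48], [48], [49], [49], [50, 51], [50, 51], [52, 53], [52, 53], [54, 55], [54, 55], [47], [47],
  [56, 57], [56, 57], [58], [58], [59], [59], [60], [60], [61], [61], [62], [62], [63, 64],
  [63, 64], [65, 66], [65, 66], [67, 68], [67, 68], [60], [60], [69, 70], [69, 70], [71], [71],
  [72], [72], [73], [73], [74], [74], [75], [75], [76, 77], [76, 77], [78, 79], [78, 79], [71],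
  [71], [80, 81], [80, 81], [82, 83], [82, 83]] = true := by
  decide +kernel

theorem check_specC : base₀₀.checkType pre pool 2 specC
  [[84], [85], [86], [87], [88], [89]] = true := by
  decide +kernel

theorem check_specD : base₀₀.checkType pre pool 3 specD
  [[90], [91], [92], [93]] = true := by
  decide +kernel

theorem check_specE : base₀₀.checkType pre pool 4 specE
  [[94], [95], [96], [97], [98], [99], [100], [101]] = true := by
  decide +kernel

theorem check_specF : base₀₀.checkType pre pool 5 specF
  [[102], [103], [104], [105], [106], [107]] = true := by
  decide +kernel

theorem check_specG : base₀₀.checkType pre pool 6 specG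
  [[108], [109], [110], [111]] = true := by
  decide +kernel

theorem checked : base₀₀.Checked :=
  ⟨by decide +kernel, pool, pre, ⟨_, check_pre⟩, forall_specs (fun _ => ⟨_, check_specA⟩)
    (fun _ => ⟨_, check_specB⟩) (fun _ => ⟨_, check_specC⟩) (fun _ => ⟨_, check_specD⟩)
    (fun _ => ⟨_, check_specE⟩) (fun _ => ⟨_, check_specF⟩) (fun _ => ⟨_, check_specG⟩)⟩

end base₀₀

def base₀₀.nonadj : List (ℕ × ℕ) := [(0, 1), (0, 2), (1, 2)]

namespace base₀₀.carved

def pool : List Cert := [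
  ⟨0, [22, 23, 20, 21, 1, 2, 24, 26], [(20, 29)], [27, 21, 22, 30, 28, 25, 26, 23, 24]⟩,
  ⟨0, [21, 22, 23, 20, 0, 1, 24, 25], [(27, 29)], [20, 21, 22, 23, 24, 25, 26, 30, 28]⟩,
  ⟨0, [20, 21, 22, 23, 24, 0, 25, 3], [(28, 29)], [20, 21, 22, 23, 24, 30, 26, 27, 25]⟩,
  ⟨0, [20, 21, 22, 23, 24, 0, 25, 4], [(28, 29)], [20, 21, 22, 23, 24, 30, 26, 27, 25]⟩,
  ⟨0, [23, 20, 21, 22, 2, 24, 26, 6], [(24, 29)], [27, 21, 22, 23, 28, 25, 26, 20, 30]⟩,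
  ⟨0, [23, 20, 21, 22, 2, 24, 26, 5], [(24, 29)], [27, 21, 22, 23, 28, 25, 26, 20, 30]⟩,
  ⟨0, [21, 22, 23, 20, 0, 1, 24, 25], [(27, 29)], [20, 30, 22, 23, 24, 25, 26, 21, 28]⟩,
  ⟨0, [20, 21, 22, 23, 24, 0, 25, 4], [(28, 29)], [20, 21, 22, 23, 24, 25, 26, 27, 30]⟩,
  ⟨0, [20, 21, 22, 23, 24, 0, 25, 3], [(28, 29)], [20, 21, 22, 23, 24, 25, 26, 27, 30]⟩,
  ⟨0, [23, 20, 21, 22, 2, 24, 26, 5], [(24, 29)], [27, 21, 22, 23, 28, 25, 30, 20, 26]⟩,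
  ⟨0, [23, 20, 21, 22, 2, 24, 26, 6], [(24, 29)], [27, 21, 22, 23, 28, 25, 30, 20, 26]⟩,
  ⟨0, [22, 23, 20, 21, 1, 2, 24, 26], [(20, 29)], [27, 21, 22, 23, 28, 25, 26, 30, 24]⟩,
  ⟨0, [20, 21, 22, 23, 24, 0, 7, 8], [(27, 28)], [20, 21, 22, 23, 24, 25, 26, 29, 30]⟩,
  ⟨0, [23, 20, 21, 22, 2, 24, 7, 8], [(20, 24)], [27, 21, 22, 23, 28, 25, 26, 29, 30]⟩,
  ⟨2, [20, 21, 22, 23, 24, 25, 0, 7, 8], [], [20, 21, 22, 23, 24, 25, 26, 27, 28, 29, 30]⟩,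
  ⟨2, [20, 21, 22, 23, 24, 25, 0, 8, 7], [], [20, 21, 22, 23, 24, 25, 26, 27, 28, 29, 30]⟩,
  ⟨0, [20, 21, 22, 23, 24, 0, 7, 8], [(29, 28)], [20, 21, 22, 23, 24, 25, 26, 27, 30]⟩,
  ⟨1, [20, 21, 22, 23, 24, 25, 26, 7, 8], [], [20, 21, 22, 23, 24, 25, 26, 27, 28, 29, 30]⟩,
  ⟨2, [20, 23, 22, 21, 24, 26, 2, 7, 8], [], [27, 21, 22, 23, 28, 25, 26, 20, 24, 29, 30]⟩,
  ⟨2, [20, 23, 22, 21, 24, 26, 2, 8, 7], [], [27, 21, 22, 23, 28, 25, 26, 20, 24, 29, 30]⟩,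
  ⟨0, [23, 20, 21, 22, 2, 24, 7, 8], [(24, 29)], [27, 21, 22, 23, 28, 25, 26, 20, 30]⟩,
  ⟨4, [20, 21, 22, 23, 24, 25, 1, 7, 8], [], [20, 21, 22, 23, 24, 25, 26, 27, 28, 29, 30, 31, 32]⟩,
  ⟨4, [20, 21, 22, 23, 24, 25, 1, 8, 7], [], [20, 21, 22, 23, 24, 25, 26, 27, 28, 29, 30, 31, 32]⟩,
  ⟨0, [22, 23, 20, 21, 1, 2, 7, 8], [(23, 31), (20, 24)], [27, 21, 22, 29, 28, 25, 26, 30, 32]⟩,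
  ⟨4, [20, 23, 22, 21, 24, 26, 1, 7, 8], [], [29, 30, 22, 23, 28, 25, 26, 20, 24, 27, 21, 31, 32]⟩,
  ⟨4, [20, 23, 22, 21, 24, 26, 1, 8, 7], [], [29, 30, 22, 23, 28, 25, 26, 20, 24, 27, 21, 31, 32]⟩,
  ⟨0, [21, 22, 23, 20, 0, 1, 7, 8], [(31, 30), (29, 28)], [20, 27, 22, 23, 24, 25, 26, 21, 32]⟩,
  ⟨4, [20, 23, 22, 21, 24, 26, 1, 7, 8], [], [27, 21, 22, 23, 28, 25, 26, 20, 24, 29, 30, 31, 32]⟩,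
  ⟨4, [20, 23, 22, 21, 24, 26, 1, 8, 7], [], [27, 21, 22, 23, 28, 25, 26, 20, 24, 29, 30, 31, 32]⟩,
  ⟨0, [21, 22, 23, 20, 0, 1, 7, 8], [(21, 31), (27, 28)], [20, 29, 22, 23, 24, 25, 26, 30, 32]⟩,
  ⟨4, [20, 21, 22, 23, 24, 25, 1, 7, 8], [], [29, 21, 22, 30, 24, 25, 26, 27, 28, 20, 23, 31, 32]⟩,
  ⟨4, [20, 21, 22, 23, 24, 25, 1, 8, 7], [], [29, 21, 22, 30, 24, 25, 26, 27, 28, 20, 23, 31, 32]⟩,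
  ⟨0, [22, 23, 20, 21, 1, 2, 7, 8], [(31, 30), (29, 24)], [27, 21, 22, 20, 28, 25, 26, 23, 32]⟩]

def pre : List (List ℕ) := [
  [20, 27, 28, 24, 23, 2], [27, 28, 24, 20, 21, 22], [28, 24, 20, 27, 25, 4],
  [28, 24, 20, 27, 25, 3], [24, 20, 27, 28, 26, 6], [24, 20, 27, 28, 26, 5],
  [27, 20, 24, 28, 21, 0], [28, 27, 20, 24, 25, 4], [28, 27, 20, 24, 25, 3],
  [24, 28, 27, 20, 26, 6], [24, 28, 27, 20, 26, 5], [20, 24, 28, 27, 23, 22]]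

theorem check_pre : (base₀₀.carve base₀₀.nonadj).checkPre pool pre
  [[0], [1], [2], [3], [4], [5], [6], [7], [8], [9], [10], [11]] = true := by
  decide +kernel

theorem check_specA : (base₀₀.carve base₀₀.nonadj).checkType pre pool 0 specA
  [[12, 13], [12, 13], [14, 15, 16], [14, 15, 16], [17], [17], [18, 19, 20], [18, 19, 20], [12, 13],
  [12, 13], [14, 15, 16], [14, 15, 16], [17], [17], [18, 19, 20], [18, 19, 20]] = true := by
  decide +kernel

theorem check_specB : (base₀₀.carve base₀₀.nonadj).checkType pre pool 1 specB
  [[21, 22, 23], [21, 22, 23], [24, 25, 26], [24, 25, 26], [27, 28, 29], [27, 28, 29], [30, 31, 32],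
  [30, 31, 32]] = true := by
  decide +kernel

theorem checked : (base₀₀.carve base₀₀.nonadj).Checked :=
  ⟨by decide +kernel, pool, pre, ⟨_, check_pre⟩, forall_specs (fun _ => ⟨_, check_specA⟩)
    (fun _ => ⟨_, check_specB⟩) (by simp [Base.carve]) (by simp [Base.carve])
    (by simp [Base.carve]) (by simp [Base.carve]) (by simp [Base.carve])⟩

end base₀₀.carved

def base₁₀ : Base where
  m := 28
  E := [
    (20, 21), (21, 22), (22, 23), (23, 20), (20, 24), (24, 25), (24, 26), (22, 1), (25, 4),
    (26, 6), (21, 27), (27, 25), (27, 9), (23, 2), (26, 5)]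
  w := 25
  known := [(1, 2), (5, 6), (9, 4), (9, 1), (9, 2), (2, 5), (2, 6)]
  nonadj := []
  carved := false
  avoid := [(29, 25, 9)]
  only := []

namespace base₁₀

def pool : List Cert := [
  ⟨0, [22, 23, 20, 21, 1, 2, 24, 26], [(20, 30)], [28, 21, 22, 31, 29, 25, 26, 27, 23, 24]⟩,
  ⟨0, [21, 22, 23, 20, 27, 1, 24, 25], [(28, 30)], [20, 21, 22, 23, 24, 25, 26, 27, 31, 29]⟩,
  ⟨0, [20, 21, 22, 23, 24, 27, 25, 4], [(29, 30)], [20, 21, 22, 23, 24, 31, 26, 27, 28, 25]⟩,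
  ⟨0, [23, 20, 21, 22, 2, 24, 26, 6], [(24, 30)], [28, 21, 22, 23, 29, 25, 26, 27, 20, 31]⟩,
  ⟨0, [23, 20, 21, 22, 2, 24, 26, 5], [(24, 30)], [28, 21, 22, 23, 29, 25, 26, 27, 20, 31]⟩,
  ⟨0, [21, 22, 23, 20, 27, 1, 24, 25], [(28, 30)], [20, 31, 22, 23, 24, 25, 26, 27, 21, 29]⟩,
  ⟨0, [20, 21, 22, 23, 24, 27, 25, 4], [(29, 30)], [20, 21, 22, 23, 24, 25, 26, 27, 28, 31]⟩,
  ⟨0, [23, 20, 21, 22, 2, 24, 26, 5], [(24, 30)], [28, 21, 22, 23, 29, 25, 31, 27, 20, 26]⟩,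
  ⟨0, [23, 20, 21, 22, 2, 24, 26, 6], [(24, 30)], [28, 21, 22, 23, 29, 25, 31, 27, 20, 26]⟩,
  ⟨0, [22, 23, 20, 21, 1, 2, 24, 26], [(20, 30)], [28, 21, 22, 23, 29, 25, 26, 27, 31, 24]⟩,
  ⟨3, [20, 21, 22, 23, 24, 25, 1], [], [20, 21, 22, 23, 24, 25, 26, 27, 28, 29, 30, 31]⟩,
  ⟨0, [20, 21, 22, 23, 24, 27, 25, 4], [(28, 29)], [20, 21, 22, 23, 24, 25, 26, 27, 30, 31]⟩,
  ⟨0, [20, 21, 22, 23, 24, 27, 26, 6], [(28, 29)], [20, 21, 22, 23, 24, 25, 26, 27, 30, 31]⟩,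
  ⟨0, [23, 20, 21, 22, 2, 24, 27, 25], [(20, 24)], [28, 21, 22, 23, 29, 25, 26, 27, 30, 31]⟩,
  ⟨0, [23, 20, 21, 22, 2, 24, 27, 9], [(20, 24)], [28, 21, 22, 23, 29, 25, 26, 27, 30, 31]⟩,
  ⟨0, [20, 21, 22, 23, 24, 27, 26, 5], [(28, 29)], [20, 21, 22, 23, 24, 25, 26, 27, 30, 31]⟩,
  ⟨0, [22, 23, 20, 21, 1, 2, 24, 25], [(28, 30)], [20, 21, 22, 23, 24, 25, 26, 27, 31, 29]⟩,
  ⟨0, [21, 22, 23, 20, 27, 1, 24, 25], [(21, 22)], [20, 28, 31, 23, 24, 25, 26, 27, 30, 29]⟩,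
  ⟨0, [20, 21, 22, 23, 24, 27, 26, 6], [(30, 29)], [20, 21, 22, 23, 24, 25, 26, 27, 28, 31]⟩,
  ⟨2, [20, 21, 22, 23, 24, 25, 27, 27, 9], [], [20, 21, 22, 23, 24, 25, 26, 27, 28, 29, 30, 31]⟩,
  ⟨0, [22, 23, 20, 21, 1, 2, 24, 26], [(20, 28)], [30, 21, 22, 31, 29, 25, 26, 27, 23, 24]⟩,
  ⟨0, [20, 21, 22, 23, 24, 27, 26, 5], [(30, 29)], [20, 21, 22, 23, 24, 25, 26, 27, 28, 31]⟩,
  ⟨1, [20, 21, 22, 23, 24, 25, 26, 21, 22], [], [20, 21, 22, 23, 24, 25, 26, 27, 28, 29, 30, 31]⟩,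
  ⟨1, [20, 21, 22, 23, 24, 25, 26, 22, 23], [], [20, 21, 22, 23, 24, 25, 26, 27, 28, 29, 30, 31]⟩,
  ⟨1, [20, 21, 22, 23, 24, 25, 26, 22, 1], [], [20, 21, 22, 23, 24, 25, 26, 27, 28, 29, 30, 31]⟩,
  ⟨1, [20, 21, 22, 23, 24, 25, 26, 21, 27], [], [20, 21, 22, 23, 24, 25, 26, 27, 28, 29, 30, 31]⟩,
  ⟨1, [20, 21, 22, 23, 24, 25, 26, 27, 9], [], [20, 21, 22, 23, 24, 25, 26, 27, 28, 29, 30, 31]⟩,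
  ⟨1, [20, 21, 22, 23, 24, 25, 26, 23, 2], [], [20, 21, 22, 23, 24, 25, 26, 27, 28, 29, 30, 31]⟩,
  ⟨0, [21, 22, 23, 20, 27, 1, 24, 26], [(30, 20)], [28, 21, 22, 23, 29, 25, 26, 27, 31, 24]⟩,
  ⟨0, [22, 23, 20, 21, 1, 2, 24, 26], [(22, 23)], [28, 21, 31, 20, 29, 25, 26, 27, 30, 24]⟩,
  ⟨2, [20, 21, 22, 23, 24, 26, 27, 27, 25], [], [20, 21, 22, 23, 30, 31, 26, 27, 28, 24, 29, 25]⟩,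
  ⟨0, [21, 22, 23, 20, 27, 1, 24, 25], [(20, 28)], [30, 31, 22, 23, 24, 25, 26, 27, 21, 29]⟩,
  ⟨0, [23, 20, 21, 22, 2, 24, 27, 25], [(24, 30)], [28, 21, 22, 23, 29, 25, 26, 27, 20, 31]⟩,
  ⟨0, [23, 20, 21, 22, 2, 24, 27, 9], [(24, 30)], [28, 21, 22, 23, 29, 25, 26, 27, 20, 31]⟩,
  ⟨3, [20, 21, 22, 23, 24, 25, 1], [(21, 22)], [20, 33, 32, 23, 24, 25, 26, 27, 28, 29, 30, 31]⟩,
  ⟨1, [20, 21, 22, 23, 24, 25, 26, 22, 23], [(30, 31)], [20, 21, 22, 23, 24, 25, 26, 27, 28, 29, 33, 32]⟩,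
  ⟨0, [22, 23, 20, 21, 1, 2, 24, 25], [(23, 32), (20, 24)], [28, 21, 22, 30, 29, 25, 26, 27, 31, 33]⟩,
  ⟨0, [22, 23, 20, 21, 1, 2, 24, 26], [(32, 31), (30, 28)], [33, 21, 22, 23, 29, 25, 26, 27, 20, 24]⟩,
  ⟨0, [22, 23, 20, 21, 1, 2, 24, 26], [(23, 32), (20, 24)], [28, 21, 22, 30, 29, 25, 26, 27, 31, 33]⟩,
  ⟨4, [20, 21, 22, 23, 24, 25, 1, 4, 25], [], [20, 21, 22, 23, 24, 25, 26, 27, 28, 29, 30, 31, 32, 33]⟩,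
  ⟨0, [22, 23, 20, 21, 1, 2, 25, 4], [(23, 32), (20, 24)], [28, 21, 22, 30, 29, 25, 26, 27, 31, 33]⟩,
  ⟨0, [22, 23, 20, 21, 1, 2, 26, 6], [(23, 32), (20, 24)], [28, 21, 22, 30, 29, 25, 26, 27, 31, 33]⟩,
  ⟨4, [20, 21, 22, 23, 24, 25, 1, 6, 26], [], [20, 21, 22, 23, 24, 25, 26, 27, 28, 29, 30, 31, 32, 33]⟩,
  ⟨0, [22, 23, 20, 21, 1, 2, 27, 25], [(23, 32), (20, 24)], [28, 21, 22, 30, 29, 25, 26, 27, 31, 33]⟩,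
  ⟨0, [22, 23, 20, 21, 1, 2, 27, 9], [(23, 32), (20, 24)], [28, 21, 22, 30, 29, 25, 26, 27, 31, 33]⟩,
  ⟨0, [22, 23, 20, 21, 1, 2, 26, 5], [(23, 32), (20, 24)], [28, 21, 22, 30, 29, 25, 26, 27, 31, 33]⟩,
  ⟨4, [20, 21, 22, 23, 24, 25, 1, 5, 26], [], [20, 21, 22, 23, 24, 25, 26, 27, 28, 29, 30, 31, 32, 33]⟩,
  ⟨1, [20, 21, 22, 23, 24, 25, 26, 21, 27], [(30, 31)], [20, 21, 22, 23, 24, 25, 26, 27, 28, 29, 33, 32]⟩,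
  ⟨2, [20, 21, 22, 23, 24, 25, 27, 27, 9], [(27, 25)], [20, 21, 22, 23, 24, 33, 26, 32, 28, 29, 30, 31]⟩,
  ⟨3, [20, 21, 22, 23, 24, 25, 1], [(22, 23)], [20, 31, 32, 33, 24, 25, 26, 27, 30, 29, 28, 21]⟩,
  ⟨0, [21, 22, 23, 20, 27, 1, 24, 25], [(21, 32), (20, 28)], [33, 31, 22, 23, 24, 25, 26, 27, 30, 29]⟩,
  ⟨0, [21, 22, 23, 20, 27, 1, 24, 26], [(32, 31), (30, 29)], [20, 28, 22, 23, 24, 25, 26, 27, 21, 33]⟩,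
  ⟨0, [21, 22, 23, 20, 27, 1, 26, 6], [(32, 31), (30, 29)], [20, 28, 22, 23, 24, 25, 26, 27, 21, 33]⟩,
  ⟨4, [20, 23, 22, 21, 24, 26, 1, 6, 26], [], [30, 31, 22, 23, 29, 25, 26, 27, 20, 24, 28, 21, 32, 33]⟩,
  ⟨0, [21, 22, 23, 20, 27, 1, 26, 5], [(32, 31), (30, 29)], [20, 28, 22, 23, 24, 25, 26, 27, 21, 33]⟩,
  ⟨4, [20, 23, 22, 21, 24, 26, 1, 5, 26], [], [30, 31, 22, 23, 29, 25, 26, 27, 20, 24, 28, 21, 32, 33]⟩,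
  ⟨0, [20, 21, 22, 23, 24, 27, 25, 4], [(25, 32), (28, 29)], [20, 21, 22, 23, 24, 30, 26, 27, 33, 31]⟩,
  ⟨1, [21, 22, 23, 20, 27, 9, 25, 20, 24], [(20, 24)], [28, 33, 22, 23, 30, 31, 26, 32, 21, 27, 25, 29]⟩,
  ⟨1, [21, 22, 23, 20, 27, 25, 9, 20, 24], [(20, 24)], [28, 21, 22, 23, 30, 31, 26, 27, 33, 32, 25, 29]⟩,
  ⟨1, [21, 22, 23, 20, 27, 9, 25, 22, 23], [(32, 31)], [20, 28, 22, 23, 24, 30, 26, 29, 21, 27, 25, 33]⟩,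
  ⟨1, [21, 22, 23, 20, 27, 9, 25, 23, 20], [(32, 31)], [20, 28, 22, 23, 24, 30, 26, 29, 21, 27, 25, 33]⟩,
  ⟨1, [21, 22, 23, 20, 27, 9, 25, 20, 24], [(32, 31)], [20, 28, 22, 23, 24, 30, 26, 29, 21, 27, 25, 33]⟩,
  ⟨1, [21, 22, 23, 20, 27, 9, 25, 24, 26], [(32, 31)], [20, 28, 22, 23, 24, 30, 26, 29, 21, 27, 25, 33]⟩,
  ⟨1, [21, 22, 23, 20, 27, 9, 25, 22, 1], [(32, 31)], [20, 28, 22, 23, 24, 30, 26, 29, 21, 27, 25, 33]⟩,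
  ⟨1, [21, 22, 23, 20, 27, 9, 25, 26, 6], [(32, 31)], [20, 28, 22, 23, 24, 30, 26, 29, 21, 27, 25, 33]⟩,
  ⟨1, [21, 22, 23, 20, 27, 9, 25, 23, 2], [(32, 31)], [20, 28, 22, 23, 24, 30, 26, 29, 21, 27, 25, 33]⟩,
  ⟨1, [21, 22, 23, 20, 27, 9, 25, 26, 5], [(32, 31)], [20, 28, 22, 23, 24, 30, 26, 29, 21, 27, 25, 33]⟩,
  ⟨1, [20, 21, 22, 23, 24, 25, 26, 21, 22], [(30, 31)], [20, 21, 22, 23, 24, 25, 26, 27, 28, 29, 33, 32]⟩,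
  ⟨2, [20, 21, 22, 23, 24, 25, 27, 27, 9], [(27, 25)], [20, 31, 22, 23, 24, 33, 26, 32, 30, 29, 28, 21]⟩,
  ⟨3, [20, 21, 22, 23, 24, 25, 1], [(22, 23)], [20, 21, 32, 33, 24, 25, 26, 27, 28, 29, 30, 31]⟩,
  ⟨0, [21, 22, 23, 20, 27, 1, 24, 25], [(32, 31), (30, 20)], [33, 21, 22, 23, 24, 25, 26, 27, 28, 29]⟩,
  ⟨0, [21, 22, 23, 20, 27, 1, 24, 26], [(21, 32), (28, 29)], [20, 30, 22, 23, 24, 25, 26, 27, 31, 33]⟩,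
  ⟨0, [21, 22, 23, 20, 27, 1, 26, 6], [(21, 32), (28, 29)], [20, 30, 22, 23, 24, 25, 26, 27, 31, 33]⟩,
  ⟨4, [20, 23, 22, 21, 24, 26, 1, 6, 26], [], [28, 21, 22, 23, 29, 25, 26, 27, 20, 24, 30, 31, 32, 33]⟩,
  ⟨0, [21, 22, 23, 20, 27, 1, 26, 5], [(21, 32), (28, 29)], [20, 30, 22, 23, 24, 25, 26, 27, 31, 33]⟩,
  ⟨4, [20, 23, 22, 21, 24, 26, 1, 5, 26], [], [28, 21, 22, 23, 29, 25, 26, 27, 20, 24, 30, 31, 32, 33]⟩,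
  ⟨0, [20, 21, 22, 23, 24, 27, 25, 4], [(32, 31), (30, 28)], [20, 21, 22, 23, 24, 29, 26, 27, 33, 25]⟩,
  ⟨1, [21, 22, 23, 20, 27, 9, 25, 20, 24], [(20, 24)], [28, 33, 22, 23, 29, 25, 26, 32, 21, 27, 31, 30]⟩,
  ⟨1, [21, 22, 23, 20, 27, 25, 9, 20, 24], [(20, 24)], [28, 21, 22, 23, 29, 25, 26, 27, 33, 32, 31, 30]⟩,
  ⟨1, [21, 22, 23, 20, 27, 9, 25, 22, 23], [(25, 32)], [20, 28, 22, 23, 24, 29, 26, 30, 21, 27, 31, 33]⟩,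
  ⟨1, [21, 22, 23, 20, 27, 9, 25, 23, 20], [(25, 32)], [20, 28, 22, 23, 24, 29, 26, 30, 21, 27, 31, 33]⟩,
  ⟨1, [21, 22, 23, 20, 27, 9, 25, 20, 24], [(25, 32)], [20, 28, 22, 23, 24, 29, 26, 30, 21, 27, 31, 33]⟩,
  ⟨1, [21, 22, 23, 20, 27, 9, 25, 24, 26], [(25, 32)], [20, 28, 22, 23, 24, 29, 26, 30, 21, 27, 31, 33]⟩,
  ⟨1, [21, 22, 23, 20, 27, 9, 25, 22, 1], [(25, 32)], [20, 28, 22, 23, 24, 29, 26, 30, 21, 27, 31, 33]⟩,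
  ⟨1, [21, 22, 23, 20, 27, 9, 25, 26, 6], [(25, 32)], [20, 28, 22, 23, 24, 29, 26, 30, 21, 27, 31, 33]⟩,
  ⟨1, [21, 22, 23, 20, 27, 9, 25, 23, 2], [(25, 32)], [20, 28, 22, 23, 24, 29, 26, 30, 21, 27, 31, 33]⟩,
  ⟨1, [21, 22, 23, 20, 27, 9, 25, 26, 5], [(25, 32)], [20, 28, 22, 23, 24, 29, 26, 30, 21, 27, 31, 33]⟩,
  ⟨3, [20, 21, 22, 23, 24, 25, 1], [(21, 22)], [30, 33, 32, 31, 24, 25, 26, 27, 28, 29, 20, 23]⟩,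
  ⟨1, [20, 21, 22, 23, 24, 25, 26, 23, 2], [(30, 31)], [20, 21, 22, 23, 24, 25, 26, 27, 28, 29, 33, 32]⟩,
  ⟨0, [22, 23, 20, 21, 1, 2, 24, 25], [(32, 31), (30, 24)], [28, 21, 22, 20, 29, 25, 26, 27, 23, 33]⟩,
  ⟨0, [22, 23, 20, 21, 1, 2, 24, 26], [(23, 32), (20, 28)], [33, 21, 22, 31, 29, 25, 26, 27, 30, 24]⟩,
  ⟨0, [22, 23, 20, 21, 1, 2, 24, 26], [(32, 31), (30, 24)], [28, 21, 22, 20, 29, 25, 26, 27, 23, 33]⟩,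
  ⟨4, [20, 21, 22, 23, 24, 25, 1, 4, 25], [], [30, 21, 22, 31, 24, 25, 26, 27, 28, 29, 20, 23, 32, 33]⟩,
  ⟨0, [22, 23, 20, 21, 1, 2, 25, 4], [(32, 31), (30, 24)], [28, 21, 22, 20, 29, 25, 26, 27, 23, 33]⟩,
  ⟨0, [22, 23, 20, 21, 1, 2, 26, 6], [(32, 31), (30, 24)], [28, 21, 22, 20, 29, 25, 26, 27, 23, 33]⟩,
  ⟨4, [20, 21, 22, 23, 24, 25, 1, 6, 26], [], [30, 21, 22, 31, 24, 25, 26, 27, 28, 29, 20, 23, 32, 33]⟩,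
  ⟨0, [22, 23, 20, 21, 1, 2, 27, 25], [(32, 31), (30, 24)], [28, 21, 22, 20, 29, 25, 26, 27, 23, 33]⟩,
  ⟨0, [22, 23, 20, 21, 1, 2, 27, 9], [(32, 31), (30, 24)], [28, 21, 22, 20, 29, 25, 26, 27, 23, 33]⟩,
  ⟨0, [22, 23, 20, 21, 1, 2, 26, 5], [(32, 31), (30, 24)], [28, 21, 22, 20, 29, 25, 26, 27, 23, 33]⟩,
  ⟨4, [20, 21, 22, 23, 24, 25, 1, 5, 26], [], [30, 21, 22, 31, 24, 25, 26, 27, 28, 29, 20, 23, 32, 33]⟩,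
  ⟨1, [21, 22, 23, 20, 27, 9, 25, 22, 1], [(27, 25)], [20, 30, 31, 23, 24, 29, 26, 28, 32, 33, 21, 22]⟩,
  ⟨1, [20, 21, 22, 23, 24, 25, 26, 27, 9], [(25, 33)], [20, 21, 22, 23, 24, 32, 26, 31, 28, 30, 29, 27]⟩,
  ⟨0, [23, 20, 21, 22, 2, 24, 26, 5], [(32, 31), (26, 33)], [28, 21, 22, 23, 29, 25, 30, 27, 20, 24]⟩,
  ⟨0, [23, 20, 21, 22, 2, 24, 26, 6], [(32, 31), (26, 33)], [28, 21, 22, 23, 29, 25, 30, 27, 20, 24]⟩,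
  ⟨3, [21, 22, 23, 20, 27, 9, 2], [(27, 25)], [20, 30, 22, 23, 24, 29, 26, 28, 31, 21, 32, 33]⟩,
  ⟨0, [21, 22, 23, 20, 27, 1, 24, 25], [(32, 31), (21, 33)], [20, 28, 22, 23, 24, 25, 26, 27, 30, 29]⟩,
  ⟨0, [23, 20, 21, 22, 2, 24, 26, 6], [(32, 31), (26, 33)], [28, 21, 22, 23, 29, 25, 24, 27, 20, 30]⟩,
  ⟨0, [23, 20, 21, 22, 2, 24, 26, 5], [(32, 31), (26, 33)], [28, 21, 22, 23, 29, 25, 24, 27, 20, 30]⟩,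
  ⟨1, [20, 21, 22, 23, 24, 26, 25, 23, 2], [(29, 33)], [30, 21, 22, 31, 32, 25, 26, 27, 28, 24, 20, 23]⟩,
  ⟨1, [20, 21, 22, 23, 24, 26, 25, 21, 27], [(24, 33)], [20, 21, 22, 23, 29, 25, 26, 27, 28, 32, 30, 31]⟩,
  ⟨0, [23, 20, 21, 22, 2, 24, 27, 25], [(32, 30), (20, 33)], [28, 21, 22, 23, 24, 31, 26, 27, 29, 25]⟩,
  ⟨1, [20, 21, 22, 23, 24, 26, 25, 21, 27], [(24, 33)], [20, 31, 22, 23, 29, 25, 26, 27, 30, 32, 28, 21]⟩,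
  ⟨0, [23, 20, 21, 22, 2, 24, 27, 25], [(29, 32), (20, 33)], [28, 21, 22, 23, 24, 25, 26, 27, 30, 31]⟩,
  ⟨1, [20, 21, 22, 23, 24, 26, 25, 23, 2], [(29, 33)], [20, 21, 22, 23, 32, 25, 26, 27, 28, 24, 30, 31]⟩,
  ⟨5, [20, 21, 22, 23, 24, 25, 27, 27, 25], [], [20, 21, 22, 23, 24, 35, 26, 27, 32, 34, 28, 25, 30, 31, 33, 29]⟩,
  ⟨1, [20, 21, 22, 23, 24, 25, 26, 27, 9], [(25, 35), (21, 22)], [20, 30, 31, 23, 24, 29, 26, 28, 32, 33, 34, 27]⟩,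
  ⟨0, [23, 20, 21, 22, 2, 24, 26, 6], [(33, 34), (32, 30), (27, 25)], [28, 21, 22, 23, 24, 29, 26, 31, 20, 35]⟩,
  ⟨0, [23, 20, 21, 22, 2, 24, 26, 5], [(33, 34), (32, 30), (27, 25)], [28, 21, 22, 23, 24, 29, 26, 31, 20, 35]⟩,
  ⟨5, [20, 21, 22, 23, 24, 25, 27, 27, 25], [], [20, 21, 22, 23, 24, 31, 26, 27, 33, 30, 28, 25, 34, 35, 32, 29]⟩,
  ⟨3, [21, 22, 23, 20, 27, 9, 2], [(33, 34), (32, 30)], [20, 29, 22, 23, 24, 31, 26, 25, 21, 27, 28, 35]⟩,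
  ⟨0, [23, 20, 21, 22, 2, 24, 26, 5], [(33, 34), (32, 30), (22, 23)], [28, 21, 31, 20, 29, 25, 35, 27, 24, 26]⟩,
  ⟨0, [23, 20, 21, 22, 2, 24, 26, 6], [(33, 34), (32, 30), (22, 23)], [28, 21, 31, 20, 29, 25, 35, 27, 24, 26]⟩,
  ⟨3, [21, 22, 23, 20, 27, 9, 2], [(34, 24), (23, 35)], [32, 30, 22, 33, 29, 25, 26, 31, 21, 27, 28, 20]⟩,
  ⟨5, [20, 21, 22, 23, 24, 25, 27, 27, 25], [], [34, 21, 22, 35, 24, 25, 26, 27, 33, 29, 28, 31, 20, 23, 32, 30]⟩,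
  ⟨1, [20, 21, 22, 23, 24, 25, 26, 27, 9], [(25, 35), (21, 22)], [30, 20, 23, 31, 24, 34, 26, 28, 32, 33, 29, 27]⟩,
  ⟨5, [20, 21, 22, 23, 24, 25, 27, 27, 25], [], [30, 21, 22, 31, 24, 25, 26, 27, 32, 29, 28, 35, 20, 23, 33, 34]⟩,
  ⟨6, [20, 21, 22, 23, 24, 25], [], [20, 21, 22, 23, 24, 25, 26, 27, 28, 29, 30, 31, 32, 33, 34, 35, 36, 37]⟩,
  ⟨5, [20, 21, 22, 23, 24, 25, 27, 27, 25], [(22, 23)], [35, 31, 21, 20, 24, 25, 26, 27, 34, 29, 36, 33, 30, 28, 32, 37]⟩,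
  ⟨0, [23, 20, 21, 22, 2, 24, 26, 5], [(30, 36), (20, 35), (28, 29), (21, 27)], [32, 34, 22, 23, 37, 31, 33, 25, 24, 26]⟩,
  ⟨0, [23, 20, 21, 22, 2, 24, 26, 6], [(30, 36), (20, 35), (28, 29), (21, 27)], [32, 34, 22, 23, 37, 31, 33, 25, 24, 26]⟩,
  ⟨6, [20, 21, 22, 23, 24, 25], [], [20, 21, 22, 23, 24, 25, 26, 27, 28, 29, 32, 33, 30, 31, 34, 35, 37, 36]⟩,
  ⟨5, [20, 21, 22, 23, 24, 25, 27, 27, 25], [(22, 23)], [35, 33, 21, 20, 24, 25, 26, 27, 34, 29, 37, 31, 32, 28, 30, 36]⟩,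
  ⟨0, [23, 20, 21, 22, 2, 24, 26, 6], [(30, 36), (29, 35), (20, 28), (21, 22)], [32, 34, 23, 31, 24, 25, 26, 27, 37, 33]⟩,
  ⟨0, [23, 20, 21, 22, 2, 24, 26, 5], [(30, 36), (29, 35), (20, 28), (21, 22)], [32, 34, 23, 31, 24, 25, 26, 27, 37, 33]⟩,
  ⟨6, [20, 21, 22, 23, 24, 25], [(21, 22)], [20, 28, 31, 23, 24, 25, 26, 27, 35, 29, 32, 37, 39, 30, 38, 33, 36, 34]⟩,
  ⟨6, [20, 21, 22, 23, 24, 25], [(22, 23)], [33, 31, 21, 20, 24, 25, 26, 27, 30, 29, 38, 28, 34, 37, 39, 35, 32, 36]⟩,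
  ⟨5, [20, 21, 22, 23, 24, 25, 27, 27, 25], [(22, 23), (21, 27)], [35, 29, 28, 20, 24, 31, 26, 25, 39, 30, 32, 37, 38, 33, 34, 36]⟩,
  ⟨6, [20, 21, 22, 23, 24, 25], [(22, 23)], [35, 21, 31, 20, 24, 25, 26, 27, 28, 29, 39, 30, 32, 37, 38, 33, 34, 36]⟩,
  ⟨5, [20, 21, 22, 23, 24, 25, 27, 27, 25], [(22, 23), (21, 27)], [33, 30, 28, 20, 24, 25, 26, 31, 38, 29, 34, 37, 39, 35, 32, 36]⟩,
  ⟨6, [20, 21, 22, 23, 24, 25], [(21, 22)], [30, 28, 23, 31, 24, 25, 26, 27, 33, 29, 34, 37, 38, 20, 39, 35, 36, 32]⟩]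

def pre : List (List ℕ) := [
  [20, 28, 29, 24, 23, 2], [28, 29, 24, 20, 21, 22], [29, 24, 20, 28, 25, 27],
  [24, 20, 28, 29, 26, 6], [24, 20, 28, 29, 26, 5], [28, 20, 24, 29, 21, 27],
  [29, 28, 20, 24, 25, 4], [24, 29, 28, 20, 26, 6], [24, 29, 28, 20, 26, 5],
  [20, 24, 29, 28, 23, 22]]

theorem check_pre : base₁₀.checkPre pool pre
  [[0], [1], [2], [3], [4], [5], [6], [7], [8], [9]] = true := by
  decide +kernel

theorem check_specA : base₁₀.checkType pre pool 0 specA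
  [[10], [10], [11], [11], [12], [12], [13], [13], [14], [14], [15], [15], [16], [16], [17], [17],
  [18], [18], [19], [19], [20], [20], [21], [21], [22], [22], [23], [23], [24], [24], [25], [25],
  [26], [26], [27], [27], [28], [28], [29], [29], [30], [30], [31], [31], [32], [32], [33], [33],
  [10], [10], [11], [11], [12], [12], [13], [13], [14], [14], [15], [15], [16], [16], [17], [17],
  [18], [18], [19], [19], [20], [20], [21], [21], [22], [22], [23], [23], [24], [24], [25], [25],
  [26], [26], [27], [27], [28], [28], [29], [29], [30], [30], [31], [31], [32], [32], [33], [33]] = true := by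
  decide +kernel

theorem check_specB : base₁₀.checkType pre pool 1 specB
  [[34], [34], [35], [35], [36], [36], [37], [37], [38], [38], [39, 40], [39, 40], [41, 42],
  [41, 42], [34], [34], [43], [43], [44], [44], [45, 46], [45, 46], [47], [47], [48], [48], [49],
  [49], [50], [50], [51], [51], [48], [48], [52, 53], [52, 53], [49], [49], [54, 55], [54, 55],
  [56], [56], [57], [57], [58], [58], [59], [59], [60], [60], [61], [61], [62], [62], [63], [63],
  [64], [64], [65], [65], [66], [66], [67], [67], [68], [68], [69], [69], [70], [70], [71], [71],
  [68], [68], [72, 73], [72, 73], [69], [69], [74, 75], [74, 75], [76], [76], [77], [77], [78],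
  [78], [79], [79], [80], [80], [81], [81], [82], [82], [83], [83], [84], [84], [85], [85], [86],
  [86], [87], [87], [88], [88], [89], [89], [90], [90], [91], [91], [92, 93], [92, 93], [94, 95],
  [94, 95], [87], [87], [96], [96], [97], [97], [98, 99], [98, 99]] = true := by
  decide +kernel

theorem check_specC : base₁₀.checkType pre pool 2 specC
  [[100], [101], [102], [103], [104], [105], [106], [107]] = true := by
  decide +kernel

theorem check_specD : base₁₀.checkType pre pool 3 specD
  [[108], [109], [110], [111], [112], [113]] = true := by
  decide +kernel

theorem check_specE : base₁₀.checkType pre pool 4 specE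
  [[114], [115], [116], [117], [118], [119], [120], [121], [122], [123], [124], [125]] = true := by
  decide +kernel

theorem check_specF : base₁₀.checkType pre pool 5 specF
  [[126], [127], [128], [129], [130], [131], [132], [133]] = true := by
  decide +kernel

theorem check_specG : base₁₀.checkType pre pool 6 specG
  [[134], [135], [136], [137], [138], [139]] = true := by
  decide +kernel

theorem checked : base₁₀.Checked :=
  ⟨by decide +kernel, pool, pre, ⟨_, check_pre⟩, forall_specs (fun _ => ⟨_, check_specA⟩)
    (fun _ => ⟨_, check_specB⟩) (fun _ => ⟨_, check_specC⟩) (fun _ => ⟨_, check_specD⟩)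
    (fun _ => ⟨_, check_specE⟩) (fun _ => ⟨_, check_specF⟩) (fun _ => ⟨_, check_specG⟩)⟩

end base₁₀

def base₁₀.nonadj : List (ℕ × ℕ) := [(1, 2)]

namespace base₁₀.carved

def pool : List Cert := [
  ⟨0, [22, 23, 20, 21, 1, 2, 24, 26], [(20, 30)], [28, 21, 22, 31, 29, 25, 26, 27, 23, 24]⟩,
  ⟨0, [21, 22, 23, 20, 27, 1, 24, 25], [(28, 30)], [20, 21, 22, 23, 24, 25, 26, 27, 31, 29]⟩,
  ⟨0, [20, 21, 22, 23, 24, 27, 25, 4], [(29, 30)], [20, 21, 22, 23, 24, 31, 26, 27, 28, 25]⟩,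
  ⟨0, [23, 20, 21, 22, 2, 24, 26, 6], [(24, 30)], [28, 21, 22, 23, 29, 25, 26, 27, 20, 31]⟩,
  ⟨0, [23, 20, 21, 22, 2, 24, 26, 5], [(24, 30)], [28, 21, 22, 23, 29, 25, 26, 27, 20, 31]⟩,
  ⟨0, [21, 22, 23, 20, 27, 1, 24, 25], [(28, 30)], [20, 31, 22, 23, 24, 25, 26, 27, 21, 29]⟩,
  ⟨0, [20, 21, 22, 23, 24, 27, 25, 4], [(29, 30)], [20, 21, 22, 23, 24, 25, 26, 27, 28, 31]⟩,
  ⟨0, [23, 20, 21, 22, 2, 24, 26, 5], [(24, 30)], [28, 21, 22, 23, 29, 25, 31, 27, 20, 26]⟩,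
  ⟨0, [23, 20, 21, 22, 2, 24, 26, 6], [(24, 30)], [28, 21, 22, 23, 29, 25, 31, 27, 20, 26]⟩,
  ⟨0, [22, 23, 20, 21, 1, 2, 24, 26], [(20, 30)], [28, 21, 22, 23, 29, 25, 26, 27, 31, 24]⟩,
  ⟨0, [20, 21, 22, 23, 24, 27, 7, 8], [(28, 29)], [20, 21, 22, 23, 24, 25, 26, 27, 30, 31]⟩,
  ⟨0, [20, 21, 22, 23, 24, 27, 7, 8], [(30, 29)], [20, 21, 22, 23, 24, 25, 26, 27, 28, 31]⟩,
  ⟨1, [20, 21, 22, 23, 24, 25, 26, 7, 8], [], [20, 21, 22, 23, 24, 25, 26, 27, 28, 29, 30, 31]⟩,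
  ⟨2, [20, 23, 22, 21, 24, 26, 2, 7, 8], [], [28, 21, 22, 23, 29, 25, 26, 27, 20, 24, 30, 31]⟩,
  ⟨2, [20, 23, 22, 21, 24, 26, 2, 8, 7], [], [28, 21, 22, 23, 29, 25, 26, 27, 20, 24, 30, 31]⟩,
  ⟨0, [23, 20, 21, 22, 2, 24, 7, 8], [(24, 30)], [28, 21, 22, 23, 29, 25, 26, 27, 20, 31]⟩,
  ⟨4, [20, 21, 22, 23, 24, 25, 1, 7, 8], [], [20, 21, 22, 23, 24, 25, 26, 27, 28, 29, 30, 31, 32, 33]⟩,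
  ⟨4, [20, 21, 22, 23, 24, 25, 1, 8, 7], [], [20, 21, 22, 23, 24, 25, 26, 27, 28, 29, 30, 31, 32, 33]⟩,
  ⟨0, [22, 23, 20, 21, 1, 2, 7, 8], [(23, 32), (20, 24)], [28, 21, 22, 30, 29, 25, 26, 27, 31, 33]⟩,
  ⟨4, [20, 23, 22, 21, 24, 26, 1, 7, 8], [], [30, 31, 22, 23, 29, 25, 26, 27, 20, 24, 28, 21, 32, 33]⟩,
  ⟨4, [20, 23, 22, 21, 24, 26, 1, 8, 7], [], [30, 31, 22, 23, 29, 25, 26, 27, 20, 24, 28, 21, 32, 33]⟩,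
  ⟨0, [21, 22, 23, 20, 27, 1, 7, 8], [(32, 31), (30, 29)], [20, 28, 22, 23, 24, 25, 26, 27, 21, 33]⟩,
  ⟨1, [21, 22, 23, 20, 27, 9, 25, 7, 8], [(32, 31)], [20, 28, 22, 23, 24, 30, 26, 29, 21, 27, 25, 33]⟩,
  ⟨4, [20, 23, 22, 21, 24, 26, 1, 7, 8], [], [28, 21, 22, 23, 29, 25, 26, 27, 20, 24, 30, 31, 32, 33]⟩,
  ⟨4, [20, 23, 22, 21, 24, 26, 1, 8, 7], [], [28, 21, 22, 23, 29, 25, 26, 27, 20, 24, 30, 31, 32, 33]⟩,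
  ⟨0, [21, 22, 23, 20, 27, 1, 7, 8], [(21, 32), (28, 29)], [20, 30, 22, 23, 24, 25, 26, 27, 31, 33]⟩,
  ⟨1, [21, 22, 23, 20, 27, 9, 25, 7, 8], [(25, 32)], [20, 28, 22, 23, 24, 29, 26, 30, 21, 27, 31, 33]⟩,
  ⟨4, [20, 21, 22, 23, 24, 25, 1, 7, 8], [], [30, 21, 22, 31, 24, 25, 26, 27, 28, 29, 20, 23, 32, 33]⟩,
  ⟨4, [20, 21, 22, 23, 24, 25, 1, 8, 7], [], [30, 21, 22, 31, 24, 25, 26, 27, 28, 29, 20, 23, 32, 33]⟩,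
  ⟨0, [22, 23, 20, 21, 1, 2, 7, 8], [(32, 31), (30, 24)], [28, 21, 22, 20, 29, 25, 26, 27, 23, 33]⟩]

def pre : List (List ℕ) := [
  [20, 28, 29, 24, 23, 2], [28, 29, 24, 20, 21, 22], [29, 24, 20, 28, 25, 27],
  [24, 20, 28, 29, 26, 6], [24, 20, 28, 29, 26, 5], [28, 20, 24, 29, 21, 27],
  [29, 28, 20, 24, 25, 4], [24, 29, 28, 20, 26, 6], [24, 29, 28, 20, 26, 5],
  [20, 24, 29, 28, 23, 22]]

theorem check_pre : (base₁₀.carve base₁₀.nonadj).checkPre pool pre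
  [[0], [1], [2], [3], [4], [5], [6], [7], [8], [9]] = true := by
  decide +kernel

theorem check_specA : (base₁₀.carve base₁₀.nonadj).checkType pre pool 0 specA
  [[10], [10], [11], [11], [12], [12], [13, 14, 15], [13, 14, 15], [10], [10], [11], [11], [12],
  [12], [13, 14, 15], [13, 14, 15]] = true := by
  decide +kernel

theorem check_specB : (base₁₀.carve base₁₀.nonadj).checkType pre pool 1 specB
  [[16, 17, 18], [16, 17, 18], [19, 20, 21], [19, 20, 21], [22], [22], [23, 24, 25], [23, 24, 25],
  [26], [26], [27, 28, 29], [27, 28, 29]] = true := by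
  decide +kernel

theorem checked : (base₁₀.carve base₁₀.nonadj).Checked :=
  ⟨by decide +kernel, pool, pre, ⟨_, check_pre⟩, forall_specs (fun _ => ⟨_, check_specA⟩)
    (fun _ => ⟨_, check_specB⟩) (by simp [Base.carve]) (by simp [Base.carve])
    (by simp [Base.carve]) (by simp [Base.carve]) (by simp [Base.carve])⟩

end base₁₀.carved

def base₁₁ : Base where
  m := 29
  E := [
    (20, 21), (21, 22), (22, 23), (23, 20), (20, 24), (24, 25), (24, 26), (22, 1), (25, 4),
    (26, 6), (21, 27), (27, 25), (27, 9), (23, 28), (28, 26), (28, 10)]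
  w := 25
  known := [(9, 4), (9, 1), (10, 6), (10, 1)]
  nonadj := []
  carved := false
  avoid := [(30, 25, 9), (24, 26, 10)]
  only := []

namespace base₁₁

def pool : List Cert := [
  ⟨0, [22, 23, 20, 21, 1, 28, 24, 26], [(20, 31)], [29, 21, 22, 32, 30, 25, 26, 27, 28, 23, 24]⟩,
  ⟨0, [21, 22, 23, 20, 27, 1, 24, 25], [(29, 31)], [20, 21, 22, 23, 24, 25, 26, 27, 28, 32, 30]⟩,
  ⟨0, [20, 21, 22, 23, 24, 27, 25, 4], [(30, 31)], [20, 21, 22, 23, 24, 32, 26, 27, 28, 29, 25]⟩,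
  ⟨0, [23, 20, 21, 22, 28, 24, 26, 6], [(24, 31)], [29, 21, 22, 23, 30, 25, 26, 27, 28, 20, 32]⟩,
  ⟨0, [21, 22, 23, 20, 27, 1, 24, 25], [(29, 31)], [20, 32, 22, 23, 24, 25, 26, 27, 28, 21, 30]⟩,
  ⟨0, [20, 21, 22, 23, 24, 27, 25, 4], [(30, 31)], [20, 21, 22, 23, 24, 25, 26, 27, 28, 29, 32]⟩,
  ⟨0, [23, 20, 21, 22, 28, 24, 26, 6], [(24, 31)], [29, 21, 22, 23, 30, 25, 32, 27, 28, 20, 26]⟩,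
  ⟨0, [22, 23, 20, 21, 1, 28, 24, 26], [(20, 31)], [29, 21, 22, 23, 30, 25, 26, 27, 28, 32, 24]⟩,
  ⟨3, [20, 21, 22, 23, 24, 25, 1], [], [20, 21, 22, 23, 24, 25, 26, 27, 28, 29, 30, 31, 32]⟩,
  ⟨0, [20, 21, 22, 23, 24, 27, 25, 4], [(29, 30)], [20, 21, 22, 23, 24, 25, 26, 27, 28, 31, 32]⟩,
  ⟨0, [20, 21, 22, 23, 24, 27, 26, 6], [(29, 30)], [20, 21, 22, 23, 24, 25, 26, 27, 28, 31, 32]⟩,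
  ⟨0, [23, 20, 21, 22, 28, 24, 27, 25], [(20, 24)], [29, 21, 22, 23, 30, 25, 26, 27, 28, 31, 32]⟩,
  ⟨0, [23, 20, 21, 22, 28, 24, 27, 9], [(20, 24)], [29, 21, 22, 23, 30, 25, 26, 27, 28, 31, 32]⟩,
  ⟨0, [20, 21, 22, 23, 24, 27, 28, 26], [(29, 30)], [20, 21, 22, 23, 24, 25, 26, 27, 28, 31, 32]⟩,
  ⟨0, [20, 21, 22, 23, 24, 27, 28, 10], [(29, 30)], [20, 21, 22, 23, 24, 25, 26, 27, 28, 31, 32]⟩,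
  ⟨0, [22, 23, 20, 21, 1, 28, 24, 25], [(29, 31)], [20, 21, 22, 23, 24, 25, 26, 27, 28, 32, 30]⟩,
  ⟨0, [21, 22, 23, 20, 27, 1, 24, 25], [(21, 22)], [20, 29, 32, 23, 24, 25, 26, 27, 28, 31, 30]⟩,
  ⟨2, [23, 20, 21, 22, 28, 26, 24, 24, 25], [], [29, 21, 22, 23, 31, 25, 32, 27, 28, 20, 26, 24, 30]⟩,
  ⟨2, [20, 21, 22, 23, 24, 25, 27, 27, 9], [], [20, 21, 22, 23, 24, 25, 26, 27, 28, 29, 30, 31, 32]⟩,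
  ⟨0, [22, 23, 20, 21, 1, 28, 24, 26], [(20, 29)], [31, 21, 22, 32, 30, 25, 26, 27, 28, 23, 24]⟩,
  ⟨0, [20, 21, 22, 23, 24, 27, 28, 26], [(31, 30)], [20, 21, 22, 23, 24, 25, 26, 27, 28, 29, 32]⟩,
  ⟨0, [20, 21, 22, 23, 24, 27, 28, 10], [(31, 30)], [20, 21, 22, 23, 24, 25, 26, 27, 28, 29, 32]⟩,
  ⟨1, [20, 21, 22, 23, 24, 25, 26, 21, 22], [], [20, 21, 22, 23, 24, 25, 26, 27, 28, 29, 30, 31, 32]⟩,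
  ⟨1, [20, 21, 22, 23, 24, 25, 26, 22, 23], [], [20, 21, 22, 23, 24, 25, 26, 27, 28, 29, 30, 31, 32]⟩,
  ⟨1, [20, 21, 22, 23, 24, 25, 26, 22, 1], [], [20, 21, 22, 23, 24, 25, 26, 27, 28, 29, 30, 31, 32]⟩,
  ⟨1, [20, 21, 22, 23, 24, 25, 26, 21, 27], [], [20, 21, 22, 23, 24, 25, 26, 27, 28, 29, 30, 31, 32]⟩,
  ⟨1, [20, 21, 22, 23, 24, 25, 26, 27, 9], [], [20, 21, 22, 23, 24, 25, 26, 27, 28, 29, 30, 31, 32]⟩,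
  ⟨1, [20, 21, 22, 23, 24, 25, 26, 23, 28], [], [20, 21, 22, 23, 24, 25, 26, 27, 28, 29, 30, 31, 32]⟩,
  ⟨1, [20, 21, 22, 23, 24, 25, 26, 28, 10], [], [20, 21, 22, 23, 24, 25, 26, 27, 28, 29, 30, 31, 32]⟩,
  ⟨0, [21, 22, 23, 20, 27, 1, 24, 26], [(31, 20)], [29, 21, 22, 23, 30, 25, 26, 27, 28, 32, 24]⟩,
  ⟨0, [22, 23, 20, 21, 1, 28, 24, 26], [(22, 23)], [29, 21, 32, 20, 30, 25, 26, 27, 28, 31, 24]⟩,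
  ⟨2, [20, 21, 22, 23, 24, 26, 27, 27, 25], [], [20, 21, 22, 23, 31, 32, 26, 27, 28, 29, 24, 30, 25]⟩,
  ⟨0, [21, 22, 23, 20, 27, 1, 24, 25], [(20, 29)], [31, 32, 22, 23, 24, 25, 26, 27, 28, 21, 30]⟩,
  ⟨0, [23, 20, 21, 22, 28, 24, 27, 25], [(24, 31)], [29, 21, 22, 23, 30, 25, 26, 27, 28, 20, 32]⟩,
  ⟨0, [23, 20, 21, 22, 28, 24, 27, 9], [(24, 31)], [29, 21, 22, 23, 30, 25, 26, 27, 28, 20, 32]⟩,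
  ⟨2, [23, 20, 21, 22, 28, 10, 24, 24, 26], [], [29, 21, 22, 23, 30, 25, 26, 27, 28, 20, 32, 31, 24]⟩,
  ⟨3, [20, 21, 22, 23, 24, 25, 1], [(21, 22)], [20, 34, 33, 23, 24, 25, 26, 27, 28, 29, 30, 31, 32]⟩,
  ⟨1, [20, 21, 22, 23, 24, 25, 26, 22, 23], [(31, 32)], [20, 21, 22, 23, 24, 25, 26, 27, 28, 29, 30, 34, 33]⟩,
  ⟨0, [22, 23, 20, 21, 1, 28, 24, 25], [(23, 33), (20, 24)], [29, 21, 22, 31, 30, 25, 26, 27, 28, 32, 34]⟩,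
  ⟨0, [22, 23, 20, 21, 1, 28, 24, 26], [(33, 32), (31, 29)], [34, 21, 22, 23, 30, 25, 26, 27, 28, 20, 24]⟩,
  ⟨2, [23, 20, 21, 22, 28, 10, 24, 24, 26], [(28, 26)], [29, 21, 22, 32, 30, 25, 34, 27, 33, 31, 23, 20, 24]⟩,
  ⟨0, [22, 23, 20, 21, 1, 28, 25, 4], [(23, 33), (20, 24)], [29, 21, 22, 31, 30, 25, 26, 27, 28, 32, 34]⟩,
  ⟨4, [20, 21, 22, 23, 24, 25, 1, 4, 25], [], [20, 21, 22, 23, 24, 25, 26, 27, 28, 29, 30, 31, 32, 33, 34]⟩,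
  ⟨0, [22, 23, 20, 21, 1, 28, 27, 25], [(23, 33), (20, 24)], [29, 21, 22, 31, 30, 25, 26, 27, 28, 32, 34]⟩,
  ⟨0, [22, 23, 20, 21, 1, 28, 27, 9], [(23, 33), (20, 24)], [29, 21, 22, 31, 30, 25, 26, 27, 28, 32, 34]⟩,
  ⟨1, [20, 21, 22, 23, 24, 25, 26, 21, 27], [(31, 32)], [20, 21, 22, 23, 24, 25, 26, 27, 28, 29, 30, 34, 33]⟩,
  ⟨2, [20, 21, 22, 23, 24, 25, 27, 27, 9], [(27, 25)], [20, 21, 22, 23, 24, 34, 26, 33, 28, 29, 30, 31, 32]⟩,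
  ⟨3, [20, 21, 22, 23, 24, 25, 1], [(22, 23)], [20, 32, 33, 34, 24, 25, 26, 27, 28, 31, 30, 29, 21]⟩,
  ⟨0, [21, 22, 23, 20, 27, 1, 24, 25], [(21, 33), (20, 29)], [34, 32, 22, 23, 24, 25, 26, 27, 28, 31, 30]⟩,
  ⟨0, [21, 22, 23, 20, 27, 1, 24, 26], [(33, 32), (31, 30)], [20, 29, 22, 23, 24, 25, 26, 27, 28, 21, 34]⟩,
  ⟨0, [21, 22, 23, 20, 27, 1, 26, 6], [(33, 32), (31, 30)], [20, 29, 22, 23, 24, 25, 26, 27, 28, 21, 34]⟩,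
  ⟨4, [20, 23, 22, 21, 24, 26, 1, 6, 26], [], [31, 32, 22, 23, 30, 25, 26, 27, 28, 20, 24, 29, 21, 33, 34]⟩,
  ⟨0, [21, 22, 23, 20, 27, 1, 28, 26], [(33, 32), (31, 30)], [20, 29, 22, 23, 24, 25, 26, 27, 28, 21, 34]⟩,
  ⟨0, [21, 22, 23, 20, 27, 1, 28, 10], [(33, 32), (31, 30)], [20, 29, 22, 23, 24, 25, 26, 27, 28, 21, 34]⟩,
  ⟨0, [20, 21, 22, 23, 24, 27, 25, 4], [(25, 33), (29, 30)], [20, 21, 22, 23, 24, 31, 26, 27, 28, 34, 32]⟩,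
  ⟨1, [21, 22, 23, 20, 27, 9, 25, 20, 24], [(20, 24)], [29, 34, 22, 23, 31, 32, 26, 33, 28, 21, 27, 25, 30]⟩,
  ⟨1, [21, 22, 23, 20, 27, 25, 9, 20, 24], [(20, 24)], [29, 21, 22, 23, 31, 32, 26, 27, 28, 34, 33, 25, 30]⟩,
  ⟨1, [21, 22, 23, 20, 27, 9, 25, 22, 23], [(33, 32)], [20, 29, 22, 23, 24, 31, 26, 30, 28, 21, 27, 25, 34]⟩,
  ⟨1, [21, 22, 23, 20, 27, 9, 25, 23, 20], [(33, 32)], [20, 29, 22, 23, 24, 31, 26, 30, 28, 21, 27, 25, 34]⟩,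
  ⟨1, [21, 22, 23, 20, 27, 9, 25, 20, 24], [(33, 32)], [20, 29, 22, 23, 24, 31, 26, 30, 28, 21, 27, 25, 34]⟩,
  ⟨1, [21, 22, 23, 20, 27, 9, 25, 24, 26], [(33, 32)], [20, 29, 22, 23, 24, 31, 26, 30, 28, 21, 27, 25, 34]⟩,
  ⟨1, [21, 22, 23, 20, 27, 9, 25, 22, 1], [(33, 32)], [20, 29, 22, 23, 24, 31, 26, 30, 28, 21, 27, 25, 34]⟩,
  ⟨1, [21, 22, 23, 20, 27, 9, 25, 26, 6], [(33, 32)], [20, 29, 22, 23, 24, 31, 26, 30, 28, 21, 27, 25, 34]⟩,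
  ⟨1, [21, 22, 23, 20, 27, 9, 25, 23, 28], [(33, 32)], [20, 29, 22, 23, 24, 31, 26, 30, 28, 21, 27, 25, 34]⟩,
  ⟨1, [21, 22, 23, 20, 27, 9, 25, 28, 26], [(33, 32)], [20, 29, 22, 23, 24, 31, 26, 30, 28, 21, 27, 25, 34]⟩,
  ⟨1, [21, 22, 23, 20, 27, 9, 25, 28, 10], [(33, 32)], [20, 29, 22, 23, 24, 31, 26, 30, 28, 21, 27, 25, 34]⟩,
  ⟨0, [23, 20, 21, 22, 28, 24, 26, 6], [(33, 32), (31, 20)], [29, 21, 22, 23, 30, 25, 24, 27, 28, 34, 26]⟩,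
  ⟨1, [23, 20, 21, 22, 28, 26, 10, 20, 21], [(26, 33)], [29, 21, 22, 23, 30, 25, 24, 27, 28, 20, 31, 32, 34]⟩,
  ⟨1, [23, 20, 21, 22, 28, 26, 10, 24, 25], [(26, 33)], [29, 21, 22, 23, 30, 25, 24, 27, 28, 20, 31, 32, 34]⟩,
  ⟨1, [23, 20, 21, 22, 28, 26, 10, 20, 24], [(26, 33)], [29, 21, 22, 23, 30, 25, 24, 27, 28, 20, 31, 32, 34]⟩,
  ⟨1, [23, 20, 21, 22, 28, 26, 10, 21, 22], [(26, 33)], [29, 21, 22, 23, 30, 25, 24, 27, 28, 20, 31, 32, 34]⟩,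
  ⟨1, [23, 20, 21, 22, 28, 10, 26, 20, 24], [(29, 30)], [20, 21, 22, 34, 24, 25, 26, 27, 33, 23, 28, 32, 31]⟩,
  ⟨1, [23, 20, 21, 22, 28, 26, 10, 20, 24], [(29, 30)], [20, 21, 22, 23, 24, 25, 26, 27, 28, 34, 33, 32, 31]⟩,
  ⟨1, [23, 20, 21, 22, 28, 26, 10, 22, 1], [(26, 33)], [29, 21, 22, 23, 30, 25, 24, 27, 28, 20, 31, 32, 34]⟩,
  ⟨1, [23, 20, 21, 22, 28, 26, 10, 25, 4], [(26, 33)], [29, 21, 22, 23, 30, 25, 24, 27, 28, 20, 31, 32, 34]⟩,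
  ⟨1, [23, 20, 21, 22, 28, 26, 10, 21, 27], [(26, 33)], [29, 21, 22, 23, 30, 25, 24, 27, 28, 20, 31, 32, 34]⟩,
  ⟨1, [23, 20, 21, 22, 28, 26, 10, 27, 25], [(26, 33)], [29, 21, 22, 23, 30, 25, 24, 27, 28, 20, 31, 32, 34]⟩,
  ⟨1, [23, 20, 21, 22, 28, 26, 10, 27, 9], [(26, 33)], [29, 21, 22, 23, 30, 25, 24, 27, 28, 20, 31, 32, 34]⟩,
  ⟨1, [20, 21, 22, 23, 24, 25, 26, 21, 22], [(31, 32)], [20, 21, 22, 23, 24, 25, 26, 27, 28, 29, 30, 34, 33]⟩,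
  ⟨2, [20, 21, 22, 23, 24, 25, 27, 27, 9], [(27, 25)], [20, 32, 22, 23, 24, 34, 26, 33, 28, 31, 30, 29, 21]⟩,
  ⟨3, [20, 21, 22, 23, 24, 25, 1], [(22, 23)], [20, 21, 33, 34, 24, 25, 26, 27, 28, 29, 30, 31, 32]⟩,
  ⟨0, [21, 22, 23, 20, 27, 1, 24, 25], [(33, 32), (31, 20)], [34, 21, 22, 23, 24, 25, 26, 27, 28, 29, 30]⟩,
  ⟨0, [21, 22, 23, 20, 27, 1, 24, 26], [(21, 33), (29, 30)], [20, 31, 22, 23, 24, 25, 26, 27, 28, 32, 34]⟩,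
  ⟨0, [21, 22, 23, 20, 27, 1, 26, 6], [(21, 33), (29, 30)], [20, 31, 22, 23, 24, 25, 26, 27, 28, 32, 34]⟩,
  ⟨4, [20, 23, 22, 21, 24, 26, 1, 6, 26], [], [29, 21, 22, 23, 30, 25, 26, 27, 28, 20, 24, 31, 32, 33, 34]⟩,
  ⟨0, [21, 22, 23, 20, 27, 1, 28, 26], [(21, 33), (29, 30)], [20, 31, 22, 23, 24, 25, 26, 27, 28, 32, 34]⟩,
  ⟨0, [21, 22, 23, 20, 27, 1, 28, 10], [(21, 33), (29, 30)], [20, 31, 22, 23, 24, 25, 26, 27, 28, 32, 34]⟩,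
  ⟨0, [20, 21, 22, 23, 24, 27, 25, 4], [(33, 32), (31, 29)], [20, 21, 22, 23, 24, 30, 26, 27, 28, 34, 25]⟩,
  ⟨1, [21, 22, 23, 20, 27, 9, 25, 20, 24], [(20, 24)], [29, 34, 22, 23, 30, 25, 26, 33, 28, 21, 27, 32, 31]⟩,
  ⟨1, [21, 22, 23, 20, 27, 25, 9, 20, 24], [(20, 24)], [29, 21, 22, 23, 30, 25, 26, 27, 28, 34, 33, 32, 31]⟩,
  ⟨1, [21, 22, 23, 20, 27, 9, 25, 22, 23], [(25, 33)], [20, 29, 22, 23, 24, 30, 26, 31, 28, 21, 27, 32, 34]⟩,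
  ⟨1, [21, 22, 23, 20, 27, 9, 25, 23, 20], [(25, 33)], [20, 29, 22, 23, 24, 30, 26, 31, 28, 21, 27, 32, 34]⟩,
  ⟨1, [21, 22, 23, 20, 27, 9, 25, 20, 24], [(25, 33)], [20, 29, 22, 23, 24, 30, 26, 31, 28, 21, 27, 32, 34]⟩,
  ⟨1, [21, 22, 23, 20, 27, 9, 25, 24, 26], [(25, 33)], [20, 29, 22, 23, 24, 30, 26, 31, 28, 21, 27, 32, 34]⟩,
  ⟨1, [21, 22, 23, 20, 27, 9, 25, 22, 1], [(25, 33)], [20, 29, 22, 23, 24, 30, 26, 31, 28, 21, 27, 32, 34]⟩,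
  ⟨1, [21, 22, 23, 20, 27, 9, 25, 26, 6], [(25, 33)], [20, 29, 22, 23, 24, 30, 26, 31, 28, 21, 27, 32, 34]⟩,
  ⟨1, [21, 22, 23, 20, 27, 9, 25, 23, 28], [(25, 33)], [20, 29, 22, 23, 24, 30, 26, 31, 28, 21, 27, 32, 34]⟩,
  ⟨1, [21, 22, 23, 20, 27, 9, 25, 28, 26], [(25, 33)], [20, 29, 22, 23, 24, 30, 26, 31, 28, 21, 27, 32, 34]⟩,
  ⟨1, [21, 22, 23, 20, 27, 9, 25, 28, 10], [(25, 33)], [20, 29, 22, 23, 24, 30, 26, 31, 28, 21, 27, 32, 34]⟩,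
  ⟨0, [23, 20, 21, 22, 28, 24, 26, 6], [(26, 33), (20, 24)], [29, 21, 22, 23, 30, 25, 31, 27, 28, 34, 32]⟩,
  ⟨1, [23, 20, 21, 22, 28, 26, 10, 20, 21], [(33, 32)], [29, 21, 22, 23, 30, 25, 31, 27, 28, 20, 24, 26, 34]⟩,
  ⟨1, [23, 20, 21, 22, 28, 26, 10, 24, 25], [(33, 32)], [29, 21, 22, 23, 30, 25, 31, 27, 28, 20, 24, 26, 34]⟩,
  ⟨1, [23, 20, 21, 22, 28, 26, 10, 20, 24], [(33, 32)], [29, 21, 22, 23, 30, 25, 31, 27, 28, 20, 24, 26, 34]⟩,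
  ⟨1, [23, 20, 21, 22, 28, 26, 10, 21, 22], [(33, 32)], [29, 21, 22, 23, 30, 25, 31, 27, 28, 20, 24, 26, 34]⟩,
  ⟨1, [23, 20, 21, 22, 28, 10, 26, 20, 24], [(29, 30)], [20, 21, 22, 34, 31, 25, 32, 27, 33, 23, 28, 26, 24]⟩,
  ⟨1, [23, 20, 21, 22, 28, 26, 10, 20, 24], [(29, 30)], [20, 21, 22, 23, 31, 25, 32, 27, 28, 34, 33, 26, 24]⟩,
  ⟨1, [23, 20, 21, 22, 28, 26, 10, 22, 1], [(33, 32)], [29, 21, 22, 23, 30, 25, 31, 27, 28, 20, 24, 26, 34]⟩,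
  ⟨1, [23, 20, 21, 22, 28, 26, 10, 25, 4], [(33, 32)], [29, 21, 22, 23, 30, 25, 31, 27, 28, 20, 24, 26, 34]⟩,
  ⟨1, [23, 20, 21, 22, 28, 26, 10, 21, 27], [(33, 32)], [29, 21, 22, 23, 30, 25, 31, 27, 28, 20, 24, 26, 34]⟩,
  ⟨1, [23, 20, 21, 22, 28, 26, 10, 27, 25], [(33, 32)], [29, 21, 22, 23, 30, 25, 31, 27, 28, 20, 24, 26, 34]⟩,
  ⟨1, [23, 20, 21, 22, 28, 26, 10, 27, 9], [(33, 32)], [29, 21, 22, 23, 30, 25, 31, 27, 28, 20, 24, 26, 34]⟩,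
  ⟨3, [20, 21, 22, 23, 24, 25, 1], [(21, 22)], [31, 34, 33, 32, 24, 25, 26, 27, 28, 29, 30, 20, 23]⟩,
  ⟨1, [20, 21, 22, 23, 24, 25, 26, 23, 28], [(31, 32)], [20, 21, 22, 23, 24, 25, 26, 27, 28, 29, 30, 34, 33]⟩,
  ⟨0, [22, 23, 20, 21, 1, 28, 24, 25], [(33, 32), (31, 24)], [29, 21, 22, 20, 30, 25, 26, 27, 28, 23, 34]⟩,
  ⟨0, [22, 23, 20, 21, 1, 28, 24, 26], [(23, 33), (20, 29)], [34, 21, 22, 32, 30, 25, 26, 27, 28, 31, 24]⟩,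
  ⟨2, [23, 20, 21, 22, 28, 10, 24, 24, 26], [(28, 26)], [29, 21, 22, 23, 30, 25, 34, 27, 33, 20, 32, 31, 24]⟩,
  ⟨0, [22, 23, 20, 21, 1, 28, 25, 4], [(33, 32), (31, 24)], [29, 21, 22, 20, 30, 25, 26, 27, 28, 23, 34]⟩,
  ⟨4, [20, 21, 22, 23, 24, 25, 1, 4, 25], [], [31, 21, 22, 32, 24, 25, 26, 27, 28, 29, 30, 20, 23, 33, 34]⟩,
  ⟨0, [22, 23, 20, 21, 1, 28, 27, 25], [(33, 32), (31, 24)], [29, 21, 22, 20, 30, 25, 26, 27, 28, 23, 34]⟩,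
  ⟨0, [22, 23, 20, 21, 1, 28, 27, 9], [(33, 32), (31, 24)], [29, 21, 22, 20, 30, 25, 26, 27, 28, 23, 34]⟩,
  ⟨1, [21, 22, 23, 20, 27, 9, 25, 22, 1], [(27, 25)], [20, 31, 32, 23, 24, 30, 26, 29, 28, 33, 34, 21, 22]⟩,
  ⟨1, [20, 21, 22, 23, 24, 25, 26, 27, 9], [(25, 34)], [20, 21, 22, 23, 24, 33, 26, 32, 28, 29, 31, 30, 27]⟩,
  ⟨4, [21, 22, 23, 20, 27, 9, 28, 28, 26], [], [31, 30, 22, 23, 33, 32, 34, 25, 28, 21, 27, 29, 20, 24, 26]⟩,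
  ⟨0, [23, 20, 21, 22, 28, 24, 26, 6], [(33, 32), (26, 34)], [29, 21, 22, 23, 30, 25, 31, 27, 28, 20, 24]⟩,
  ⟨0, [22, 23, 20, 21, 1, 28, 24, 26], [(33, 32), (23, 34)], [29, 21, 22, 20, 30, 25, 26, 27, 28, 31, 24]⟩,
  ⟨3, [21, 22, 23, 20, 27, 9, 28], [(27, 25)], [20, 31, 22, 23, 24, 30, 26, 29, 28, 32, 21, 33, 34]⟩,
  ⟨0, [21, 22, 23, 20, 27, 1, 24, 25], [(33, 32), (21, 34)], [20, 29, 22, 23, 24, 25, 26, 27, 28, 31, 30]⟩,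
  ⟨4, [21, 22, 23, 20, 27, 9, 28, 28, 26], [], [31, 30, 22, 23, 33, 34, 32, 25, 28, 21, 27, 29, 20, 24, 26]⟩,
  ⟨0, [20, 21, 22, 23, 24, 27, 25, 4], [(33, 32), (25, 34)], [20, 21, 22, 23, 24, 31, 26, 27, 28, 29, 30]⟩,
  ⟨1, [20, 21, 22, 23, 24, 25, 26, 28, 10], [(26, 34)], [20, 21, 22, 23, 31, 25, 33, 27, 32, 29, 30, 24, 28]⟩,
  ⟨1, [20, 21, 22, 23, 24, 26, 25, 23, 28], [(30, 34)], [31, 21, 22, 32, 33, 25, 26, 27, 28, 29, 24, 20, 23]⟩,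
  ⟨1, [20, 21, 22, 23, 24, 26, 25, 21, 27], [(24, 34)], [20, 21, 22, 23, 30, 25, 26, 27, 28, 29, 33, 31, 32]⟩,
  ⟨0, [23, 20, 21, 22, 28, 24, 27, 25], [(33, 31), (20, 34)], [29, 21, 22, 23, 24, 32, 26, 27, 28, 30, 25]⟩,
  ⟨0, [20, 21, 22, 23, 24, 27, 28, 26], [(24, 33), (29, 34)], [20, 21, 22, 23, 30, 25, 26, 27, 28, 31, 32]⟩,
  ⟨1, [20, 21, 22, 23, 24, 26, 25, 21, 27], [(24, 34)], [20, 32, 22, 23, 30, 25, 26, 27, 28, 31, 33, 29, 21]⟩,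
  ⟨0, [23, 20, 21, 22, 28, 24, 27, 25], [(30, 33), (20, 34)], [29, 21, 22, 23, 24, 25, 26, 27, 28, 31, 32]⟩,
  ⟨0, [20, 21, 22, 23, 24, 27, 28, 26], [(33, 31), (29, 34)], [20, 21, 22, 23, 30, 25, 32, 27, 28, 24, 26]⟩,
  ⟨1, [20, 21, 22, 23, 24, 26, 25, 23, 28], [(30, 34)], [20, 21, 22, 23, 33, 25, 26, 27, 28, 29, 24, 31, 32]⟩,
  ⟨5, [20, 21, 22, 23, 24, 25, 27, 27, 25], [], [20, 21, 22, 23, 24, 36, 26, 27, 28, 33, 35, 29, 25, 31, 32, 34, 30]⟩,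
  ⟨1, [20, 21, 22, 23, 24, 25, 26, 27, 9], [(25, 36), (21, 22)], [20, 31, 32, 23, 24, 30, 26, 29, 28, 33, 34, 35, 27]⟩,
  ⟨1, [20, 21, 22, 23, 24, 25, 26, 28, 10], [(26, 36), (22, 23)], [33, 32, 21, 29, 34, 25, 35, 27, 20, 31, 30, 24, 28]⟩,
  ⟨5, [23, 20, 21, 22, 28, 26, 24, 24, 26], [], [31, 32, 22, 23, 30, 25, 26, 27, 28, 20, 36, 33, 24, 29, 21, 35, 34]⟩,
  ⟨5, [20, 21, 22, 23, 24, 25, 27, 27, 25], [], [20, 21, 22, 23, 24, 32, 26, 27, 28, 34, 31, 29, 25, 35, 36, 33, 30]⟩,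
  ⟨3, [21, 22, 23, 20, 27, 9, 28], [(34, 35), (33, 31)], [20, 30, 22, 23, 24, 32, 26, 25, 28, 21, 27, 29, 36]⟩,
  ⟨3, [23, 20, 21, 22, 28, 26, 27], [(35, 30), (21, 36)], [33, 34, 22, 23, 24, 25, 26, 27, 28, 31, 32, 20, 29]⟩,
  ⟨5, [23, 20, 21, 22, 28, 26, 24, 24, 26], [], [35, 36, 22, 23, 30, 25, 26, 27, 28, 20, 32, 34, 24, 29, 21, 31, 33]⟩,
  ⟨5, [23, 20, 21, 22, 28, 26, 24, 24, 26], [], [29, 21, 22, 23, 30, 25, 36, 27, 28, 20, 26, 33, 35, 31, 32, 24, 34]⟩,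
  ⟨1, [20, 21, 22, 23, 24, 25, 26, 28, 10], [(26, 36), (22, 23)], [33, 21, 32, 31, 34, 25, 24, 27, 20, 29, 30, 35, 28]⟩,
  ⟨3, [21, 22, 23, 20, 27, 9, 28], [(35, 24), (23, 36)], [33, 31, 22, 34, 30, 25, 26, 32, 28, 21, 27, 29, 20]⟩,
  ⟨5, [20, 21, 22, 23, 24, 25, 27, 27, 25], [], [35, 21, 22, 36, 24, 25, 26, 27, 28, 34, 30, 29, 32, 20, 23, 33, 31]⟩,
  ⟨5, [23, 20, 21, 22, 28, 26, 24, 24, 26], [], [29, 21, 22, 23, 30, 25, 32, 27, 28, 20, 26, 34, 31, 35, 36, 24, 33]⟩,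
  ⟨3, [23, 20, 21, 22, 28, 26, 27], [(34, 35), (33, 31)], [29, 21, 22, 23, 30, 25, 32, 27, 28, 24, 26, 20, 36]⟩,
  ⟨1, [20, 21, 22, 23, 24, 25, 26, 27, 9], [(25, 36), (21, 22)], [31, 20, 23, 32, 24, 35, 26, 29, 28, 33, 34, 30, 27]⟩,
  ⟨5, [20, 21, 22, 23, 24, 25, 27, 27, 25], [], [31, 21, 22, 32, 24, 25, 26, 27, 28, 33, 30, 29, 36, 20, 23, 34, 35]⟩,
  ⟨6, [20, 21, 22, 23, 24, 25], [], [20, 21, 22, 23, 24, 25, 26, 27, 28, 29, 30, 31, 32, 33, 34, 35, 36, 37, 38]⟩,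
  ⟨5, [20, 21, 22, 23, 24, 25, 27, 27, 25], [(22, 23)], [36, 32, 21, 20, 24, 25, 26, 27, 28, 35, 30, 37, 34, 31, 29, 33, 38]⟩,
  ⟨5, [23, 20, 21, 22, 28, 26, 24, 24, 26], [(21, 27)], [31, 30, 22, 23, 37, 32, 34, 25, 28, 20, 26, 35, 38, 36, 29, 24, 33]⟩,
  ⟨5, [23, 20, 21, 22, 28, 26, 24, 24, 26], [(21, 22)], [36, 29, 23, 34, 30, 25, 26, 27, 28, 38, 32, 35, 24, 33, 20, 37, 31]⟩,
  ⟨6, [20, 21, 22, 23, 24, 25], [], [20, 21, 22, 23, 24, 25, 26, 27, 28, 29, 30, 33, 34, 31, 32, 35, 36, 38, 37]⟩,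
  ⟨5, [20, 21, 22, 23, 24, 25, 27, 27, 25], [(22, 23)], [36, 34, 21, 20, 24, 25, 26, 27, 28, 35, 30, 38, 32, 33, 29, 31, 37]⟩,
  ⟨5, [23, 20, 21, 22, 28, 26, 24, 24, 26], [(21, 27)], [33, 30, 22, 23, 38, 34, 32, 25, 28, 20, 26, 35, 37, 36, 29, 24, 31]⟩,
  ⟨5, [23, 20, 21, 22, 28, 26, 24, 24, 26], [(21, 22)], [36, 29, 23, 32, 30, 25, 26, 27, 28, 37, 34, 35, 24, 31, 20, 38, 33]⟩,
  ⟨6, [20, 21, 22, 23, 24, 25], [(21, 22)], [20, 29, 32, 23, 24, 25, 26, 27, 28, 36, 30, 33, 38, 40, 31, 39, 34, 37, 35]⟩,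
  ⟨6, [20, 21, 22, 23, 24, 25], [(22, 23)], [34, 32, 21, 20, 24, 25, 26, 27, 28, 31, 30, 39, 29, 35, 38, 40, 36, 33, 37]⟩,
  ⟨5, [20, 21, 22, 23, 24, 25, 27, 27, 25], [(22, 23), (21, 27)], [36, 30, 29, 20, 24, 32, 26, 25, 28, 40, 31, 33, 38, 39, 34, 35, 37]⟩,
  ⟨5, [23, 20, 21, 22, 28, 26, 24, 24, 26], [(21, 22), (23, 28)], [34, 29, 20, 31, 30, 25, 26, 27, 32, 35, 38, 39, 24, 40, 36, 37, 33]⟩,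
  ⟨6, [20, 21, 22, 23, 24, 25], [(22, 23)], [36, 21, 32, 20, 24, 25, 26, 27, 28, 29, 30, 40, 31, 33, 38, 39, 34, 35, 37]⟩,
  ⟨5, [20, 21, 22, 23, 24, 25, 27, 27, 25], [(22, 23), (21, 27)], [34, 31, 29, 20, 24, 25, 26, 32, 28, 39, 30, 35, 38, 40, 36, 33, 37]⟩,
  ⟨5, [23, 20, 21, 22, 28, 26, 24, 24, 26], [(21, 22), (23, 28)], [36, 29, 20, 24, 30, 25, 32, 27, 26, 33, 38, 40, 31, 39, 34, 37, 35]⟩,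
  ⟨6, [20, 21, 22, 23, 24, 25], [(21, 22)], [31, 29, 23, 32, 24, 25, 26, 27, 28, 34, 30, 35, 38, 39, 20, 40, 36, 37, 33]⟩]

def pre : List (List ℕ) := [
  [20, 29, 30, 24, 23, 28], [29, 30, 24, 20, 21, 22], [30, 24, 20, 29, 25, 27],
  [24, 20, 29, 30, 26, 6], [29, 20, 24, 30, 21, 27], [30, 29, 20, 24, 25, 4],
  [24, 30, 29, 20, 26, 28], [20, 24, 30, 29, 23, 22]]

theorem check_pre : base₁₁.checkPre pool pre
  [[0], [1], [2], [3], [4], [5], [6], [7]] = true := by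
  decide +kernel

theorem check_specA : base₁₁.checkType pre pool 0 specA
  [[8], [8], [9], [9], [10], [10], [11], [11], [12], [12], [13], [13], [14], [14], [15], [15], [16],
  [16], [17], [17], [18], [18], [19], [19], [20], [20], [21], [21], [22], [22], [23], [23], [24],
  [24], [25], [25], [26], [26], [27], [27], [28], [28], [29], [29], [30], [30], [31], [31], [32],
  [32], [33], [33], [34], [34], [35], [35], [8], [8], [9], [9], [10], [10], [11], [11], [12], [12],
  [13], [13], [14], [14], [15], [15], [16], [16], [17], [17], [18], [18], [19], [19], [20], [20],
  [21], [21], [22], [22], [23], [23], [24], [24], [25], [25], [26], [26], [27], [27], [28], [28],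
  [29], [29], [30], [30], [31], [31], [32], [32], [33], [33], [34], [34], [35], [35]] = true := by
  decide +kernel

theorem check_specB : base₁₁.checkType pre pool 1 specB
  [[36], [36], [37], [37], [38], [38], [39], [39], [40], [40], [41, 42], [41, 42], [40], [40], [36],
  [36], [43], [43], [44], [44], [45], [45], [46], [46], [47], [47], [48], [48], [49], [49], [46],
  [46], [50, 51], [50, 51], [47], [47], [52], [52], [53], [53], [54], [54], [55], [55], [56], [56],
  [57], [57], [58], [58], [59], [59], [60], [60], [61], [61], [62], [62], [63], [63], [64], [64],
  [65], [65], [66], [66], [67], [67], [68], [68], [69], [69], [70], [70], [71], [71], [72], [72],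
  [73], [73], [74], [74], [75], [75], [76], [76], [77], [77], [78], [78], [79], [79], [80], [80],
  [81], [81], [82], [82], [79], [79], [83, 84], [83, 84], [80], [80], [85], [85], [86], [86], [87],
  [87], [88], [88], [89], [89], [90], [90], [91], [91], [92], [92], [93], [93], [94], [94], [95],
  [95], [96], [96], [97], [97], [98], [98], [99], [99], [100], [100], [101], [101], [102], [102],
  [103], [103], [104], [104], [105], [105], [106], [106], [107], [107], [108], [108], [109], [109],
  [110], [110], [111], [111], [112], [112], [113], [113], [114], [114], [115], [115], [116, 117],
  [116, 117], [115], [115], [111], [111], [118], [118], [119], [119]] = true := by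
  decide +kernel

theorem check_specC : base₁₁.checkType pre pool 2 specC
  [[120], [121], [122], [123], [124], [125], [126], [127], [128], [129]] = true := by
  decide +kernel

theorem check_specD : base₁₁.checkType pre pool 3 specD
  [[130], [131], [132], [133], [134], [135], [136], [137]] = true := by
  decide +kernel

theorem check_specE : base₁₁.checkType pre pool 4 specE
  [[138], [139], [140], [141], [142], [143], [144], [145], [146], [147], [148], [149], [150], [151],
  [152], [153]] = true := by
  decide +kernel

theorem check_specF : base₁₁.checkType pre pool 5 specF
  [[154], [155], [156], [157], [158], [159], [160], [161]] = true := by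
  decide +kernel

theorem check_specG : base₁₁.checkType pre pool 6 specG
  [[162], [163], [164], [165], [166], [167], [168], [169]] = true := by
  decide +kernel

theorem checked : base₁₁.Checked :=
  ⟨by decide +kernel, pool, pre, ⟨_, check_pre⟩, forall_specs (fun _ => ⟨_, check_specA⟩)
    (fun _ => ⟨_, check_specB⟩) (fun _ => ⟨_, check_specC⟩) (fun _ => ⟨_, check_specD⟩)
    (fun _ => ⟨_, check_specE⟩) (fun _ => ⟨_, check_specF⟩) (fun _ => ⟨_, check_specG⟩)⟩

end base₁₁

def base₁₁.nonadj : List (ℕ × ℕ) := []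

namespace base₁₁.carved

def pool : List Cert := [
  ⟨0, [22, 23, 20, 21, 1, 28, 24, 26], [(20, 31)], [29, 21, 22, 32, 30, 25, 26, 27, 28, 23, 24]⟩,
  ⟨0, [21, 22, 23, 20, 27, 1, 24, 25], [(29, 31)], [20, 21, 22, 23, 24, 25, 26, 27, 28, 32, 30]⟩,
  ⟨0, [20, 21, 22, 23, 24, 27, 25, 4], [(30, 31)], [20, 21, 22, 23, 24, 32, 26, 27, 28, 29, 25]⟩,
  ⟨0, [23, 20, 21, 22, 28, 24, 26, 6], [(24, 31)], [29, 21, 22, 23, 30, 25, 26, 27, 28, 20, 32]⟩,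
  ⟨0, [21, 22, 23, 20, 27, 1, 24, 25], [(29, 31)], [20, 32, 22, 23, 24, 25, 26, 27, 28, 21, 30]⟩,
  ⟨0, [20, 21, 22, 23, 24, 27, 25, 4], [(30, 31)], [20, 21, 22, 23, 24, 25, 26, 27, 28, 29, 32]⟩,
  ⟨0, [23, 20, 21, 22, 28, 24, 26, 6], [(24, 31)], [29, 21, 22, 23, 30, 25, 32, 27, 28, 20, 26]⟩,
  ⟨0, [22, 23, 20, 21, 1, 28, 24, 26], [(20, 31)], [29, 21, 22, 23, 30, 25, 26, 27, 28, 32, 24]⟩,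
  ⟨0, [20, 21, 22, 23, 24, 27, 7, 8], [(29, 30)], [20, 21, 22, 23, 24, 25, 26, 27, 28, 31, 32]⟩,
  ⟨0, [20, 21, 22, 23, 24, 27, 7, 8], [(31, 30)], [20, 21, 22, 23, 24, 25, 26, 27, 28, 29, 32]⟩,
  ⟨1, [20, 21, 22, 23, 24, 25, 26, 7, 8], [], [20, 21, 22, 23, 24, 25, 26, 27, 28, 29, 30, 31, 32]⟩,
  ⟨0, [23, 20, 21, 22, 28, 24, 7, 8], [(24, 31)], [29, 21, 22, 23, 30, 25, 26, 27, 28, 20, 32]⟩,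
  ⟨4, [20, 21, 22, 23, 24, 25, 1, 7, 8], [], [20, 21, 22, 23, 24, 25, 26, 27, 28, 29, 30, 31, 32, 33, 34]⟩,
  ⟨4, [20, 21, 22, 23, 24, 25, 1, 8, 7], [], [20, 21, 22, 23, 24, 25, 26, 27, 28, 29, 30, 31, 32, 33, 34]⟩,
  ⟨0, [22, 23, 20, 21, 1, 28, 7, 8], [(23, 33), (20, 24)], [29, 21, 22, 31, 30, 25, 26, 27, 28, 32, 34]⟩,
  ⟨4, [20, 23, 22, 21, 24, 26, 1, 7, 8], [], [31, 32, 22, 23, 30, 25, 26, 27, 28, 20, 24, 29, 21, 33, 34]⟩,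
  ⟨4, [20, 23, 22, 21, 24, 26, 1, 8, 7], [], [31, 32, 22, 23, 30, 25, 26, 27, 28, 20, 24, 29, 21, 33, 34]⟩,
  ⟨0, [21, 22, 23, 20, 27, 1, 7, 8], [(33, 32), (31, 30)], [20, 29, 22, 23, 24, 25, 26, 27, 28, 21, 34]⟩,
  ⟨1, [21, 22, 23, 20, 27, 9, 25, 7, 8], [(33, 32)], [20, 29, 22, 23, 24, 31, 26, 30, 28, 21, 27, 25, 34]⟩,
  ⟨1, [23, 20, 21, 22, 28, 26, 10, 7, 8], [(26, 33)], [29, 21, 22, 23, 30, 25, 24, 27, 28, 20, 31, 32, 34]⟩,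
  ⟨4, [20, 23, 22, 21, 24, 26, 1, 7, 8], [], [29, 21, 22, 23, 30, 25, 26, 27, 28, 20, 24, 31, 32, 33, 34]⟩,
  ⟨4, [20, 23, 22, 21, 24, 26, 1, 8, 7], [], [29, 21, 22, 23, 30, 25, 26, 27, 28, 20, 24, 31, 32, 33, 34]⟩,
  ⟨0, [21, 22, 23, 20, 27, 1, 7, 8], [(21, 33), (29, 30)], [20, 31, 22, 23, 24, 25, 26, 27, 28, 32, 34]⟩,
  ⟨1, [21, 22, 23, 20, 27, 9, 25, 7, 8], [(25, 33)], [20, 29, 22, 23, 24, 30, 26, 31, 28, 21, 27, 32, 34]⟩,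
  ⟨1, [23, 20, 21, 22, 28, 26, 10, 7, 8], [(33, 32)], [29, 21, 22, 23, 30, 25, 31, 27, 28, 20, 24, 26, 34]⟩,
  ⟨4, [20, 21, 22, 23, 24, 25, 1, 7, 8], [], [31, 21, 22, 32, 24, 25, 26, 27, 28, 29, 30, 20, 23, 33, 34]⟩,
  ⟨4, [20, 21, 22, 23, 24, 25, 1, 8, 7], [], [31, 21, 22, 32, 24, 25, 26, 27, 28, 29, 30, 20, 23, 33, 34]⟩,
  ⟨0, [22, 23, 20, 21, 1, 28, 7, 8], [(33, 32), (31, 24)], [29, 21, 22, 20, 30, 25, 26, 27, 28, 23, 34]⟩]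

def pre : List (List ℕ) := [
  [20, 29, 30, 24, 23, 28], [29, 30, 24, 20, 21, 22], [30, 24, 20, 29, 25, 27],
  [24, 20, 29, 30, 26, 6], [29, 20, 24, 30, 21, 27], [30, 29, 20, 24, 25, 4],
  [24, 30, 29, 20, 26, 28], [20, 24, 30, 29, 23, 22]]

theorem check_pre : (base₁₁.carve base₁₁.nonadj).checkPre pool pre
  [[0], [1], [2], [3], [4], [5], [6], [7]] = true := by
  decide +kernel

theorem check_specA : (base₁₁.carve base₁₁.nonadj).checkType pre pool 0 specA
  [[8], [8], [9], [9], [10], [10], [11], [11], [8], [8], [9], [9], [10], [10], [11], [11]] = true := by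
  decide +kernel

theorem check_specB : (base₁₁.carve base₁₁.nonadj).checkType pre pool 1 specB
  [[12, 13, 14], [12, 13, 14], [15, 16, 17], [15, 16, 17], [18], [18], [19], [19], [20, 21, 22],
  [20, 21, 22], [23], [23], [24], [24], [25, 26, 27], [25, 26, 27]] = true := by
  decide +kernel

theorem checked : (base₁₁.carve base₁₁.nonadj).Checked :=
  ⟨by decide +kernel, pool, pre, ⟨_, check_pre⟩, forall_specs (fun _ => ⟨_, check_specA⟩)
    (fun _ => ⟨_, check_specB⟩) (by simp [Base.carve]) (by simp [Base.carve])
    (by simp [Base.carve]) (by simp [Base.carve]) (by simp [Base.carve])⟩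

end base₁₁.carved

def baseLeft : Base where
  m := 28
  E := [
    (20, 21), (21, 22), (22, 23), (23, 20), (20, 24), (24, 25), (25, 26), (21, 26), (26, 27),
    (22, 1), (23, 2), (24, 5), (25, 4), (27, 11), (27, 12)]
  w := 25
  known := [(1, 2), (4, 5), (11, 12), (1, 5), (2, 5)]
  nonadj := []
  carved := false
  avoid := []
  only := [(29, 25, 27)]

namespace baseLeft

def pool : List Cert := [

  ⟨1, [20, 21, 22, 23, 24, 25, 5, 21, 26], [(26, 27)], [20, 21, 22, 23, 24, 25, 32, 33, 28, 29, 30, 31]⟩,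
  ⟨0, [21, 22, 23, 20, 26, 1, 27, 12], [(32, 31), (27, 33)], [20, 28, 22, 23, 24, 30, 29, 25, 21, 26]⟩,
  ⟨4, [20, 23, 22, 21, 24, 5, 1, 12, 27], [], [29, 25, 22, 23, 30, 31, 32, 33, 20, 24, 28, 21, 26, 27]⟩,
  ⟨0, [21, 22, 23, 20, 26, 1, 27, 11], [(32, 31), (27, 33)], [20, 28, 22, 23, 24, 30, 29, 25, 21, 26]⟩,
  ⟨4, [20, 23, 22, 21, 24, 5, 1, 11, 27], [], [29, 25, 22, 23, 30, 31, 32, 33, 20, 24, 28, 21, 26, 27]⟩,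
  ⟨0, [21, 22, 23, 20, 26, 1, 27, 12], [(25, 32), (27, 33)], [20, 28, 22, 23, 24, 29, 30, 31, 21, 26]⟩,
  ⟨4, [20, 23, 22, 21, 24, 5, 1, 12, 27], [], [30, 31, 22, 23, 29, 25, 32, 33, 20, 24, 28, 21, 26, 27]⟩,
  ⟨0, [21, 22, 23, 20, 26, 1, 27, 11], [(25, 32), (27, 33)], [20, 28, 22, 23, 24, 29, 30, 31, 21, 26]⟩,
  ⟨4, [20, 23, 22, 21, 24, 5, 1, 11, 27], [], [30, 31, 22, 23, 29, 25, 32, 33, 20, 24, 28, 21, 26, 27]⟩,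
  ⟨1, [20, 21, 22, 23, 24, 25, 5, 21, 26], [(26, 27)], [20, 21, 22, 23, 24, 31, 32, 33, 28, 30, 29, 25]⟩]

def pre : List (List ℕ) := []

theorem check_pre : baseLeft.checkPre pool pre
  [] = true := by
  decide +kernel

theorem check_specB : baseLeft.checkType pre pool 1 specB
  [[0], [0], [0], [0], [1, 2], [1, 2], [3, 4], [3, 4], [5, 6], [5, 6], [7, 8], [7, 8], [9], [9],
  [9], [9]] = true := by
  decide +kernel

theorem checked : baseLeft.Checked :=
  ⟨by decide +kernel, pool, pre, ⟨_, check_pre⟩, forall_specs (fun _ => ⟨[], by decide +kernel⟩)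
    (fun _ => ⟨_, check_specB⟩) (fun _ => ⟨[], by decide +kernel⟩)
    (fun _ => ⟨[], by decide +kernel⟩) (fun _ => ⟨[], by decide +kernel⟩)
    (fun _ => ⟨[], by decide +kernel⟩) (fun _ => ⟨[], by decide +kernel⟩)⟩

end baseLeft

def baseRight : Base where
  m := 28
  E := [
    (20, 21), (21, 22), (22, 23), (23, 20), (20, 24), (24, 25), (25, 26), (23, 26), (26, 27),
    (22, 1), (21, 0), (24, 5), (25, 6), (27, 11), (27, 12)]
  w := 5
  known := [(0, 1), (5, 6), (11, 12), (0, 5), (1, 5)]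
  nonadj := []
  carved := false
  avoid := []
  only := [(24, 25, 27)]

namespace baseRight

def pool : List Cert := [

  ⟨0, [22, 23, 20, 21, 1, 26, 27, 12], [(25, 32), (27, 33)], [28, 21, 22, 20, 29, 24, 30, 31, 23, 26]⟩,
  ⟨4, [20, 21, 22, 23, 24, 5, 1, 12, 27], [], [30, 21, 22, 31, 24, 25, 32, 33, 28, 29, 20, 23, 26, 27]⟩,
  ⟨0, [22, 23, 20, 21, 1, 26, 27, 11], [(25, 32), (27, 33)], [28, 21, 22, 20, 29, 24, 30, 31, 23, 26]⟩,
  ⟨4, [20, 21, 22, 23, 24, 5, 1, 11, 27], [], [30, 21, 22, 31, 24, 25, 32, 33, 28, 29, 20, 23, 26, 27]⟩,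
  ⟨1, [20, 21, 22, 23, 24, 5, 25, 23, 26], [(26, 27)], [20, 21, 22, 23, 30, 31, 32, 33, 28, 29, 24, 25]⟩,
  ⟨1, [20, 21, 22, 23, 24, 5, 25, 23, 26], [(26, 27)], [20, 21, 22, 23, 24, 25, 32, 33, 28, 29, 30, 31]⟩,
  ⟨0, [22, 23, 20, 21, 1, 26, 27, 12], [(32, 31), (27, 33)], [28, 21, 22, 20, 29, 30, 24, 25, 23, 26]⟩,
  ⟨4, [20, 21, 22, 23, 24, 5, 1, 12, 27], [], [24, 21, 22, 25, 30, 31, 32, 33, 28, 29, 20, 23, 26, 27]⟩,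
  ⟨0, [22, 23, 20, 21, 1, 26, 27, 11], [(32, 31), (27, 33)], [28, 21, 22, 20, 29, 30, 24, 25, 23, 26]⟩,
  ⟨4, [20, 21, 22, 23, 24, 5, 1, 11, 27], [], [24, 21, 22, 25, 30, 31, 32, 33, 28, 29, 20, 23, 26, 27]⟩]

def pre : List (List ℕ) := []

theorem check_pre : baseRight.checkPre pool pre
  [] = true := by
  decide +kernel

theorem check_specB : baseRight.checkType pre pool 1 specB
  [[0, 1], [0, 1], [2, 3], [2, 3], [4], [4], [4], [4], [5], [5], [5], [5], [6, 7], [6, 7], [8, 9],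
  [8, 9]] = true := by
  decide +kernel

theorem checked : baseRight.Checked :=
  ⟨by decide +kernel, pool, pre, ⟨_, check_pre⟩, forall_specs (fun _ => ⟨[], by decide +kernel⟩)
    (fun _ => ⟨_, check_specB⟩) (fun _ => ⟨[], by decide +kernel⟩)
    (fun _ => ⟨[], by decide +kernel⟩) (fun _ => ⟨[], by decide +kernel⟩)
    (fun _ => ⟨[], by decide +kernel⟩) (fun _ => ⟨[], by decide +kernel⟩)⟩

end baseRight

end Skel

end QuadExp

namespace QuadExp

open SimpleGraph

variable {X : Type*} {W : Type*} {K : SimpleGraph X} {H : SimpleGraph W}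
  {u₁ u₂ u₃ u₄ v₁ v₂ v₃ v₄ w x p q : X}

namespace QS

lemma third_neighbor (h : QS K u₁ u₂ u₃ u₄ v₁ v₂ v₃ v₄) {z a b : X} (ha : K.Adj z a) (hb : K.Adj z b)
    (hab : a ≠ b) : ∃ c, c ≠ a ∧ c ≠ b ∧ ∀ y, K.Adj z y ↔ y = a ∨ y = b ∨ y = c := by
  have hc := h.cubic z ⟨a, ha⟩
  obtain ⟨c, hc1, hc2⟩ : ∃ c ∈ K.neighborSet z, c ∉ ({a, b} : Set X) := by
    by_contra! hcon
    have h1 : (K.neighborSet z).encard ≤ ({a, b} : Set X).encard := Set.encard_le_encard hcon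
    rw [hc, Set.encard_pair hab] at h1
    exact absurd h1 (by decide)
  simp only [Set.mem_insert_iff, Set.mem_singleton_iff, not_or] at hc2
  refine ⟨c, hc2.1, hc2.2, fun y => ⟨fun hy => ?_, ?_⟩⟩
  · exact eq_of_encard_eq_three hc ha hb hc1 hab (Ne.symm hc2.1) (Ne.symm hc2.2) y hy
  · rintro (rfl | rfl | rfl) <;> assumption

lemma two_neighbors (h : QS K u₁ u₂ u₃ u₄ v₁ v₂ v₃ v₄) {z a : X} (ha : K.Adj z a) :
    ∃ b c, b ≠ a ∧ c ≠ a ∧ c ≠ b ∧ ∀ y, K.Adj z y ↔ y = a ∨ y = b ∨ y = c := by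
  have hc := h.cubic z ⟨a, ha⟩
  obtain ⟨b, hb1, hb2⟩ : ∃ c ∈ K.neighborSet z, c ∉ ({a} : Set X) := by
    by_contra! hcon
    have h1 : (K.neighborSet z).encard ≤ ({a} : Set X).encard := Set.encard_le_encard hcon
    rw [hc, Set.encard_singleton] at h1
    exact absurd h1 (by decide)
  obtain ⟨c, h1, h2, h3⟩ := h.third_neighbor ha hb1 (Ne.symm hb2)
  exact ⟨b, c, hb2, h1, h2, h3⟩

/-- A neighbor of `v₁` is none of the other seven vertices except `u₁`. -/
lemma off (h : QS K u₁ u₂ u₃ u₄ v₁ v₂ v₃ v₄) {y : X} (hy : K.Adj v₁ y) :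
    (y ≠ u₂ ∧ y ≠ u₃ ∧ y ≠ u₄) ∧ y ≠ v₁ ∧ y ≠ v₂ ∧ y ≠ v₃ ∧ y ≠ v₄ := by
  have hnd := h.nodup
  have hna := h.nonadj
  simp only [List.nodup_cons, List.mem_cons, List.not_mem_nil, or_false, not_or] at hnd
  obtain ⟨⟨-, -, -, n1, -⟩, ⟨-, -, n2, -⟩, ⟨-, n3, -⟩, ⟨n4, -⟩, ⟨n5, n6, n7⟩, -⟩ := hnd
  refine ⟨⟨?_, ?_, ?_⟩, ?_, ?_, ?_, ?_⟩
  · rintro rfl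
    rcases (h.n₂ v₁).1 hy.symm with h | h | h
    exacts [n3 h.symm, n1 h.symm, n5 h]
  · rintro rfl
    rcases (h.n₃ v₁).1 hy.symm with h | h | h
    exacts [n4 h.symm, n2 h.symm, n6 h]
  · rintro rfl
    rcases (h.n₄ v₁).1 hy.symm with h | h | h
    exacts [n1 h.symm, n3 h.symm, n7 h]
  · exact hy.ne'
  · rintro rfl; exact hna.1 hy
  · rintro rfl; exact hna.2.1 hy
  · rintro rfl; exact hna.2.2.1 hy

/-- A neighbor of a vertex outside the eight vertices is not on the quadrangle. -/
lemma off_of_adj (h : QS K u₁ u₂ u₃ u₄ v₁ v₂ v₃ v₄) {y z : X} (hu : z ≠ u₁ ∧ z ≠ u₂ ∧ z ≠ u₃ ∧ z ≠ u₄)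
    (hv : z ≠ v₁ ∧ z ≠ v₂ ∧ z ≠ v₃ ∧ z ≠ v₄) (hzy : K.Adj z y) :
    y ≠ u₁ ∧ y ≠ u₂ ∧ y ≠ u₃ ∧ y ≠ u₄ := by
  refine ⟨?_, ?_, ?_, ?_⟩
  · rintro rfl; have := (h.n₁ z).1 hzy.symm; tauto
  · rintro rfl; have := (h.n₂ z).1 hzy.symm; tauto
  · rintro rfl; have := (h.n₃ z).1 hzy.symm; tauto
  · rintro rfl; have := (h.n₄ z).1 hzy.symm; tauto

end QS

namespace Skel

/-- A labelling: the leaves in `L`, the inner vertices in `I`, and then the values of `h`. -/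
def mkLab (d : X) (L I : List X) (h : ℕ → X) (n : ℕ) : X :=
  if n < 20 then L.getD n d else I.getD (n - 20) (h (n - 20 - I.length))

lemma mkLab_fresh {d : X} {L I : List X} {h : ℕ → X} (hh : ∀ j, h j ∉ K.support) (n : ℕ)
    (hn : 20 + I.length ≤ n) : mkLab d L I h n ∉ K.support := by
  rw [mkLab, if_neg (by omega), List.getD_eq_default _ _ (by omega)]
  exact hh _

lemma mkLab_new {d : X} {L I : List X} {h : ℕ → X} (n : ℕ) :
    mkLab d L I h (20 + I.length + n) = h n := by
  rw [mkLab, if_neg (by omega), List.getD_eq_default _ _ (by omega)]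
  congr 1
  omega

lemma mkLab_inj {d : X} {L I : List X} {h : ℕ → X} (hI : I.Nodup) (hIK : ∀ x ∈ I, x ∈ K.support)
    (hL : ∀ x ∈ d :: L, x ∈ K.support ∧ x ∉ I) (hi : ∀ i j, h i = h j → i = j)
    (hh : ∀ j, h j ∉ K.support) (n k : ℕ) (hn : 20 ≤ n)
    (hnk : mkLab d L I h n = mkLab d L I h k) : n = k := by
  have hleaf : k < 20 → mkLab d L I h k ∈ K.support ∧ mkLab d L I h k ∉ I := by
    intro hk
    apply hL
    rw [mkLab, if_pos hk]
    by_cases hkl : k < L.length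
    · rw [List.getD_eq_getElem _ _ hkl]
      exact List.mem_cons_of_mem _ (List.getElem_mem _)
    · rw [List.getD_eq_default _ _ (by omega)]
      exact List.mem_cons_self
  have hinn : ∀ k, 20 ≤ k → k < 20 + I.length → mkLab d L I h k ∈ I := by
    intro k h1 h2
    rw [mkLab, if_neg (by omega), List.getD_eq_getElem _ _ (by omega)]
    exact List.getElem_mem _
  rcases lt_or_ge n (20 + I.length) with h1 | h1
  · have h2 := hinn n hn h1
    rcases lt_or_ge k 20 with h3 | h3
    · exact absurd (hnk ▸ h2) (hleaf h3).2
    rcases lt_or_ge k (20 + I.length) with h4 | h4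
    · rw [mkLab, mkLab, if_neg (by omega), if_neg (by omega), List.getD_eq_getElem _ _ (by omega),
        List.getD_eq_getElem _ _ (by omega)] at hnk
      have := (List.Nodup.getElem_inj_iff hI).1 hnk
      omega
    · exact absurd (hnk ▸ hIK _ h2) (mkLab_fresh hh k h4)
  · have h2 := mkLab_fresh (d := d) (L := L) hh n h1
    rcases lt_or_ge k 20 with h3 | h3
    · exact absurd (hleaf h3).1 (hnk ▸ h2)
    rcases lt_or_ge k (20 + I.length) with h4 | h4
    · exact absurd (hIK _ (hinn k h3 h4)) (hnk ▸ h2)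
    · rw [mkLab, mkLab, if_neg (by omega), if_neg (by omega), List.getD_eq_default _ _ (by omega),
        List.getD_eq_default _ _ (by omega)] at hnk
      have := hi _ _ hnk
      omega

lemma nb_iff {E : List (ℕ × ℕ)} {lab : ℕ → X} {n a b c : ℕ} {z : X} (hE : nb E n = [a, b, c])
    (h : ∀ y, K.Adj z y ↔ y = lab a ∨ y = lab b ∨ y = lab c) (hz : lab n = z) (y : X) :
    K.Adj (lab n) y ↔ ∃ a ∈ nb E n, y = lab a := by
  rw [hE, hz, h]
  simp

/-- The new vertices of a short extension, followed by those of an expansion. -/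
def ext (p q : X) (g : ℕ → X) : ℕ → X
  | 0 => p
  | 1 => q
  | j + 2 => g (20 + j)

lemma ext_props {K₁ : SimpleGraph X} {sp : Spec} {g : ℕ → X} {a b c d : X}
    (hg : IsExp K₁ a b c d sp g) (hp : p ∉ K.support) (hq : q ∉ K.support) (hpq : p ≠ q)
    (hK₁ : K₁.support = insert p (insert q K.support)) :
    (∀ i j, ext p q g i = ext p q g j → i = j) ∧ ∀ j, ext p q g j ∉ K.support := by
  have hf := hg.fresh
  simp only [hK₁, Set.mem_insert_iff, not_or] at hf
  constructor
  · intro i j hij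
    match i, j with
    | 0, 0 => rfl
    | 0, 1 => exact absurd hij hpq
    | 1, 0 => exact absurd hij hpq.symm
    | 1, 1 => rfl
    | 0, j + 2 => exact absurd hij.symm (hf j).1
    | 1, j + 2 => exact absurd hij.symm (hf j).2.1
    | j + 2, 0 => exact absurd hij (hf j).1
    | j + 2, 1 => exact absurd hij (hf j).2.1
    | i + 2, j + 2 => rw [hg.inj i j hij]
  · intro j
    match j with
    | 0 => exact hp
    | 1 => exact hq
    | j + 2 => exact (hf j).2.2

end Skel

end QuadExp

namespace QuadExp

open SimpleGraph

namespace Skel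

variable {X : Type*} {W : Type*} {K : SimpleGraph X} {H : SimpleGraph W}
  {u₁ u₂ u₃ u₄ v₁ v₂ v₃ v₄ w x p q : X}

lemma exp_of_ins₀₀ (hK : QS K u₁ u₂ u₃ u₄ v₁ v₂ v₃ v₄) (hv : ∀ y, K.Adj v₁ y ↔ y = u₁ ∨ y = w ∨ y = x)
    (hwu : w ≠ u₁) (hxu : x ≠ u₁) (hxw : x ≠ w) (ha : ¬ K.Adj w v₂) (hb : ¬ K.Adj x v₄)
    (hp : p ∉ K.support) (hq : q ∉ K.support) (hpq : p ≠ q) {k : ℕ} {sp : Spec}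
    (hk : specs[k]? = some sp) {g : ℕ → X} (hg : IsExp (ins K u₁ u₂ v₁ w p q) u₁ p q v₁ sp g)
    (hH : Emb (insL g sp.ops 20 (ins K u₁ u₂ v₁ w p q)) H)
    (hH₁ : Emb (insL g (sp.ops.take 1) 20 (ins K u₁ u₂ v₁ w p q)) H) :
    Exp K H u₁ u₂ u₃ u₄ := by
  have au₁ : K.Adj u₁ u₂ := (hK.n₁ _).2 (by simp)
  have au₃ : K.Adj u₃ u₄ := (hK.n₃ _).2 (by simp)
  have av₁ : K.Adj u₁ v₁ := (hK.n₁ _).2 (by simp)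
  have av₂ : K.Adj u₂ v₂ := (hK.n₂ _).2 (by simp)
  have av₃ : K.Adj u₃ v₃ := (hK.n₃ _).2 (by simp)
  have av₄ : K.Adj u₄ v₄ := (hK.n₄ _).2 (by simp)
  have aw : K.Adj v₁ w := (hv _).2 (by simp)
  have ax : K.Adj v₁ x := (hv _).2 (by simp)
  obtain ⟨ow, ow'⟩ := hK.off aw
  obtain ⟨ox, ox'⟩ := hK.off ax
  obtain ⟨w₁, w₂, hw1, hw2, hw12, hw⟩ := hK.two_neighbors aw.symm
  obtain ⟨x₁, x₂, hx1, hx2, hx12, hx⟩ := hK.two_neighbors ax.symm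
  have aw₁ : K.Adj w w₁ := (hw _).2 (by simp)
  have aw₂ : K.Adj w w₂ := (hw _).2 (by simp)
  have ax₁ : K.Adj x x₁ := (hx _).2 (by simp)
  have ax₂ : K.Adj x x₂ := (hx _).2 (by simp)
  have hnwx : ¬ K.Adj w x := fun h => hK.tri v₁ w x aw h ax
  have ow₁ := hK.off_of_adj ⟨hwu, ow⟩ ow' aw₁
  have ow₂ := hK.off_of_adj ⟨hwu, ow⟩ ow' aw₂
  have ox₁ := hK.off_of_adj ⟨hxu, ox⟩ ox' ax₁
  have ox₂ := hK.off_of_adj ⟨hxu, ox⟩ ox' ax₂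
  have hnd := hK.nodup
  simp only [List.nodup_cons, List.mem_cons, List.not_mem_nil, or_false, not_or, not_false_eq_true,
    List.nodup_nil, and_true] at hnd
  have hsup := ins_support au₁ aw hp hq hpq
  obtain ⟨hi, hf⟩ := ext_props hg hp hq hpq hsup
  have hfit : base₀₀.Fit K (mkLab v₃ [v₂, v₃, v₄, w₁, w₂, x₁, x₂] [u₁, u₂, u₃, u₄, v₁, w, x]
      (ext p q g)) := by
    refine ⟨mkLab_inj ?_ ?_ ?_ hi hf, fun n hn => mkLab_fresh hf n hn, ?_, ?_, by simp [base₀₀], by simp [base₀₀]⟩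
    · simp only [List.nodup_cons, List.mem_cons, List.not_mem_nil, or_false, not_or,
        not_false_eq_true, List.nodup_nil, and_true]
      grind
    · simp only [List.forall_mem_cons]
      exact ⟨⟨_, au₁⟩, ⟨_, au₁.symm⟩, ⟨_, au₃⟩, ⟨_, au₃.symm⟩, ⟨_, aw⟩, ⟨_, aw₁⟩, ⟨_, ax₁⟩, by simp⟩
    · simp only [List.forall_mem_cons]
      simp only [List.mem_cons, List.not_mem_nil, or_false, not_or]
      refine ⟨⟨⟨_, av₃.symm⟩, ?_⟩, ⟨⟨_, av₂.symm⟩, ?_⟩, ⟨⟨_, av₃.symm⟩, ?_⟩, ⟨⟨_, av₄.symm⟩, ?_⟩,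
        ⟨⟨_, aw₁.symm⟩, ?_⟩, ⟨⟨_, aw₂.symm⟩, ?_⟩, ⟨⟨_, ax₁.symm⟩, ?_⟩, ⟨⟨_, ax₂.symm⟩, ?_⟩, by simp⟩ <;> grind [SimpleGraph.irrefl, SimpleGraph.adj_comm]
    · intro n h1 h2
      replace h2 : n < 27 := h2
      interval_cases n
      · exact nb_iff rfl hK.n₁ rfl
      · exact nb_iff rfl (fun y => (hK.n₂ y).trans or_left_comm) rfl
      · exact nb_iff rfl (fun y => (hK.n₃ y).trans or_left_comm) rfl
      · exact nb_iff rfl (fun y => (hK.n₄ y).trans or_left_comm) rfl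
      · exact nb_iff rfl hv rfl
      · exact nb_iff rfl (fun y => (hw y).trans (or_congr_right or_comm)) rfl
      · exact nb_iff rfl (fun y => (hx y).trans (or_congr_right or_comm)) rfl
    · simp only [base₀₀, List.forall_mem_cons]
      change v₂ ≠ v₃ ∧ v₂ ≠ v₄ ∧ v₃ ≠ v₄ ∧ w₁ ≠ w₂ ∧ x₁ ≠ x₂ ∧ v₂ ≠ w₁ ∧ v₂ ≠ w₂ ∧ v₄ ≠ x₁ ∧ v₄ ≠ x₂ ∧ _
      refine ⟨?_, ?_, ?_, ?_, ?_, ?_, ?_, ?_, ?_, by simp⟩ <;> grind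
  refine base₀₀.checked.exp_of_carve base₀₀.carved.checked (by decide) hfit ?_ (by simp [base₀₀]) hk hg
    (fun j => ?_) (by simp [base₀₀]) hH hH₁
  · simp only [base₀₀.nonadj, List.forall_mem_cons]
    exact ⟨hK.nonadj.2.2.2.1, hK.nonadj.2.2.2.2.1, hK.nonadj.2.2.2.2.2, by simp⟩
  · have := mkLab_new (d := v₃) (L := [v₂, v₃, v₄, w₁, w₂, x₁, x₂])
      (I := [u₁, u₂, u₃, u₄, v₁, w, x]) (h := ext p q g) (j + 2)
    rw [show base₀₀.m + 2 + j = 20 + [u₁, u₂, u₃, u₄, v₁, w, x].length + (j + 2) by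
      simp [base₀₀]; omega]
    exact this.symm

lemma forall_mem_of_subset {l l' : List X} {P : X → Prop} (hl : l ⊆ l') (h : ∀ t ∈ l', P t) :
    ∀ t ∈ l, P t :=
  fun t ht => h t (hl ht)

lemma exists_mem_S {B : Base} {lab : ℕ → X} (h : B.Fit K lab) (hs : B.shape = true) {a b : X} {n : ℕ}
    (hab : (ins K (lab 20) (lab 21) (lab 24) (lab B.w) (lab B.m) (lab (B.m + 1))).Adj a b)
    (hn : 20 ≤ n) (hab' : a = lab n ∨ b = lab n) : ∃ d ∈ B.S, pair lab d = s(a, b) := by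
  rw [← h.glue_S hs, glue_adj] at hab
  rcases hab with h' | h'
  · exfalso
    rcases hab' with rfl | rfl
    · exact (h.model hs).good.iso n _ hn h'
    · exact (h.model hs).good.iso n _ hn h'.symm
  · exact h'.1

lemma exp_of_ins_left (hK : QS K u₁ u₂ u₃ u₄ v₁ v₂ v₃ v₄) (hv : ∀ y, K.Adj v₁ y ↔ y = u₁ ∨ y = w ∨ y = x)
    (hwu : w ≠ u₁) (hxu : x ≠ u₁) (hxw : x ≠ w) (ha : K.Adj w v₂)
    (hp : p ∉ K.support) (hq : q ∉ K.support) (hpq : p ≠ q)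
    {g : ℕ → X} (hg : IsExp (ins K u₁ u₂ v₁ w p q) u₁ p q v₁ specB g)
    (hH : Emb (insL g specB.ops 20 (ins K u₁ u₂ v₁ w p q)) H)
    (hH₁ : Emb (insL g (specB.ops.take 1) 20 (ins K u₁ u₂ v₁ w p q)) H)
    {y : X} (hv₂ : ∀ t, K.Adj v₂ t ↔ t = u₂ ∨ t = w ∨ t = y) (hyu : y ≠ u₂) (hyw : y ≠ w)
    (h0 : g 0 = q) (h4 : g 4 = w) (h78 : g 7 = y ∨ g 8 = y) :
    Exp K H u₁ u₂ u₃ u₄ := by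
  have au₁ : K.Adj u₁ u₂ := (hK.n₁ _).2 (by simp)
  have au₃ : K.Adj u₃ u₄ := (hK.n₃ _).2 (by simp)
  have av₁ : K.Adj u₁ v₁ := (hK.n₁ _).2 (by simp)
  have av₂ : K.Adj u₂ v₂ := (hK.n₂ _).2 (by simp)
  have av₃ : K.Adj u₃ v₃ := (hK.n₃ _).2 (by simp)
  have av₄ : K.Adj u₄ v₄ := (hK.n₄ _).2 (by simp)
  have aw : K.Adj v₁ w := (hv _).2 (by simp)
  have ax : K.Adj v₁ x := (hv _).2 (by simp)
  obtain ⟨ow, ow'⟩ := hK.off aw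
  obtain ⟨ox, ox'⟩ := hK.off ax
  have hnwx : ¬ K.Adj w x := fun h => hK.tri v₁ w x aw h ax
  have hnd := hK.nodup
  simp only [List.nodup_cons, List.mem_cons, List.not_mem_nil, or_false, not_or, not_false_eq_true,
    List.nodup_nil, and_true] at hnd
  have hsup := ins_support au₁ aw hp hq hpq
  obtain ⟨hi, hf⟩ := ext_props hg hp hq hpq hsup
  obtain ⟨z, hz1, hz2, hw⟩ := hK.third_neighbor aw.symm ha (fun h => by simp [h] at hnd)
  have az : K.Adj w z := (hw _).2 (by simp)
  have oz := hK.off_of_adj ⟨hwu, ow⟩ ow' az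
  have ay : K.Adj v₂ y := (hv₂ _).2 (by simp)
  obtain ⟨oy, oy'⟩ := hK.rot.off ay
  have hnx : ¬ K.Adj x v₂ := fun h => hK.m₁₂ w x hxw.symm aw ax ha.symm h.symm
  have hnzy : ¬ K.Adj w y := fun h => hK.tri v₂ w y ha.symm h ay
  obtain ⟨t₁, t₂, ht1, ht2, ht12, hy⟩ := hK.two_neighbors ay.symm
  have at₁ : K.Adj y t₁ := (hy _).2 (by simp)
  have at₂ : K.Adj y t₂ := (hy _).2 (by simp)
  have oy₁ : y ≠ u₁ ∧ y ≠ u₂ ∧ y ≠ u₃ ∧ y ≠ u₄ := ⟨oy.2.2, hyu, oy.1, oy.2.1⟩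
  have oy₂ : y ≠ v₁ ∧ y ≠ v₂ ∧ y ≠ v₃ ∧ y ≠ v₄ := ⟨oy'.2.2.2, oy'.1, oy'.2.1, oy'.2.2.1⟩
  have ot₁ := hK.off_of_adj oy₁ oy₂ at₁
  have ot₂ := hK.off_of_adj oy₁ oy₂ at₂
  have hfit : baseLeft.Fit K (mkLab v₃ [v₃, v₃, v₄, v₃, z, x, v₃, v₃, v₃, v₃, v₃, t₁, t₂]
      [u₁, u₂, u₃, u₄, v₁, w, v₂, y] (ext p q g)) := by
    refine ⟨mkLab_inj ?_ ?_ ?_ hi hf, fun n hn => mkLab_fresh hf n hn, ?_, ?_, by simp [baseLeft],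
      by simp [baseLeft]⟩
    · simp only [List.nodup_cons, List.mem_cons, List.not_mem_nil, or_false, not_or,
        not_false_eq_true, List.nodup_nil, and_true]
      grind [SimpleGraph.adj_comm]
    · simp only [List.forall_mem_cons]
      exact ⟨⟨_, au₁⟩, ⟨_, au₁.symm⟩, ⟨_, au₃⟩, ⟨_, au₃.symm⟩, ⟨_, aw⟩, ⟨_, aw.symm⟩, ⟨_, av₂.symm⟩, ⟨_, ay.symm⟩, by simp⟩
    · suffices h : ∀ t ∈ [v₃, v₄, z, x, t₁, t₂], t ∈ K.support ∧ t ∉ [u₁, u₂, u₃, u₄, v₁, w, v₂, y] from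
        forall_mem_of_subset (by simp [List.cons_subset]) h
      simp only [List.forall_mem_cons]
      simp only [List.mem_cons, List.not_mem_nil, or_false, not_or]
      refine ⟨⟨⟨_, av₃.symm⟩, ?_⟩, ⟨⟨_, av₄.symm⟩, ?_⟩, ⟨⟨_, az.symm⟩, ?_⟩, ⟨⟨_, ax.symm⟩, ?_⟩, ⟨⟨_, at₁.symm⟩, ?_⟩, ⟨⟨_, at₂.symm⟩, ?_⟩, by simp⟩ <;>
        grind [SimpleGraph.irrefl, SimpleGraph.adj_comm]
    · intro n h1 h2
      replace h2 : n < 28 := h2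
      interval_cases n
      · exact nb_iff rfl hK.n₁ rfl
      · exact nb_iff rfl (fun y => (hK.n₂ y).trans or_left_comm) rfl
      · exact nb_iff rfl (fun y => (hK.n₃ y).trans or_left_comm) rfl
      · exact nb_iff rfl (fun y => (hK.n₄ y).trans or_left_comm) rfl
      · exact nb_iff rfl hv rfl
      · exact nb_iff rfl hw rfl
      · exact nb_iff rfl (fun y => (hv₂ y).trans or_left_comm) rfl
      · exact nb_iff rfl hy rfl
    · simp only [baseLeft, List.forall_mem_cons]
      change v₃ ≠ v₄ ∧ z ≠ x ∧ t₁ ≠ t₂ ∧ v₃ ≠ x ∧ v₄ ≠ x ∧ _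
      refine ⟨?_, ?_, ?_, ?_, ?_, by simp⟩ <;> grind [SimpleGraph.adj_comm]
  refine baseLeft.checked.exp hfit (k := 1) rfl (by simp [baseLeft]) hg (fun j => ?_) ?_
    (by simp [baseLeft]) (Or.inr ⟨rfl, (29, 25, 27), by simp [baseLeft], h0, h4, h78⟩) hH hH₁
  · have := mkLab_new (d := v₃) (L := [v₃, v₃, v₄, v₃, z, x, v₃, v₃, v₃, v₃, v₃, t₁, t₂])
      (I := [u₁, u₂, u₃, u₄, v₁, w, v₂, y]) (h := ext p q g) (j + 2)
    rw [show baseLeft.m + 2 + j = 20 + [u₁, u₂, u₃, u₄, v₁, w, v₂, y].length + (j + 2) by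
      simp [baseLeft]; omega]
    exact this.symm
  · intro e he
    replace he : e ∈ [(7, 8)] := he
    rw [List.mem_singleton] at he
    subst he
    exact exists_mem_S hfit baseLeft.checked.shape (n := 27) (hg.adj (7, 8) (by decide)) (by norm_num) h78

lemma exp_of_ins_right (hK : QS K u₁ u₂ u₃ u₄ v₁ v₂ v₃ v₄) (hv : ∀ y, K.Adj v₁ y ↔ y = u₁ ∨ y = w ∨ y = x)
    (hwu : w ≠ u₁) (hxu : x ≠ u₁) (hxw : x ≠ w) (hb : K.Adj x v₄)
    (hp : p ∉ K.support) (hq : q ∉ K.support) (hpq : p ≠ q)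
    {g : ℕ → X} (hg : IsExp (ins K u₁ u₂ v₁ w p q) u₁ p q v₁ specB g)
    (hH : Emb (insL g specB.ops 20 (ins K u₁ u₂ v₁ w p q)) H)
    (hH₁ : Emb (insL g (specB.ops.take 1) 20 (ins K u₁ u₂ v₁ w p q)) H)
    {y' : X} (hv₄ : ∀ t, K.Adj v₄ t ↔ t = u₄ ∨ t = x ∨ t = y') (hyu : y' ≠ u₄) (hyx : y' ≠ x)
    (h0 : g 0 = v₁) (h4 : g 4 = x) (h78 : g 7 = y' ∨ g 8 = y') :
    Exp K H u₁ u₂ u₃ u₄ := by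
  have au₁ : K.Adj u₁ u₂ := (hK.n₁ _).2 (by simp)
  have au₃ : K.Adj u₃ u₄ := (hK.n₃ _).2 (by simp)
  have av₁ : K.Adj u₁ v₁ := (hK.n₁ _).2 (by simp)
  have av₂ : K.Adj u₂ v₂ := (hK.n₂ _).2 (by simp)
  have av₃ : K.Adj u₃ v₃ := (hK.n₃ _).2 (by simp)
  have av₄ : K.Adj u₄ v₄ := (hK.n₄ _).2 (by simp)
  have aw : K.Adj v₁ w := (hv _).2 (by simp)
  have ax : K.Adj v₁ x := (hv _).2 (by simp)
  obtain ⟨ow, ow'⟩ := hK.off aw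
  obtain ⟨ox, ox'⟩ := hK.off ax
  have hnwx : ¬ K.Adj w x := fun h => hK.tri v₁ w x aw h ax
  have hnd := hK.nodup
  simp only [List.nodup_cons, List.mem_cons, List.not_mem_nil, or_false, not_or, not_false_eq_true,
    List.nodup_nil, and_true] at hnd
  have hsup := ins_support au₁ aw hp hq hpq
  obtain ⟨hi, hf⟩ := ext_props hg hp hq hpq hsup
  obtain ⟨z', hz1', hz2', hx⟩ := hK.third_neighbor ax.symm hb (fun h => by simp [h] at hnd)
  have az' : K.Adj x z' := (hx _).2 (by simp)
  have oz' := hK.off_of_adj ⟨hxu, ox⟩ ox' az'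
  have ay' : K.Adj v₄ y' := (hv₄ _).2 (by simp)
  obtain ⟨oy₄, oy₄'⟩ := hK.rot.rot.rot.off ay'
  have hnw : ¬ K.Adj w v₄ := fun h => hK.m₄₁ w x hxw.symm h.symm hb.symm aw ax
  have hnzy' : ¬ K.Adj x y' := fun h => hK.tri v₄ x y' hb.symm h ay'
  obtain ⟨t₁, t₂, ht1, ht2, ht12, hy⟩ := hK.two_neighbors ay'.symm
  have at₁ : K.Adj y' t₁ := (hy _).2 (by simp)
  have at₂ : K.Adj y' t₂ := (hy _).2 (by simp)
  have oy₁ : y' ≠ u₁ ∧ y' ≠ u₂ ∧ y' ≠ u₃ ∧ y' ≠ u₄ := ⟨oy₄.1, oy₄.2.1, oy₄.2.2, hyu⟩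
  have oy₂ : y' ≠ v₁ ∧ y' ≠ v₂ ∧ y' ≠ v₃ ∧ y' ≠ v₄ :=
    ⟨oy₄'.2.1, oy₄'.2.2.1, oy₄'.2.2.2, oy₄'.1⟩
  have ot₁ := hK.off_of_adj oy₁ oy₂ at₁
  have ot₂ := hK.off_of_adj oy₁ oy₂ at₂
  have hfit : baseRight.Fit K (mkLab v₃ [v₂, v₃, v₃, v₃, v₃, w, z', v₃, v₃, v₃, v₃, t₁, t₂]
      [u₁, u₂, u₃, u₄, v₁, x, v₄, y'] (ext p q g)) := by
    refine ⟨mkLab_inj ?_ ?_ ?_ hi hf, fun n hn => mkLab_fresh hf n hn, ?_, ?_, by simp [baseRight],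
      by simp [baseRight]⟩
    · simp only [List.nodup_cons, List.mem_cons, List.not_mem_nil, or_false, not_or,
        not_false_eq_true, List.nodup_nil, and_true]
      grind [SimpleGraph.adj_comm]
    · simp only [List.forall_mem_cons]
      exact ⟨⟨_, au₁⟩, ⟨_, au₁.symm⟩, ⟨_, au₃⟩, ⟨_, au₃.symm⟩, ⟨_, aw⟩, ⟨_, ax.symm⟩, ⟨_, av₄.symm⟩, ⟨_, ay'.symm⟩, by simp⟩
    · suffices h : ∀ t ∈ [v₃, v₂, z', w, t₁, t₂], t ∈ K.support ∧ t ∉ [u₁, u₂, u₃, u₄, v₁, x, v₄, y'] from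
        forall_mem_of_subset (by simp [List.cons_subset]) h
      simp only [List.forall_mem_cons]
      simp only [List.mem_cons, List.not_mem_nil, or_false, not_or]
      refine ⟨⟨⟨_, av₃.symm⟩, ?_⟩, ⟨⟨_, av₂.symm⟩, ?_⟩, ⟨⟨_, az'.symm⟩, ?_⟩, ⟨⟨_, aw.symm⟩, ?_⟩, ⟨⟨_, at₁.symm⟩, ?_⟩, ⟨⟨_, at₂.symm⟩, ?_⟩, by simp⟩ <;>
        grind [SimpleGraph.irrefl, SimpleGraph.adj_comm]
    · intro n h1 h2
      replace h2 : n < 28 := h2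
      interval_cases n
      · exact nb_iff rfl hK.n₁ rfl
      · exact nb_iff rfl (fun y => (hK.n₂ y).trans or_left_comm) rfl
      · exact nb_iff rfl (fun y => (hK.n₃ y).trans or_left_comm) rfl
      · exact nb_iff rfl (fun y => (hK.n₄ y).trans or_left_comm) rfl
      · exact nb_iff rfl (fun y => (hv y).trans (or_congr_right or_comm)) rfl
      · exact nb_iff rfl hx rfl
      · exact nb_iff rfl (fun y => (hv₄ y).trans or_left_comm) rfl
      · exact nb_iff rfl hy rfl
    · simp only [baseRight, List.forall_mem_cons]
      change v₂ ≠ v₃ ∧ w ≠ z' ∧ t₁ ≠ t₂ ∧ v₂ ≠ w ∧ v₃ ≠ w ∧ _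
      refine ⟨?_, ?_, ?_, ?_, ?_, by simp⟩ <;> grind [SimpleGraph.adj_comm]
  refine baseRight.checked.exp hfit (k := 1) rfl (by simp [baseRight]) hg (fun j => ?_) ?_
    (by simp [baseRight]) (Or.inr ⟨rfl, (24, 25, 27), by simp [baseRight], h0, h4, h78⟩) hH hH₁
  · have := mkLab_new (d := v₃) (L := [v₂, v₃, v₃, v₃, v₃, w, z', v₃, v₃, v₃, v₃, t₁, t₂])
      (I := [u₁, u₂, u₃, u₄, v₁, x, v₄, y']) (h := ext p q g) (j + 2)
    rw [show baseRight.m + 2 + j = 20 + [u₁, u₂, u₃, u₄, v₁, x, v₄, y'].length + (j + 2) by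
      simp [baseRight]; omega]
    exact this.symm
  · intro e he
    replace he : e ∈ [(7, 8)] := he
    rw [List.mem_singleton] at he
    subst he
    exact exists_mem_S hfit baseRight.checked.shape (n := 27) (hg.adj (7, 8) (by decide)) (by norm_num) h78

lemma exp_of_ins₁₀ (hK : QS K u₁ u₂ u₃ u₄ v₁ v₂ v₃ v₄) (hv : ∀ y, K.Adj v₁ y ↔ y = u₁ ∨ y = w ∨ y = x)
    (hwu : w ≠ u₁) (hxu : x ≠ u₁) (hxw : x ≠ w) (ha : K.Adj w v₂) (hb : ¬ K.Adj x v₄)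
    (hp : p ∉ K.support) (hq : q ∉ K.support) (hpq : p ≠ q) {k : ℕ} {sp : Spec}
    (hk : specs[k]? = some sp)
    {g : ℕ → X} (hg : IsExp (ins K u₁ u₂ v₁ w p q) u₁ p q v₁ sp g)
    (hH : Emb (insL g sp.ops 20 (ins K u₁ u₂ v₁ w p q)) H)
    (hH₁ : Emb (insL g (sp.ops.take 1) 20 (ins K u₁ u₂ v₁ w p q)) H) :
    Exp K H u₁ u₂ u₃ u₄ := by
  have au₁ : K.Adj u₁ u₂ := (hK.n₁ _).2 (by simp)
  have au₃ : K.Adj u₃ u₄ := (hK.n₃ _).2 (by simp)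
  have av₁ : K.Adj u₁ v₁ := (hK.n₁ _).2 (by simp)
  have av₂ : K.Adj u₂ v₂ := (hK.n₂ _).2 (by simp)
  have av₃ : K.Adj u₃ v₃ := (hK.n₃ _).2 (by simp)
  have av₄ : K.Adj u₄ v₄ := (hK.n₄ _).2 (by simp)
  have aw : K.Adj v₁ w := (hv _).2 (by simp)
  have ax : K.Adj v₁ x := (hv _).2 (by simp)
  obtain ⟨ow, ow'⟩ := hK.off aw
  obtain ⟨ox, ox'⟩ := hK.off ax
  obtain ⟨y, hyu, hyw, hv₂⟩ := hK.third_neighbor av₂.symm ha.symm (fun h => ow.1 h.symm)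
  by_cases hviol : k = 1 ∧ g 0 = q ∧ g 4 = w ∧ (g 7 = y ∨ g 8 = y)
  · obtain ⟨rfl, h0, h4, h78⟩ := hviol
    obtain rfl : specB = sp := by simpa [specs] using hk
    exact exp_of_ins_left hK hv hwu hxu hxw ha hp hq hpq hg hH hH₁ hv₂ hyu hyw h0 h4 h78
  have hnwx : ¬ K.Adj w x := fun h => hK.tri v₁ w x aw h ax
  have hnd := hK.nodup
  simp only [List.nodup_cons, List.mem_cons, List.not_mem_nil, or_false, not_or, not_false_eq_true,
    List.nodup_nil, and_true] at hnd
  have hsup := ins_support au₁ aw hp hq hpq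
  obtain ⟨hi, hf⟩ := ext_props hg hp hq hpq hsup
  obtain ⟨z, hz1, hz2, hw⟩ := hK.third_neighbor aw.symm ha (fun h => by simp [h] at hnd)
  have az : K.Adj w z := (hw _).2 (by simp)
  have oz := hK.off_of_adj ⟨hwu, ow⟩ ow' az
  have ay : K.Adj v₂ y := (hv₂ _).2 (by simp)
  obtain ⟨oy, oy'⟩ := hK.rot.off ay
  have hnx : ¬ K.Adj x v₂ := fun h => hK.m₁₂ w x hxw.symm aw ax ha.symm h.symm
  have hnzy : ¬ K.Adj w y := fun h => hK.tri v₂ w y ha.symm h ay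
  obtain ⟨x₁, x₂, hx1, hx2, hx12, hx⟩ := hK.two_neighbors ax.symm
  have ax₁ : K.Adj x x₁ := (hx _).2 (by simp)
  have ax₂ : K.Adj x x₂ := (hx _).2 (by simp)
  have ox₁ := hK.off_of_adj ⟨hxu, ox⟩ ox' ax₁
  have ox₂ := hK.off_of_adj ⟨hxu, ox⟩ ox' ax₂
  have hfit : base₁₀.Fit K (mkLab v₃ [v₃, v₃, v₄, v₃, z, x₁, x₂, v₃, v₃, y]
      [u₁, u₂, u₃, u₄, v₁, w, x, v₂] (ext p q g)) := by
    refine ⟨mkLab_inj ?_ ?_ ?_ hi hf, fun n hn => mkLab_fresh hf n hn, ?_, ?_, by simp [base₁₀],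
      by simp [base₁₀]⟩
    · simp only [List.nodup_cons, List.mem_cons, List.not_mem_nil, or_false, not_or,
        not_false_eq_true, List.nodup_nil, and_true]
      grind [SimpleGraph.adj_comm]
    · simp only [List.forall_mem_cons]
      exact ⟨⟨_, au₁⟩, ⟨_, au₁.symm⟩, ⟨_, au₃⟩, ⟨_, au₃.symm⟩, ⟨_, aw⟩, ⟨_, aw.symm⟩, ⟨_, ax.symm⟩, ⟨_, av₂.symm⟩, by simp⟩
    · suffices h : ∀ t ∈ [v₃, v₄, z, x₁, x₂, y], t ∈ K.support ∧ t ∉ [u₁, u₂, u₃, u₄, v₁, w, x, v₂] from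
        forall_mem_of_subset (by simp [List.cons_subset]) h
      simp only [List.forall_mem_cons]
      simp only [List.mem_cons, List.not_mem_nil, or_false, not_or]
      refine ⟨⟨⟨_, av₃.symm⟩, ?_⟩, ⟨⟨_, av₄.symm⟩, ?_⟩, ⟨⟨_, az.symm⟩, ?_⟩, ⟨⟨_, ax₁.symm⟩, ?_⟩, ⟨⟨_, ax₂.symm⟩, ?_⟩, ⟨⟨_, ay.symm⟩, ?_⟩, by simp⟩ <;>
        grind [SimpleGraph.irrefl, SimpleGraph.adj_comm]
    · intro n h1 h2
      replace h2 : n < 28 := h2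
      interval_cases n
      · exact nb_iff rfl hK.n₁ rfl
      · exact nb_iff rfl (fun y => (hK.n₂ y).trans or_left_comm) rfl
      · exact nb_iff rfl (fun y => (hK.n₃ y).trans or_left_comm) rfl
      · exact nb_iff rfl (fun y => (hK.n₄ y).trans or_left_comm) rfl
      · exact nb_iff rfl hv rfl
      · exact nb_iff rfl (fun y => (hw y).trans (or_congr_right or_comm)) rfl
      · exact nb_iff rfl (fun y => (hx y).trans (or_congr_right or_comm)) rfl
      · exact nb_iff rfl hv₂ rfl
    · simp only [base₁₀, List.forall_mem_cons]
      change v₃ ≠ v₄ ∧ x₁ ≠ x₂ ∧ y ≠ z ∧ y ≠ v₃ ∧ y ≠ v₄ ∧ v₄ ≠ x₁ ∧ v₄ ≠ x₂ ∧ _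
      refine ⟨?_, ?_, ?_, ?_, ?_, ?_, ?_, by simp⟩ <;> grind [SimpleGraph.adj_comm]
  refine base₁₀.checked.exp_of_carve base₁₀.carved.checked (by decide) hfit ?_ (by simp [base₁₀]) hk
    hg (fun j => ?_) ?_ hH hH₁
  · simp only [base₁₀.nonadj, List.forall_mem_cons]
    exact ⟨hK.nonadj.2.2.2.2.2, by simp⟩
  · have := mkLab_new (d := v₃) (L := [v₃, v₃, v₄, v₃, z, x₁, x₂, v₃, v₃, y])
      (I := [u₁, u₂, u₃, u₄, v₁, w, x, v₂]) (h := ext p q g) (j + 2)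
    rw [show base₁₀.m + 2 + j = 20 + [u₁, u₂, u₃, u₄, v₁, w, x, v₂].length + (j + 2) by
      simp [base₁₀]; omega]
    exact this.symm
  · intro hk1 a ha' h0 h4
    simp only [base₁₀, List.mem_singleton] at ha'
    subst ha'
    exact not_or.1 fun h => hviol ⟨hk1, h0, h4, h⟩

lemma exp_of_ins₁₁ (hK : QS K u₁ u₂ u₃ u₄ v₁ v₂ v₃ v₄) (hv : ∀ y, K.Adj v₁ y ↔ y = u₁ ∨ y = w ∨ y = x)
    (hwu : w ≠ u₁) (hxu : x ≠ u₁) (hxw : x ≠ w) (ha : K.Adj w v₂) (hb : K.Adj x v₄)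
    (hp : p ∉ K.support) (hq : q ∉ K.support) (hpq : p ≠ q) {k : ℕ} {sp : Spec}
    (hk : specs[k]? = some sp)
    {g : ℕ → X} (hg : IsExp (ins K u₁ u₂ v₁ w p q) u₁ p q v₁ sp g)
    (hH : Emb (insL g sp.ops 20 (ins K u₁ u₂ v₁ w p q)) H)
    (hH₁ : Emb (insL g (sp.ops.take 1) 20 (ins K u₁ u₂ v₁ w p q)) H) :
    Exp K H u₁ u₂ u₃ u₄ := by
  have au₁ : K.Adj u₁ u₂ := (hK.n₁ _).2 (by simp)
  have au₃ : K.Adj u₃ u₄ := (hK.n₃ _).2 (by simp)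
  have av₁ : K.Adj u₁ v₁ := (hK.n₁ _).2 (by simp)
  have av₂ : K.Adj u₂ v₂ := (hK.n₂ _).2 (by simp)
  have av₃ : K.Adj u₃ v₃ := (hK.n₃ _).2 (by simp)
  have av₄ : K.Adj u₄ v₄ := (hK.n₄ _).2 (by simp)
  have aw : K.Adj v₁ w := (hv _).2 (by simp)
  have ax : K.Adj v₁ x := (hv _).2 (by simp)
  obtain ⟨ow, ow'⟩ := hK.off aw
  obtain ⟨ox, ox'⟩ := hK.off ax
  obtain ⟨y, hyu, hyw, hv₂⟩ := hK.third_neighbor av₂.symm ha.symm (fun h => ow.1 h.symm)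
  by_cases hviol : k = 1 ∧ g 0 = q ∧ g 4 = w ∧ (g 7 = y ∨ g 8 = y)
  · obtain ⟨rfl, h0, h4, h78⟩ := hviol
    obtain rfl : specB = sp := by simpa [specs] using hk
    exact exp_of_ins_left hK hv hwu hxu hxw ha hp hq hpq hg hH hH₁ hv₂ hyu hyw h0 h4 h78
  obtain ⟨y', hyu', hyx, hv₄⟩ := hK.third_neighbor av₄.symm hb.symm (fun h => ox.2.2 h.symm)
  by_cases hviol' : k = 1 ∧ g 0 = v₁ ∧ g 4 = x ∧ (g 7 = y' ∨ g 8 = y')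
  · obtain ⟨rfl, h0, h4, h78⟩ := hviol'
    obtain rfl : specB = sp := by simpa [specs] using hk
    exact exp_of_ins_right hK hv hwu hxu hxw hb hp hq hpq hg hH hH₁ hv₄ hyu' hyx h0 h4 h78
  have hnwx : ¬ K.Adj w x := fun h => hK.tri v₁ w x aw h ax
  have hnd := hK.nodup
  simp only [List.nodup_cons, List.mem_cons, List.not_mem_nil, or_false, not_or, not_false_eq_true,
    List.nodup_nil, and_true] at hnd
  have hsup := ins_support au₁ aw hp hq hpq
  obtain ⟨hi, hf⟩ := ext_props hg hp hq hpq hsup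
  obtain ⟨z, hz1, hz2, hw⟩ := hK.third_neighbor aw.symm ha (fun h => by simp [h] at hnd)
  have az : K.Adj w z := (hw _).2 (by simp)
  have oz := hK.off_of_adj ⟨hwu, ow⟩ ow' az
  have ay : K.Adj v₂ y := (hv₂ _).2 (by simp)
  obtain ⟨oy, oy'⟩ := hK.rot.off ay
  have hnx : ¬ K.Adj x v₂ := fun h => hK.m₁₂ w x hxw.symm aw ax ha.symm h.symm
  have hnzy : ¬ K.Adj w y := fun h => hK.tri v₂ w y ha.symm h ay
  obtain ⟨z', hz1', hz2', hx⟩ := hK.third_neighbor ax.symm hb (fun h => by simp [h] at hnd)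
  have az' : K.Adj x z' := (hx _).2 (by simp)
  have oz' := hK.off_of_adj ⟨hxu, ox⟩ ox' az'
  have ay' : K.Adj v₄ y' := (hv₄ _).2 (by simp)
  obtain ⟨oy₄, oy₄'⟩ := hK.rot.rot.rot.off ay'
  have hnw : ¬ K.Adj w v₄ := fun h => hK.m₄₁ w x hxw.symm h.symm hb.symm aw ax
  have hnzy' : ¬ K.Adj x y' := fun h => hK.tri v₄ x y' hb.symm h ay'
  have hfit : base₁₁.Fit K (mkLab v₃ [v₃, v₃, v₃, v₃, z, v₃, z', v₃, v₃, y, y']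
      [u₁, u₂, u₃, u₄, v₁, w, x, v₂, v₄] (ext p q g)) := by
    refine ⟨mkLab_inj ?_ ?_ ?_ hi hf, fun n hn => mkLab_fresh hf n hn, ?_, ?_, by simp [base₁₁],
      by simp [base₁₁]⟩
    · simp only [List.nodup_cons, List.mem_cons, List.not_mem_nil, or_false, not_or,
        not_false_eq_true, List.nodup_nil, and_true]
      grind [SimpleGraph.adj_comm]
    · simp only [List.forall_mem_cons]
      exact ⟨⟨_, au₁⟩, ⟨_, au₁.symm⟩, ⟨_, au₃⟩, ⟨_, au₃.symm⟩, ⟨_, aw⟩, ⟨_, aw.symm⟩, ⟨_, ax.symm⟩, ⟨_, av₂.symm⟩, ⟨_, av₄.symm⟩, by simp⟩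
    · suffices h : ∀ t ∈ [v₃, z, z', y, y'], t ∈ K.support ∧ t ∉ [u₁, u₂, u₃, u₄, v₁, w, x, v₂, v₄] from
        forall_mem_of_subset (by simp [List.cons_subset]) h
      simp only [List.forall_mem_cons]
      simp only [List.mem_cons, List.not_mem_nil, or_false, not_or]
      refine ⟨⟨⟨_, av₃.symm⟩, ?_⟩, ⟨⟨_, az.symm⟩, ?_⟩, ⟨⟨_, az'.symm⟩, ?_⟩, ⟨⟨_, ay.symm⟩, ?_⟩, ⟨⟨_, ay'.symm⟩, ?_⟩, by simp⟩ <;>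
        grind [SimpleGraph.irrefl, SimpleGraph.adj_comm]
    · intro n h1 h2
      replace h2 : n < 29 := h2
      interval_cases n
      · exact nb_iff rfl hK.n₁ rfl
      · exact nb_iff rfl (fun y => (hK.n₂ y).trans or_left_comm) rfl
      · exact nb_iff rfl (fun y => (hK.n₃ y).trans or_left_comm) rfl
      · exact nb_iff rfl (fun y => (hK.n₄ y).trans or_left_comm) rfl
      · exact nb_iff rfl hv rfl
      · exact nb_iff rfl (fun y => (hw y).trans (or_congr_right or_comm)) rfl
      · exact nb_iff rfl (fun y => (hx y).trans (or_congr_right or_comm)) rfl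
      · exact nb_iff rfl hv₂ rfl
      · exact nb_iff rfl hv₄ rfl
    · simp only [base₁₁, List.forall_mem_cons]
      change y ≠ z ∧ y ≠ v₃ ∧ y' ≠ z' ∧ y' ≠ v₃ ∧ _
      refine ⟨?_, ?_, ?_, ?_, by simp⟩ <;> grind [SimpleGraph.adj_comm]
  refine base₁₁.checked.exp_of_carve base₁₁.carved.checked (by decide) hfit ?_ (by simp [base₁₁]) hk
    hg (fun j => ?_) ?_ hH hH₁
  · simp [base₁₁.nonadj]
  · have := mkLab_new (d := v₃) (L := [v₃, v₃, v₃, v₃, z, v₃, z', v₃, v₃, y, y'])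
      (I := [u₁, u₂, u₃, u₄, v₁, w, x, v₂, v₄]) (h := ext p q g) (j + 2)
    rw [show base₁₁.m + 2 + j = 20 + [u₁, u₂, u₃, u₄, v₁, w, x, v₂, v₄].length + (j + 2) by
      simp [base₁₁]; omega]
    exact this.symm
  · intro hk1 a ha' h0 h4
    simp only [base₁₁, List.mem_cons, List.not_mem_nil, or_false] at ha'
    rcases ha' with rfl | rfl
    · exact not_or.1 fun h => hviol ⟨hk1, h0, h4, h⟩
    · exact not_or.1 fun h => hviol' ⟨hk1, h0, h4, h⟩

/-- An expansion of a short extension leads to an expansion of the original graph. -/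
theorem exp_of_ins (hK : QS K u₁ u₂ u₃ u₄ v₁ v₂ v₃ v₄) (hv : ∀ y, K.Adj v₁ y ↔ y = u₁ ∨ y = w ∨ y = x)
    (hwu : w ≠ u₁) (hxu : x ≠ u₁) (hxw : x ≠ w) (hab : K.Adj x v₄ → K.Adj w v₂)
    (hp : p ∉ K.support) (hq : q ∉ K.support) (hpq : p ≠ q)
    (h : Exp (ins K u₁ u₂ v₁ w p q) H u₁ p q v₁) : Exp K H u₁ u₂ u₃ u₄ := by
  obtain ⟨sp, hsp, g, hg, hH, hH₁⟩ := h
  obtain ⟨k, hk⟩ := List.mem_iff_getElem?.1 hsp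
  by_cases ha : K.Adj w v₂
  · by_cases hb : K.Adj x v₄
    · exact exp_of_ins₁₁ hK hv hwu hxu hxw ha hb hp hq hpq hk hg hH hH₁
    · exact exp_of_ins₁₀ hK hv hwu hxu hxw ha hb hp hq hpq hk hg hH hH₁
  · exact exp_of_ins₀₀ hK hv hwu hxu hxw ha (fun hb => ha (hab hb)) hp hq hpq hk hg hH hH₁

end Skel

end QuadExp

namespace QuadExp

open SimpleGraph

variable {X : Type*} {W : Type*} {K : SimpleGraph X} {H : SimpleGraph W}
  {u₁ u₂ u₃ u₄ v₁ v₂ v₃ v₄ w x p q : X}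

section Ins

variable {u v x y : X}

lemma ins_adj_left (huv : K.Adj u v) (hxy : K.Adj x y) (hp : p ∉ K.support) (hpq : p ≠ q) (t : X) :
    (ins K u v x y p q).Adj p t ↔ t = u ∨ t = v ∨ t = q := by
  have h1 : p ≠ u := fun h => hp (h ▸ ⟨v, huv⟩)
  have h2 : p ≠ v := fun h => hp (h ▸ ⟨u, huv.symm⟩)
  have h3 : p ≠ x := fun h => hp (h ▸ ⟨y, hxy⟩)
  have h4 : p ≠ y := fun h => hp (h ▸ ⟨x, hxy.symm⟩)
  have h5 : ¬ K.Adj p t := fun h => hp ⟨t, h⟩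
  rw [ins_adj]
  simp only [Sym2.eq_iff]
  constructor
  · tauto
  · rintro (rfl | rfl | rfl) <;> simp [*]

lemma ins_adj_right (huv : K.Adj u v) (hxy : K.Adj x y) (hq : q ∉ K.support) (hpq : p ≠ q) (t : X) :
    (ins K u v x y p q).Adj q t ↔ t = x ∨ t = y ∨ t = p := by
  have h1 : q ≠ u := fun h => hq (h ▸ ⟨v, huv⟩)
  have h2 : q ≠ v := fun h => hq (h ▸ ⟨u, huv.symm⟩)
  have h3 : q ≠ x := fun h => hq (h ▸ ⟨y, hxy⟩)
  have h4 : q ≠ y := fun h => hq (h ▸ ⟨x, hxy.symm⟩)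
  have h5 : ¬ K.Adj q t := fun h => hq ⟨t, h⟩
  rw [ins_adj]
  simp only [Sym2.eq_iff]
  constructor
  · tauto
  · rintro (rfl | rfl | rfl)
    · simp [*]
    · simp [*]
    · simp [*, hpq.symm]

lemma ins_cubic (hK : ∀ z ∈ K.support, (K.neighborSet z).encard = 3) (huv : K.Adj u v)
    (hxy : K.Adj x y) (hux : u ≠ x) (huy : u ≠ y) (hvx : v ≠ x) (hvy : v ≠ y) (hp : p ∉ K.support)
    (hq : q ∉ K.support) (hpq : p ≠ q) :
    ∀ z ∈ (ins K u v x y p q).support, ((ins K u v x y p q).neighborSet z).encard = 3 := by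
  have hu : u ∈ K.support := ⟨v, huv⟩
  have hv : v ∈ K.support := ⟨u, huv.symm⟩
  have hx : x ∈ K.support := ⟨y, hxy⟩
  have hy : y ∈ K.support := ⟨x, hxy.symm⟩
  have hn : ∀ z ∈ K.support, z ≠ p ∧ z ≠ q := fun z hz =>
    ⟨fun h => hp (h ▸ hz), fun h => hq (h ▸ hz)⟩
  have three : ∀ a b c : X, a ≠ b → a ≠ c → b ≠ c → ({a, b, c} : Set X).encard = 3 := by
    intro a b c h1 h2 h3
    rw [Set.encard_insert_of_notMem (by simp [h1, h2]), Set.encard_pair h3]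
    rfl
  have exch : ∀ z a b, K.Adj z b → a ∉ K.support →
      (insert a (K.neighborSet z \ {b})).encard = 3 := by
    intro z a b hb ha
    have h1 : a ∉ K.neighborSet z := fun h => ha ⟨z, (show K.Adj z a from h).symm⟩
    have h2 : b ∈ K.neighborSet z := hb
    rw [Set.encard_exchange h1 h2, hK z ⟨b, hb⟩]
  rw [ins_support huv hxy hp hq hpq]
  rintro z (rfl | rfl | hz)
  · rw [← three u v q huv.ne (hn u hu).2 (hn v hv).2]
    congr 1
    ext t
    exact ins_adj_left huv hxy hp hpq t
  · rw [← three x y p hxy.ne (hn x hx).1 (hn y hy).1]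
    congr 1
    ext t
    exact ins_adj_right huv hxy hq hpq t
  · have huv' := huv.ne
    have hxy' := hxy.ne
    have hzp := hn z hz
    by_cases h1 : z = u
    · subst h1
      rw [← exch z p v huv hp]
      congr 1
      ext t
      simp only [mem_neighborSet, ins_adj, Sym2.eq_iff, Set.mem_insert_iff, Set.mem_sdiff,
        Set.mem_singleton_iff]
      have := K.ne_of_adj (a := z) (b := t)
      grind
    by_cases h2 : z = v
    · subst h2
      rw [← exch z p u huv.symm hp]
      congr 1
      ext t
      simp only [mem_neighborSet, ins_adj, Sym2.eq_iff, Set.mem_insert_iff, Set.mem_sdiff,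
        Set.mem_singleton_iff]
      grind
    by_cases h3 : z = x
    · subst h3
      rw [← exch z q y hxy hq]
      congr 1
      ext t
      simp only [mem_neighborSet, ins_adj, Sym2.eq_iff, Set.mem_insert_iff, Set.mem_sdiff,
        Set.mem_singleton_iff]
      grind
    by_cases h4 : z = y
    · subst h4
      rw [← exch z q x hxy.symm hq]
      congr 1
      ext t
      simp only [mem_neighborSet, ins_adj, Sym2.eq_iff, Set.mem_insert_iff, Set.mem_sdiff,
        Set.mem_singleton_iff]
      grind
    rw [← hK z hz]
    congr 1
    ext t
    simp only [mem_neighborSet, ins_adj, Sym2.eq_iff]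
    grind

end Ins

set_option maxHeartbeats 800000 in
/-- A short extension at a quadrangle inherits the conditions for its new quadrangle. -/
theorem QS.ins (hK : QS K u₁ u₂ u₃ u₄ v₁ v₂ v₃ v₄) (hv : ∀ y, K.Adj v₁ y ↔ y = u₁ ∨ y = w ∨ y = x)
    (hwu : w ≠ u₁) (hxu : x ≠ u₁) (hxw : x ≠ w) (hp : p ∉ K.support) (hq : q ∉ K.support)
    (hpq : p ≠ q) : QS (ins K u₁ u₂ v₁ w p q) u₁ p q v₁ u₄ u₂ w x := by
  have a12 : K.Adj u₁ u₂ := (hK.n₁ _).2 (by simp)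
  have a14 : K.Adj u₁ u₄ := (hK.n₁ _).2 (by simp)
  have av₁ : K.Adj u₁ v₁ := (hK.n₁ _).2 (by simp)
  have aw : K.Adj v₁ w := (hv _).2 (by simp)
  have ax : K.Adj v₁ x := (hv _).2 (by simp)
  obtain ⟨⟨ow2, ow3, ow4⟩, ow1', ow2', ow3', ow4'⟩ := hK.off aw
  obtain ⟨⟨ox2, ox3, ox4⟩, ox1', ox2', ox3', ox4'⟩ := hK.off ax
  have hnwx : ¬ K.Adj w x := fun h => hK.tri v₁ w x aw h ax
  have hnd := hK.nodup
  simp only [List.nodup_cons, List.mem_cons, List.not_mem_nil, or_false, not_or, not_false_eq_true,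
    List.nodup_nil, and_true] at hnd
  have hn : ∀ z ∈ K.support, z ≠ p ∧ z ≠ q := fun z hz =>
    ⟨fun h => hp (h ▸ hz), fun h => hq (h ▸ hz)⟩
  have su₁ := hn u₁ ⟨_, a12⟩
  have su₂ := hn u₂ ⟨_, a12.symm⟩
  have su₄ := hn u₄ ⟨_, a14.symm⟩
  have su₃ := hn u₃ ⟨_, (hK.n₃ u₄).2 (by simp)⟩
  have sv₂ := hn v₂ ⟨u₂, ((hK.n₂ v₂).2 (by simp)).symm⟩
  have sv₄ := hn v₄ ⟨u₄, ((hK.n₄ v₄).2 (by simp)).symm⟩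
  have sv₁ := hn v₁ ⟨_, aw⟩
  have sw := hn w ⟨_, aw.symm⟩
  have sx := hn x ⟨_, ax.symm⟩
  have np := ins_adj_left (q := q) a12 aw hp hpq
  have nq := ins_adj_right (p := p) a12 aw hq hpq
  have hKp : ∀ t, ¬ K.Adj t p := fun t h => hp ⟨t, h.symm⟩
  have hKq : ∀ t, ¬ K.Adj t q := fun t h => hq ⟨t, h.symm⟩
  have nu₁ : ∀ t, (QuadExp.ins K u₁ u₂ v₁ w p q).Adj u₁ t ↔ t = p ∨ t = v₁ ∨ t = u₄ := by
    intro t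
    rw [ins_adj, hK.n₁]
    simp only [Sym2.eq_iff]
    grind
  have nu₂ : ∀ t, (QuadExp.ins K u₁ u₂ v₁ w p q).Adj u₂ t ↔ t = p ∨ t = u₃ ∨ t = v₂ := by
    intro t
    rw [ins_adj, hK.n₂]
    simp only [Sym2.eq_iff]
    grind
  have nu₄ : ∀ t, (QuadExp.ins K u₁ u₂ v₁ w p q).Adj u₄ t ↔ t = u₁ ∨ t = u₃ ∨ t = v₄ := by
    intro t
    rw [ins_adj, hK.n₄]
    simp only [Sym2.eq_iff]
    grind
  have nv₁ : ∀ t, (QuadExp.ins K u₁ u₂ v₁ w p q).Adj v₁ t ↔ t = q ∨ t = u₁ ∨ t = x := by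
    intro t
    rw [ins_adj, hv]
    simp only [Sym2.eq_iff]
    grind
  have nw : ∀ t, (QuadExp.ins K u₁ u₂ v₁ w p q).Adj w t ↔ t = q ∨ (K.Adj w t ∧ t ≠ v₁) := by
    intro t
    rw [ins_adj]
    simp only [Sym2.eq_iff]
    grind
  have nx : ∀ t, (QuadExp.ins K u₁ u₂ v₁ w p q).Adj x t ↔ K.Adj x t := by
    intro t
    rw [ins_adj]
    simp only [Sym2.eq_iff]
    grind
  have nold : ∀ s t, s ≠ p → s ≠ q → t ≠ p → t ≠ q →
      (QuadExp.ins K u₁ u₂ v₁ w p q).Adj s t → K.Adj s t := by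
    intro s t h1 h2 h3 h4 h
    rw [ins_adj] at h
    simp only [Sym2.eq_iff] at h
    grind
  have kw : ¬ K.Adj w u₁ ∧ ¬ K.Adj w u₂ ∧ ¬ K.Adj w u₃ ∧ ¬ K.Adj w u₄ := by
    simp only [K.adj_comm w, hK.n₁, hK.n₂, hK.n₃, hK.n₄]
    grind
  have kx : ¬ K.Adj x u₁ ∧ ¬ K.Adj x u₂ ∧ ¬ K.Adj x u₃ ∧ ¬ K.Adj x u₄ := by
    simp only [K.adj_comm x, hK.n₁, hK.n₂, hK.n₃, hK.n₄]
    grind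
  have hcub := ins_cubic hK.cubic a12 aw (by grind) (by grind) (by grind) (by grind) hp hq hpq
  refine ⟨?_, hcub, ?_, ?_, ?_, ?_, ?_, ?_, ?_, ?_, ?_, ?_, ?_, ?_⟩
  · rw [ins_support a12 aw hp hq hpq]
    exact (hK.fin.insert q).insert p
  · have tp : ∀ b c, (QuadExp.ins K u₁ u₂ v₁ w p q).Adj p b →
        (QuadExp.ins K u₁ u₂ v₁ w p q).Adj b c → ¬ (QuadExp.ins K u₁ u₂ v₁ w p q).Adj p c := by
      intro b c h1 h2 h3
      rw [np] at h1 h3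
      rcases h1 with rfl | rfl | rfl
      · rw [nu₁] at h2; grind
      · rw [nu₂] at h2; grind
      · rw [nq] at h2; grind
    have tq : ∀ b c, (QuadExp.ins K u₁ u₂ v₁ w p q).Adj q b →
        (QuadExp.ins K u₁ u₂ v₁ w p q).Adj b c → ¬ (QuadExp.ins K u₁ u₂ v₁ w p q).Adj q c := by
      intro b c h1 h2 h3
      rw [nq] at h1 h3
      rcases h1 with rfl | rfl | rfl
      · rw [nv₁] at h2; grind
      · rw [nw] at h2
        have := K.loopless.irrefl b
        grind
      · rw [np] at h2; grind
    intro a b c h1 h2 h3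
    by_cases hap : a = p
    · subst hap; exact tp b c h1 h2 h3
    by_cases haq : a = q
    · subst haq; exact tq b c h1 h2 h3
    by_cases hbp : b = p
    · subst hbp; exact tp a c h1.symm h3 h2
    by_cases hbq : b = q
    · subst hbq; exact tq a c h1.symm h3 h2
    by_cases hcp : c = p
    · subst hcp; exact tp b a h2.symm h1.symm h3.symm
    by_cases hcq : c = q
    · subst hcq; exact tq b a h2.symm h1.symm h3.symm
    exact hK.tri a b c (nold _ _ hap haq hbp hbq h1) (nold _ _ hbp hbq hcp hcq h2)
      (nold _ _ hap haq hcp hcq h3)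
  · intro a b c d e hab hcd hce hde h1 h2 h3 h4 h5 h6
    have hN : ∀ t, (QuadExp.ins K u₁ u₂ v₁ w p q).Adj a t →
        (QuadExp.ins K u₁ u₂ v₁ w p q).Adj b t := by
      intro t ht
      rcases eq_of_encard_eq_three (hcub a ⟨_, h1⟩) h1 h2 h3 hcd hce hde t ht with rfl | rfl | rfl <;>
        assumption
    have hN' : ∀ t, (QuadExp.ins K u₁ u₂ v₁ w p q).Adj b t →
        (QuadExp.ins K u₁ u₂ v₁ w p q).Adj a t := by
      intro t ht
      rcases eq_of_encard_eq_three (hcub b ⟨_, h4⟩) h4 h5 h6 hcd hce hde t ht with rfl | rfl | rfl <;>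
        assumption
    have bp : ∀ b, b ≠ p → (∀ t, (QuadExp.ins K u₁ u₂ v₁ w p q).Adj p t →
        (QuadExp.ins K u₁ u₂ v₁ w p q).Adj b t) → False := by
      intro b hb hN
      have e1 := hN u₂ ((np _).2 (by simp))
      have e2 := hN q ((np _).2 (by simp))
      rw [adj_comm, nu₂] at e1
      rw [adj_comm, nq] at e2
      grind
    have bq : ∀ b, b ≠ q → (∀ t, (QuadExp.ins K u₁ u₂ v₁ w p q).Adj q t →
        (QuadExp.ins K u₁ u₂ v₁ w p q).Adj b t) → False := by
      intro b hb hN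
      have e1 := hN v₁ ((nq _).2 (by simp))
      have e2 := hN p ((nq _).2 (by simp))
      rw [adj_comm, nv₁] at e1
      rw [adj_comm, np] at e2
      have e3 := hN w ((nq _).2 (by simp))
      rw [adj_comm, nw] at e3
      grind
    have hap : a ≠ p := by rintro rfl; exact bp b hab.symm hN
    have haq : a ≠ q := by rintro rfl; exact bq b hab.symm hN
    have hbp : b ≠ p := by rintro rfl; exact bp a hab hN'
    have hbq : b ≠ q := by rintro rfl; exact bq a hab hN'
    have hcp : ∀ c, (QuadExp.ins K u₁ u₂ v₁ w p q).Adj a c → c ≠ p := by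
      rintro c h rfl
      have h' := hN _ h
      have e1 := hN v₁
      have e2 := hN' v₁
      rw [adj_comm, np] at h h'
      rcases h with rfl | rfl | h
      · rcases h' with rfl | rfl | h'
        · exact hab rfl
        · rw [nu₁, nu₂] at e1; grind
        · exact hbq h'
      · rcases h' with rfl | rfl | h'
        · rw [nu₁, nu₂] at e2; grind
        · exact hab rfl
        · exact hbq h'
      · exact haq h
    have hcq : ∀ c, (QuadExp.ins K u₁ u₂ v₁ w p q).Adj a c → c ≠ q := by
      rintro c h rfl
      have h' := hN _ h
      have e1 := hN u₁
      have e2 := hN' u₁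
      rw [adj_comm, nq] at h h'
      rcases h with rfl | rfl | h
      · rcases h' with rfl | rfl | h'
        · exact hab rfl
        · rw [nv₁, nw] at e1; grind
        · exact hbp h'
      · rcases h' with rfl | rfl | h'
        · rw [nv₁, nw] at e2; grind
        · exact hab rfl
        · exact hbp h'
      · exact hap h
    have o : ∀ s c, s ≠ p → s ≠ q → (QuadExp.ins K u₁ u₂ v₁ w p q).Adj a c →
        (QuadExp.ins K u₁ u₂ v₁ w p q).Adj s c → K.Adj s c := fun s c h h' h1 h2 =>
      nold s c h h' (hcp c h1) (hcq c h1) h2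
    exact hK.k23 a b c d e hab hcd hce hde (o a c hap haq h1 h1) (o a d hap haq h2 h2)
      (o a e hap haq h3 h3) (o b c hbp hbq h1 h4) (o b d hbp hbq h2 h5) (o b e hbp hbq h3 h6)
  · exact fun t => (nu₁ t)
  · exact fun t => (np t).trans ⟨by rintro (h | h | h) <;> simp [h], by rintro (h | h | h) <;> simp [h]⟩
  · exact fun t => (nq t).trans ⟨by rintro (h | h | h) <;> simp [h], by rintro (h | h | h) <;> simp [h]⟩
  · exact fun t => (nv₁ t).trans or_left_comm
  · simp only [List.nodup_cons, List.mem_cons, List.not_mem_nil, or_false, not_or,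
      not_false_eq_true, List.nodup_nil, and_true]
    grind
  · simp only [nu₄, nu₂, nw]
    grind
  · intro s t hst h1 h2 h3 h4
    rw [nu₄] at h1 h2
    rw [nu₂] at h3 h4
    grind
  · intro s t hst h1 h2 h3 h4
    rw [nu₂] at h1 h2
    rw [nw] at h3 h4
    grind
  · intro s t hst h1 h2 h3 h4
    rw [nw] at h1 h2
    rw [nx] at h3 h4
    have h1 : K.Adj w s ∧ s ≠ v₁ := h1.resolve_left (by rintro rfl; exact hKq _ h3)
    have h2 : K.Adj w t ∧ t ≠ v₁ := h2.resolve_left (by rintro rfl; exact hKq _ h4)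
    exact hK.k23 w x v₁ s t hxw.symm h1.2.symm h2.2.symm hst aw.symm h1.1 h2.1 ax.symm h3 h4
  · intro s t hst h1 h2 h3 h4
    rw [nx] at h1 h2
    rw [nu₄] at h3 h4
    grind

end QuadExp

namespace QuadExp

open SimpleGraph

variable {X : Type*} {W : Type*} {K : SimpleGraph X} {H : SimpleGraph W}
  {u₁ u₂ u₃ u₄ v₁ v₂ v₃ v₄ w x p q : X}

/-- The two descriptions of a short extension at `u₁` and `v₁`. -/
lemma emb_ins_mirror (hK : QS K u₁ u₂ u₃ u₄ v₁ v₂ v₃ v₄)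
    (hv : ∀ y, K.Adj v₁ y ↔ y = u₁ ∨ y = w ∨ y = x) (hwu : w ≠ u₁) (hxu : x ≠ u₁) (hxw : x ≠ w)
    (hp : p ∉ K.support) (hq : q ∉ K.support) (hpq : p ≠ q) :
    Emb (ins K u₁ u₄ v₁ x p q) (ins K u₁ u₂ v₁ w p q) := by
  classical
  have a12 : K.Adj u₁ u₂ := (hK.n₁ _).2 (by simp)
  have a14 : K.Adj u₁ u₄ := (hK.n₁ _).2 (by simp)
  have av₁ : K.Adj u₁ v₁ := (hK.n₁ _).2 (by simp)
  have aw : K.Adj v₁ w := (hv _).2 (by simp)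
  have ax : K.Adj v₁ x := (hv _).2 (by simp)
  have hnd := hK.nodup
  simp only [List.nodup_cons, List.mem_cons, List.not_mem_nil, or_false, not_or, not_false_eq_true,
    List.nodup_nil, and_true] at hnd
  have hn : ∀ z ∈ K.support, z ≠ p ∧ z ≠ q := fun z hz =>
    ⟨fun h => hp (h ▸ hz), fun h => hq (h ▸ hz)⟩
  have su₁ := hn u₁ ⟨_, a12⟩
  have su₂ := hn u₂ ⟨_, a12.symm⟩
  have su₄ := hn u₄ ⟨_, a14.symm⟩
  have sv₁ := hn v₁ ⟨_, aw⟩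
  have sw := hn w ⟨_, aw.symm⟩
  have sx := hn x ⟨_, ax.symm⟩
  have np := ins_adj_left (q := q) a12 aw hp hpq
  have nq := ins_adj_right (p := p) a12 aw hq hpq
  obtain ⟨⟨ow2, ow3, ow4⟩, ow1', -⟩ := hK.off aw
  obtain ⟨⟨ox2, ox3, ox4⟩, ox1', -⟩ := hK.off ax
  let f : X → X := fun t => if t = u₁ then p else if t = p then u₁ else if t = v₁ then q else
    if t = q then v₁ else t
  have fu : f u₁ = p := by simp [f]
  have fp : f p = u₁ := by simp [f, su₁.1.symm]
  have fv : f v₁ = q := by simp [f, Ne.symm hnd.1.2.2.2.1, sv₁.1]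
  have fq : f q = v₁ := by simp [f, su₁.2.symm, hpq.symm, sv₁.2.symm]
  have fo : ∀ t, t ≠ u₁ → t ≠ p → t ≠ v₁ → t ≠ q → f t = t := by
    intro t h1 h2 h3 h4
    simp [f, h1, h2, h3, h4]
  have fi : ∀ t, f (f t) = t := by
    intro t
    by_cases h1 : t = u₁
    · rw [h1, fu, fp]
    by_cases h2 : t = p
    · rw [h2, fp, fu]
    by_cases h3 : t = v₁
    · rw [h3, fv, fq]
    by_cases h4 : t = q
    · rw [h4, fq, fv]
    rw [fo t h1 h2 h3 h4, fo t h1 h2 h3 h4]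
  have fu₂ : f u₂ = u₂ := fo _ (Ne.symm hnd.1.1) su₂.1 hnd.2.1.2.2.1 su₂.2
  have fu₄ : f u₄ = u₄ := fo _ (Ne.symm hnd.1.2.2.1) su₄.1 hnd.2.2.2.1.1 su₄.2
  have fw : f w = w := fo _ hwu sw.1 ow1' sw.2
  have fx : f x = x := fo _ hxu sx.1 ox1' sx.2
  have hup : (ins K u₁ u₂ v₁ w p q).Adj p u₁ := (np _).2 (by simp)
  have hpu₂ : (ins K u₁ u₂ v₁ w p q).Adj p u₂ := (np _).2 (by simp)
  have hpq' : (ins K u₁ u₂ v₁ w p q).Adj p q := (np _).2 (by simp)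
  have hqv : (ins K u₁ u₂ v₁ w p q).Adj q v₁ := (nq _).2 (by simp)
  have hqw : (ins K u₁ u₂ v₁ w p q).Adj q w := (nq _).2 (by simp)
  have hu14 : (ins K u₁ u₂ v₁ w p q).Adj u₁ u₄ := by
    rw [ins_adj, Sym2.eq_iff, Sym2.eq_iff]
    exact Or.inl ⟨a14, by grind, by grind⟩
  have huv : (ins K u₁ u₂ v₁ w p q).Adj u₁ v₁ := by
    rw [ins_adj, Sym2.eq_iff, Sym2.eq_iff]
    exact Or.inl ⟨av₁, by grind, by grind⟩
  have hvx : (ins K u₁ u₂ v₁ w p q).Adj v₁ x := by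
    rw [ins_adj, Sym2.eq_iff, Sym2.eq_iff]
    exact Or.inl ⟨ax, by grind, by grind⟩
  refine Emb.of_hom f (fun a _ b _ h => by rw [← fi a, h, fi]) ?_
  have key : ∀ a b, K.Adj a b → s(a, b) ≠ s(u₁, u₄) → s(a, b) ≠ s(v₁, x) → b ≠ u₁ →
      (a = u₁ ∨ a = v₁ ∨ b ≠ v₁) → (ins K u₁ u₂ v₁ w p q).Adj (f a) (f b) := by
    intro a b hab h1 h2 h3 h4
    have ha := hn a ⟨_, hab⟩
    have hb := hn b ⟨_, hab.symm⟩
    by_cases ha1 : a = u₁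
    · subst ha1
      rw [hK.n₁] at hab
      rcases hab with rfl | rfl | rfl
      · rw [fu, fu₂]; exact hpu₂
      · exact absurd rfl h1
      · rw [fu, fv]; exact hpq'
    by_cases ha2 : a = v₁
    · subst ha2
      rw [hv] at hab
      rcases hab with rfl | rfl | rfl
      · exact absurd rfl h3
      · rw [fv, fw]; exact hqw
      · exact absurd rfl h2
    have h4 := (h4.resolve_left ha1).resolve_left ha2
    rw [fo a ha1 ha.1 ha2 ha.2, fo b h3 hb.1 h4 hb.2]
    refine ins_adj.2 (Or.inl ⟨hab, ?_, ?_⟩) <;> rw [Ne, Sym2.eq_iff] <;> grind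
  intro a b hab
  rcases ins_adj.1 hab with ⟨h, h1, h2⟩ | ⟨-, h⟩
  · have key' := key b a h.symm (by rwa [Sym2.eq_swap]) (by rwa [Sym2.eq_swap])
    by_cases hb : b = u₁
    · exact (key' (fun h' => h.ne (h'.trans hb.symm)) (Or.inl hb)).symm
    by_cases ha : a = u₁ ∨ a = v₁ ∨ b ≠ v₁
    · exact key a b h h1 h2 hb ha
    · simp only [not_or, not_not, ne_eq] at ha
      exact (key' ha.1 (Or.inr (Or.inl ha.2.2))).symm
  · simp only [Sym2.eq_iff] at h
    rcases h with h | h | h | h | h <;> rcases h with ⟨rfl, rfl⟩ | ⟨rfl, rfl⟩ <;>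
      simp only [fu, fp, fv, fq, fu₄, fx]
    · exact hup
    · exact hup.symm
    · exact hu14
    · exact hu14.symm
    · exact hqv
    · exact hqv.symm
    · exact hvx
    · exact hvx.symm
    · exact huv
    · exact huv.symm

namespace Skel

lemma Exp.rot (h : Exp K H u₂ u₃ u₄ u₁) : Exp K H u₁ u₂ u₃ u₄ := by
  obtain ⟨sp, hsp, g, hg, h1, h2⟩ := h
  refine ⟨sp, hsp, g, ⟨?_, hg.adj, hg.ne, hg.eq, hg.pad, hg.inj, hg.fresh⟩, h1, h2⟩
  have := hg.rot
  simp only [rots, List.mem_cons, List.not_mem_nil, or_false] at this ⊢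
  tauto

lemma Exp.refl (h : Exp K H u₂ u₁ u₄ u₃) : Exp K H u₁ u₂ u₃ u₄ := by
  obtain ⟨sp, hsp, g, hg, h1, h2⟩ := h
  refine ⟨sp, hsp, g, ⟨?_, hg.adj, hg.ne, hg.eq, hg.pad, hg.inj, hg.fresh⟩, h1, h2⟩
  have := hg.rot
  simp only [rots, List.mem_cons, List.not_mem_nil, or_false] at this ⊢
  tauto

/-- Infinitely many new vertices. -/
lemma exists_fresh [Infinite X] {s : Set X} (hs : s.Finite) :
    ∃ h : ℕ → X, (∀ i j, h i = h j → i = j) ∧ ∀ i, h i ∉ s := by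
  have hinf : sᶜ.Infinite := hs.infinite_compl
  refine ⟨fun i => hinf.natEmbedding _ i, fun i j h => ?_, fun i => (hinf.natEmbedding _ i).2⟩
  exact (hinf.natEmbedding _).injective (Subtype.ext h)

lemma exp_of_long [Infinite X] (hK : QS K u₁ u₂ u₃ u₄ v₁ v₂ v₃ v₄) {y : X} (hxy : K.Adj x y)
    (hx : x ∉ ({u₁, u₂, u₃, u₄} : Set X)) (hy : y ∉ ({u₁, u₂, u₃, u₄} : Set X))
    (hxv : x ≠ v₁ ∧ x ≠ v₂) (hyv : y ≠ v₁ ∧ y ≠ v₂)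
    (h : ∀ p q, p ∉ K.support → q ∉ K.support → p ≠ q → Emb (ins K u₁ u₂ x y p q) H) :
    Exp K H u₁ u₂ u₃ u₄ := by
  obtain ⟨f, hf1, hf2⟩ := exists_fresh hK.fin
  have hnd := hK.nodup
  simp only [List.nodup_cons, List.mem_cons, List.not_mem_nil, or_false, not_or, not_false_eq_true,
    List.nodup_nil, and_true] at hnd
  simp only [Set.mem_insert_iff, Set.mem_singleton_iff, not_or] at hx hy
  have hE : Emb (ins K u₁ u₂ x y (f 0) (f 1)) H :=
    h _ _ (hf2 0) (hf2 1) fun h => absurd (hf1 _ _ h) (by decide)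
  refine ⟨specA, by simp [specs], mkLab u₁ [u₁, u₂, u₃, u₄, v₁, v₂, x, y] [] f,
    ⟨?_, ?_, ?_, ?_, ?_, ?_, ?_⟩, hE, hE⟩
  · exact List.mem_cons_self
  · change ∀ e ∈ [(0, 4), (1, 5), (6, 7)], _
    simp only [List.forall_mem_cons]
    exact ⟨(hK.n₁ v₁).2 (by simp), (hK.n₂ v₂).2 (by simp), hxy, by simp⟩
  · change ∀ e ∈ [(4, 1), (4, 3), (5, 0), (5, 2), (6, 0), (6, 1), (6, 2), (6, 3), (6, 4), (6, 5),
      (7, 0), (7, 1), (7, 2), (7, 3), (7, 4), (7, 5)], _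
    simp only [List.forall_mem_cons]
    change v₁ ≠ u₂ ∧ v₁ ≠ u₄ ∧ v₂ ≠ u₁ ∧ v₂ ≠ u₃ ∧ x ≠ u₁ ∧ x ≠ u₂ ∧ x ≠ u₃ ∧ x ≠ u₄ ∧ x ≠ v₁ ∧
      x ≠ v₂ ∧ y ≠ u₁ ∧ y ≠ u₂ ∧ y ≠ u₃ ∧ y ≠ u₄ ∧ y ≠ v₁ ∧ y ≠ v₂ ∧ _
    refine ⟨?_, ?_, ?_, ?_, hx.1, hx.2.1, hx.2.2.1, hx.2.2.2, hxv.1, hxv.2, hy.1, hy.2.1, hy.2.2.1,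
      hy.2.2.2, hyv.1, hyv.2, by simp⟩ <;> grind
  · intro e he
    exact absurd he (by decide +revert)
  · intro t h1 h2
    replace h1 : 8 ≤ t := h1
    rw [mkLab, if_pos h2, List.getD_eq_default _ _ (by simpa using h1)]
    rfl
  · intro i j hij
    simp only [mkLab, Nat.not_lt.2 (Nat.le_add_right 20 _), if_false, List.getD_nil] at hij
    have := hf1 _ _ hij
    simpa using this
  · intro i
    simp only [mkLab, Nat.not_lt.2 (Nat.le_add_right 20 _), if_false, List.getD_nil]
    exact hf2 _

lemma Emb.ncard_le [Finite W] (h : Emb K H) : K.support.ncard ≤ Nat.card W := by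
  obtain ⟨f, -, hf, -⟩ := h
  rw [← Set.ncard_univ]
  exact Set.ncard_le_ncard_of_injOn f (fun _ _ => Set.mem_univ _) hf

/-- A graph that satisfies the conditions `QS` has an expansion contained in `H`. -/
theorem exists_exp [Infinite X] [Finite W] (hH : H.IsCubic) (hH5 : H.IsCyclicallyConnected 5) (n : ℕ) :
    ∀ (K : SimpleGraph X) (u₁ u₂ u₃ u₄ v₁ v₂ v₃ v₄ : X), QS K u₁ u₂ u₃ u₄ v₁ v₂ v₃ v₄ → Emb K H →
      Nat.card W < K.support.ncard + n → Exp K H u₁ u₂ u₃ u₄ := by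
  induction n with
  | zero =>
    intro K u₁ u₂ u₃ u₄ v₁ v₂ v₃ v₄ _ hE hn
    have := Emb.ncard_le hE
    omega
  | succ n ih =>
    have key : ∀ (K : SimpleGraph X) (u₁ u₂ u₃ u₄ v₁ v₂ v₃ v₄ w x : X),
        QS K u₁ u₂ u₃ u₄ v₁ v₂ v₃ v₄ → Nat.card W < K.support.ncard + (n + 1) →
        (∀ y, K.Adj v₁ y ↔ y = u₁ ∨ y = w ∨ y = x) → w ≠ u₁ → x ≠ u₁ → x ≠ w →
        (K.Adj x v₄ → K.Adj w v₂) →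
        (∀ p q, p ∉ K.support → q ∉ K.support → p ≠ q → Emb (ins K u₁ u₂ v₁ w p q) H) →
        Exp K H u₁ u₂ u₃ u₄ := by
      intro K u₁ u₂ u₃ u₄ v₁ v₂ v₃ v₄ w x hK hn hv hwu hxu hxw hab h
      obtain ⟨f, hf1, hf2⟩ := exists_fresh hK.fin
      have hpq : f 0 ≠ f 1 := fun h => absurd (hf1 _ _ h) (by decide)
      refine exp_of_ins hK hv hwu hxu hxw hab (hf2 0) (hf2 1) hpq ?_
      refine ih _ _ _ _ _ _ _ _ _ (hK.ins hv hwu hxu hxw (hf2 0) (hf2 1) hpq)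
        (h _ _ (hf2 0) (hf2 1) hpq) ?_
      rw [ins_support ((hK.n₁ _).2 (by simp)) ((hv _).2 (by simp)) (hf2 0) (hf2 1) hpq,
        Set.ncard_insert_of_notMem _ (hK.fin.insert _), Set.ncard_insert_of_notMem (hf2 1) hK.fin]
      · omega
      · simp only [Set.mem_insert_iff, not_or]
        exact ⟨hpq, hf2 0⟩
    have short : ∀ (K : SimpleGraph X) (u₁ u₂ u₃ u₄ v₁ v₂ v₃ v₄ w : X),
        QS K u₁ u₂ u₃ u₄ v₁ v₂ v₃ v₄ → Nat.card W < K.support.ncard + (n + 1) →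
        K.Adj v₁ w → w ≠ u₁ →
        (∀ p q, p ∉ K.support → q ∉ K.support → p ≠ q → Emb (ins K u₁ u₂ v₁ w p q) H) →
        Exp K H u₁ u₂ u₃ u₄ := by
      intro K u₁ u₂ u₃ u₄ v₁ v₂ v₃ v₄ w hK hn hw hwu h
      obtain ⟨x, hxu, hxw, hv⟩ := hK.third_neighbor (((hK.n₁ v₁).2 (by simp)).symm) hw hwu.symm
      by_cases hab : K.Adj x v₄ → K.Adj w v₂
      · exact key K u₁ u₂ u₃ u₄ v₁ v₂ v₃ v₄ w x hK hn hv hwu hxu hxw hab h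
      · rw [Classical.not_imp] at hab
        have hE := key K u₁ u₄ u₃ u₂ v₁ v₄ v₃ v₂ x w hK.refl.rot hn
          (fun y => (hv y).trans (or_congr_right or_comm)) hxu hwu hxw.symm (fun _ => hab.1)
          fun p q hp hq hpq => (emb_ins_mirror hK hv hwu hxu hxw hp hq hpq).trans (h p q hp hq hpq)
        exact hE.refl.rot.rot.rot
    intro K u₁ u₂ u₃ u₄ v₁ v₂ v₃ v₄ hK hE hn
    obtain ⟨a₁, a₂, a₃, a₄, b₁, b₂, b₃, b₄, x, y, hQ, hP, hxy, hx, hy, h⟩ :=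
      exists_extension hK hH hH5 hE (fun a b c d => Exp K H a b c d → Exp K H u₁ u₂ u₃ u₄)
        (fun a b c d h h' => h h'.rot) (fun a b c d h h' => h h'.refl) id
    apply hP
    have main : ∀ x y, K.Adj x y → x ∉ ({a₁, a₂, a₃, a₄} : Set X) → y ∉ ({a₁, a₂, a₃, a₄} : Set X) →
        (∀ p q, p ∉ K.support → q ∉ K.support → p ≠ q → Emb (ins K a₁ a₂ x y p q) H) →
        x = b₁ ∨ x = b₂ → Exp K H a₁ a₂ a₃ a₄ := by
      intro x y hxy hx hy h hxb
      simp only [Set.mem_insert_iff, Set.mem_singleton_iff, not_or] at hy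
      rcases hxb with rfl | rfl
      · exact short K a₁ a₂ a₃ a₄ _ b₂ b₃ b₄ y hQ hn hxy hy.1 h
      · refine (short K a₂ a₁ a₄ a₃ _ b₁ b₄ b₃ y hQ.refl hn hxy hy.2.1 ?_).refl
        intro p q hp hq hpq
        rw [← ins_swap_left]
        exact h p q hp hq hpq
    by_cases hxb : x = b₁ ∨ x = b₂
    · exact main x y hxy hx hy h hxb
    by_cases hyb : y = b₁ ∨ y = b₂
    · refine main y x hxy.symm hy hx ?_ hyb
      intro p q hp hq hpq
      rw [← ins_swap_right]
      exact h p q hp hq hpq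
    exact exp_of_long hQ hxy hx hy (not_or.1 hxb) (not_or.1 hyb) h

end Skel

end QuadExp

namespace QuadExp

open SimpleGraph

section QuadConnected

variable {V : Type*} {G : SimpleGraph V}

lemma exists_quadrangle {a b c d : V} (hnd : [a, b, c, d].Nodup) (hab : G.Adj a b) (hbc : G.Adj b c)
    (hcd : G.Adj c d) (hda : G.Adj d a) : ∃ D : G.Subgraph, D.IsQuadrangleWith a b c d := by
  refine ⟨{ verts := {a, b, c, d}
            Adj := fun x y => s(x, y) ∈ ({s(a, b), s(b, c), s(c, d), s(d, a)} : Set (Sym2 V))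
            adj_sub := ?_, edge_vert := ?_, symm := ⟨?_⟩ }, hnd, rfl, ?_⟩
  · rintro x y (h | h | h | h) <;> rcases Sym2.eq_iff.1 h with ⟨rfl, rfl⟩ | ⟨rfl, rfl⟩ <;>
      first | assumption | (apply SimpleGraph.Adj.symm; assumption)
  · rintro x y (h | h | h | h) <;> rcases Sym2.eq_iff.1 h with ⟨rfl, rfl⟩ | ⟨rfl, rfl⟩ <;> simp
  · intro x y h
    rwa [Sym2.eq_swap (a := y) (b := x)]
  · ext e
    induction e with
    | h x y => rfl

lemma edgeCut_encard_le {A : Set V} {S : Finset (Sym2 V)}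
    (h : ∀ a ∈ A, ∀ b ∉ A, G.Adj a b → s(a, b) ∈ S) : (G.edgeCut A).encard ≤ S.card := by
  rw [← Set.encard_coe_eq_coe_finsetCard]
  apply Set.encard_le_encard
  rintro e ⟨a, ha, b, hb, hab, rfl⟩
  exact h a ha b hb hab

lemma third_of_cubic (hG : G.IsCubic) {z a b : V} (ha : G.Adj z a) (hb : G.Adj z b)
    (hab : a ≠ b) : ∃ c, c ≠ a ∧ c ≠ b ∧ ∀ y, G.Adj z y ↔ y = a ∨ y = b ∨ y = c := by
  obtain ⟨c, hc1, hc2⟩ : ∃ c ∈ G.neighborSet z, c ∉ ({a, b} : Set V) := by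
    by_contra! hcon
    have h1 : (G.neighborSet z).encard ≤ ({a, b} : Set V).encard := Set.encard_le_encard hcon
    rw [hG z, Set.encard_pair hab] at h1
    exact absurd h1 (by decide)
  simp only [Set.mem_insert_iff, Set.mem_singleton_iff, not_or] at hc2
  refine ⟨c, hc2.1, hc2.2, fun y => ⟨fun hy => ?_, ?_⟩⟩
  · exact eq_of_encard_eq_three (hG z) ha hb hc1 hab (Ne.symm hc2.1) (Ne.symm hc2.2) y hy
  · rintro (rfl | rfl | rfl) <;> assumption

lemma ncard_toFinset_list [DecidableEq V] {l : List V} (h : l.Nodup) :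
    {x | x ∈ l}.ncard = l.length := by
  rw [← List.toFinset_card_of_nodup h, ← Set.ncard_coe_finset]
  congr 1
  ext x
  simp

variable [Finite V]

lemma ncard_le_of_edgeCut_le_three (hG : G.IsCubic) (hQ : G.IsQuadConnected) {A : Set V}
    (hne : A.Nonempty) (hcut : (G.edgeCut A).encard ≤ 3) : A.ncard ≤ 1 ∨ Nat.card V ≤ A.ncard + 1 := by
  by_cases huniv : A = Set.univ
  · right
    rw [huniv, Set.ncard_univ]
    omega
  have hnec : Aᶜ.Nonempty := Set.nonempty_compl.2 huniv
  have hcut' : (G.edgeCut A).ncard ≤ 3 := by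
    have := (Set.toFinite (G.edgeCut A)).cast_ncard_eq
    rw [← this] at hcut
    exact_mod_cast hcut
  have hcard := Set.ncard_add_ncard_compl A
  rcases hQ.1.2.2 A hne huniv (lt_of_le_of_lt hcut (by norm_num)) with h | h
  · have := card_add_two_le_edgeCut hG hne h
    omega
  · have := card_add_two_le_edgeCut hG hnec h
    rw [edgeCut_compl] at this
    omega

lemma false_of_edgeCut_le_four (hG : G.IsCubic) (hQ : G.IsQuadConnected) {C : G.Subgraph}
    (hC : C.IsQuadrangle) {A : Set V} (hA : A.ncard = 6) (hCA : ∃ t ∈ C.verts, t ∈ A)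
    (hcut : (G.edgeCut A).encard ≤ 4) : False := by
  have hne : A.Nonempty := by rw [← Set.ncard_pos]; omega
  have hcard := Set.ncard_add_ncard_compl A
  have h10 := hQ.2.1
  have hnec : Aᶜ.Nonempty := by rw [← Set.ncard_pos]; omega
  have four : ∀ B : Set V, Nonempty (G.induce B ≃g cycleGraph 4) → B.ncard = 4 := by
    rintro B ⟨e⟩
    rw [← Nat.card_coe_set_eq, Nat.card_congr e.toEquiv, Nat.card_fin]
  rcases hQ.2.2.2 A hne (Set.nonempty_compl.1 hnec) hcut with (h | h) | (h | h)
  · exact not_isAcyclic_of_edgeCut_le hG (by omega) hcut h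
  · have := four A h
    omega
  · exact not_isAcyclic_of_edgeCut_le hG (by omega) (by rwa [edgeCut_compl]) h
  · have h4 := four _ h
    obtain ⟨e⟩ := h
    have hadj : ∀ i j : Fin 4, (cycleGraph 4).Adj i j → G.Adj (e.symm i).1 (e.symm j).1 := by
      intro i j hij
      have := e.symm.map_rel_iff.2 hij
      exact this
    have hinj : ∀ i j : Fin 4, i ≠ j → (e.symm i).1 ≠ (e.symm j).1 := fun i j hij h =>
      hij (e.symm.injective (Subtype.ext h))
    obtain ⟨D, hD⟩ := exists_quadrangle (G := G) (a := (e.symm 0).1) (b := (e.symm 1).1)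
      (c := (e.symm 2).1) (d := (e.symm 3).1) (by
        simp only [List.nodup_cons, List.mem_cons, List.not_mem_nil, or_false, not_or,
          not_false_eq_true, List.nodup_nil, and_true]
        refine ⟨⟨hinj _ _ ?_, hinj _ _ ?_, hinj _ _ ?_⟩, ⟨hinj _ _ ?_, hinj _ _ ?_⟩,
          hinj _ _ ?_⟩ <;> decide)
      (hadj _ _ (by decide)) (hadj _ _ (by decide)) (hadj _ _ (by decide)) (hadj _ _ (by decide))
    have := hQ.2.2.1 ⟨C, D, hC, ⟨_, _, _, _, hD⟩, ?_⟩
    · omega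
    · rintro rfl
      obtain ⟨t, ht, htA⟩ := hCA
      rw [hD.verts_eq] at ht
      rcases ht with rfl | rfl | rfl | rfl <;> exact (e.symm _).2 htA

lemma not_triangle (hG : G.IsCubic) (hQ : G.IsQuadConnected) (a b c : V) (hab : G.Adj a b)
    (hbc : G.Adj b c) : ¬ G.Adj a c := by
  classical
  intro hac
  obtain ⟨a', -, -, ha⟩ := third_of_cubic hG hab hac hbc.ne
  obtain ⟨b', -, -, hb⟩ := third_of_cubic hG hab.symm hbc hac.ne
  obtain ⟨c', -, -, hc⟩ := third_of_cubic hG hac.symm hbc.symm hab.ne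
  have hn : {x | x ∈ [a, b, c]}.ncard = 3 := ncard_toFinset_list (by
    simp [hab.ne, hac.ne, hbc.ne])
  have hcut := edgeCut_encard_le (G := G) (A := {x | x ∈ [a, b, c]})
    (S := {s(a, a'), s(b, b'), s(c, c')}) (by
      intro x hx y hy hxy
      simp only [Set.mem_ofPred_eq, List.mem_cons, List.not_mem_nil, or_false, not_or] at hx hy
      rcases hx with rfl | rfl | rfl
      · rw [ha] at hxy; simp [hxy.resolve_left hy.2.1 |>.resolve_left hy.2.2]
      · rw [hb] at hxy; simp [hxy.resolve_left hy.1 |>.resolve_left hy.2.2]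
      · rw [hc] at hxy; simp [hxy.resolve_left hy.1 |>.resolve_left hy.2.1])
  have := ncard_le_of_edgeCut_le_three hG hQ (A := {x | x ∈ [a, b, c]}) ⟨a, by simp⟩
    (hcut.trans (by exact_mod_cast Finset.card_le_three))
  have := hQ.2.1
  omega

lemma not_completeBipartite (hG : G.IsCubic) (hQ : G.IsQuadConnected) (a b x y z : V) (hab : a ≠ b)
    (hxy : x ≠ y) (hxz : x ≠ z) (hyz : y ≠ z) (hax : G.Adj a x) (hay : G.Adj a y) (haz : G.Adj a z)
    (hbx : G.Adj b x) (hby : G.Adj b y) : ¬ G.Adj b z := by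
  classical
  intro hbz
  have ha := eq_of_encard_eq_three (hG a) hax hay haz hxy hxz hyz
  have hb := eq_of_encard_eq_three (hG b) hbx hby hbz hxy hxz hyz
  obtain ⟨x', -, -, hx⟩ := third_of_cubic hG hax.symm hbx.symm hab
  obtain ⟨y', -, -, hy⟩ := third_of_cubic hG hay.symm hby.symm hab
  obtain ⟨z', -, -, hz⟩ := third_of_cubic hG haz.symm hbz.symm hab
  have hn : {t | t ∈ [a, b, x, y, z]}.ncard = 5 := ncard_toFinset_list (by
    simp [hab, hax.ne, hay.ne, haz.ne, hbx.ne, hby.ne, hbz.ne, hxy, hxz, hyz])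
  have hcut := edgeCut_encard_le (G := G) (A := {t | t ∈ [a, b, x, y, z]})
    (S := {s(x, x'), s(y, y'), s(z, z')}) (by
      intro s hs t ht hst
      simp only [Set.mem_ofPred_eq, List.mem_cons, List.not_mem_nil, or_false, not_or] at hs ht
      rcases hs with rfl | rfl | rfl | rfl | rfl
      · have := ha t hst; tauto
      · have := hb t hst; tauto
      · rw [hx] at hst; simp [hst.resolve_left ht.1 |>.resolve_left ht.2.1]
      · rw [hy] at hst; simp [hst.resolve_left ht.1 |>.resolve_left ht.2.1]
      · rw [hz] at hst; simp [hst.resolve_left ht.1 |>.resolve_left ht.2.1])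
  have := ncard_le_of_edgeCut_le_three hG hQ (A := {t | t ∈ [a, b, x, y, z]}) ⟨a, by simp⟩
    (hcut.trans (by exact_mod_cast Finset.card_le_three))
  have := hQ.2.1
  omega

section

variable {C : G.Subgraph} {u₁ u₂ u₃ u₄ v₁ v₂ v₃ v₄ : V}

lemma not_adj_outer (hG : G.IsCubic) (hQ : G.IsQuadConnected) (hC : C.IsQuadrangle) (hu : u₁ ∈ C.verts)
    (n₁ : ∀ y, G.Adj u₁ y ↔ y = u₂ ∨ y = u₄ ∨ y = v₁) (n₂ : ∀ y, G.Adj u₂ y ↔ y = u₃ ∨ y = u₁ ∨ y = v₂)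
    (n₃ : ∀ y, G.Adj u₃ y ↔ y = u₄ ∨ y = u₂ ∨ y = v₃) (n₄ : ∀ y, G.Adj u₄ y ↔ y = u₁ ∨ y = u₃ ∨ y = v₄)
    (hnd : [u₁, u₂, u₃, u₄, v₁, v₂, v₃, v₄].Nodup) : ¬ G.Adj v₁ v₂ ∧ ¬ G.Adj v₁ v₃ := by
  classical
  have a1 : G.Adj v₁ u₁ := ((n₁ v₁).2 (by simp)).symm
  have a2 : G.Adj v₂ u₂ := ((n₂ v₂).2 (by simp)).symm
  have a3 : G.Adj v₃ u₃ := ((n₃ v₃).2 (by simp)).symm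
  have hnd' := hnd
  simp only [List.nodup_cons, List.mem_cons, List.not_mem_nil, or_false, not_or, not_false_eq_true,
    List.nodup_nil, and_true] at hnd
  constructor
  · intro h
    obtain ⟨s, -, -, hs⟩ := third_of_cubic hG a1 h (by grind)
    obtain ⟨t, -, -, ht⟩ := third_of_cubic hG a2 h.symm (by grind)
    refine false_of_edgeCut_le_four hG hQ hC (A := {x | x ∈ [u₁, u₂, u₃, u₄, v₁, v₂]})
      (ncard_toFinset_list (hnd'.sublist (by simp))) ⟨u₁, hu, by simp⟩
      ((edgeCut_encard_le (S := {s(u₃, v₃), s(u₄, v₄), s(v₁, s), s(v₂, t)}) ?_).trans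
        (by exact_mod_cast Finset.card_le_four))
    intro x hx y hy hxy
    simp only [Set.mem_ofPred_eq, List.mem_cons, List.not_mem_nil, or_false, not_or,
      Finset.mem_insert, Finset.mem_singleton] at hx hy ⊢
    rcases hx with rfl | rfl | rfl | rfl | rfl | rfl
    · rw [n₁] at hxy; grind
    · rw [n₂] at hxy; grind
    · rw [n₃] at hxy; grind
    · rw [n₄] at hxy; grind
    · rw [hs] at hxy; grind
    · rw [ht] at hxy; grind
  · intro h
    obtain ⟨s, -, -, hs⟩ := third_of_cubic hG a1 h (by grind)
    obtain ⟨t, -, -, ht⟩ := third_of_cubic hG a3 h.symm (by grind)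
    refine false_of_edgeCut_le_four hG hQ hC (A := {x | x ∈ [u₁, u₂, u₃, u₄, v₁, v₃]})
      (ncard_toFinset_list (hnd'.sublist (by simp))) ⟨u₁, hu, by simp⟩
      ((edgeCut_encard_le (S := {s(u₂, v₂), s(u₄, v₄), s(v₁, s), s(v₃, t)}) ?_).trans
        (by exact_mod_cast Finset.card_le_four))
    intro x hx y hy hxy
    simp only [Set.mem_ofPred_eq, List.mem_cons, List.not_mem_nil, or_false, not_or,
      Finset.mem_insert, Finset.mem_singleton] at hx hy ⊢
    rcases hx with rfl | rfl | rfl | rfl | rfl | rfl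
    · rw [n₁] at hxy; grind
    · rw [n₂] at hxy; grind
    · rw [n₃] at hxy; grind
    · rw [n₄] at hxy; grind
    · rw [hs] at hxy; grind
    · rw [ht] at hxy; grind

lemma not_two_common (hG : G.IsCubic) (hQ : G.IsQuadConnected) (hC : C.IsQuadrangle) (hu : u₁ ∈ C.verts)
    (n₁ : ∀ y, G.Adj u₁ y ↔ y = u₂ ∨ y = u₄ ∨ y = v₁) (n₂ : ∀ y, G.Adj u₂ y ↔ y = u₃ ∨ y = u₁ ∨ y = v₂)
    (hnd : [u₁, u₂, u₃, u₄, v₁, v₂, v₃, v₄].Nodup) (w x : V) (hwx : w ≠ x)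
    (h1 : G.Adj v₁ w) (h2 : G.Adj v₁ x) (h3 : G.Adj v₂ w) : ¬ G.Adj v₂ x := by
  classical
  intro h4
  have a1 : G.Adj v₁ u₁ := ((n₁ v₁).2 (by simp)).symm
  have a2 : G.Adj v₂ u₂ := ((n₂ v₂).2 (by simp)).symm
  simp only [List.nodup_cons, List.mem_cons, List.not_mem_nil, or_false, not_or, not_false_eq_true,
    List.nodup_nil, and_true] at hnd
  have hne : ∀ t, G.Adj v₁ t → G.Adj v₂ t → t ≠ u₁ ∧ t ≠ u₂ ∧ t ≠ v₁ ∧ t ≠ v₂ := by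
    intro t ht1 ht2
    refine ⟨?_, ?_, ht1.ne', ht2.ne'⟩
    · rintro rfl; have := (n₁ _).1 ht2.symm; grind
    · rintro rfl; have := (n₂ _).1 ht1.symm; grind
  have hw := hne w h1 h3
  have hx := hne x h2 h4
  have e1 := eq_of_encard_eq_three (hG v₁) a1 h1 h2 hw.1.symm hx.1.symm hwx
  have e2 := eq_of_encard_eq_three (hG v₂) a2 h3 h4 hw.2.1.symm hx.2.1.symm hwx
  obtain ⟨s, -, -, hs⟩ := third_of_cubic hG h1.symm h3.symm (by grind)
  obtain ⟨t, -, -, ht⟩ := third_of_cubic hG h2.symm h4.symm (by grind)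
  refine false_of_edgeCut_le_four hG hQ hC (A := {x' | x' ∈ [u₁, u₂, v₁, v₂, w, x]})
    (ncard_toFinset_list (by
      simp only [List.nodup_cons, List.mem_cons, List.not_mem_nil, or_false, not_or,
        not_false_eq_true, List.nodup_nil, and_true]
      grind)) ⟨u₁, hu, by simp⟩
    ((edgeCut_encard_le (S := {s(u₁, u₄), s(u₂, u₃), s(w, s), s(x, t)}) ?_).trans
      (by exact_mod_cast Finset.card_le_four))
  intro r hr y hy hry
  simp only [Set.mem_ofPred_eq, List.mem_cons, List.not_mem_nil, or_false, not_or,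
    Finset.mem_insert, Finset.mem_singleton] at hr hy ⊢
  rcases hr with rfl | rfl | rfl | rfl | rfl | rfl
  · rw [n₁] at hry; grind
  · rw [n₂] at hry; grind
  · have := e1 y hry; grind
  · have := e2 y hry; grind
  · rw [hs] at hry; grind
  · rw [ht] at hry; grind

/-- A quadrangle of a quad-connected graph satisfies the conditions `QS`. -/
theorem exists_qs (hG : G.IsCubic) (hQ : G.IsQuadConnected) (hC : C.IsQuadrangleWith u₁ u₂ u₃ u₄) :
    ∃ v₁ v₂ v₃ v₄, QS G u₁ u₂ u₃ u₄ v₁ v₂ v₃ v₄ := by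
  have hnd := hC.nodup
  simp only [List.nodup_cons, List.mem_cons, List.not_mem_nil, or_false, not_or, not_false_eq_true,
    List.nodup_nil, and_true] at hnd
  have hadj : ∀ a b, s(a, b) ∈ ({s(u₁, u₂), s(u₂, u₃), s(u₃, u₄), s(u₄, u₁)} : Set (Sym2 V)) →
      G.Adj a b := by
    intro a b h
    rw [← hC.edgeSet_eq] at h
    exact C.edgeSet_subset h
  have a12 := hadj u₁ u₂ (by simp)
  have a23 := hadj u₂ u₃ (by simp)
  have a34 := hadj u₃ u₄ (by simp)
  have a41 := hadj u₄ u₁ (by simp)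
  have tri := not_triangle hG hQ
  have k23 := not_completeBipartite hG hQ
  obtain ⟨v₁, h11, h12, n₁⟩ := third_of_cubic hG a12 a41.symm (by grind)
  obtain ⟨v₂, h21, h22, n₂⟩ := third_of_cubic hG a23 a12.symm (by grind)
  obtain ⟨v₃, h31, h32, n₃⟩ := third_of_cubic hG a34 a23.symm (by grind)
  obtain ⟨v₄, h41, h42, n₄⟩ := third_of_cubic hG a41 a34.symm (by grind)
  have a1 : G.Adj u₁ v₁ := (n₁ v₁).2 (by simp)
  have a2 : G.Adj u₂ v₂ := (n₂ v₂).2 (by simp)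
  have a3 : G.Adj u₃ v₃ := (n₃ v₃).2 (by simp)
  have a4 : G.Adj u₄ v₄ := (n₄ v₄).2 (by simp)
  have c1 : v₁ ≠ u₃ := by rintro rfl; exact tri _ _ _ a12 a23 a1
  have c2 : v₂ ≠ u₄ := by rintro rfl; exact tri _ _ _ a23 a34 a2
  have c3 : v₃ ≠ u₁ := by rintro rfl; exact tri _ _ _ a34 a41 a3
  have c4 : v₄ ≠ u₂ := by rintro rfl; exact tri _ _ _ a41 a12 a4
  have d12 : v₁ ≠ v₂ := by rintro rfl; exact tri _ _ _ a12 a2 a1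
  have d23 : v₂ ≠ v₃ := by rintro rfl; exact tri _ _ _ a23 a3 a2
  have d34 : v₃ ≠ v₄ := by rintro rfl; exact tri _ _ _ a34 a4 a3
  have d41 : v₄ ≠ v₁ := by rintro rfl; exact tri _ _ _ a41 a1 a4
  have d13 : v₁ ≠ v₃ := by
    rintro rfl
    exact k23 u₁ u₃ u₂ u₄ v₁ (by grind) (by grind) h11.symm h12.symm a12 a41.symm a1 a23.symm a34 a3
  have d24 : v₂ ≠ v₄ := by
    rintro rfl
    exact k23 u₂ u₄ u₃ u₁ v₂ (by grind) (by grind) h21.symm h22.symm a23 a12.symm a2 a34.symm a41 a4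
  have s1 := a1.ne
  have s2 := a2.ne
  have s3 := a3.ne
  have s4 := a4.ne
  have hnd8 : [u₁, u₂, u₃, u₄, v₁, v₂, v₃, v₄].Nodup := by
    simp only [List.nodup_cons, List.mem_cons, List.not_mem_nil, or_false, not_or,
      not_false_eq_true, List.nodup_nil, and_true]
    grind
  have rot : ∀ a b c d e f g h : V, [a, b, c, d, e, f, g, h].Nodup → [b, c, d, a, f, g, h, e].Nodup := by
    intro a b c d e f g h hn
    refine hn.perm ?_ 
    exact ((List.perm_append_comm (l₁ := [a]) (l₂ := [b, c, d])).append
      (List.perm_append_comm (l₁ := [e]) (l₂ := [f, g, h])))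
  have hnd8' := rot _ _ _ _ _ _ _ _ hnd8
  have hnd8'' := rot _ _ _ _ _ _ _ _ hnd8'
  have hnd8''' := rot _ _ _ _ _ _ _ _ hnd8''
  have hC' : C.IsQuadrangle := ⟨_, _, _, _, hC⟩
  have hu₁ : u₁ ∈ C.verts := by rw [hC.verts_eq]; simp
  have hu₂ : u₂ ∈ C.verts := by rw [hC.verts_eq]; simp
  have hu₃ : u₃ ∈ C.verts := by rw [hC.verts_eq]; simp
  have hu₄ : u₄ ∈ C.verts := by rw [hC.verts_eq]; simp
  obtain ⟨o12, o13⟩ := not_adj_outer hG hQ hC' hu₁ n₁ n₂ n₃ n₄ hnd8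
  obtain ⟨o23, o24⟩ := not_adj_outer hG hQ hC' hu₂ n₂ n₃ n₄ n₁ hnd8'
  obtain ⟨o34, -⟩ := not_adj_outer hG hQ hC' hu₃ n₃ n₄ n₁ n₂ hnd8''
  obtain ⟨o41, -⟩ := not_adj_outer hG hQ hC' hu₄ n₄ n₁ n₂ n₃ hnd8'''
  exact ⟨v₁, v₂, v₃, v₄, Set.toFinite _, fun x _ => hG x, tri, k23, n₁, n₂, n₃, n₄, hnd8,
    ⟨o12, o13, fun h => o41 h.symm, o23, o24, o34⟩,
    not_two_common hG hQ hC' hu₁ n₁ n₂ hnd8, not_two_common hG hQ hC' hu₂ n₂ n₃ hnd8',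
    not_two_common hG hQ hC' hu₃ n₃ n₄ hnd8'', not_two_common hG hQ hC' hu₄ n₄ n₁ hnd8'''⟩

end

end QuadConnected

end QuadExp

namespace QuadExp

open SimpleGraph

section Plus

variable {V : Type*} {G : SimpleGraph V} {u v x y a b : V}

lemma plus_old_old : (G.plus u v x y).Adj (old a) (old b) ↔
    G.Adj a b ∧ s(a, b) ≠ s(u, v) ∧ s(a, b) ≠ s(x, y) := Iff.rfl

lemma plus_old_newK : (G.plus u v x y).Adj (old a) newK ↔ a = u ∨ a = v := Iff.rfl

lemma plus_old_newL : (G.plus u v x y).Adj (old a) newL ↔ a = x ∨ a = y := Iff.rfl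

lemma plus_newK_old : (G.plus u v x y).Adj newK (old a) ↔ a = u ∨ a = v := Iff.rfl

lemma plus_newL_old : (G.plus u v x y).Adj newL (old a) ↔ a = x ∨ a = y := Iff.rfl

lemma plus_newK_newL : (G.plus u v x y).Adj newK newL := show (0 : Fin 2) ≠ 1 by decide

lemma mem_support_plus (h : ∀ a, a ∈ G.support) (c : V ⊕ Fin 2) : c ∈ (G.plus u v x y).support := by
  rcases c with a | i
  · obtain ⟨b, hb⟩ := h a
    by_cases h1 : s(a, b) = s(u, v)
    · exact ⟨newK, by rcases Sym2.eq_iff.1 h1 with h | h <;> simp [plus_old_newK, h.1]⟩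
    by_cases h2 : s(a, b) = s(x, y)
    · exact ⟨newL, by rcases Sym2.eq_iff.1 h2 with h | h <;> simp [plus_old_newL, h.1]⟩
    exact ⟨old b, hb, h1, h2⟩
  · match i with
    | 0 => exact ⟨old u, Or.inl rfl⟩
    | 1 => exact ⟨old x, Or.inl rfl⟩

end Plus

section Lift

variable {V : Type*} {X : Type*} {W : Type*} {G : SimpleGraph V} {K : SimpleGraph X} {H : SimpleGraph W}
  {f : V → X} {g : ℕ → X} {t : ℕ}

/-- `f` embeds `G` in `K`, and the vertices `g t, g (t + 1), …` are not used. -/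
structure Lift (G : SimpleGraph V) (K : SimpleGraph X) (f : V → X) (g : ℕ → X) (t : ℕ) : Prop where
  inj : Function.Injective f
  hom : ∀ a b, G.Adj a b → K.Adj (f a) (f b)
  fresh : ∀ a j, t ≤ j → f a ≠ g j
  injg : ∀ i j, t ≤ i → t ≤ j → g i = g j → i = j
  full : ∀ a, a ∈ G.support

lemma Lift.plus (h : Lift G K f g t) (u v x y : V) {u' v' x' y' : X} (hu : f u = u') (hv : f v = v')
    (hx : f x = x') (hy : f y = y') : Lift (G.plus u v x y)
      (ins K u' v' x' y' (g t) (g (t + 1))) (Sum.elim f ![g t, g (t + 1)]) g (t + 2) where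
  inj := by
    have h01 : g t ≠ g (t + 1) := fun h' => by
      have := h.injg _ _ le_rfl (Nat.le_succ t) h'
      omega
    have h0 : ∀ a (i : Fin 2), f a ≠ ![g t, g (t + 1)] i := fun a i => by
      match i with
      | 0 => exact h.fresh a t le_rfl
      | 1 => exact h.fresh a (t + 1) (Nat.le_succ t)
    rintro (a | i) (b | j) hab
    · exact congrArg _ (h.inj hab)
    · exact absurd hab (h0 a j)
    · exact absurd hab.symm (h0 b i)
    · congr 1
      match i, j with
      | 0, 0 => rfl
      | 1, 1 => rfl
      | 0, 1 => exact absurd hab h01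
      | 1, 0 => exact absurd hab.symm h01
  hom := by
    subst hu hv hx hy
    have hnew : ∀ a (i : Fin 2), (G.plus u v x y).Adj (old a) (Sum.inr i) →
        (ins K (f u) (f v) (f x) (f y) (g t) (g (t + 1))).Adj (f a) (![g t, g (t + 1)] i) := by
      intro a i hab
      match i with
      | 0 =>
        refine ins_adj.2 (Or.inr ⟨h.fresh a t le_rfl, ?_⟩)
        rcases plus_old_newK.1 hab with rfl | rfl
        · exact Or.inl rfl
        · exact Or.inr (Or.inl Sym2.eq_swap)
      | 1 =>
        refine ins_adj.2 (Or.inr ⟨h.fresh a (t + 1) (Nat.le_succ t), ?_⟩)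
        rcases plus_old_newL.1 hab with rfl | rfl
        · exact Or.inr (Or.inr (Or.inl rfl))
        · exact Or.inr (Or.inr (Or.inr (Or.inl Sym2.eq_swap)))
    have hpq : (ins K (f u) (f v) (f x) (f y) (g t) (g (t + 1))).Adj (g t) (g (t + 1)) := by
      refine ins_adj.2 (Or.inr ⟨fun h' => ?_, by simp⟩)
      have := h.injg _ _ le_rfl (Nat.le_succ t) h'
      omega
    rintro (a | i) (b | j) hab
    · obtain ⟨h1, h2, h3⟩ := plus_old_old.1 hab
      exact ins_adj.2 (Or.inl ⟨h.hom _ _ h1, fun h' => h2 (Sym2.map.injective h.inj h'),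
        fun h' => h3 (Sym2.map.injective h.inj h')⟩)
    · exact hnew a j hab
    · exact (hnew b i hab.symm).symm
    · match i, j with
      | 0, 0 => exact absurd rfl hab
      | 1, 1 => exact absurd rfl hab
      | 0, 1 => exact hpq
      | 1, 0 => exact hpq.symm
  fresh := by
    rintro (a | i) j hj hab
    · exact h.fresh a j (by omega) hab
    · match i with
      | 0 => have := h.injg _ _ le_rfl (by omega) hab; omega
      | 1 => have := h.injg _ _ (Nat.le_succ t) (by omega) hab; omega
  injg := fun i j hi hj => h.injg i j (by omega) (by omega)
  full := mem_support_plus h.full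

lemma Lift.homeoEmbedding (h : Lift G K f g t) (hE : Emb K H) : Nonempty (G.HomeoEmbedding H) :=
  ((Emb.of_hom f h.inj.injOn h.hom).trans hE).homeoEmbedding h.full

end Lift

section Quadrangle

variable {V : Type*} {G : SimpleGraph V} {C : G.Subgraph} {a b c d : V}

lemma rot_quadrangle (h : C.IsQuadrangleWith a b c d) : C.IsQuadrangleWith b c d a where
  nodup := by have := h.nodup; grind
  verts_eq := by rw [h.verts_eq]; grind
  edgeSet_eq := by rw [h.edgeSet_eq]; grind

lemma refl_quadrangle (h : C.IsQuadrangleWith a b c d) : C.IsQuadrangleWith b a d c where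
  nodup := by have := h.nodup; grind
  verts_eq := by rw [h.verts_eq]; grind
  edgeSet_eq := by
    rw [h.edgeSet_eq, Sym2.eq_swap (a := b) (b := a), Sym2.eq_swap (a := a) (b := d),
      Sym2.eq_swap (a := d) (b := c), Sym2.eq_swap (a := c) (b := b)]
    grind

end Quadrangle

end QuadExp

namespace QuadExp

open SimpleGraph

section Types

variable {V : Type*} {G : SimpleGraph V} {C : G.Subgraph} {u₁ u₂ u₃ u₄ v₁ v₂ v₃ v₄ w z : V}

/-- The vertices `u₁, u₂, u₃, u₄` of the quadrangle `C` and the neighbors `vᵢ` of `uᵢ` off `C`. -/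
def Based (C : G.Subgraph) (u₁ u₂ u₃ u₄ v₁ v₂ v₃ v₄ : V) : Prop :=
  C.IsQuadrangleWith u₁ u₂ u₃ u₄ ∧ QS G u₁ u₂ u₃ u₄ v₁ v₂ v₃ v₄

lemma Based.rot (h : Based C u₁ u₂ u₃ u₄ v₁ v₂ v₃ v₄) : Based C u₂ u₃ u₄ u₁ v₂ v₃ v₄ v₁ :=
  ⟨rot_quadrangle h.1, h.2.rot⟩

lemma Based.refl (h : Based C u₁ u₂ u₃ u₄ v₁ v₂ v₃ v₄) : Based C u₂ u₁ u₄ u₃ v₂ v₁ v₄ v₃ :=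
  ⟨refl_quadrangle h.1, h.2.refl⟩

lemma Based.outer (h : Based C u₁ u₂ u₃ u₄ v₁ v₂ v₃ v₄) : C.IsOuterNeighbor u₁ v₁ := by
  refine ⟨(h.2.n₁ v₁).2 (by simp), ?_⟩
  have := h.2.nodup
  rw [h.1.verts_eq]
  grind

lemma Based.shortData (h : Based C u₁ u₂ u₃ u₄ v₁ v₂ v₃ v₄) (hw : G.Adj v₁ w) (hwu : w ≠ u₁) :
    C.IsShortData u₁ u₂ u₃ u₄ v₁ w where
  quad := h.1
  outer := h.outer
  outer' := by
    have := h.2.off hw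
    refine ⟨hw, ?_⟩
    rw [h.1.verts_eq]
    grind
  ext := by
    have := h.2.off hw
    have := h.2.nodup
    exact ⟨(h.2.n₁ u₂).2 (by simp), hw, by grind⟩

lemma Based.long (h : Based C u₁ u₂ u₃ u₄ v₁ v₂ v₃ v₄) {x y : V} (hxy : G.Adj x y)
    (hx : x ∉ [u₁, u₂, u₃, u₄, v₁, v₂]) (hy : y ∉ [u₁, u₂, u₃, u₄, v₁, v₂]) :
    C.IsTypeA (G.plus u₁ u₂ x y) := by
  simp only [List.mem_cons, List.not_mem_nil, or_false, not_or] at hx hy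
  have hnd := h.2.nodup
  simp only [List.nodup_cons, List.mem_cons, List.not_mem_nil, or_false, not_or] at hnd
  have hadj : C.Adj u₁ u₂ := by
    rw [← Subgraph.mem_edgeSet, h.1.edgeSet_eq]
    simp
  refine ⟨u₁, u₂, x, y, hadj, ?_, ?_, ⟨⟨(h.2.n₁ u₂).2 (by simp), hxy, ?_⟩, ?_, ?_, ?_, ?_⟩,
    ⟨Iso.refl⟩⟩
  · rw [h.1.verts_eq]; grind
  · rw [h.1.verts_eq]; grind
  · have := hxy.ne
    grind
  · rw [h.2.n₁]; grind
  · rw [h.2.n₁]; grind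
  · rw [h.2.n₂]; grind
  · rw [h.2.n₂]; grind

lemma Based.typeB (h : Based C u₁ u₂ u₃ u₄ v₁ v₂ v₃ v₄) {x a b : V} (hw : G.Adj v₁ w) (hwu : w ≠ u₁)
    (hx : G.Adj v₁ x) (hxu : x ≠ u₁) (hxw : x ≠ w) (hab : G.Adj a b) (ha : a ∉ [u₁, v₁, w, x])
    (hb : b ∉ [u₁, v₁, w, x]) :
    C.IsTypeB ((G.plus u₁ u₂ v₁ w).plus (old v₁) newL (old a) (old b)) := by
  have hv : ∀ y, G.Adj v₁ y → y = u₁ ∨ y = w ∨ y = x := by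
    have hu := h.outer.1.symm
    obtain ⟨c, -, -, hc⟩ := h.2.third_neighbor hu hw hwu.symm
    intro y hy
    have := (hc x).1 hx
    have := (hc y).1 hy
    grind
  have := hab.ne
  refine ⟨u₁, u₂, u₃, u₄, v₁, w, old a, old b, h.shortData hw hwu,
    ⟨⟨?_, ?_, ?_⟩, ?_, ?_, ?_, ?_⟩, ⟨Iso.refl⟩⟩
  · exact Or.inl rfl
  · refine ⟨hab, ?_, ?_⟩ <;> · rw [ne_eq, Sym2.eq_iff]; grind
  · simp; grind
  · rintro ⟨h1, -⟩
    have := hv _ h1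
    grind
  · rintro ⟨h1, -⟩
    have := hv _ h1
    grind
  · rw [plus_newL_old]; grind
  · rw [plus_newL_old]; grind

lemma Based.typeC (h : Based C u₁ u₂ u₃ u₄ v₁ v₂ v₃ v₄) (hw : G.Adj v₁ w) (hwu : w ≠ u₁)
    (hz : G.Adj v₂ z) (hzu : z ≠ u₂) (hzw : z ≠ w) :
    C.IsTypeC ((G.plus u₁ u₂ v₁ w).plus newK newL (old v₂) (old z)) := by
  have hnd := h.2.nodup
  simp only [List.nodup_cons, List.mem_cons, List.not_mem_nil, or_false, not_or] at hnd
  have := h.2.off hw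
  have := h.2.rot.off hz
  refine ⟨u₁, u₂, u₃, u₄, v₁, w, h.shortData hw hwu, Or.inl ⟨v₂, z, h.rot.outer, hz, hzu,
    ⟨⟨plus_newK_newL, ⟨hz, ?_, ?_⟩, ?_⟩, ?_, ?_, ?_, ?_⟩, ⟨Iso.refl⟩⟩⟩
  · rw [ne_eq, Sym2.eq_iff]; grind
  · rw [ne_eq, Sym2.eq_iff]; grind
  · simp; grind
  · rw [plus_newK_old]; grind
  · rw [plus_newK_old]; grind
  · rw [plus_newL_old]; grind
  · rw [plus_newL_old]; grind

lemma Based.typeD (h : Based C u₁ u₂ u₃ u₄ v₁ v₂ v₃ v₄) (hw : G.Adj v₁ w) (hwu : w ≠ u₁) :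
    C.IsTypeD ((G.plus u₁ u₂ v₁ w).plus (old u₁) newK (old u₃) (old v₃)) := by
  have hnd := h.2.nodup
  simp only [List.nodup_cons, List.mem_cons, List.not_mem_nil, or_false, not_or] at hnd
  have := h.2.off hw
  refine ⟨u₁, u₂, u₃, u₄, v₁, w, v₃, h.shortData hw hwu, h.rot.rot.outer,
    ⟨Or.inl rfl, ⟨h.rot.rot.outer.1, ?_, ?_⟩, ?_⟩, ⟨Iso.refl⟩⟩
  · rw [ne_eq, Sym2.eq_iff]; grind
  · rw [ne_eq, Sym2.eq_iff]; grind
  · simp; grind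

lemma Based.typeE (h : Based C u₁ u₂ u₃ u₄ v₁ v₂ v₃ v₄) (hw : G.Adj v₁ w) (hwu : w ≠ u₁)
    (hz : G.Adj v₃ z) (hzu : z ≠ u₃) :
    C.IsTypeE (((G.plus u₁ u₂ v₁ w).plus (old u₁) newK (old u₃) (old u₄)).plus
      newL (old (old u₄)) (old (old v₃)) (old (old z))) := by
  have hnd := h.2.nodup
  simp only [List.nodup_cons, List.mem_cons, List.not_mem_nil, or_false, not_or] at hnd
  have := h.2.off hw
  have := h.2.rot.rot.off hz
  refine ⟨u₁, u₂, u₃, u₄, v₁, w, v₃, z, h.shortData hw hwu, h.rot.rot.outer, hz, hzu,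
    ⟨Or.inl rfl, ⟨(h.2.n₃ _).2 (Or.inl rfl), ?_, ?_⟩, ?_⟩,
    ⟨Or.inr rfl, ⟨⟨hz, ?_, ?_⟩, ?_, ?_⟩, ?_⟩, ⟨Iso.refl⟩⟩
  · rw [ne_eq, Sym2.eq_iff]; grind
  · rw [ne_eq, Sym2.eq_iff]; grind
  · simp; grind
  · rw [ne_eq, Sym2.eq_iff]; grind
  · rw [ne_eq, Sym2.eq_iff]; grind
  · simp
  · simp; grind
  · simp; grind

/-- The graph of a type F expansion. -/
def typeF (G : SimpleGraph V) (u₁ u₂ u₃ u₄ v₁ v₂ z : V) :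
    SimpleGraph ((((V ⊕ Fin 2) ⊕ Fin 2) ⊕ Fin 2) ⊕ Fin 2) :=
  (((G.plus u₁ u₂ v₁ z).plus (old u₂) newK (old v₂) (old z)).plus
    newK (old newK) (old (old u₃)) (old (old u₄))).plus
    (old (old newK)) (old (old newL)) (old newK) (old newL)

lemma typeFOn (hC : C.IsQuadrangleWith u₁ u₂ u₃ u₄) (h12 : G.Adj u₁ u₂) (h34 : G.Adj u₃ u₄)
    (h₁ : G.Adj u₁ v₁) (h₂ : G.Adj u₂ v₂) (hz₁ : G.Adj v₁ z) (hz₂ : G.Adj v₂ z)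
    (hnd : [u₁, u₂, u₃, u₄, v₁, v₂, z].Nodup) :
    C.IsTypeFOn (typeF G u₁ u₂ u₃ u₄ v₁ v₂ z) u₁ u₂ := by
  refine ⟨u₃, u₄, v₁, v₂, z, ⟨hC, ⟨h₁, ?_⟩, ⟨hz₁, ?_⟩, ⟨h12, hz₁, ?_⟩⟩, ⟨h₂, ?_⟩, hz₂,
    ⟨Or.inr rfl, ⟨hz₂, ?_, ?_⟩, ?_⟩, ⟨Or.inr rfl, ⟨⟨h34, ?_, ?_⟩, ?_, ?_⟩, ?_⟩,
    ⟨⟨⟨plus_newK_newL, ?_, ?_⟩, ?_, ?_⟩, ⟨plus_newK_newL, ?_, ?_⟩, ?_⟩, ⟨Iso.refl⟩⟩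
  · rw [hC.verts_eq]; grind
  · rw [hC.verts_eq]; grind
  · grind
  · rw [hC.verts_eq]; grind
  · rw [ne_eq, Sym2.eq_iff]; grind
  · rw [ne_eq, Sym2.eq_iff]; grind
  · simp; grind
  · rw [ne_eq, Sym2.eq_iff]; grind
  · rw [ne_eq, Sym2.eq_iff]; grind
  · simp
  · simp; grind
  · simp; grind
  all_goals simp

lemma Based.typeF (h : Based C u₁ u₂ u₃ u₄ v₁ v₂ v₃ v₄) (hw : G.Adj v₁ w) (hwu : w ≠ u₁)
    (hw₂ : G.Adj v₂ w) : C.IsTypeF (QuadExp.typeF G u₁ u₂ u₃ u₄ v₁ v₂ w) := by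
  have hnd := h.2.nodup
  simp only [List.nodup_cons, List.mem_cons, List.not_mem_nil, or_false, not_or] at hnd
  have := h.2.off hw
  exact ⟨u₁, u₂, typeFOn h.1 ((h.2.n₁ _).2 (Or.inl rfl)) ((h.2.n₃ _).2 (Or.inl rfl)) h.outer.1
    h.rot.outer.1 hw hw₂ (by grind)⟩

lemma Based.typeG (h : Based C u₁ u₂ u₃ u₄ v₁ v₂ v₃ v₄) (hw : G.Adj v₁ w) (hwu : w ≠ u₁) :
    C.IsTypeG (QuadExp.typeF (G.plus u₁ u₂ v₁ w) (old u₁) newK newL (old v₁) (old u₄) (old u₂)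
      (old u₃)) := by
  have hnd := h.2.nodup
  simp only [List.nodup_cons, List.mem_cons, List.not_mem_nil, or_false, not_or] at hnd
  have := h.2.off hw
  have h1 : (G.plus u₁ u₂ v₁ w).Adj (old u₁) newK := Or.inl rfl
  have h3 : (G.plus u₁ u₂ v₁ w).Adj newL (old v₁) := Or.inl rfl
  have h4 : (G.plus u₁ u₂ v₁ w).Adj (old v₁) (old u₁) := by
    refine ⟨h.outer.1.symm, ?_, ?_⟩ <;> · rw [ne_eq, Sym2.eq_iff]; grind
  obtain ⟨D, hD⟩ := exists_quadrangle (by simp; grind) h1 plus_newK_newL h3 h4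
  refine ⟨u₁, u₂, u₃, u₄, v₁, w, h.shortData hw hwu, D, hD,
    typeFOn hD h1 h3 ⟨(h.2.n₁ _).2 (by simp), ?_, ?_⟩ (Or.inr rfl) ⟨(h.2.n₄ _).2 (by simp), ?_, ?_⟩
      ⟨(h.2.n₂ _).2 (by simp), ?_, ?_⟩ ?_⟩
  iterate 6
    · rw [ne_eq, Sym2.eq_iff]; grind
  simp; grind

end Types

end QuadExp

namespace QuadExp

open SimpleGraph

section Transfer

variable {V : Type*} {G : SimpleGraph V} {u₁ u₂ u₃ u₄ v₁ v₂ v₃ v₄ : V}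

/-- The graph `G` with infinitely many isolated vertices added. -/
abbrev pad (G : SimpleGraph V) : SimpleGraph (V ⊕ ℕ) := G.map Function.Embedding.inl

lemma pad_adj {a b : V} : (pad G).Adj (Sum.inl a) (Sum.inl b) ↔ G.Adj a b :=
  SimpleGraph.map_adj_apply

lemma exists_of_pad_adj {a : V} {y : V ⊕ ℕ} (h : (pad G).Adj (Sum.inl a) y) :
    ∃ b, y = Sum.inl b ∧ G.Adj a b := by
  obtain ⟨-, a', b, hab, h1, rfl⟩ := h
  obtain rfl : a' = a := Sum.inl_injective h1
  exact ⟨b, rfl, hab⟩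

lemma exists_of_mem_pad_support {x : V ⊕ ℕ} (h : x ∈ (pad G).support) : ∃ a, x = Sum.inl a := by
  obtain ⟨y, -, a, b, hab, rfl, rfl⟩ := h
  exact ⟨a, rfl⟩

lemma QS.pad (h : QS G u₁ u₂ u₃ u₄ v₁ v₂ v₃ v₄) [Finite V] :
    QS (QuadExp.pad G) (.inl u₁) (.inl u₂) (.inl u₃) (.inl u₄) (.inl v₁) (.inl v₂) (.inl v₃)
      (.inl v₄) := by
  have nb : ∀ {u a b c : V}, (∀ y, G.Adj u y ↔ y = a ∨ y = b ∨ y = c) → ∀ y,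
      (QuadExp.pad G).Adj (.inl u) y ↔ y = .inl a ∨ y = .inl b ∨ y = .inl c := by
    intro u a b c hu y
    rcases y with y | n
    · rw [pad_adj, hu]
      simp
    · simp [QuadExp.pad]
  have m : ∀ {a b : V}, (∀ w x, w ≠ x → G.Adj a w → G.Adj a x → G.Adj b w → ¬ G.Adj b x) →
      ∀ w x, w ≠ x → (QuadExp.pad G).Adj (.inl a) w → (QuadExp.pad G).Adj (.inl a) x →
        (QuadExp.pad G).Adj (.inl b) w → ¬ (QuadExp.pad G).Adj (.inl b) x := by
    intro a b hab w x hwx h1 h2 h3 h4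
    obtain ⟨w, rfl, -⟩ := exists_of_pad_adj h1
    obtain ⟨x, rfl, -⟩ := exists_of_pad_adj h2
    exact hab w x (fun h => hwx (congrArg _ h)) (pad_adj.1 h1) (pad_adj.1 h2) (pad_adj.1 h3)
      (pad_adj.1 h4)
  refine ⟨?_, ?_, ?_, ?_, nb h.n₁, nb h.n₂, nb h.n₃, nb h.n₄, ?_, ?_, m h.m₁₂, m h.m₂₃, m h.m₃₄,
    m h.m₄₁⟩
  · refine (Set.finite_range (Sum.inl : V → V ⊕ ℕ)).subset fun x hx => ?_
    obtain ⟨a, rfl⟩ := exists_of_mem_pad_support hx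
    exact ⟨a, rfl⟩
  · intro x hx
    obtain ⟨a, rfl⟩ := exists_of_mem_pad_support hx
    obtain ⟨y, hy⟩ := hx
    obtain ⟨b, rfl, hab⟩ := exists_of_pad_adj hy
    rw [← h.cubic a ⟨b, hab⟩, ← Sum.inl_injective.encard_image (β := V ⊕ ℕ)]
    congr 1
    ext y
    refine ⟨fun hy => ?_, ?_⟩
    · obtain ⟨b, rfl, hab⟩ := exists_of_pad_adj hy
      exact ⟨b, hab, rfl⟩
    · rintro ⟨b, hab, rfl⟩
      exact pad_adj.2 hab
  · intro a b c hab hbc hac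
    obtain ⟨a, rfl⟩ := exists_of_mem_pad_support ⟨b, hab⟩
    obtain ⟨b, rfl, -⟩ := exists_of_pad_adj hab
    obtain ⟨c, rfl, -⟩ := exists_of_pad_adj hac
    exact h.tri a b c (pad_adj.1 hab) (pad_adj.1 hbc) (pad_adj.1 hac)
  · intro a b x y z hab hxy hxz hyz h1 h2 h3 h4 h5 h6
    obtain ⟨a, rfl⟩ := exists_of_mem_pad_support ⟨x, h1⟩
    obtain ⟨b, rfl⟩ := exists_of_mem_pad_support ⟨x, h4⟩
    obtain ⟨x, rfl, -⟩ := exists_of_pad_adj h1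
    obtain ⟨y, rfl, -⟩ := exists_of_pad_adj h2
    obtain ⟨z, rfl, -⟩ := exists_of_pad_adj h3
    exact h.k23 a b x y z (fun h => hab (congrArg _ h)) (fun h => hxy (congrArg _ h))
      (fun h => hxz (congrArg _ h)) (fun h => hyz (congrArg _ h)) (pad_adj.1 h1)
      (pad_adj.1 h2) (pad_adj.1 h3) (pad_adj.1 h4) (pad_adj.1 h5) (pad_adj.1 h6)
  · exact h.nodup.map (f := Sum.inl) Sum.inl_injective
  · simpa only [pad_adj] using h.nonadj

lemma emb_pad {W : Type*} {H : SimpleGraph W} (h : Emb G H) (a : V) : Emb (pad G) H := by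
  refine (Emb.of_hom (Sum.elim id fun _ => a) ?_ ?_).trans h
  · intro x hx y hy hxy
    obtain ⟨x, rfl⟩ := exists_of_mem_pad_support hx
    obtain ⟨y, rfl⟩ := exists_of_mem_pad_support hy
    exact congrArg _ hxy
  · rintro _ _ ⟨-, x, y, hxy, rfl, rfl⟩
    exact hxy

end Transfer

namespace Skel

variable {V : Type*} {G : SimpleGraph V} {C : G.Subgraph} {u₁ u₂ u₃ u₄ v₁ v₂ v₃ v₄ : V}

lemma exists_based (h : Based C u₁ u₂ u₃ u₄ v₁ v₂ v₃ v₄) {x₁ x₂ x₃ x₄ : V ⊕ ℕ}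
    (hx : [x₁, x₂, x₃, x₄] ∈ rots (Sum.inl u₁) (Sum.inl u₂) (Sum.inl u₃) (Sum.inl u₄)) :
    ∃ a₁ a₂ a₃ a₄ b₁ b₂ b₃ b₄, Based C a₁ a₂ a₃ a₄ b₁ b₂ b₃ b₄ ∧ Sum.inl a₁ = x₁ ∧ Sum.inl a₂ = x₂ ∧
      Sum.inl a₃ = x₃ ∧ Sum.inl a₄ = x₄ := by
  simp only [rots, List.mem_cons, List.cons.injEq, and_true, List.not_mem_nil, or_false] at hx
  rcases hx with ⟨rfl, rfl, rfl, rfl⟩ | ⟨rfl, rfl, rfl, rfl⟩ | ⟨rfl, rfl, rfl, rfl⟩ |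
    ⟨rfl, rfl, rfl, rfl⟩ | ⟨rfl, rfl, rfl, rfl⟩ | ⟨rfl, rfl, rfl, rfl⟩ | ⟨rfl, rfl, rfl, rfl⟩ |
    ⟨rfl, rfl, rfl, rfl⟩
  · exact ⟨_, _, _, _, _, _, _, _, h, rfl, rfl, rfl, rfl⟩
  · exact ⟨_, _, _, _, _, _, _, _, h.rot, rfl, rfl, rfl, rfl⟩
  · exact ⟨_, _, _, _, _, _, _, _, h.rot.rot, rfl, rfl, rfl, rfl⟩
  · exact ⟨_, _, _, _, _, _, _, _, h.rot.rot.rot, rfl, rfl, rfl, rfl⟩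
  · exact ⟨_, _, _, _, _, _, _, _, h.refl, rfl, rfl, rfl, rfl⟩
  · exact ⟨_, _, _, _, _, _, _, _, h.rot.refl, rfl, rfl, rfl, rfl⟩
  · exact ⟨_, _, _, _, _, _, _, _, h.rot.rot.refl, rfl, rfl, rfl, rfl⟩
  · exact ⟨_, _, _, _, _, _, _, _, h.rot.rot.rot.refl, rfl, rfl, rfl, rfl⟩

lemma exists_child {a : V} {x y : V ⊕ ℕ} (ha : Sum.inl a = x) (h : (pad G).Adj x y) :
    ∃ b, Sum.inl b = y ∧ G.Adj a b := by
  subst ha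
  obtain ⟨b, rfl, hb⟩ := exists_of_pad_adj h
  exact ⟨b, rfl, hb⟩

lemma ne_of_inl {a b : V} {x y : V ⊕ ℕ} (h : x ≠ y) (ha : Sum.inl a = x) (hb : Sum.inl b = y) :
    a ≠ b := by
  rintro rfl
  exact h (ha.symm.trans hb)

/-- An expansion of the padded graph is an expansion of the graph. -/
theorem exists_expansion {V : Type u} {W : Type v} {G : SimpleGraph V} {H : SimpleGraph W}
    {C : G.Subgraph} {u₁ u₂ u₃ u₄ v₁ v₂ v₃ v₄ : V} (hG : G.IsCubic)
    (hB : Based C u₁ u₂ u₃ u₄ v₁ v₂ v₃ v₄)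
    (hE : Exp (pad G) H (.inl u₁) (.inl u₂) (.inl u₃) (.inl u₄)) :
    ∃ (V' : Type u) (G' : SimpleGraph V'), C.IsExpansion G' ∧ Nonempty (G'.HomeoEmbedding H) := by
  obtain ⟨sp, hsp, g, hg, hE, -⟩ := hE
  have hfull : ∀ a, a ∈ G.support := by
    intro a
    obtain ⟨b, hb⟩ : (G.neighborSet a).Nonempty := by
      rw [← Set.encard_pos, hG a]
      norm_num
    exact ⟨b, hb⟩
  have hL : Lift G (pad G) Sum.inl g 20 := by
    refine ⟨Sum.inl_injective, fun a b h => pad_adj.2 h, fun a j hj h => ?_, fun i j hi hj h => ?_,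
      hfull⟩
    · obtain ⟨b, hb⟩ := hfull a
      obtain ⟨k, rfl⟩ := Nat.exists_eq_add_of_le hj
      exact hg.fresh k (h ▸ ⟨_, pad_adj.2 hb⟩)
    · obtain ⟨i, rfl⟩ := Nat.exists_eq_add_of_le hi
      obtain ⟨j, rfl⟩ := Nat.exists_eq_add_of_le hj
      rw [hg.inj i j h]
  obtain ⟨a₁, a₂, a₃, a₄, b₁, b₂, b₃, b₄, hB, h1, h2, h3, h4⟩ := exists_based hB hg.rot
  have hadj := hg.adj
  have hne := hg.ne
  have heq := hg.eq
  have c₁ : ∀ y, G.Adj a₁ y → y ≠ a₂ → y ≠ a₄ → y = b₁ := fun y h => by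
    have := (hB.2.n₁ y).1 h
    tauto
  have c₂ : ∀ y, G.Adj a₂ y → y ≠ a₁ → y ≠ a₃ → y = b₂ := fun y h => by
    have := (hB.2.n₂ y).1 h
    tauto
  have c₃ : ∀ y, G.Adj a₃ y → y ≠ a₂ → y ≠ a₄ → y = b₃ := fun y h => by
    have := (hB.2.n₃ y).1 h
    tauto
  have hb₁ : (pad G).Adj (g 0) (g 4) → g 4 ≠ g 1 → g 4 ≠ g 3 → Sum.inl b₁ = g 4 := by
    intro hadj hne hne'
    obtain ⟨b, hb, hab⟩ := exists_child h1 hadj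
    rw [← c₁ b hab (ne_of_inl hne hb h2) (ne_of_inl hne' hb h4), hb]
  simp only [specs, List.mem_cons, List.not_mem_nil, or_false] at hsp
  rcases hsp with rfl | rfl | rfl | rfl | rfl | rfl | rfl <;>
    simp only [specA, specB, specC, specD, specE, specF, specG, adjs, nes, copies, List.map_cons,
      List.map_nil, List.cons_append, List.nil_append, List.forall_mem_cons, List.not_mem_nil,
      IsEmpty.forall_iff, forall_const, Nat.reduceAdd, and_true] at hadj hne heq
  · obtain ⟨h04, h15, h67⟩ := hadj
    obtain ⟨n41, n43, n50, n52, n60, n61, n62, n63, n64, n65, n70, n71, n72, n73, n74, n75⟩ := hne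
    have h5 := hb₁ h04 n41 n43
    obtain ⟨b, h6, hb⟩ := exists_child h2 h15
    obtain rfl := c₂ b hb (ne_of_inl n50 h6 h1) (ne_of_inl n52 h6 h3)
    obtain ⟨x, h7⟩ := exists_of_mem_pad_support ⟨_, h67⟩
    obtain ⟨y, h8, hxy⟩ := exists_child h7.symm h67
    refine ⟨_, _, Or.inl (hB.long hxy ?_ ?_), (hL.plus a₁ a₂ x y h1 h2 h7.symm h8).homeoEmbedding hE⟩
    · simp only [List.mem_cons, List.not_mem_nil, or_false, not_or]
      exact ⟨ne_of_inl n60 h7.symm h1, ne_of_inl n61 h7.symm h2, ne_of_inl n62 h7.symm h3,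
        ne_of_inl n63 h7.symm h4, ne_of_inl n64 h7.symm h5, ne_of_inl n65 h7.symm h6⟩
    · simp only [List.mem_cons, List.not_mem_nil, or_false, not_or]
      exact ⟨ne_of_inl n70 h8 h1, ne_of_inl n71 h8 h2, ne_of_inl n72 h8 h3,
        ne_of_inl n73 h8 h4, ne_of_inl n74 h8 h5, ne_of_inl n75 h8 h6⟩
  · obtain ⟨h04, h45, h46, h78⟩ := hadj
    obtain ⟨n41, n43, n50, n60, n65, n70, n74, n75, n76, n80, n84, n85, n86⟩ := hne
    have h5 := hb₁ h04 n41 n43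
    obtain ⟨w, h6, hw⟩ := exists_child h5 h45
    obtain ⟨x, h7, hx⟩ := exists_child h5 h46
    obtain ⟨c, h8⟩ := exists_of_mem_pad_support ⟨_, h78⟩
    obtain ⟨d, h9, hcd⟩ := exists_child h8.symm h78
    refine ⟨_, _, Or.inr (Or.inl (hB.typeB hw (ne_of_inl n50 h6 h1) hx (ne_of_inl n60 h7 h1)
      (ne_of_inl n65 h7 h6) hcd ?_ ?_)),
      ((hL.plus a₁ a₂ b₁ w h1 h2 h5 h6).plus (old b₁) newL (old c) (old d) h5 rfl h8.symm h9).homeoEmbedding hE⟩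
    · simp only [List.mem_cons, List.not_mem_nil, or_false, not_or]
      exact ⟨ne_of_inl n70 h8.symm h1, ne_of_inl n74 h8.symm h5, ne_of_inl n75 h8.symm h6,
        ne_of_inl n76 h8.symm h7⟩
    · simp only [List.mem_cons, List.not_mem_nil, or_false, not_or]
      exact ⟨ne_of_inl n80 h9 h1, ne_of_inl n84 h9 h5, ne_of_inl n85 h9 h6, ne_of_inl n86 h9 h7⟩
  · obtain ⟨h04, h45, h16, h78⟩ := hadj
    obtain ⟨n41, n43, n50, n60, n62, n81, n85⟩ := hne
    have h5 := hb₁ h04 n41 n43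
    obtain ⟨w, h6, hw⟩ := exists_child h5 h45
    obtain ⟨b, h7, hb⟩ := exists_child h2 h16
    obtain rfl := c₂ b hb (ne_of_inl n60 h7 h1) (ne_of_inl n62 h7 h3)
    rw [← heq] at h7
    obtain ⟨z, h8, hz⟩ := exists_child h7 h78
    exact ⟨_, _, Or.inr (Or.inr (Or.inl (hB.typeC hw (ne_of_inl n50 h6 h1) hz (ne_of_inl n81 h8 h2)
      (ne_of_inl n85 h8 h6)))), ((hL.plus a₁ a₂ b₁ w h1 h2 h5 h6).plus newK newL (old b) (old z) rfl rfl h7 h8).homeoEmbedding hE⟩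
  · obtain ⟨h04, h45, h26⟩ := hadj
    obtain ⟨n41, n43, n50, n61, n63⟩ := hne
    have h5 := hb₁ h04 n41 n43
    obtain ⟨w, h6, hw⟩ := exists_child h5 h45
    obtain ⟨b, h7, hb⟩ := exists_child h3 h26
    obtain rfl := c₃ b hb (ne_of_inl n61 h7 h2) (ne_of_inl n63 h7 h4)
    exact ⟨_, _, Or.inr (Or.inr (Or.inr (Or.inl (hB.typeD hw (ne_of_inl n50 h6 h1))))),
      ((hL.plus a₁ a₂ b₁ w h1 h2 h5 h6).plus (old a₁) newK (old a₃) (old b) h1 rfl h3 h7).homeoEmbedding hE⟩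
  · obtain ⟨h04, h45, h26, h78⟩ := hadj
    obtain ⟨n41, n43, n50, n61, n63, n82⟩ := hne
    have h5 := hb₁ h04 n41 n43
    obtain ⟨w, h6, hw⟩ := exists_child h5 h45
    obtain ⟨b, h7, hb⟩ := exists_child h3 h26
    obtain rfl := c₃ b hb (ne_of_inl n61 h7 h2) (ne_of_inl n63 h7 h4)
    rw [← heq] at h7
    obtain ⟨z, h8, hz⟩ := exists_child h7 h78
    exact ⟨_, _, Or.inr (Or.inr (Or.inr (Or.inr (Or.inl (hB.typeE hw (ne_of_inl n50 h6 h1) hz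
      (ne_of_inl n82 h8 h3)))))), (((hL.plus a₁ a₂ b₁ w h1 h2 h5 h6).plus (old a₁) newK (old a₃) (old a₄) h1 rfl
      h3 h4).plus newL (old (old a₄)) (old (old b)) (old (old z)) rfl h4 h7 h8).homeoEmbedding hE⟩
  · obtain ⟨h04, h45, h16, h78⟩ := hadj
    obtain ⟨n41, n43, n50, n60, n62, n81⟩ := hne
    have h5 := hb₁ h04 n41 n43
    obtain ⟨w, h6, hw⟩ := exists_child h5 h45
    obtain ⟨b, h7, hb⟩ := exists_child h2 h16
    obtain rfl := c₂ b hb (ne_of_inl n60 h7 h1) (ne_of_inl n62 h7 h3)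
    rw [← heq.2] at h7
    obtain ⟨z, h8, hz⟩ := exists_child h7 h78
    obtain rfl : z = w := Sum.inl_injective (h8.trans (heq.1.symm.trans h6.symm))
    exact ⟨_, _, Or.inr (Or.inr (Or.inr (Or.inr (Or.inr (Or.inl
      (hB.typeF hw (ne_of_inl n50 h6 h1) hz)))))), ((((hL.plus a₁ a₂ b₁ z h1 h2 h5 h6).plus
      (old a₂) newK (old b) (old z) h2 rfl h7 h8).plus
      newK (old newK) (old (old a₃)) (old (old a₄)) rfl rfl h3 h4).plus
      (old (old newK)) (old (old newL)) (old newK) (old newL) rfl rfl rfl rfl).homeoEmbedding hE⟩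
  · have h5 := hb₁ hadj.1 hne.1 hne.2.1
    obtain ⟨w, h6, hw⟩ := exists_child h5 hadj.2
    exact ⟨_, _, Or.inr (Or.inr (Or.inr (Or.inr (Or.inr (Or.inr (Or.inl
      (hB.typeG hw (ne_of_inl hne.2.2 h6 h1)))))))), (((((hL.plus a₁ a₂ b₁ w h1 h2 h5 h6).plus
      (old a₁) newK (old a₄) (old a₃) h1 rfl h4 h3).plus
      (old newK) newK (old (old a₂)) (old (old a₃)) rfl rfl h2 h3).plus
      newK (old newK) (old (old newL)) (old (old (old b₁))) rfl rfl rfl h5).plus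
      (old (old newK)) (old (old newL)) (old newK) (old newL) rfl rfl rfl rfl).homeoEmbedding hE⟩

end Skel

end QuadExp

theorem mainTheorem5 {V : Type u} {W : Type v} [Finite V] [Finite W]
    (G : SimpleGraph V) (H : SimpleGraph W)
    (hGcubic : G.IsCubic) (hHcubic : H.IsCubic)
    (hGquad : G.IsQuadConnected) (hH : H.IsCyclicallyConnected 5)
    (C : G.Subgraph) (hC : C.IsQuadrangle)
    (hGH : Nonempty (G.HomeoEmbedding H)) :
    ∃ (V' : Type u) (G' : SimpleGraph V'),
      C.IsExpansion G' ∧ Nonempty (G'.HomeoEmbedding H) := by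
  obtain ⟨u₁, u₂, u₃, u₄, hC⟩ := hC
  obtain ⟨η⟩ := hGH
  obtain ⟨v₁, v₂, v₃, v₄, hQ⟩ := QuadExp.exists_qs hGcubic hGquad hC
  exact QuadExp.Skel.exists_expansion hGcubic ⟨hC, hQ⟩
    (QuadExp.Skel.exists_exp hHcubic hH (Nat.card W + 1) _ _ _ _ _ _ _ _ _ hQ.pad
      (QuadExp.emb_pad (QuadExp.Emb.of_homeoEmbedding η) u₁) (by omega))
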